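/- **Setting.** Let $\Gamma^A$ be $2N$ real coordinates ($N$ even, $N$ odd, parities $\epsilon_A$) on a superdomain over an open set $U\subseteq\mathbb R^N$. Let $E^{AB}$ be a smooth, possibly degenerate antisymplectic structure: parity $\epsilon_A+\epsilon_B+1$, $E^{BA}=-(-1)^{(\epsilon_A+1)(\epsilon_B+1)}E^{AB}$, and the antibracket $(F,G)=(F\overleftarrow{\partial}_A)E^{AB}(\overrightarrow{\partial}_BG)$ satisfies the graded Jacobi identity. Let $\rho$ be a smooth even density with nowhere vanishing body, and $\Delta=\frac{(-1)^{\epsilon_A}}{2\rho}\partial_A\rho E^{AB}\partial_B$. Add Lagrange multipliers $\lambda^\alpha$ of parity $\epsilon_\alpha$ and antifields $\lambda^*_\alpha$ of parity $\epsilon_\alpha+1$ ($\alpha=1,\dots,N$), and put $\Delta_{[1]}=\Delta+(-1)^{\epsilon_\alpha}\frac{\partial}{\partial\lambda^\alpha}\frac{\partial}{\partial\lambda^*_\alpha}$. Actions and generators are formal power series in $i\hbar_{(1)}$ whose coefficients are smooth superfunctions of $(\Gamma,\lambda,\lambda^*)$ on an open neighbourhood of $U\times\{\lambda=\lambda^*=0\}$.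 The Planck number is the grading with $\mathrm{Pl}(\lambda^\alpha)=\mathrm{Pl}(\hbar_{(1)})=1$, $\mathrm{Pl}(\lambda^*_\alpha)=-1$, $\mathrm{Pl}(\Gamma^A)=0$. A bosonic action $X$ with $\mathrm{Pl}(X)=1$ has the form $X=G_\alpha\lambda^\alpha+(i\hbar_{(1)})H+\mathcal O(\lambda^*)$, which defines the constraints $G_\alpha$ (of parity $\epsilon_\alpha$) and the quantum correction $H$. The Quantum Master Equation is not assumed. **The square root formula.** Let $F^\alpha$ be smooth superfunctions of $\Gamma$ of parity $\epsilon_\alpha+1$ and let $c\in\mathbb R$. We say that $(F,G,H)$ satisfies the on-shell square root formula with integration constant $c$ if near every point of the constraint surface (the points of $U$ at which all even $G_\alpha$ have vanishing body) $\{F^\alpha;G_\alpha\}$ is a local coordinate system (invertible Jacobian supermatrix), $(F^\alpha,G_\beta)$ is invertible, and $$H=c-\ln\sqrt{\frac{1}{\rho}\,\mathrm{sdet}\Big(\frac{\partial\{F;G\}}{\partial\Gamma}\Big)\,\mathrm{sdet}(F^\alpha,G_\beta)}+\mathcal O(G).$$ Here $\mathcal O(G)$ denotes a combination $G_\alpha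 k^\alpha$ with smooth $k^\alpha$, and $\ln\sqrt{a}$ means $\tfrac12\ln|a|$. **Deformations.** Let $\Psi(t)$ be a smooth family of fermionic generators with $\mathrm{Pl}(\Psi(t))=0$, and $X(t)$ a smooth family of bosonic actions with $$\frac{d}{dt}e^{\frac{i}{\hbar_{(1)}}X(t)}=-[\Delta_{[1]},\Psi(t)]\,e^{\frac{i}{\hbar_{(1)}}X(t)},$$ for $t$ in an open interval containing $[0,1]$, and suppose $X_i=X(0)$, $X_f=X(1)$ have Planck number $1$. (For constant $\Psi$ this is $e^{\frac{i}{\hbar}X_f}=e^{-[\Delta_{[1]},\Psi]}e^{\frac{i}{\hbar}X_i}$.) Let $\Psi_{(0)}(t)$ be the part of $\Psi(t)$ with $\hbar_{(1)}=\lambda=\lambda^*=0$. Assume that the path-ordered exponential $\mathcal U(t)=\mathcal P\exp\int_0^t(\Psi_{(0)}(s),\cdot\,)\,ds$ exists as a smooth family of invertible operators on the superfunctions on $U$. (For constant $\Psi$ it is $e^{t\,\mathrm{ad}\Psi_{(0)}}$.) Write $\tilde f=\mathcal U(1)f$. **Theorem.** Suppose that $(F_i,G_i,H_i)$ satisfies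 the on-shell square root formula with integration constant $c$, where $G_i,H_i$ come from $X_i$, and let $G_f,H_f$ come from $X_f$. Then: 1. $f\mapsto\tilde f$ is an anticanonical transformation: it preserves smoothness, parity, products and the antibracket. 2. The constraints are rotated and anticanonically transformed: $G_{f,\alpha}=\Lambda_\alpha{}^\beta\,\tilde G_{i,\beta}$ on $U$ for a smooth, everywhere invertible matrix $\Lambda$ with entries of parity $\epsilon_\alpha+\epsilon_\beta$. 3. $(F_f,G_f,H_f)$, with $F_f^\alpha=\tilde F_i^\alpha$, satisfies the on-shell square root formula with the same integration constant $c$. -/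

import Mathlib

open scoped ContDiff

noncomputable section

namespace BV

/-! ### Grassmann algebras and superfunctions -/

/-- The real Grassmann algebra on generators `θ^j`, `j ∈ q`. -/
abbrev Gr (q : Type) : Type := ExteriorAlgebra ℝ (q → ℝ)

/-- A linear isomorphism of the Grassmann algebra with a coordinate space. -/
def grCoord (q : Type) [Fintype q] : Gr q ≃ₗ[ℝ] (Finset q → ℝ) :=
  letI : LinearOrder q := LinearOrder.lift' (Fintype.equivFin q) (Fintype.equivFin q).injective
  (Module.Basis.ExteriorAlgebra (Pi.basisFun ℝ q)).equivFun

/-- The Grassmann algebra is finite dimensional; it is given the sup norm of coordinates. All norms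
on it are equivalent, so smoothness and derivatives do not depend on this choice. -/
instance instNormedAddCommGroupGr (q : Type) [Fintype q] : NormedAddCommGroup (Gr q) :=
  NormedAddCommGroup.induced (Gr q) (Finset q → ℝ) (grCoord q) (grCoord q).injective

instance instNormedSpaceGr (q : Type) [Fintype q] : NormedSpace ℝ (Gr q) :=
  NormedSpace.induced ℝ (Gr q) (Finset q → ℝ) (grCoord q)

/-- The homogeneous part of Grassmann parity `e`. -/
def grPart (q : Type) (e : ZMod 2) : Submodule ℝ (Gr q) :=
  CliffordAlgebra.evenOdd (0 : QuadraticForm ℝ (q → ℝ)) e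

/-- The body, i.e. the part of degree zero in the generators. -/
def body {q : Type} : Gr q →ₐ[ℝ] ℝ := ExteriorAlgebra.algebraMapInv

/-- The even subalgebra of the Grassmann algebra. -/
abbrev GrEven (q : Type) : Subalgebra ℝ (Gr q) :=
  CliffordAlgebra.even (0 : QuadraticForm ℝ (q → ℝ))

theorem grEven_mul_comm {q : Type} (a b : GrEven q) : a * b = b * a := by
  apply Subtype.ext
  have h := CliffordAlgebra.commute_map_mul_map_of_isOrtho_of_mem_evenOdd_zero_left
    (QuadraticMap.Isometry.id (0 : QuadraticForm ℝ (q → ℝ)))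
    (QuadraticMap.Isometry.id (0 : QuadraticForm ℝ (q → ℝ)))
    (fun x y => by simp [QuadraticMap.IsOrtho]) (a : Gr q) (b : Gr q) (i₂ := 0) a.2 b.2
  rw [CliffordAlgebra.map_id] at h
  exact h

instance instCommRingGrEven (q : Type) : CommRing (GrEven q) :=
  { (inferInstance : Ring (GrEven q)) with mul_comm := grEven_mul_comm }

open Classical in
/-- The determinant of a square matrix with even entries. -/
def evenDet {q m : Type} [Fintype m] [DecidableEq m] (M : Matrix m m (Gr q)) : Gr q :=
  if h : ∀ i j, M i j ∈ GrEven q then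
    ((Matrix.of fun i j => (⟨M i j, h i j⟩ : GrEven q)).det : Gr q)
  else 0

/-- The superdeterminant (Berezinian) `det (A - B D⁻¹ C) / det D` of an invertible even
supermatrix with rows and columns sorted as (even ⊕ odd). -/
def sdet {q m n : Type} [Fintype m] [DecidableEq m] [Fintype n] [DecidableEq n]
    (M : Matrix (m ⊕ n) (m ⊕ n) (Gr q)) : Gr q :=
  evenDet (M.toBlocks₁₁ - M.toBlocks₁₂ * Ring.inverse M.toBlocks₂₂ * M.toBlocks₂₁) *
    Ring.inverse (evenDet M.toBlocks₂₂)

/-- The logarithm `ln |a|` of an even element `a` with non-zero body `a₀`, that is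
`ln |a₀| + ln (1 + s)` with `s = a / a₀ - 1` nilpotent (so that the logarithmic series stops). -/
def grLog {q : Type} [Fintype q] (a : Gr q) : Gr q :=
  algebraMap ℝ (Gr q) (Real.log (body a)) +
    ∑ k ∈ Finset.range (Fintype.card q),
      ((-1 : ℝ) ^ k / (k + 1)) • ((body a)⁻¹ • a - 1) ^ (k + 1)

/-- Superfunctions with even coordinates indexed by `p` and odd coordinates indexed by `q`:
functions of the even coordinates with values in the Grassmann algebra on the odd ones. They are
only considered on open sets `U ⊆ ℝ^p` where they are smooth. -/
abbrev SFun (p q : Type) : Type := (p → ℝ) → Gr q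

section Calculus

variable {p q : Type} [Fintype p] [DecidableEq p] [Fintype q]

/-- Smooth on `U`. -/
def Smooth (U : Set (p → ℝ)) (f : SFun p q) : Prop := ContDiffOn ℝ ∞ f U

/-- A family of superfunctions on `U`, jointly smooth in the parameter `t ∈ T`. -/
def SmoothFamily (T : Set ℝ) (U : Set (p → ℝ)) (F : ℝ → SFun p q) : Prop :=
  ContDiffOn ℝ ∞ (fun z : ℝ × (p → ℝ) => F z.1 z.2) (T ×ˢ U)

/-- `f` has Grassmann parity `e` on `U`. -/
def HasParity (U : Set (p → ℝ)) (e : ZMod 2) (f : SFun p q) : Prop :=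
  ∀ x ∈ U, f x ∈ grPart q e

/-- Grassmann parity of the coordinates. -/
def par : p ⊕ q → ZMod 2 := Sum.elim (fun _ => 0) (fun _ => 1)

/-- The sign `(-1)^e`. -/
def sg (e : ZMod 2) : ℝ := (-1) ^ e.val

/-- Left partial derivative with respect to a coordinate. -/
def dL : p ⊕ q → SFun p q → SFun p q
  | Sum.inl i, f => fun x => fderiv ℝ f x (Pi.single i 1)
  | Sum.inr j, f => fun x => CliffordAlgebra.contractLeft (LinearMap.proj j) (f x)

/-- Right partial derivative with respect to a coordinate. -/
def dR : p ⊕ q → SFun p q → SFun p q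
  | Sum.inl i, f => fun x => fderiv ℝ f x (Pi.single i 1)
  | Sum.inr j, f => fun x => CliffordAlgebra.contractRight (f x) (LinearMap.proj j)

/-- The antibracket `(F,G) = (F ∂ᵣ/∂Γ^A) E^{AB} (∂ₗ/∂Γ^B G)`. -/
def bracket (E : p ⊕ q → p ⊕ q → SFun p q) (F G : SFun p q) : SFun p q :=
  ∑ A, ∑ B, dR A F * E A B * dL B G

/-- A possibly degenerate antisymplectic structure on `U`: smooth, of parity `ε_A + ε_B + 1`,
graded skewsymmetric, and satisfying the graded Jacobi identity. -/
structure IsAntisymplectic (U : Set (p → ℝ)) (E : p ⊕ q → p ⊕ q → SFun p q) : Prop where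
  smooth : ∀ A B, Smooth U (E A B)
  parity : ∀ A B, HasParity U (par A + par B + 1) (E A B)
  skew : ∀ A B, ∀ x ∈ U, E B A x = -sg ((par A + 1) * (par B + 1)) • E A B x
  jacobi : ∀ (F G H : SFun p q) (eF eG eH : ZMod 2),
    Smooth U F → Smooth U G → Smooth U H →
    HasParity U eF F → HasParity U eG G → HasParity U eH H → ∀ x ∈ U,
      sg ((eF + 1) * (eH + 1)) • bracket E F (bracket E G H) x +
      sg ((eG + 1) * (eF + 1)) • bracket E G (bracket E H F) x +
      sg ((eH + 1) * (eG + 1)) • bracket E H (bracket E F G) x = 0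

/-- A measure density on `U`: a smooth even superfunction with nowhere vanishing body. -/
structure IsDensity (U : Set (p → ℝ)) (ρ : SFun p q) : Prop where
  smooth : Smooth U ρ
  parity : HasParity U 0 ρ
  body_ne_zero : ∀ x ∈ U, body (ρ x) ≠ 0

/-- `Φ` is a (finite) anticanonical transformation of the superfunctions on `U`: it preserves
smoothness and parity, products, and antibrackets. -/
structure IsAnticanonical (U : Set (p → ℝ)) (E : p ⊕ q → p ⊕ q → SFun p q)
    (Φ : SFun p q → SFun p q) : Prop where
  smooth : ∀ F, Smooth U F → Smooth U (Φ F)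
  parity : ∀ F e, Smooth U F → HasParity U e F → HasParity U e (Φ F)
  map_mul : ∀ F G, Smooth U F → Smooth U G → ∀ x ∈ U, Φ (F * G) x = Φ F x * Φ G x
  map_bracket : ∀ F G, Smooth U F → Smooth U G →
    ∀ x ∈ U, Φ (bracket E F G) x = bracket E (Φ F) (Φ G) x

/-- `𝒰 t` is the path-ordered exponential `P exp ∫₀ᵗ ad ψ(s) ds` acting on superfunctions on `U`,
where `ad ψ = (ψ, ·)`: a smooth family of invertible linear operators with `𝒰 0 = 1` and
`d/dt 𝒰(t) = ad ψ(t) ∘ 𝒰(t)`. Operators only see superfunctions on `U`. The last fields say that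
`𝒰` and its inverse depend smoothly on `t`, and the differential equation is written for `𝒰 t`
applied to a superfunction that may itself depend on `t`. If `ψ` does not depend on `t`, this is
`𝒰 t = exp (t ad ψ)`. -/
structure IsPathOrderedExp (T : Set ℝ) (U : Set (p → ℝ)) (E : p ⊕ q → p ⊕ q → SFun p q)
    (ψ : ℝ → SFun p q) (𝒰 : ℝ → SFun p q → SFun p q) : Prop where
  congr : ∀ t ∈ T, ∀ F G, Smooth U F → Set.EqOn F G U → Set.EqOn (𝒰 t F) (𝒰 t G) U
  map_add : ∀ t ∈ T, ∀ F G, Smooth U F → Smooth U G →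
    ∀ x ∈ U, 𝒰 t (F + G) x = 𝒰 t F x + 𝒰 t G x
  map_smul : ∀ t ∈ T, ∀ (r : ℝ) F, Smooth U F → ∀ x ∈ U, 𝒰 t (r • F) x = r • 𝒰 t F x
  init : ∀ F, Smooth U F → Set.EqOn (𝒰 0 F) F U
  smooth : ∀ F, SmoothFamily T U F → SmoothFamily T U (fun t => 𝒰 t (F t))
  deriv : ∀ F, SmoothFamily T U F → ∀ t ∈ T, ∀ x ∈ U,
    HasDerivAt (fun s => 𝒰 s (F s) x)
      (bracket E (ψ t) (𝒰 t (F t)) x + 𝒰 t (fun y => deriv (fun s => F s y) t) x) t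
  inverse : ∃ 𝒱 : ℝ → SFun p q → SFun p q,
    (∀ t ∈ T, ∀ F G, Smooth U F → Set.EqOn F G U → Set.EqOn (𝒱 t F) (𝒱 t G) U) ∧
    (∀ F, SmoothFamily T U F → SmoothFamily T U (fun t => 𝒱 t (F t))) ∧
    ∀ t ∈ T, ∀ F, Smooth U F →
      Set.EqOn (𝒱 t (𝒰 t F)) F U ∧ Set.EqOn (𝒰 t (𝒱 t F)) F U

end Calculus

/-! ### The first-level phase space -/

/-- Index set of `N = a + b` constraints: `a` even ones (`ε_α = 0`), then `b` odd ones
(`ε_α = 1`). -/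
abbrev CIdx (a b : ℕ) : Type := Fin a ⊕ Fin b

/-- Superfunctions of the zeroth-level variables `Γ^A`, of which `N` are even and `N` are odd. -/
abbrev SFun₀ (a b : ℕ) : Type := SFun (CIdx a b) (CIdx a b)

/-- Indices of the zeroth-level coordinates `Γ^A`. -/
abbrev Coord₀ (a b : ℕ) : Type := CIdx a b ⊕ CIdx a b

/-- Superfunctions of the first-level variables `{Γ^A; λ^α, λ*_α}`. The even variables are the even
`Γ^A` followed by `λ^α` (`ε_α = 0`) and `λ*_α` (`ε_α = 1`); the odd variables are the odd `Γ^A`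
followed by `λ*_α` (`ε_α = 0`) and `λ^α` (`ε_α = 1`). -/
abbrev SFun₁ (a b : ℕ) : Type := SFun (CIdx a b ⊕ CIdx a b) (CIdx a b ⊕ CIdx a b)

/-- Indices of the first-level coordinates. -/
abbrev Coord₁ (a b : ℕ) : Type := (CIdx a b ⊕ CIdx a b) ⊕ (CIdx a b ⊕ CIdx a b)

/-- Formal power series in `η = iħ₍₁₎` with coefficients in the first-level superfunctions. -/
abbrev Series (a b : ℕ) : Type := PowerSeries (SFun₁ a b)

section FirstLevel

variable {a b : ℕ}

/-- Position of `Γ^A` among the first-level coordinates. -/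
def gam : Coord₀ a b → Coord₁ a b := Sum.map Sum.inl Sum.inl

/-- Position of the Lagrange multiplier `λ^α`. -/
def lam : CIdx a b → Coord₁ a b :=
  Sum.elim (fun i => Sum.inl (Sum.inr (Sum.inl i))) (fun j => Sum.inr (Sum.inr (Sum.inr j)))

/-- Position of the antifield `λ*_α`. -/
def lamStar : CIdx a b → Coord₁ a b :=
  Sum.elim (fun i => Sum.inr (Sum.inr (Sum.inl i))) (fun j => Sum.inl (Sum.inr (Sum.inr j)))

/-- Grassmann parity `ε_α` of `λ^α` and of the constraint `G_α`. -/
def eps : CIdx a b → ZMod 2 := par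

/-- A coordinate, viewed as a superfunction. -/
def coordFun {p q : Type} [DecidableEq q] : p ⊕ q → SFun p q
  | Sum.inl i => fun x => algebraMap ℝ (Gr q) (x i)
  | Sum.inr j => fun _ => ExteriorAlgebra.ι ℝ (Pi.single j 1)

/-- A zeroth-level superfunction, viewed as a first-level one. -/
def lift (f : SFun₀ a b) : SFun₁ a b := fun y =>
  ExteriorAlgebra.map (Function.ExtendByZero.linearMap ℝ Sum.inl) (f (fun i => y (Sum.inl i)))

/-- The point with even zeroth-level coordinates `x` and with `λ = λ* = 0`. -/
def zeroSection (x : CIdx a b → ℝ) : CIdx a b ⊕ CIdx a b → ℝ := Sum.elim x 0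

/-- The restriction of a first-level superfunction to `λ = λ* = 0`. -/
def restrict (f : SFun₁ a b) : SFun₀ a b := fun x =>
  ExteriorAlgebra.map (LinearMap.funLeft ℝ ℝ Sum.inl) (f (zeroSection x))

/-- The Planck number operator `λ^α ∂/∂λ^α - λ*_α ∂/∂λ*_α` at fixed `ħ₍₁₎`. -/
def planckOp (f : SFun₁ a b) : SFun₁ a b :=
  ∑ α, (coordFun (lam α) * dL (lam α) f - coordFun (lamStar α) * dL (lamStar α) f)

/-- `F` has Planck number `k` on `W`, where `Pl(λ) = Pl(ħ₍₁₎) = 1`, `Pl(λ*) = -1`, `Pl(Γ) = 0`. -/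
def HasPlanckNumber (W : Set (CIdx a b ⊕ CIdx a b → ℝ)) (k : ℤ) (F : Series a b) : Prop :=
  ∀ n : ℕ, ∀ y ∈ W, planckOp (PowerSeries.coeff n F) y + (n : ℝ) • PowerSeries.coeff n F y =
    (k : ℝ) • PowerSeries.coeff n F y

/-- Apply an operation to each coefficient of a series. -/
def mapCoeff (D : SFun₁ a b → SFun₁ a b) (F : Series a b) : Series a b :=
  PowerSeries.mk fun n => D (PowerSeries.coeff n F)

/-- The first-level odd Laplacian
`(-1)^{ε_A}/(2ρ) ∂_A ρ E^{AB} ∂_B + (-1)^{ε_α} ∂/∂λ^α ∂/∂λ*_α`, written for an arbitrary family of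
operators `D` in the place of the left derivatives with respect to the first-level coordinates. -/
def oddLaplacian₁ (ρ : SFun₀ a b) (E : Coord₀ a b → Coord₀ a b → SFun₀ a b)
    (D : Coord₁ a b → Series a b → Series a b) (F : Series a b) : Series a b :=
  (∑ A, ∑ B, (sg (par A) / 2) •
    (PowerSeries.C (lift fun x => Ring.inverse (ρ x)) *
      D (gam A) (PowerSeries.C (lift (ρ * E A B)) * D (gam B) F))) +
  ∑ α, sg (eps α) • D (lam α) (D (lamStar α) F)

/-- The derivative `∂_A` acting behind a Boltzmann factor: since `i/ħ₍₁₎ = -1/η`, for bosonic `X`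
`η ∂_A (e^{iX/ħ} F) = e^{iX/ħ} (η ∂_A F - (∂_A X) F)`, and this is the factor in parentheses. -/
def boltzmannD (X : Series a b) (A : Coord₁ a b) (F : Series a b) : Series a b :=
  PowerSeries.X * mapCoeff (dL A) F - mapCoeff (dL A) X * F

/-- `η² e^{-iX/ħ} Δ₍₁₎ (e^{iX/ħ} F)`. -/
def boltzmannLaplacian (ρ : SFun₀ a b) (E : Coord₀ a b → Coord₀ a b → SFun₀ a b)
    (X F : Series a b) : Series a b :=
  oddLaplacian₁ ρ E (boltzmannD X) F

/-- The derivative in `t` of a family of series. -/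
def dt (X : ℝ → Series a b) (t : ℝ) : Series a b :=
  PowerSeries.mk fun n y => deriv (fun s => PowerSeries.coeff n (X s) y) t

/-- `X t`, `t ∈ T`, is a family of bosonic actions on `W` related by finite `Δ₍₁₎`-exact
deformations with fermionic generators `Ψ t` of Planck number zero:
`d/dt e^{iX/ħ} = -[Δ₍₁₎, Ψ] e^{iX/ħ}`, i.e.
`e^{iX(t)/ħ} = P exp(-∫₀ᵗ [Δ₍₁₎, Ψ(s)] ds) e^{iX(0)/ħ}`. Here `[Δ₍₁₎, Ψ] = Δ₍₁₎ Ψ + Ψ Δ₍₁₎`, and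
the equation is multiplied by the invertible factor `η² e^{-iX/ħ}`, which turns its left-hand side
into `-η dX/dt`. -/
structure IsExactDeformation (T : Set ℝ) (W : Set (CIdx a b ⊕ CIdx a b → ℝ)) (ρ : SFun₀ a b)
    (E : Coord₀ a b → Coord₀ a b → SFun₀ a b) (Ψ X : ℝ → Series a b) : Prop where
  smooth_gen : ∀ n, SmoothFamily T W fun t => PowerSeries.coeff n (Ψ t)
  odd_gen : ∀ t ∈ T, ∀ n, HasParity W 1 (PowerSeries.coeff n (Ψ t))
  planck_gen : ∀ t ∈ T, HasPlanckNumber W 0 (Ψ t)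
  smooth : ∀ n, SmoothFamily T W fun t => PowerSeries.coeff n (X t)
  even : ∀ t ∈ T, ∀ n, HasParity W 0 (PowerSeries.coeff n (X t))
  evolution : ∀ t ∈ T, ∀ n, ∀ y ∈ W,
    (PowerSeries.coeff n (-(PowerSeries.X * dt X t) : Series a b) : SFun₁ a b) y =
      (PowerSeries.coeff n (-(boltzmannLaplacian ρ E (X t) (Ψ t) +
        Ψ t * boltzmannLaplacian ρ E (X t) 1) : Series a b) : SFun₁ a b) y

/-- The constraints `G_α` of `X = G_α λ^α + iħ₍₁₎ H + O(λ*)`. -/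
def constraint (X : Series a b) (α : CIdx a b) : SFun₀ a b :=
  restrict (dR (lam α) (PowerSeries.coeff 0 X))

/-- The quantum correction `H` of `X = G_α λ^α + iħ₍₁₎ H + O(λ*)`. -/
def quantumH (X : Series a b) : SFun₀ a b := restrict (PowerSeries.coeff 1 X)

/-! ### The on-shell square root formula -/

/-- The functions `{F^α; G_α}` sorted into even ones (`G_α` with `ε_α = 0`, `F^α` with `ε_α = 1`)
and odd ones (`F^α` with `ε_α = 0`, `G_α` with `ε_α = 1`). -/
def barGamma (F G : CIdx a b → SFun₀ a b) : Coord₀ a b → SFun₀ a b :=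
  Sum.elim
    (Sum.elim (fun i => G (Sum.inl i)) (fun j => F (Sum.inr j)))
    (Sum.elim (fun i => F (Sum.inl i)) (fun j => G (Sum.inr j)))

/-- The Jacobian supermatrix `∂{F;G}/∂Γ` at a point. -/
def jacobian (F G : CIdx a b → SFun₀ a b) (x : CIdx a b → ℝ) :
    Matrix (Coord₀ a b) (Coord₀ a b) (Gr (CIdx a b)) :=
  Matrix.of fun A B => dR B (barGamma F G A) x

/-- The supermatrix of antibrackets `(F^α, G_β)` at a point. -/
def bracketMatrix (E : Coord₀ a b → Coord₀ a b → SFun₀ a b) (F G : CIdx a b → SFun₀ a b)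
    (x : CIdx a b → ℝ) : Matrix (CIdx a b) (CIdx a b) (Gr (CIdx a b)) :=
  Matrix.of fun α β => bracket E (F α) (G β) x

/-- The on-shell square root formula
`H = c - ln √( sdet(∂{F;G}/∂Γ) sdet(F^α,G_β) / ρ ) + O(G)`
on `U`: near each point of the constraint surface (where the even `G_α` have vanishing body),
`{F;G}` are local coordinates, `(F^α,G_β)` is invertible, and the two sides differ by a
combination `G_α k^α` with smooth `k^α`. -/
def SquareRootFormula (U : Set (CIdx a b → ℝ)) (ρ : SFun₀ a b)
    (E : Coord₀ a b → Coord₀ a b → SFun₀ a b) (F G : CIdx a b → SFun₀ a b) (H : SFun₀ a b)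
    (c : ℝ) : Prop :=
  ∀ x ∈ U, (∀ i : Fin a, body (G (Sum.inl i) x) = 0) →
    ∃ V ⊆ U, IsOpen V ∧ x ∈ V ∧
      (∀ y ∈ V, IsUnit (jacobian F G y) ∧ IsUnit (bracketMatrix E F G y)) ∧
      ∃ k : CIdx a b → SFun₀ a b, (∀ α, Smooth V (k α)) ∧ ∀ y ∈ V,
        H y = algebraMap ℝ (Gr (CIdx a b)) c -
          (1 / 2 : ℝ) • grLog (sdet (jacobian F G y) * sdet (bracketMatrix E F G y) *
            Ring.inverse (ρ y)) +
          ∑ α, G α y * k α y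

end FirstLevel

end BV

end

set_option linter.unusedSectionVars false

noncomputable section

namespace BV

/-! ### Signs -/

/-! Write η = iħ, let ψ(t) be the part of Ψ(t) at ħ = λ = λ* = 0, and put ∇ = d/dt - (ψ(t), ·).
Stripped of the Boltzmann factor, the evolution equation is an identity of power series in η. The
commutator [Δ₍₁₎, Ψ] consists of a first-order operator and the function Δ₍₁₎Ψ; the function appears
one order in η later, so it does not affect the classical part of X and enters the evolution of the
η-coefficient only through the η⁰-part of Ψ. On the zero section λ = λ* = 0 a superfunction with
nonzero eigenvalue of λ∂_λ - λ*∂_λ* vanishes, so the Planck number of Ψ removes most terms. What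
survives is ∇G_α = M_α^β G_β and ∇H = Δψ - str M + ν^β G_β, where M is, up to signs, the
λλ*-coefficient of Ψ at η = 0 (`nabla_constraint`, `nabla_quantumH`). The transported functions 𝒰F
satisfy ∇F = 0.

Let 𝒱 be the inverse of 𝒰. Since d/dt (𝒱z) = 𝒱(∇z) (`Flow.hasDerivAt_inv`), applying 𝒱 turns these
relations into linear ordinary differential equations at a fixed point. A family with ∇z = 0 is 𝒰
applied to its initial value; as ∇ is a derivation of products and, by the Jacobi identity, of
antibrackets, 𝒰 preserves both. The pulled back constraints solve a linear system whose transport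
matrix is smooth, invertible and of the right parity; applying 𝒰 to it gives the rotation of the
constraints.

The square root formula is a Liouville argument. With N the Jacobian matrix of the Hamiltonian
vector field of ψ, the pulled back Jacobian J of {F;G} obeys J' = J N + M J + O(G), and the matrix B
= (F,G) obeys B' = B Mᵗ + O(G), with a signed transpose. Hence ln sdet J, ln sdet B and -ln ρ have
derivatives str N + str M, str M and ρ⁻¹(ψ,ρ) modulo G. Since Δψ = -½(str N + ρ⁻¹(ψ,ρ))
(`oddLaplacian_odd`), half of their sum is str M - Δψ, which cancels the derivative of H. So H + ln
√(…) changes by O(G) only (`DeformedFrame.hasDerivAt_log`); integrating together with the linear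
equation for G keeps the error a smooth combination of constraints and leaves c untouched. On the
constraint surface the O(G) terms have no body, so the body determinants of J and B solve scalar
linear equations and cannot reach zero; by compactness invertibility holds on a neighbourhood for
all times in [0,1].

The pulled back formula holds only near a point, whereas 𝒰 acts on superfunctions on all of U.
Locality closes this gap: an algebra homomorphism evaluated at x sees bodies at a single base point
(`Flow.body_exp`) and only the germ there. Combined with a cut-off it becomes an even homomorphism
on local superfunctions, which commutes with inverses and superdeterminants (`LocalChar.map_sdet`)
and with logarithms (`Flow.exp_cut_grLog`). -/

theorem sg_zero : sg 0 = 1 := by simp [sg]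

theorem sg_one : sg 1 = -1 := by simp [sg, ZMod.val_one]

theorem zmod_two_cases (e : ZMod 2) : e = 0 ∨ e = 1 := by
  revert e; decide

theorem sg_add (a b : ZMod 2) : sg (a + b) = sg a * sg b := by
  rcases zmod_two_cases a with rfl | rfl <;> rcases zmod_two_cases b with rfl | rfl <;>
    simp [sg_zero, sg_one, show (1 : ZMod 2) + 1 = 0 from rfl]

theorem sg_mul_self (a : ZMod 2) : sg a * sg a = 1 := by
  rcases zmod_two_cases a with rfl | rfl <;> simp [sg_zero, sg_one]

theorem one_add_one_zmod : (1 : ZMod 2) + 1 = 0 := rfl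

theorem zmod_add_self (a : ZMod 2) : a + a = 0 := by
  revert a; decide

/-! ### Grassmann algebras -/

section Grassmann

variable {q : Type}

/-- The `e`-th power of the grade involution. -/
def tw (e : ZMod 2) : Gr q →ₐ[ℝ] Gr q :=
  if e = 0 then AlgHom.id ℝ (Gr q)
  else CliffordAlgebra.involute (Q := (0 : QuadraticForm ℝ (q → ℝ)))

@[simp] theorem tw_zero (x : Gr q) : tw 0 x = x := rfl

theorem tw_one_ι (v : q → ℝ) : tw 1 (ExteriorAlgebra.ι ℝ v) = -ExteriorAlgebra.ι ℝ v :=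
  CliffordAlgebra.involute_ι (Q := (0 : QuadraticForm ℝ (q → ℝ))) v

theorem tw_one_tw_one (x : Gr q) : tw 1 (tw 1 x) = x :=
  CliffordAlgebra.involute_involute (Q := (0 : QuadraticForm ℝ (q → ℝ))) x

theorem tw_tw_self (e : ZMod 2) (x : Gr q) : tw e (tw e x) = x := by
  rcases zmod_two_cases e with rfl | rfl
  · rfl
  · exact tw_one_tw_one x

/-- Splitting x into even and odd parts u + v, the eigenvalue equation forces 2v = 0 or 2u = 0. In
this form parity passes through every linear map that commutes with the involution, and it can be
differentiated. -/
theorem mem_grPart_iff {e : ZMod 2} {x : Gr q} : x ∈ grPart q e ↔ tw 1 x = sg e • x := by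
  have h0 : ∀ y ∈ grPart q 0, tw 1 y = y := fun y hy =>
    CliffordAlgebra.involute_eq_of_mem_even (Q := (0 : QuadraticForm ℝ (q → ℝ))) hy
  have h1 : ∀ y ∈ grPart q 1, tw 1 y = -y := fun y hy =>
    CliffordAlgebra.involute_eq_of_mem_odd (Q := (0 : QuadraticForm ℝ (q → ℝ))) hy
  constructor
  · intro hx
    rcases zmod_two_cases e with rfl | rfl
    · rw [h0 x hx, sg_zero, one_smul]
    · rw [h1 x hx, sg_one, neg_one_smul]
  · intro hx
    have hc := CliffordAlgebra.evenOdd_isCompl (0 : QuadraticForm ℝ (q → ℝ))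
    obtain ⟨u, hu, v, hv, huv⟩ := Submodule.mem_sup.1
      (hc.sup_eq_top ▸ Submodule.mem_top : x ∈ _)
    have h3 : tw 1 x = u - v := by
      rw [← huv, map_add, h0 u hu, h1 v hv, sub_eq_add_neg]
    rcases zmod_two_cases e with rfl | rfl
    · rw [sg_zero, one_smul, h3, ← huv] at hx
      have : v = 0 := by
        have h4 : (2 : ℝ) • v = 0 := by 
          rw [two_smul, show v + v = (u + v) - (u - v) by abel, hx, sub_self]
        simpa using h4
      rw [← huv, this, add_zero]; exact hu
    · rw [sg_one, neg_one_smul, h3, ← huv] at hx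
      have : u = 0 := by
        have h4 : (2 : ℝ) • u = 0 := by 
          rw [two_smul, show u + u = (u - v) - -(u + v) by abel, hx, sub_self]
        simpa using h4
      rw [← huv, this, zero_add]; exact hv

theorem tw_of_mem {d e : ZMod 2} {x : Gr q} (hx : x ∈ grPart q e) : tw d x = sg (d * e) • x := by
  rcases zmod_two_cases d with rfl | rfl
  · simp [sg_zero]
  · rw [one_mul]; exact mem_grPart_iff.1 hx

theorem mul_mem_grPart {d e : ZMod 2} {x y : Gr q} (hx : x ∈ grPart q d) (hy : y ∈ grPart q e) :
    x * y ∈ grPart q (d + e) := by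
  rw [mem_grPart_iff] at *
  rw [map_mul, hx, hy, sg_add, smul_mul_smul_comm]

theorem algebraMap_mem_grPart (r : ℝ) : algebraMap ℝ (Gr q) r ∈ grPart q 0 := by
  rw [mem_grPart_iff, AlgHom.commutes, sg_zero, one_smul]

theorem one_mem_grPart : (1 : Gr q) ∈ grPart q 0 := by
  simpa using algebraMap_mem_grPart (q := q) 1

theorem tw_mem_grPart {d e : ZMod 2} {x : Gr q} (hx : x ∈ grPart q e) : tw d x ∈ grPart q e := by
  rw [tw_of_mem hx]; exact Submodule.smul_mem _ _ hx

theorem tw_comm (d e : ZMod 2) (x : Gr q) : tw d (tw e x) = tw e (tw d x) := by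
  rcases zmod_two_cases d with rfl | rfl <;> rcases zmod_two_cases e with rfl | rfl <;> rfl

theorem tw_add (d e : ZMod 2) (x : Gr q) : tw (d + e) x = tw d (tw e x) := by
  rcases zmod_two_cases d with rfl | rfl <;> rcases zmod_two_cases e with rfl | rfl
  · rfl
  · rfl
  · rfl
  · rw [one_add_one_zmod, tw_one_tw_one, tw_zero]

/-- The part of parity `e`. -/
def grProj (e : ZMod 2) : Gr q →ₗ[ℝ] Gr q :=
  (1 / 2 : ℝ) • (LinearMap.id + sg e • (tw 1).toLinearMap)

theorem grProj_apply (e : ZMod 2) (x : Gr q) : grProj e x = (1 / 2 : ℝ) • (x + sg e • tw 1 x) :=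
  rfl

theorem grProj_mem (e : ZMod 2) (x : Gr q) : grProj e x ∈ grPart q e := by
  rw [mem_grPart_iff, grProj_apply, map_smul, map_add, map_smul, tw_one_tw_one,
    smul_comm (sg e) (1 / 2 : ℝ), smul_add (sg e), smul_smul, sg_mul_self, one_smul, add_comm]

theorem grProj_add_grProj (e : ZMod 2) (x : Gr q) : grProj e x + grProj (e + 1) x = x := by
  simp only [grProj_apply, sg_add, sg_one]
  module

theorem grProj_of_mem {e : ZMod 2} {x : Gr q} (hx : x ∈ grPart q e) : grProj e x = x := by
  rw [grProj_apply, mem_grPart_iff.1 hx, smul_smul, sg_mul_self]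
  module

theorem eq_grProj_zero_add_grProj_one (x : Gr q) : x = grProj 0 x + grProj 1 x := by
  have := grProj_add_grProj 0 x
  rw [zero_add] at this
  exact this.symm

/-- Graded commutativity with only y homogeneous: the sign is absorbed in a twist of x. Two odd
elements anticommute; in all other cases one factor is even, hence central. -/
theorem mul_eq_mul_tw {d : ZMod 2} (x : Gr q) {y : Gr q} (hy : y ∈ grPart q d) :
    x * y = y * tw d x := by
  have key : ∀ e, ∀ z ∈ grPart q e, z * y = y * tw d z := by
    intro e z hz
    rw [tw_of_mem hz]
    by_cases hde : d = 1 ∧ e = 1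
    · obtain ⟨rfl, rfl⟩ := hde
      have h1 := CliffordAlgebra.map_mul_map_eq_neg_of_isOrtho_of_mem_evenOdd_one
        (QuadraticMap.Isometry.id (0 : QuadraticForm ℝ (q → ℝ)))
        (QuadraticMap.Isometry.id (0 : QuadraticForm ℝ (q → ℝ)))
        (fun x y => by simp [QuadraticMap.IsOrtho]) z y hz hy
      rw [CliffordAlgebra.map_id] at h1
      rw [one_mul, sg_one, neg_one_smul, mul_neg, ← neg_mul]
      exact h1
    · have h0 : d = 0 ∨ e = 0 := by
        rcases zmod_two_cases d with rfl | rfl <;> rcases zmod_two_cases e with rfl | rfl <;> simp_all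
      rcases h0 with rfl | rfl
      · have h := CliffordAlgebra.commute_map_mul_map_of_isOrtho_of_mem_evenOdd_zero_right
          (QuadraticMap.Isometry.id (0 : QuadraticForm ℝ (q → ℝ)))
          (QuadraticMap.Isometry.id (0 : QuadraticForm ℝ (q → ℝ)))
          (fun x y => by simp [QuadraticMap.IsOrtho]) z y (i₁ := e) hz hy
        rw [CliffordAlgebra.map_id] at h
        rw [zero_mul, sg_zero, one_smul]
        exact h
      · have h := CliffordAlgebra.commute_map_mul_map_of_isOrtho_of_mem_evenOdd_zero_left
          (QuadraticMap.Isometry.id (0 : QuadraticForm ℝ (q → ℝ)))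
          (QuadraticMap.Isometry.id (0 : QuadraticForm ℝ (q → ℝ)))
          (fun x y => by simp [QuadraticMap.IsOrtho]) z y (i₂ := d) hz hy
        rw [CliffordAlgebra.map_id] at h
        rw [mul_zero, sg_zero, one_smul]
        exact h
  conv_lhs => rw [eq_grProj_zero_add_grProj_one x]
  conv_rhs => rw [eq_grProj_zero_add_grProj_one x]
  rw [add_mul, map_add, mul_add, key 0 _ (grProj_mem 0 x), key 1 _ (grProj_mem 1 x)]

theorem mul_comm_of_mem {d e : ZMod 2} {x y : Gr q} (hx : x ∈ grPart q d) (hy : y ∈ grPart q e) :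
    x * y = sg (d * e) • (y * x) := by
  rw [mul_eq_mul_tw x hy, tw_of_mem hx, mul_smul_comm, mul_comm d e]

theorem mul_comm_of_even {x : Gr q} (hx : x ∈ grPart q 0) (y : Gr q) : x * y = y * x := by
  rw [mul_eq_mul_tw y hx, tw_zero]

/-! ### The body -/

@[simp] theorem body_algebraMap (r : ℝ) : body (algebraMap ℝ (Gr q) r) = r :=
  AlgHom.commutes _ r

theorem body_ι (v : q → ℝ) : body (ExteriorAlgebra.ι ℝ v : Gr q) = 0 := by
  simp [body, ExteriorAlgebra.algebraMapInv]

theorem body_tw (e : ZMod 2) (x : Gr q) : body (tw e x) = body x := by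
  rcases zmod_two_cases e with rfl | rfl
  · rfl
  · have : body.comp (tw 1) = (body : Gr q →ₐ[ℝ] ℝ) := by
      apply ExteriorAlgebra.hom_ext
      ext v
      simp [tw_one_ι, body_ι]
    exact DFunLike.congr_fun this x

theorem body_of_odd {x : Gr q} (hx : x ∈ grPart q 1) : body x = 0 := by
  have h := body_tw 1 x
  rw [mem_grPart_iff.1 hx, sg_one, neg_one_smul, map_neg] at h
  linarith

/-- The ideal of elements of degree at least `k` in the generators. -/
def soulPow (q : Type) (k : ℕ) : Submodule ℝ (Gr q) :=
  LinearMap.range (ExteriorAlgebra.ι ℝ : (q → ℝ) →ₗ[ℝ] Gr q) ^ k * ⊤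

/-- A generator can be moved to the left through any element at the price of a twist, so the
generators of both factors can be collected in front. -/
theorem soulPow_mul_le (a b : ℕ) : soulPow q a * soulPow q b ≤ soulPow q (a + b) := by
  have comm : (⊤ : Submodule ℝ (Gr q)) * LinearMap.range (ExteriorAlgebra.ι ℝ) ≤
      LinearMap.range (ExteriorAlgebra.ι ℝ) * ⊤ := by
    rw [Submodule.mul_le]
    rintro x - _ ⟨v, rfl⟩
    rw [mul_eq_mul_tw x (d := 1)
      (CliffordAlgebra.ι_mem_evenOdd_one (0 : QuadraticForm ℝ (q → ℝ)) v)]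
    exact Submodule.mul_mem_mul (LinearMap.mem_range_self _ v) Submodule.mem_top
  have commk : ∀ k : ℕ, (⊤ : Submodule ℝ (Gr q)) * LinearMap.range (ExteriorAlgebra.ι ℝ) ^ k ≤
      LinearMap.range (ExteriorAlgebra.ι ℝ) ^ k * ⊤ := by
    intro k
    induction k with
    | zero => simp
    | succ k ih =>
      calc (⊤ : Submodule ℝ (Gr q)) * LinearMap.range (ExteriorAlgebra.ι ℝ) ^ (k + 1)
          = (⊤ * LinearMap.range (ExteriorAlgebra.ι ℝ) ^ k) * LinearMap.range (ExteriorAlgebra.ι ℝ) := by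
            rw [pow_succ, mul_assoc]
        _ ≤ (LinearMap.range (ExteriorAlgebra.ι ℝ) ^ k * ⊤) * LinearMap.range (ExteriorAlgebra.ι ℝ) :=
            mul_le_mul_left ih _
        _ = LinearMap.range (ExteriorAlgebra.ι ℝ) ^ k * (⊤ * LinearMap.range (ExteriorAlgebra.ι ℝ)) := by
            rw [mul_assoc]
        _ ≤ LinearMap.range (ExteriorAlgebra.ι ℝ) ^ k * (LinearMap.range (ExteriorAlgebra.ι ℝ) * ⊤) :=
            mul_le_mul_right comm _
        _ = _ := by rw [← mul_assoc, pow_succ]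
  calc soulPow q a * soulPow q b
      = LinearMap.range (ExteriorAlgebra.ι ℝ) ^ a * ((⊤ * LinearMap.range (ExteriorAlgebra.ι ℝ) ^ b) * ⊤) := by
        simp only [soulPow, mul_assoc]
    _ ≤ LinearMap.range (ExteriorAlgebra.ι ℝ) ^ a * ((LinearMap.range (ExteriorAlgebra.ι ℝ) ^ b * ⊤) * ⊤) :=
        mul_le_mul_right (mul_le_mul_left (commk b) _) _
    _ = LinearMap.range (ExteriorAlgebra.ι ℝ) ^ (a + b) * (⊤ * ⊤) := by simp only [pow_add, mul_assoc]
    _ ≤ soulPow q (a + b) := mul_le_mul_right le_top _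

/-- Left induction on the generators shows more: subtracting its body from any element leaves
something of positive degree. -/
theorem mem_soulPow_one {x : Gr q} (hx : body x = 0) : x ∈ soulPow q 1 := by
  have key : ∀ y : Gr q, y - algebraMap ℝ (Gr q) (body y) ∈ soulPow q 1 := by
    intro y
    induction y using CliffordAlgebra.left_induction with
    | algebraMap r =>
      have : body (algebraMap ℝ (Gr q) r) = r := body_algebraMap r
      have h2 : algebraMap ℝ (Gr q) r - algebraMap ℝ (Gr q) (body (algebraMap ℝ (Gr q) r)) = 0 := by
        rw [this, sub_self]
      exact h2 ▸ Submodule.zero_mem _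
    | add x y hx hy =>
      have := Submodule.add_mem _ hx hy
      rw [map_add, map_add]
      convert this using 1
      abel
    | ι_mul x m _ =>
      have h1 : body (ExteriorAlgebra.ι ℝ m * x) = 0 := by rw [map_mul, body_ι, zero_mul]
      have h2 : ExteriorAlgebra.ι ℝ m * x - algebraMap ℝ (Gr q) (body (ExteriorAlgebra.ι ℝ m * x))
          = ExteriorAlgebra.ι ℝ m * x := by rw [h1, map_zero, sub_zero]
      have h3 : ExteriorAlgebra.ι ℝ m * x ∈ soulPow q 1 := by
        rw [soulPow, pow_one]
        exact Submodule.mul_mem_mul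
          (LinearMap.mem_range_self (ExteriorAlgebra.ι ℝ : (q → ℝ) →ₗ[ℝ] Gr q) m)
          Submodule.mem_top
      exact (congrArg (· ∈ soulPow q 1) h2).mpr h3
  have := key x
  rwa [hx, map_zero, sub_zero] at this

/-- The exterior power one above the number of generators has binomial dimension zero. Hence
elements without body are nilpotent, which is the source of all invertibility criteria below. -/
theorem soulPow_card_succ [Fintype q] : soulPow q (Fintype.card q + 1) = ⊥ := by
  have : LinearMap.range (ExteriorAlgebra.ι ℝ : (q → ℝ) →ₗ[ℝ] Gr q) ^ (Fintype.card q + 1) = ⊥ := by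
    have h := exteriorPower.finrank_eq (R := ℝ) (M := q → ℝ) (n := Fintype.card q + 1)
    rw [Module.finrank_fintype_fun_eq_card, Nat.choose_succ_self] at h
    exact Submodule.finrank_eq_zero.1 h
  rw [soulPow, this, Submodule.bot_mul]

theorem mul_mem_soulPow {a b : ℕ} {x y : Gr q} (hx : x ∈ soulPow q a) (hy : y ∈ soulPow q b) :
    x * y ∈ soulPow q (a + b) :=
  soulPow_mul_le a b (Submodule.mul_mem_mul hx hy)

theorem mem_soulPow_zero (x : Gr q) : x ∈ soulPow q 0 := by
  simp [soulPow]

theorem pow_mem_soulPow {x : Gr q} (hx : body x = 0) (k : ℕ) : x ^ k ∈ soulPow q k := by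
  induction k with
  | zero => exact mem_soulPow_zero _
  | succ k ih => rw [pow_succ]; exact mul_mem_soulPow ih (mem_soulPow_one hx)

theorem soulPow_eq_zero [Fintype q] {x : Gr q} (hx : x ∈ soulPow q (Fintype.card q + 1)) :
    x = 0 := by
  rw [soulPow_card_succ] at hx
  exact hx

end Grassmann

/-! ### Analysis in Grassmann algebras -/

section Analysis

variable {q : Type} [Fintype q]

instance instFiniteDimensionalGr : FiniteDimensional ℝ (Gr q) :=
  LinearEquiv.finiteDimensional (grCoord q).symm

/-- Multiplication as a continuous bilinear map. -/
def grMulL (q : Type) [Fintype q] : Gr q →L[ℝ] Gr q →L[ℝ] Gr q :=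
  (LinearMap.mul ℝ (Gr q)).toContinuousBilinearMap

theorem grMulL_apply (x y : Gr q) : grMulL q x y = x * y := rfl

/-- A linear map on the Grassmann algebra as a continuous one. -/
def grLin {F : Type*} [NormedAddCommGroup F] [NormedSpace ℝ F] (L : Gr q →ₗ[ℝ] F) : Gr q →L[ℝ] F :=
  LinearMap.toContinuousLinearMap L

section

variable {E : Type*} [NormedAddCommGroup E] [NormedSpace ℝ E]

theorem contDiffOn_grMul {n : WithTop ℕ∞} {s : Set E} {f g : E → Gr q} (hf : ContDiffOn ℝ n f s)
    (hg : ContDiffOn ℝ n g s) : ContDiffOn ℝ n (fun x => f x * g x) s :=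
  (grMulL q).isBoundedBilinearMap.contDiff.comp_contDiffOn (hf.prodMk hg)

theorem contDiffOn_grLin {F : Type*} [NormedAddCommGroup F] [NormedSpace ℝ F] (L : Gr q →ₗ[ℝ] F)
    {n : WithTop ℕ∞} {s : Set E} {f : E → Gr q} (hf : ContDiffOn ℝ n f s) :
    ContDiffOn ℝ n (fun x => L (f x)) s :=
  (grLin L).contDiff.comp_contDiffOn hf

theorem contDiffOn_algebraMap {n : WithTop ℕ∞} {s : Set E} {f : E → ℝ} (hf : ContDiffOn ℝ n f s) :
    ContDiffOn ℝ n (fun x => algebraMap ℝ (Gr q) (f x)) s :=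
  (LinearMap.toContinuousLinearMap (Algebra.linearMap ℝ (Gr q))).contDiff.comp_contDiffOn hf

theorem contDiffOn_grPow {n : WithTop ℕ∞} {s : Set E} {f : E → Gr q} (hf : ContDiffOn ℝ n f s)
    (k : ℕ) : ContDiffOn ℝ n (fun x => f x ^ k) s := by
  induction k with
  | zero => simpa using contDiffOn_const
  | succ k ih => simp only [pow_succ]; exact contDiffOn_grMul ih hf

theorem hasFDerivAt_grMul {f g : E → Gr q} {f' g' : E →L[ℝ] Gr q} {x : E}
    (hf : HasFDerivAt f f' x) (hg : HasFDerivAt g g' x) :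
    HasFDerivAt (fun y => f y * g y)
      ((grMulL q (f x)).comp g' + ((grMulL q).flip (g x)).comp f') x := by
  have h := ((grMulL q).isBoundedBilinearMap.hasFDerivAt (f x, g x)).comp x (hf.prodMk hg)
  refine h.congr_fderiv ?_
  ext v
  simp

theorem hasDerivAt_grMul {f g : ℝ → Gr q} {f' g' : Gr q} {t : ℝ} (hf : HasDerivAt f f' t)
    (hg : HasDerivAt g g' t) : HasDerivAt (fun s => f s * g s) (f' * g t + f t * g') t := by
  have h := (hasFDerivAt_grMul hf.hasFDerivAt hg.hasFDerivAt).hasDerivAt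
  convert h using 1
  simp [grMulL_apply, add_comm]

theorem hasDerivAt_grLin {F : Type*} [NormedAddCommGroup F] [NormedSpace ℝ F] (L : Gr q →ₗ[ℝ] F)
    {f : ℝ → Gr q} {f' : Gr q} {t : ℝ} (hf : HasDerivAt f f' t) :
    HasDerivAt (fun s => L (f s)) (L f') t :=
  (grLin L).hasFDerivAt.comp_hasDerivAt t hf

theorem fderiv_grLin {F : Type*} [NormedAddCommGroup F] [NormedSpace ℝ F] (L : Gr q →ₗ[ℝ] F)
    {f : E → Gr q} {x : E} (hf : DifferentiableAt ℝ f x) (v : E) :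
    fderiv ℝ (fun y => L (f y)) x v = L (fderiv ℝ f x v) := by
  have h : HasFDerivAt (fun y => L (f y)) ((grLin L).comp (fderiv ℝ f x)) x :=
    (grLin L).hasFDerivAt.comp x hf.hasFDerivAt
  rw [h.fderiv]; rfl

end

end Analysis

/-! ### Contractions -/

section Contraction

variable {q : Type}

/-- The left derivative with respect to an odd generator. -/
def iL (j : q) : Gr q →ₗ[ℝ] Gr q :=
  CliffordAlgebra.contractLeft (Q := (0 : QuadraticForm ℝ (q → ℝ))) (LinearMap.proj j)

theorem iL_ι_mul (j : q) (v : q → ℝ) (x : Gr q) :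
    iL j (ExteriorAlgebra.ι ℝ v * x) = v j • x - ExteriorAlgebra.ι ℝ v * iL j x :=
  CliffordAlgebra.contractLeft_ι_mul (Q := (0 : QuadraticForm ℝ (q → ℝ))) _ v x

theorem iL_algebraMap (j : q) (r : ℝ) : iL j (algebraMap ℝ (Gr q) r) = 0 :=
  CliffordAlgebra.contractLeft_algebraMap (0 : QuadraticForm ℝ (q → ℝ)) _ r

theorem iL_ι (j : q) (v : q → ℝ) : iL j (ExteriorAlgebra.ι ℝ v) = algebraMap ℝ (Gr q) (v j) :=
  CliffordAlgebra.contractLeft_ι (0 : QuadraticForm ℝ (q → ℝ)) _ v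

theorem iL_mul (j : q) (x y : Gr q) : iL j (x * y) = iL j x * y + tw 1 x * iL j y := by
  induction x using CliffordAlgebra.left_induction with
  | algebraMap r =>
    change iL j (algebraMap ℝ (Gr q) r * y) =
      iL j (algebraMap ℝ (Gr q) r) * y + tw 1 (algebraMap ℝ (Gr q) r) * iL j y
    rw [iL_algebraMap, zero_mul, zero_add, AlgHom.commutes, ← Algebra.smul_def,
      ← Algebra.smul_def, map_smul]
  | add x x' hx hx' =>
    rw [add_mul, map_add, hx, hx', map_add, map_add, add_mul, add_mul]
    abel
  | ι_mul x m hx =>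
    change iL j (ExteriorAlgebra.ι ℝ m * x * y) =
      iL j (ExteriorAlgebra.ι ℝ m * x) * y + tw 1 (ExteriorAlgebra.ι ℝ m * x) * iL j y
    rw [mul_assoc, iL_ι_mul, hx, iL_ι_mul, map_mul, tw_one_ι, sub_mul, smul_mul_assoc, mul_add,
      mul_assoc, neg_mul, neg_mul, mul_assoc]
    abel

theorem iL_tw_one (j : q) (x : Gr q) : iL j (tw 1 x) = -tw 1 (iL j x) := by
  induction x using CliffordAlgebra.left_induction with
  | algebraMap r =>
    change iL j (tw 1 (algebraMap ℝ (Gr q) r)) = -tw 1 (iL j (algebraMap ℝ (Gr q) r))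
    rw [AlgHom.commutes, iL_algebraMap, map_zero, neg_zero]
  | add x x' hx hx' => simp only [map_add, hx, hx', neg_add]
  | ι_mul x m hx =>
    change iL j (tw 1 (ExteriorAlgebra.ι ℝ m * x)) = -tw 1 (iL j (ExteriorAlgebra.ι ℝ m * x))
    rw [map_mul, tw_one_ι, neg_mul, map_neg, iL_ι_mul, iL_ι_mul, hx, map_sub, map_smul, map_mul,
      tw_one_ι]
    simp

theorem iL_mem {e : ZMod 2} {x : Gr q} (hx : x ∈ grPart q e) (j : q) :
    iL j x ∈ grPart q (e + 1) := by
  have h := iL_tw_one j x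
  rw [mem_grPart_iff.1 hx, map_smul] at h
  rw [mem_grPart_iff, sg_add, sg_one, mul_neg_one, neg_smul, h, neg_neg]

theorem iL_comm (i j : q) (x : Gr q) : iL i (iL j x) = -iL j (iL i x) :=
  CliffordAlgebra.contractLeft_comm (Q := (0 : QuadraticForm ℝ (q → ℝ))) _ _ x

/-- Reduces right derivatives to left ones. On a homogeneous x of parity ε the twist is the familiar
sign (-1)^(ε+1). -/
theorem contractRight_eq_tw (j : q) (x : Gr q) :
    CliffordAlgebra.contractRight (Q := (0 : QuadraticForm ℝ (q → ℝ))) x (LinearMap.proj j) =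
      tw 1 (iL j x) := by
  induction x using CliffordAlgebra.right_induction with
  | algebraMap r =>
    rw [CliffordAlgebra.contractRight_algebraMap]
    change 0 = tw 1 (iL j (algebraMap ℝ (Gr q) r))
    rw [iL_algebraMap, map_zero]
  | add x x' hx hx' => rw [map_add, LinearMap.add_apply, hx, hx', map_add, map_add]
  | mul_ι m x hx =>
    rw [CliffordAlgebra.contractRight_mul_ι, hx]
    change m j • x - tw 1 (iL j x) * ExteriorAlgebra.ι ℝ m =
      tw 1 (iL j (x * ExteriorAlgebra.ι ℝ m))
    rw [iL_mul, map_add, map_mul, map_mul, tw_one_tw_one, tw_one_ι, iL_ι, AlgHom.commutes,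
      ← Algebra.commutes, ← Algebra.smul_def]
    simp only [mul_neg]
    abel

end Contraction

/-! ### Calculus of superfunctions -/

section SuperCalculus

variable {p q : Type} [Fintype p] [DecidableEq p] [Fintype q]

/-- Pointwise grade involution. -/
def twF (e : ZMod 2) (f : SFun p q) : SFun p q := fun x => tw e (f x)

@[simp] theorem twF_apply (e : ZMod 2) (f : SFun p q) (x : p → ℝ) : twF e f x = tw e (f x) := rfl

@[simp] theorem par_inl (i : p) : par (Sum.inl i : p ⊕ q) = 0 := rfl

@[simp] theorem par_inr (j : q) : par (Sum.inr j : p ⊕ q) = 1 := rfl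

theorem dL_inl (i : p) (f : SFun p q) (x : p → ℝ) :
    dL (Sum.inl i) f x = fderiv ℝ f x (Pi.single i 1) := rfl

theorem dL_inr (j : q) (f : SFun p q) (x : p → ℝ) : dL (Sum.inr j) f x = iL j (f x) := rfl

theorem dR_eq (A : p ⊕ q) (f : SFun p q) (x : p → ℝ) : dR A f x = tw (par A) (dL A f x) := by
  cases A with
  | inl i => rfl
  | inr j => exact contractRight_eq_tw j (f x)

theorem Smooth.differentiableAt {U : Set (p → ℝ)} {f : SFun p q} (hU : IsOpen U) (hf : Smooth U f)
    {x : p → ℝ} (hx : x ∈ U) : DifferentiableAt ℝ f x :=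
  (hf.differentiableOn (by simp)).differentiableAt (hU.mem_nhds hx)

theorem dL_mul (A : p ⊕ q) {f g : SFun p q} {x : p → ℝ} (hf : DifferentiableAt ℝ f x)
    (hg : DifferentiableAt ℝ g x) :
    dL A (f * g) x = dL A f x * g x + tw (par A) (f x) * dL A g x := by
  cases A with
  | inl i =>
    have := (hasFDerivAt_grMul hf.hasFDerivAt hg.hasFDerivAt).fderiv
    rw [dL_inl, show (f * g : SFun p q) = fun y => f y * g y from rfl, this, par_inl, tw_zero]
    simp [grMulL_apply, dL_inl, add_comm]
  | inr j => exact iL_mul j (f x) (g x)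

theorem dL_congr (A : p ⊕ q) {f g : SFun p q} {x : p → ℝ} (h : f =ᶠ[nhds x] g) :
    dL A f x = dL A g x := by
  cases A with
  | inl i => rw [dL_inl, dL_inl, h.fderiv_eq]
  | inr j => rw [dL_inr, dL_inr, h.eq_of_nhds]

theorem dR_congr (A : p ⊕ q) {f g : SFun p q} {x : p → ℝ} (h : f =ᶠ[nhds x] g) :
    dR A f x = dR A g x := by
  rw [dR_eq, dR_eq, dL_congr A h]

theorem dL_congr_on {U : Set (p → ℝ)} (hU : IsOpen U) (A : p ⊕ q) {f g : SFun p q}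
    (h : Set.EqOn f g U) : Set.EqOn (dL A f) (dL A g) U := fun _ hx =>
  dL_congr A (h.eventuallyEq_of_mem (hU.mem_nhds hx))

theorem dR_congr_on {U : Set (p → ℝ)} (hU : IsOpen U) (A : p ⊕ q) {f g : SFun p q}
    (h : Set.EqOn f g U) : Set.EqOn (dR A f) (dR A g) U := fun _ hx =>
  dR_congr A (h.eventuallyEq_of_mem (hU.mem_nhds hx))

theorem dL_add (A : p ⊕ q) {f g : SFun p q} {x : p → ℝ} (hf : DifferentiableAt ℝ f x)
    (hg : DifferentiableAt ℝ g x) : dL A (f + g) x = dL A f x + dL A g x := by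
  cases A with
  | inl i => rw [dL_inl, fderiv_add hf hg]; rfl
  | inr j => exact map_add (iL j) _ _

theorem dL_smul (A : p ⊕ q) (r : ℝ) {f : SFun p q} {x : p → ℝ} (hf : DifferentiableAt ℝ f x) :
    dL A (r • f) x = r • dL A f x := by
  cases A with
  | inl i => rw [dL_inl, fderiv_const_smul hf]; rfl
  | inr j => exact map_smul (iL j) _ _

theorem dL_sub (A : p ⊕ q) {f g : SFun p q} {x : p → ℝ} (hf : DifferentiableAt ℝ f x)
    (hg : DifferentiableAt ℝ g x) : dL A (f - g) x = dL A f x - dL A g x := by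
  cases A with
  | inl i => rw [dL_inl, fderiv_sub hf hg]; rfl
  | inr j => exact map_sub (iL j) _ _

theorem dL_zero (A : p ⊕ q) (x : p → ℝ) : dL A (0 : SFun p q) x = 0 := by
  cases A with
  | inl i => rw [dL_inl, fderiv_zero]; rfl
  | inr j => exact map_zero (iL j)

theorem dL_sum {ι : Type*} (s : Finset ι) (A : p ⊕ q) {f : ι → SFun p q} {x : p → ℝ}
    (hf : ∀ i ∈ s, DifferentiableAt ℝ (f i) x) :
    dL A (∑ i ∈ s, f i) x = ∑ i ∈ s, dL A (f i) x := by
  cases A with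
  | inl i => rw [dL_inl, fderiv_sum hf]; simp [dL_inl]
  | inr j => rw [dL_inr, Finset.sum_apply, map_sum]; rfl

theorem dL_tw (A : p ⊕ q) (e : ZMod 2) {f : SFun p q} {x : p → ℝ} (hf : DifferentiableAt ℝ f x) :
    dL A (twF e f) x = sg (par A * e) • tw e (dL A f x) := by
  cases A with
  | inl i =>
    rw [par_inl, zero_mul, sg_zero, one_smul]
    exact fderiv_grLin (tw e).toLinearMap hf _
  | inr j =>
    rcases zmod_two_cases e with rfl | rfl
    · simp only [mul_zero, sg_zero, one_smul]; rfl
    · simp only [par_inr, mul_one, sg_one, neg_one_smul]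
      exact iL_tw_one j (f x)

theorem dR_mul (A : p ⊕ q) {f g : SFun p q} {x : p → ℝ} (hf : DifferentiableAt ℝ f x)
    (hg : DifferentiableAt ℝ g x) :
    dR A (f * g) x = f x * dR A g x + dR A f x * tw (par A) (g x) := by
  rw [dR_eq, dL_mul A hf hg, map_add, map_mul, map_mul, tw_tw_self, dR_eq, dR_eq, add_comm]

theorem dR_sum {ι : Type*} (s : Finset ι) (A : p ⊕ q) {f : ι → SFun p q} {x : p → ℝ}
    (hf : ∀ i ∈ s, DifferentiableAt ℝ (f i) x) :
    dR A (∑ i ∈ s, f i) x = ∑ i ∈ s, dR A (f i) x := by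
  simp only [dR_eq, dL_sum s A hf, map_sum]

theorem dR_add (A : p ⊕ q) {f g : SFun p q} {x : p → ℝ} (hf : DifferentiableAt ℝ f x)
    (hg : DifferentiableAt ℝ g x) : dR A (f + g) x = dR A f x + dR A g x := by
  simp only [dR_eq, dL_add A hf hg, map_add]

theorem Smooth.tw {U : Set (p → ℝ)} {f : SFun p q} (hf : Smooth U f) (e : ZMod 2) :
    Smooth U (twF e f) :=
  contDiffOn_grLin (F := Gr q) (f := f) (AlgHom.toLinearMap (BV.tw e)) hf

theorem Smooth.mul {U : Set (p → ℝ)} {f g : SFun p q} (hf : Smooth U f) (hg : Smooth U g) :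
    Smooth U (f * g) := contDiffOn_grMul hf hg

theorem Smooth.add {U : Set (p → ℝ)} {f g : SFun p q} (hf : Smooth U f) (hg : Smooth U g) :
    Smooth U (f + g) := ContDiffOn.add hf hg

theorem Smooth.sub {U : Set (p → ℝ)} {f g : SFun p q} (hf : Smooth U f) (hg : Smooth U g) :
    Smooth U (f - g) := ContDiffOn.sub hf hg

theorem Smooth.smul {U : Set (p → ℝ)} {f : SFun p q} (hf : Smooth U f) (r : ℝ) :
    Smooth U (r • f) := ContDiffOn.const_smul r hf

theorem Smooth.one (U : Set (p → ℝ)) : Smooth U (1 : SFun p q) := contDiffOn_const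

theorem Smooth.zero (U : Set (p → ℝ)) : Smooth U (0 : SFun p q) := contDiffOn_const

theorem Smooth.sum {ι : Type*} (s : Finset ι) {U : Set (p → ℝ)} {f : ι → SFun p q}
    (hf : ∀ i ∈ s, Smooth U (f i)) : Smooth U (∑ i ∈ s, f i) := by
  have := ContDiffOn.sum (𝕜 := ℝ) (n := ∞) (t := U) (s := s) (f := f) hf
  refine this.congr fun x _ => ?_
  simp

theorem Smooth.dL {U : Set (p → ℝ)} (hU : IsOpen U) {f : SFun p q} (hf : Smooth U f) (A : p ⊕ q) :
    Smooth U (dL A f) := by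
  cases A with
  | inl i =>
    have h : ContDiffOn ℝ ∞ (fderiv ℝ f) U := hf.fderiv_of_isOpen hU (by simp)
    exact h.clm_apply contDiffOn_const
  | inr j => exact contDiffOn_grLin (iL j) hf

theorem Smooth.dR {U : Set (p → ℝ)} (hU : IsOpen U) {f : SFun p q} (hf : Smooth U f) (A : p ⊕ q) :
    Smooth U (dR A f) := by
  refine ((hf.dL hU A).tw (par A)).congr fun x _ => ?_
  rw [dR_eq]; rfl

theorem Smooth.mono {U V : Set (p → ℝ)} {f : SFun p q} (hf : Smooth U f) (h : V ⊆ U) :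
    Smooth V f := ContDiffOn.mono hf h

/-- Two even derivatives commute by symmetry of the second derivative, an even and an odd one
because contraction is a constant linear map, and two contractions anticommute. -/
theorem dL_dL_comm {U : Set (p → ℝ)} (hU : IsOpen U) {f : SFun p q} (hf : Smooth U f)
    (A B : p ⊕ q) {x : p → ℝ} (hx : x ∈ U) :
    dL A (dL B f) x = sg (par A * par B) • dL B (dL A f) x := by
  have hd := hf.differentiableAt hU hx
  have lin : ∀ (i : p) (j : q), dL (Sum.inl i) (dL (Sum.inr j) f) x =
      dL (Sum.inr j) (dL (Sum.inl i) f) x := fun i j => fderiv_grLin (iL j) hd _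
  rcases A with i | i <;> rcases B with j | j
  · rw [par_inl, zero_mul, sg_zero, one_smul]
    have hc : ContDiffAt ℝ ∞ f x := hf.contDiffAt (hU.mem_nhds hx)
    have hs : IsSymmSndFDerivAt ℝ f x := hc.isSymmSndFDerivAt (by
      rw [minSmoothness_of_isRCLikeNormedField]; exact WithTop.coe_le_coe.2 le_top)
    have hdf : DifferentiableAt ℝ (fderiv ℝ f) x :=
      ((hf.fderiv_of_isOpen hU (m := ∞) (by simp)).differentiableOn (by simp)).differentiableAt
        (hU.mem_nhds hx)
    have key : ∀ v w, fderiv ℝ (fun y => fderiv ℝ f y v) x w = fderiv ℝ (fderiv ℝ f) x w v := by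
      intro v w
      rw [fderiv_clm_apply hdf (differentiableAt_const v)]
      simp
    change fderiv ℝ (fun y => fderiv ℝ f y _) x _ = fderiv ℝ (fun y => fderiv ℝ f y _) x _
    rw [key, key]
    exact hs _ _
  · rw [par_inl, zero_mul, sg_zero, one_smul]; exact lin i j
  · rw [par_inl, mul_zero, sg_zero, one_smul]; exact (lin j i).symm
  · rw [par_inr, par_inr, mul_one, sg_one, neg_one_smul]
    exact iL_comm i j (f x)

/-- The eigenvalue equation for the grade involution holds on an open set, so it can be
differentiated; the derivative commutes with the involution up to the sign of `par A`. -/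
theorem HasParity.dL {U : Set (p → ℝ)} (hU : IsOpen U) {f : SFun p q} {e : ZMod 2}
    (hf : Smooth U f) (he : HasParity U e f) (A : p ⊕ q) : HasParity U (e + par A) (dL A f) := by
  intro x hx
  have h1 : Set.EqOn (twF 1 f) (sg e • f) U := fun y hy => mem_grPart_iff.1 (he y hy)
  have h2 := dL_congr_on hU A h1 hx
  rw [dL_tw A 1 (hf.differentiableAt hU hx), dL_smul A _ (hf.differentiableAt hU hx), mul_one] at h2
  rw [mem_grPart_iff, sg_add, mul_comm, mul_smul, ← h2, smul_smul, sg_mul_self, one_smul]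

theorem HasParity.dR {U : Set (p → ℝ)} (hU : IsOpen U) {f : SFun p q} {e : ZMod 2}
    (hf : Smooth U f) (he : HasParity U e f) (A : p ⊕ q) : HasParity U (e + par A) (dR A f) := by
  intro x hx
  rw [dR_eq]
  exact tw_mem_grPart (he.dL hU hf A x hx)

theorem HasParity.mul {U : Set (p → ℝ)} {f g : SFun p q} {d e : ZMod 2} (hf : HasParity U d f)
    (hg : HasParity U e g) : HasParity U (d + e) (f * g) := fun x hx =>
  mul_mem_grPart (hf x hx) (hg x hx)

theorem HasParity.smul {U : Set (p → ℝ)} {f : SFun p q} {e : ZMod 2} (hf : HasParity U e f)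
    (r : ℝ) : HasParity U e (r • f) := fun x hx => Submodule.smul_mem _ _ (hf x hx)

theorem HasParity.sum {ι : Type*} (s : Finset ι) {U : Set (p → ℝ)} {f : ι → SFun p q} {e : ZMod 2}
    (hf : ∀ i ∈ s, HasParity U e (f i)) : HasParity U e (∑ i ∈ s, f i) := fun x hx => by
  rw [Finset.sum_apply]
  exact Submodule.sum_mem _ fun i hi => hf i hi x hx

theorem HasParity.congr_right {U : Set (p → ℝ)} {f : SFun p q} {d e : ZMod 2}
    (hf : HasParity U d f) (h : d = e) : HasParity U e f := h ▸ hf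

/-- The part of parity `e` of a superfunction. -/
def projF (e : ZMod 2) (f : SFun p q) : SFun p q := fun x => grProj e (f x)

theorem Smooth.proj {U : Set (p → ℝ)} {f : SFun p q} (hf : Smooth U f) (e : ZMod 2) :
    Smooth U (projF e f) := contDiffOn_grLin (F := Gr q) (f := f) (grProj e) hf

theorem projF_parity (U : Set (p → ℝ)) (e : ZMod 2) (f : SFun p q) : HasParity U e (projF e f) :=
  fun x _ => grProj_mem e (f x)

theorem projF_add_projF (f : SFun p q) : projF 0 f + projF 1 f = f := by
  funext x
  exact (eq_grProj_zero_add_grProj_one (f x)).symm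

/-! ### Families -/

/-- The derivative of a family with respect to the parameter. -/
def dtF (F : ℝ → SFun p q) (t : ℝ) : SFun p q := fun y => deriv (fun s => F s y) t

variable {T : Set ℝ} {U : Set (p → ℝ)}

theorem SmoothFamily.contDiffAt (hT : IsOpen T) (hU : IsOpen U) {F : ℝ → SFun p q}
    (hF : SmoothFamily T U F) {t : ℝ} (ht : t ∈ T) {y : p → ℝ} (hy : y ∈ U) :
    ContDiffAt ℝ ∞ (fun z : ℝ × (p → ℝ) => F z.1 z.2) (t, y) :=
  ContDiffOn.contDiffAt hF ((hT.prod hU).mem_nhds ⟨ht, hy⟩)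

theorem SmoothFamily.smooth {F : ℝ → SFun p q} (hF : SmoothFamily T U F) {t : ℝ} (ht : t ∈ T) :
    Smooth U (F t) := by
  have : ContDiffOn ℝ ∞ (fun y : p → ℝ => (t, y)) U := (contDiff_prodMk_right t).contDiffOn
  exact ContDiffOn.comp (g := fun z : ℝ × (p → ℝ) => F z.1 z.2) hF this fun y hy => ⟨ht, hy⟩

theorem SmoothFamily.const {f : SFun p q} (hf : Smooth U f) : SmoothFamily T U fun _ => f :=
  ContDiffOn.comp hf contDiff_snd.contDiffOn fun _ hz => hz.2

theorem SmoothFamily.hasDerivAt (hT : IsOpen T) (hU : IsOpen U) {F : ℝ → SFun p q}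
    (hF : SmoothFamily T U F) {t : ℝ} (ht : t ∈ T) {y : p → ℝ} (hy : y ∈ U) :
    HasDerivAt (fun s => F s y) (dtF F t y) t := by
  have h1 : DifferentiableAt ℝ (fun z : ℝ × (p → ℝ) => F z.1 z.2) (t, y) :=
    (hF.contDiffAt hT hU ht hy).differentiableAt (by simp)
  have h2 : DifferentiableAt ℝ (fun s : ℝ => (s, y)) t := by fun_prop
  exact (h1.comp t h2).hasDerivAt

theorem dtF_eq_fderiv (hT : IsOpen T) (hU : IsOpen U) {F : ℝ → SFun p q} (hF : SmoothFamily T U F)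
    {t : ℝ} (ht : t ∈ T) {y : p → ℝ} (hy : y ∈ U) :
    dtF F t y = fderiv ℝ (fun z : ℝ × (p → ℝ) => F z.1 z.2) (t, y) (1, 0) := by
  have h1 : DifferentiableAt ℝ (fun z : ℝ × (p → ℝ) => F z.1 z.2) (t, y) :=
    (hF.contDiffAt hT hU ht hy).differentiableAt (by simp)
  have h2 : HasDerivAt (fun s : ℝ => (s, y)) ((1 : ℝ), (0 : p → ℝ)) t :=
    (hasDerivAt_id t).prodMk (hasDerivAt_const t y)
  exact (h1.hasFDerivAt.comp_hasDerivAt t h2).deriv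

theorem fderiv_family (hT : IsOpen T) (hU : IsOpen U) {F : ℝ → SFun p q} (hF : SmoothFamily T U F)
    {t : ℝ} (ht : t ∈ T) {y : p → ℝ} (hy : y ∈ U) (v : p → ℝ) :
    fderiv ℝ (F t) y v = fderiv ℝ (fun z : ℝ × (p → ℝ) => F z.1 z.2) (t, y) (0, v) := by
  have h1 : DifferentiableAt ℝ (fun z : ℝ × (p → ℝ) => F z.1 z.2) (t, y) :=
    (hF.contDiffAt hT hU ht hy).differentiableAt (by simp)
  have h2 : HasFDerivAt (fun x : p → ℝ => (t, x)) (ContinuousLinearMap.inr ℝ ℝ (p → ℝ)) y :=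
    hasFDerivAt_prodMk_right t y
  have h3 := (h1.hasFDerivAt.comp y h2).fderiv
  have h4 : ((fun z : ℝ × (p → ℝ) => F z.1 z.2) ∘ fun x => (t, x)) = F t := rfl
  rw [h4] at h3
  rw [h3]; rfl

theorem SmoothFamily.dt (hT : IsOpen T) (hU : IsOpen U) {F : ℝ → SFun p q}
    (hF : SmoothFamily T U F) : SmoothFamily T U (dtF F) := by
  have h : ContDiffOn ℝ ∞ (fderiv ℝ (fun z : ℝ × (p → ℝ) => F z.1 z.2)) (T ×ˢ U) :=
    ContDiffOn.fderiv_of_isOpen hF (hT.prod hU) (by simp)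
  refine (h.clm_apply (contDiffOn_const (c := ((1 : ℝ), (0 : p → ℝ))))).congr fun z hz => ?_
  exact dtF_eq_fderiv hT hU hF hz.1 hz.2

theorem SmoothFamily.dL (hT : IsOpen T) (hU : IsOpen U) {F : ℝ → SFun p q}
    (hF : SmoothFamily T U F) (A : p ⊕ q) : SmoothFamily T U fun t => dL A (F t) := by
  cases A with
  | inl i =>
    have h : ContDiffOn ℝ ∞ (fderiv ℝ (fun z : ℝ × (p → ℝ) => F z.1 z.2)) (T ×ˢ U) :=
      ContDiffOn.fderiv_of_isOpen hF (hT.prod hU) (by simp)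
    refine (h.clm_apply
      (contDiffOn_const (c := ((0 : ℝ), (Pi.single i 1 : p → ℝ))))).congr fun z hz => ?_
    exact fderiv_family hT hU hF hz.1 hz.2 _
  | inr j => exact contDiffOn_grLin (iL j) hF

theorem SmoothFamily.lin (L : Gr q →ₗ[ℝ] Gr q) {F : ℝ → SFun p q} (hF : SmoothFamily T U F) :
    SmoothFamily T U fun t x => L (F t x) := contDiffOn_grLin L hF

theorem SmoothFamily.congr {F G : ℝ → SFun p q} (hF : SmoothFamily T U F)
    (h : ∀ t ∈ T, ∀ y ∈ U, G t y = F t y) : SmoothFamily T U G :=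
  ContDiffOn.congr hF fun z hz => h z.1 hz.1 z.2 hz.2

theorem SmoothFamily.dR (hT : IsOpen T) (hU : IsOpen U) {F : ℝ → SFun p q}
    (hF : SmoothFamily T U F) (A : p ⊕ q) : SmoothFamily T U fun t => dR A (F t) :=
  ((hF.dL hT hU A).lin (BV.tw (par A)).toLinearMap).congr fun t _ y _ => dR_eq A (F t) y

theorem SmoothFamily.mul {F G : ℝ → SFun p q} (hF : SmoothFamily T U F)
    (hG : SmoothFamily T U G) : SmoothFamily T U fun t => F t * G t := contDiffOn_grMul hF hG

theorem SmoothFamily.add {F G : ℝ → SFun p q} (hF : SmoothFamily T U F)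
    (hG : SmoothFamily T U G) : SmoothFamily T U fun t => F t + G t := ContDiffOn.add hF hG

theorem SmoothFamily.sub {F G : ℝ → SFun p q} (hF : SmoothFamily T U F)
    (hG : SmoothFamily T U G) : SmoothFamily T U fun t => F t - G t := ContDiffOn.sub hF hG

theorem SmoothFamily.smul {F : ℝ → SFun p q} (hF : SmoothFamily T U F) (r : ℝ) :
    SmoothFamily T U fun t => r • F t := ContDiffOn.const_smul r hF

theorem SmoothFamily.sum {ι : Type*} (s : Finset ι) {F : ι → ℝ → SFun p q}
    (hF : ∀ i ∈ s, SmoothFamily T U (F i)) : SmoothFamily T U fun t => ∑ i ∈ s, F i t := by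
  have := ContDiffOn.sum (𝕜 := ℝ) (n := ∞) (t := T ×ˢ U) (s := s)
    (f := fun i (z : ℝ × (p → ℝ)) => F i z.1 z.2) hF
  refine this.congr fun x _ => ?_
  simp

theorem SmoothFamily.mono {T' : Set ℝ} {U' : Set (p → ℝ)} {F : ℝ → SFun p q}
    (hF : SmoothFamily T U F) (hT : T' ⊆ T) (hU : U' ⊆ U) : SmoothFamily T' U' F :=
  ContDiffOn.mono hF (Set.prod_mono hT hU)

/-- For an even coordinate both sides are mixed second derivatives of the uncurried function of (t,
y), so this is again symmetry of the second derivative, now between t and a coordinate. -/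
theorem hasDerivAt_dL (hT : IsOpen T) (hU : IsOpen U) {F : ℝ → SFun p q} (hF : SmoothFamily T U F)
    (A : p ⊕ q) {t : ℝ} (ht : t ∈ T) {y : p → ℝ} (hy : y ∈ U) :
    HasDerivAt (fun s => dL A (F s) y) (dL A (dtF F t) y) t := by
  cases A with
  | inl i =>
    have h0 := (hF.dL hT hU (Sum.inl i)).hasDerivAt hT hU ht hy
    convert h0 using 1
    set Fh := fun z : ℝ × (p → ℝ) => F z.1 z.2 with hFh
    have hc := hF.contDiffAt hT hU ht hy
    have hs : IsSymmSndFDerivAt ℝ Fh (t, y) := hc.isSymmSndFDerivAt (by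
      rw [minSmoothness_of_isRCLikeNormedField]; exact WithTop.coe_le_coe.2 le_top)
    have hdf : DifferentiableAt ℝ (fderiv ℝ Fh) (t, y) :=
      ((ContDiffOn.fderiv_of_isOpen hF (hT.prod hU) (m := ∞) (by simp)).differentiableOn
        (by simp)).differentiableAt ((hT.prod hU).mem_nhds ⟨ht, hy⟩)
    have key : ∀ v w, fderiv ℝ (fun z => fderiv ℝ Fh z v) (t, y) w =
        fderiv ℝ (fderiv ℝ Fh) (t, y) w v := by
      intro v w
      rw [fderiv_clm_apply hdf (differentiableAt_const v)]
      simp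
    have hdv : ∀ v, DifferentiableAt ℝ (fun z => fderiv ℝ Fh z v) (t, y) := fun v =>
      hdf.clm_apply (differentiableAt_const v)
    have e1 : dL (Sum.inl i) (dtF F t) y = fderiv ℝ (fderiv ℝ Fh) (t, y) (0, Pi.single i 1) (1, 0) := by
      rw [← key]
      have h2 : dtF F t =ᶠ[nhds y] fun x => fderiv ℝ Fh (t, x) (1, 0) := by
        filter_upwards [hU.mem_nhds hy] with x hx
        exact dtF_eq_fderiv hT hU hF ht hx
      rw [dL_inl, h2.fderiv_eq]
      have h3 : HasFDerivAt (fun x : p → ℝ => (t, x)) (ContinuousLinearMap.inr ℝ ℝ (p → ℝ)) y :=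
        hasFDerivAt_prodMk_right t y
      have h4 := ((hdv (1, 0)).hasFDerivAt.comp y h3).fderiv
      have h5 : ((fun z => fderiv ℝ Fh z (1, 0)) ∘ fun x => (t, x)) =
        fun x => fderiv ℝ Fh (t, x) (1, 0) := rfl
      rw [h5] at h4
      rw [h4]; rfl
    have e2 : dtF (fun s => dL (Sum.inl i) (F s)) t y =
        fderiv ℝ (fderiv ℝ Fh) (t, y) (1, 0) (0, Pi.single i 1) := by
      rw [← key]
      have h2 : (fun s => dL (Sum.inl i) (F s) y) =ᶠ[nhds t]
          fun s => fderiv ℝ Fh (s, y) (0, Pi.single i 1) := by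
        filter_upwards [hT.mem_nhds ht] with s hs'
        exact fderiv_family hT hU hF hs' hy _
      have h3 : HasDerivAt (fun s : ℝ => (s, y)) ((1 : ℝ), (0 : p → ℝ)) t :=
        (hasDerivAt_id t).prodMk (hasDerivAt_const t y)
      have h4 := ((hdv (0, Pi.single i 1)).hasFDerivAt.comp_hasDerivAt t h3).deriv
      rw [dtF, h2.deriv_eq]
      exact h4
    rw [e1, e2]
    exact hs _ _
  | inr j => exact hasDerivAt_grLin (iL j) (hF.hasDerivAt hT hU ht hy)

theorem hasDerivAt_dR (hT : IsOpen T) (hU : IsOpen U) {F : ℝ → SFun p q} (hF : SmoothFamily T U F)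
    (A : p ⊕ q) {t : ℝ} (ht : t ∈ T) {y : p → ℝ} (hy : y ∈ U) :
    HasDerivAt (fun s => dR A (F s) y) (dR A (dtF F t) y) t := by
  have h := hasDerivAt_grLin (tw (par A)).toLinearMap (hasDerivAt_dL hT hU hF A ht hy)
  simp only [dR_eq]
  exact h

end SuperCalculus

/-! ### The antibracket -/

section Bracket

variable {p q : Type} [Fintype p] [DecidableEq p] [Fintype q]
  {U : Set (p → ℝ)} {E : p ⊕ q → p ⊕ q → SFun p q}

theorem bracket_apply (E : p ⊕ q → p ⊕ q → SFun p q) (F G : SFun p q) (x : p → ℝ) :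
    bracket E F G x = ∑ A, ∑ B, dR A F x * E A B x * dL B G x := by
  simp [bracket, Finset.sum_apply]

theorem bracket_congr (hU : IsOpen U) (E : p ⊕ q → p ⊕ q → SFun p q) {F F' G G' : SFun p q}
    (hF : Set.EqOn F F' U) (hG : Set.EqOn G G' U) :
    Set.EqOn (bracket E F G) (bracket E F' G') U := by
  intro x hx
  simp only [bracket_apply]
  refine Finset.sum_congr rfl fun A _ => Finset.sum_congr rfl fun B _ => ?_
  rw [dR_congr_on hU A hF hx, dL_congr_on hU B hG hx]

theorem dR_smul (A : p ⊕ q) (r : ℝ) {f : SFun p q} {x : p → ℝ} (hf : DifferentiableAt ℝ f x) :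
    dR A (r • f) x = r • dR A f x := by
  rw [dR_eq, dL_smul A r hf, map_smul, dR_eq]

theorem bracket_add_right (hU : IsOpen U) (E : p ⊕ q → p ⊕ q → SFun p q) (F : SFun p q)
    {G G' : SFun p q} (hG : Smooth U G) (hG' : Smooth U G') {x : p → ℝ} (hx : x ∈ U) :
    bracket E F (G + G') x = bracket E F G x + bracket E F G' x := by
  simp only [bracket_apply, dL_add _ (hG.differentiableAt hU hx) (hG'.differentiableAt hU hx),
    mul_add, Finset.sum_add_distrib]

theorem bracket_add_left (hU : IsOpen U) (E : p ⊕ q → p ⊕ q → SFun p q) (G : SFun p q)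
    {F F' : SFun p q} (hF : Smooth U F) (hF' : Smooth U F') {x : p → ℝ} (hx : x ∈ U) :
    bracket E (F + F') G x = bracket E F G x + bracket E F' G x := by
  simp only [bracket_apply, dR_add _ (hF.differentiableAt hU hx) (hF'.differentiableAt hU hx),
    add_mul, Finset.sum_add_distrib]

theorem bracket_smul_right (hU : IsOpen U) (E : p ⊕ q → p ⊕ q → SFun p q) (F : SFun p q)
    {G : SFun p q} (hG : Smooth U G) (r : ℝ) {x : p → ℝ} (hx : x ∈ U) :
    bracket E F (r • G) x = r • bracket E F G x := by
  simp only [bracket_apply, dL_smul _ r (hG.differentiableAt hU hx), mul_smul_comm,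
    Finset.smul_sum]

theorem bracket_sum_right {ι : Type*} (s : Finset ι) (hU : IsOpen U)
    (E : p ⊕ q → p ⊕ q → SFun p q) (F : SFun p q) {G : ι → SFun p q}
    (hG : ∀ i ∈ s, Smooth U (G i)) {x : p → ℝ} (hx : x ∈ U) :
    bracket E F (∑ i ∈ s, G i) x = ∑ i ∈ s, bracket E F (G i) x := by
  classical
  induction s using Finset.induction_on with
  | empty => simp [bracket_apply, dL_zero]
  | insert i s hi ih =>
    have h1 : ∀ j ∈ s, Smooth U (G j) := fun j hj => hG j (Finset.mem_insert_of_mem hj)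
    rw [Finset.sum_insert hi, Finset.sum_insert hi,
      bracket_add_right hU E F (hG i (Finset.mem_insert_self i s)) (Smooth.sum s h1) hx, ih h1]

theorem Smooth.bracket (hU : IsOpen U) (hE : ∀ A B, Smooth U (E A B)) {F G : SFun p q}
    (hF : Smooth U F) (hG : Smooth U G) : Smooth U (bracket E F G) :=
  Smooth.sum _ fun A _ => Smooth.sum _ fun B _ => ((hF.dR hU A).mul (hE A B)).mul (hG.dL hU B)

theorem SmoothFamily.bracket {T : Set ℝ} (hT : IsOpen T) (hU : IsOpen U)
    (hE : ∀ A B, Smooth U (E A B)) {F G : ℝ → SFun p q}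
    (hF : SmoothFamily T U F) (hG : SmoothFamily T U G) :
    SmoothFamily T U fun t => bracket E (F t) (G t) :=
  SmoothFamily.sum _ fun A _ => SmoothFamily.sum _ fun B _ =>
    ((hF.dR hT hU A).mul (SmoothFamily.const (hE A B))).mul (hG.dL hT hU B)

theorem HasParity.bracket (hU : IsOpen U) (hE : IsAntisymplectic U E) {F G : SFun p q}
    {d e : ZMod 2} (hF : Smooth U F) (hG : Smooth U G) (hF' : HasParity U d F)
    (hG' : HasParity U e G) : HasParity U (d + e + 1) (bracket E F G) := by
  refine HasParity.sum _ fun A _ => HasParity.sum _ fun B _ => ?_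
  refine (((hF'.dR hU hF A).mul (hE.parity A B)).mul (hG'.dL hU hG B)).congr_right ?_
  have key : ∀ a b d e : ZMod 2, d + a + (a + b + 1) + (e + b) = d + e + 1 := by decide
  exact key _ _ _ _

/-- The components `(ψ, Γ^B)` of the Hamiltonian vector field `(ψ, ·)`. -/
def hamCoef (E : p ⊕ q → p ⊕ q → SFun p q) (ψ : SFun p q) (B : p ⊕ q) : SFun p q :=
  ∑ A, dR A ψ * E A B

theorem bracket_eq_hamCoef (E : p ⊕ q → p ⊕ q → SFun p q) (ψ f : SFun p q) (x : p → ℝ) :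
    bracket E ψ f x = ∑ B, hamCoef E ψ B x * dL B f x := by
  rw [bracket_apply, Finset.sum_comm]
  simp only [hamCoef, Finset.sum_apply, Finset.sum_mul, Pi.mul_apply]

theorem Smooth.hamCoef (hU : IsOpen U) (hE : IsAntisymplectic U E) {ψ : SFun p q}
    (hψ : Smooth U ψ) (B : p ⊕ q) : Smooth U (hamCoef E ψ B) :=
  Smooth.sum _ fun A _ => (hψ.dR hU A).mul (hE.smooth A B)

theorem hamCoef_parity (hU : IsOpen U) (hE : IsAntisymplectic U E) {ψ : SFun p q}
    {d : ZMod 2} (hψ : Smooth U ψ) (hψ' : HasParity U d ψ) (B : p ⊕ q) :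
    HasParity U (d + 1 + par B) (hamCoef E ψ B) := by
  refine HasParity.sum _ fun A _ => ?_
  refine ((hψ'.dR hU hψ A).mul (hE.parity A B)).congr_right ?_
  have key : ∀ a b d : ZMod 2, d + a + (a + b + 1) = d + 1 + b := by decide
  exact key _ _ _

/-- The component of (F, ·) along B has parity d + 1 + `par B`. Moving f past it and past ∂_B
produces `par B` twice, leaving a twist by d + 1 independent of B. -/
theorem bracket_mul_right (hU : IsOpen U) (hE : IsAntisymplectic U E) {F f g : SFun p q}
    {d : ZMod 2} (hF : Smooth U F) (hF' : HasParity U d F) (hf : Smooth U f) (hg : Smooth U g)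
    {x : p → ℝ} (hx : x ∈ U) :
    bracket E F (f * g) x = bracket E F f x * g x + tw (d + 1) (f x) * bracket E F g x := by
  simp only [bracket_eq_hamCoef, dL_mul _ (hf.differentiableAt hU hx) (hg.differentiableAt hU hx),
    Finset.sum_mul, Finset.mul_sum, ← Finset.sum_add_distrib]
  refine Finset.sum_congr rfl fun B _ => ?_
  rw [mul_add, ← mul_assoc, ← mul_assoc, ← mul_assoc,
    mul_eq_mul_tw (tw (d + 1) (f x)) (hamCoef_parity hU hE hF hF' B x hx), ← tw_add]
  have key : ∀ b d : ZMod 2, d + 1 + b + (d + 1) = b := by decide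
  rw [key]

theorem bracket_odd_mul (hU : IsOpen U) (hE : IsAntisymplectic U E) {ψ f g : SFun p q}
    (hψ : Smooth U ψ) (hψ' : HasParity U 1 ψ) (hf : Smooth U f) (hg : Smooth U g)
    {x : p → ℝ} (hx : x ∈ U) :
    bracket E ψ (f * g) x = bracket E ψ f x * g x + f x * bracket E ψ g x := by
  have := bracket_mul_right hU hE hψ hψ' hf hg hx
  rwa [one_add_one_zmod, tw_zero] at this

/-- Each term of the double sum is reordered separately, using the skewness of E. The resulting sign
identity involves only the parities of A, B, F and G and is checked on all sixteen cases. -/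
theorem bracket_skew (hU : IsOpen U) (hE : IsAntisymplectic U E) {F G : SFun p q}
    {d e : ZMod 2} (hF : Smooth U F) (hG : Smooth U G) (hF' : HasParity U d F)
    (hG' : HasParity U e G) {x : p → ℝ} (hx : x ∈ U) :
    bracket E F G x = -sg ((d + 1) * (e + 1)) • bracket E G F x := by
  rw [bracket_apply, bracket_apply, Finset.sum_comm, Finset.smul_sum]
  refine Finset.sum_congr rfl fun B _ => ?_
  rw [Finset.smul_sum]
  refine Finset.sum_congr rfl fun A _ => ?_
  have hA := hF'.dL hU hF A x hx
  have hB := hG'.dL hU hG B x hx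
  have hAB := hE.parity A B x hx
  rw [dR_eq, dR_eq, tw_of_mem hA, tw_of_mem hB, hE.skew A B x hx, smul_mul_assoc, smul_mul_assoc,
    mul_comm_of_mem hA hAB, smul_mul_assoc, mul_assoc, mul_comm_of_mem hA hB, mul_smul_comm,
    ← mul_assoc, mul_comm_of_mem hAB hB, smul_mul_assoc, mul_smul_comm, smul_mul_assoc]
  simp only [smul_mul_assoc, smul_smul]
  congr 1
  generalize (par A : ZMod 2) = a
  generalize (par B : ZMod 2) = b
  rcases zmod_two_cases a with rfl | rfl <;> rcases zmod_two_cases b with rfl | rfl <;>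
    rcases zmod_two_cases d with rfl | rfl <;> rcases zmod_two_cases e with rfl | rfl <;>
    simp [sg_zero, sg_one, one_add_one_zmod]

/-- For odd ψ the shifted parity ε_ψ + 1 vanishes, so two of the three Jacobi signs are trivial and
the third cancels against skewness: (ψ, ·) is an ungraded derivation of the bracket. Bilinearity
extends this from homogeneous F and G to all. -/
theorem bracket_odd_bracket (hU : IsOpen U) (hE : IsAntisymplectic U E) {ψ F G : SFun p q}
    (hψ : Smooth U ψ) (hψ' : HasParity U 1 ψ) (hF : Smooth U F) (hG : Smooth U G)
    {x : p → ℝ} (hx : x ∈ U) :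
    bracket E ψ (bracket E F G) x =
      bracket E (bracket E ψ F) G x + bracket E F (bracket E ψ G) x := by
  have homog : ∀ {F G : SFun p q} {d e : ZMod 2}, Smooth U F → Smooth U G → HasParity U d F →
      HasParity U e G → bracket E ψ (bracket E F G) x =
      bracket E (bracket E ψ F) G x + bracket E F (bracket E ψ G) x := by
    intro F G d e hF hG hF' hG'
    have hj := hE.jacobi ψ F G 1 d e hψ hF hG hψ' hF' hG' x hx
    have hψF := hF.bracket hU hE.smooth hψ |>.bracket hU hE.smooth hψ
    have s1 : Smooth U (bracket E ψ F) := hψ.bracket hU hE.smooth hF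
    have s2 : Smooth U (bracket E ψ G) := hψ.bracket hU hE.smooth hG
    have p1 : HasParity U d (bracket E ψ F) :=
      (hψ'.bracket hU hE hψ hF hF').congr_right (by rw [add_right_comm, one_add_one_zmod, zero_add])
    have h1 : Set.EqOn (bracket E G ψ) ((-1 : ℝ) • bracket E ψ G) U := by
      intro y hy
      rw [bracket_skew hU hE hG hψ hG' hψ' hy, one_add_one_zmod, mul_zero, sg_zero]
      rfl
    have h2 := bracket_congr hU E (fun y _ => rfl : Set.EqOn F F U) h1 hx
    rw [h2, bracket_smul_right hU E F s2 _ hx, bracket_skew hU hE hG s1 hG' p1 hx] at hj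
    rw [one_add_one_zmod, zero_mul, mul_zero, sg_zero, one_smul, one_smul, smul_smul, mul_neg,
      sg_mul_self, neg_one_smul, neg_one_smul] at hj
    rw [← sub_eq_zero, ← hj]
    abel
  have hF0 := hF.proj 0
  have hF1 := hF.proj 1
  have hG0 := hG.proj 0
  have hG1 := hG.proj 1
  have homogL : ∀ {F : SFun p q} {d : ZMod 2}, Smooth U F → HasParity U d F →
      bracket E ψ (bracket E F G) x =
      bracket E (bracket E ψ F) G x + bracket E F (bracket E ψ G) x := by
    intro F d hF hF'
    have e1 : Set.EqOn (bracket E F G) (bracket E F (projF 0 G) + bracket E F (projF 1 G)) U := by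
      intro y hy
      rw [Pi.add_apply, ← bracket_add_right hU E F hG0 hG1 hy, projF_add_projF]
    have e2 : Set.EqOn (bracket E ψ G) (bracket E ψ (projF 0 G) + bracket E ψ (projF 1 G)) U := by
      intro y hy
      rw [Pi.add_apply, ← bracket_add_right hU E ψ hG0 hG1 hy, projF_add_projF]
    have e3 : bracket E (bracket E ψ F) G x = bracket E (bracket E ψ F) (projF 0 G) x +
        bracket E (bracket E ψ F) (projF 1 G) x := by
      rw [← bracket_add_right hU E _ hG0 hG1 hx, projF_add_projF]
    rw [bracket_congr hU E (fun y _ => rfl : Set.EqOn ψ ψ U) e1 hx,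
      bracket_congr hU E (fun y _ => rfl : Set.EqOn F F U) e2 hx, e3,
      bracket_add_right hU E _ (hF.bracket hU hE.smooth hG0) (hF.bracket hU hE.smooth hG1) hx,
      bracket_add_right hU E _ (hψ.bracket hU hE.smooth hG0) (hψ.bracket hU hE.smooth hG1) hx,
      homog hF hG0 hF' (projF_parity U 0 G), homog hF hG1 hF' (projF_parity U 1 G)]
    abel
  have e1 : Set.EqOn (bracket E F G) (bracket E (projF 0 F) G + bracket E (projF 1 F) G) U := by
    intro y hy
    rw [Pi.add_apply, ← bracket_add_left hU E G hF0 hF1 hy, projF_add_projF]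
  have e2 : Set.EqOn (bracket E ψ F) (bracket E ψ (projF 0 F) + bracket E ψ (projF 1 F)) U := by
    intro y hy
    rw [Pi.add_apply, ← bracket_add_right hU E ψ hF0 hF1 hy, projF_add_projF]
  have e3 : bracket E F (bracket E ψ G) x = bracket E (projF 0 F) (bracket E ψ G) x +
      bracket E (projF 1 F) (bracket E ψ G) x := by
    rw [← bracket_add_left hU E _ hF0 hF1 hx, projF_add_projF]
  rw [bracket_congr hU E (fun y _ => rfl : Set.EqOn ψ ψ U) e1 hx,
    bracket_congr hU E e2 (fun y _ => rfl : Set.EqOn G G U) hx, e3,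
    bracket_add_right hU E _ (hF0.bracket hU hE.smooth hG) (hF1.bracket hU hE.smooth hG) hx,
    bracket_add_left hU E _ (hψ.bracket hU hE.smooth hF0) (hψ.bracket hU hE.smooth hF1) hx,
    homogL hF0 (projF_parity U 0 F), homogL hF1 (projF_parity U 1 F)]
  abel

theorem dR_dL_comm (hU : IsOpen U) {f : SFun p q} (hf : Smooth U f) (A B : p ⊕ q) {x : p → ℝ}
    (hx : x ∈ U) : dR B (dL A f) x = dL A (dR B f) x := by
  have h1 : dR B f = twF (par B) (dL B f) := funext fun y => dR_eq B f y
  rw [h1, dL_tw A _ ((hf.dL hU B).differentiableAt hU hx), dR_eq, dL_dL_comm hU hf B A hx, map_smul,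
    mul_comm]

/-- The commutator of ∂_B with the Hamiltonian vector field is the Jacobian of its components. With
right derivatives the factors come out in the order of a matrix product, (gradient of f) times
(Jacobian), with no sign left. -/
theorem dR_bracket_odd (hU : IsOpen U) (hE : IsAntisymplectic U E) {ψ f : SFun p q}
    (hψ : Smooth U ψ) (hψ' : HasParity U 1 ψ) (hf : Smooth U f) (B : p ⊕ q)
    {x : p → ℝ} (hx : x ∈ U) :
    dR B (bracket E ψ f) x =
      bracket E ψ (dR B f) x + ∑ C, dR C f x * dR B (hamCoef E ψ C) x := by
  have ha := fun C => Smooth.hamCoef hU hE hψ C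
  have hap : ∀ C, HasParity U (par C) (hamCoef E ψ C) := fun C =>
    (hamCoef_parity hU hE hψ hψ' C).congr_right (by rw [one_add_one_zmod, zero_add])
  have h1 : bracket E ψ f = ∑ C, hamCoef E ψ C * dL C f := by
    funext y
    simp [bracket_eq_hamCoef, Finset.sum_apply]
  rw [h1, dR_sum _ _ fun C _ => ((ha C).mul (hf.dL hU C)).differentiableAt hU hx,
    bracket_eq_hamCoef, ← Finset.sum_add_distrib]
  refine Finset.sum_congr rfl fun C _ => ?_
  rw [dR_mul B ((ha C).differentiableAt hU hx) ((hf.dL hU C).differentiableAt hU hx),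
    dR_dL_comm hU hf C B hx, mul_eq_mul_tw (dR C f x) ((hap C).dR hU (ha C) B x hx), dR_eq C f,
    tw_add, ← tw_comm, tw_tw_self]

/-- The divergence `(-1)^{ε_C} ∂_C a^C` of the Hamiltonian vector field of `ψ`. -/
def hamDiv (E : p ⊕ q → p ⊕ q → SFun p q) (ψ : SFun p q) : SFun p q :=
  ∑ C, sg (par C) • dL C (hamCoef E ψ C)

/-- The zeroth-level odd Laplacian. -/
def oddLaplacian (ρ : SFun p q) (E : p ⊕ q → p ⊕ q → SFun p q) (f : SFun p q) : SFun p q :=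
  ∑ A, ∑ B, (sg (par A) / 2) • ((fun x => Ring.inverse (ρ x)) * dL A (ρ * E A B * dL B f))

/-- Skewness of E lets the gradient of ψ be contracted from the other side, so the second-order
operator Δ applied to ψ is expressed through its Hamiltonian vector field. -/
theorem sum_mul_dL_odd (hU : IsOpen U) (hE : IsAntisymplectic U E) {ψ : SFun p q}
    (hψ : Smooth U ψ) (hψ' : HasParity U 1 ψ) (A : p ⊕ q) {x : p → ℝ} (hx : x ∈ U) :
    ∑ B, E A B x * dL B ψ x = -hamCoef E ψ A x := by
  simp only [hamCoef, Finset.sum_apply, Pi.mul_apply, ← Finset.sum_neg_distrib]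
  refine Finset.sum_congr rfl fun B _ => ?_
  rw [dR_eq, mul_comm_of_mem (hE.parity A B x hx) (hψ'.dL hU hψ B x hx),
    tw_of_mem (hψ'.dL hU hψ B x hx), hE.skew B A x hx, mul_smul_comm, smul_smul, smul_mul_assoc,
    ← neg_smul]
  congr 1
  generalize (par A : ZMod 2) = a
  generalize (par B : ZMod 2) = b
  rcases zmod_two_cases a with rfl | rfl <;> rcases zmod_two_cases b with rfl | rfl <;>
    simp [sg_zero, sg_one, one_add_one_zmod]

/-- After division by its body the element is 1 minus a nilpotent. -/
theorem isUnit_of_body_ne_zero {x : Gr q} (hx : body x ≠ 0) : IsUnit x := by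
  have h0 : body (1 - (body x)⁻¹ • x) = 0 := by simp [hx]
  have h1 : IsNilpotent (1 - (body x)⁻¹ • x) :=
    ⟨Fintype.card q + 1, soulPow_eq_zero (pow_mem_soulPow h0 _)⟩
  have h2 := h1.isUnit_one_sub
  rw [sub_sub_cancel] at h2
  have h3 : x = algebraMap ℝ (Gr q) (body x) * ((body x)⁻¹ • x) := by
    rw [← Algebra.smul_def, smul_smul, mul_inv_cancel₀ hx, one_smul]
  rw [h3]
  exact ((isUnit_iff_ne_zero.2 hx).map (algebraMap ℝ (Gr q))).mul h2

/-- The right-hand side is -½ times the divergence, with respect to ρ, of the Hamiltonian vector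
field of ψ. This is the infinitesimal reason why H behaves like the logarithm of the square root of
a Berezinian. -/
theorem oddLaplacian_odd (hU : IsOpen U) (hE : IsAntisymplectic U E) {ρ ψ : SFun p q}
    (hρ : IsDensity U ρ) (hψ : Smooth U ψ) (hψ' : HasParity U 1 ψ) {x : p → ℝ} (hx : x ∈ U) :
    oddLaplacian ρ E ψ x =
      -(1 / 2 : ℝ) • (hamDiv E ψ x + Ring.inverse (ρ x) * bracket E ψ ρ x) := by
  have ha := fun C => Smooth.hamCoef hU hE hψ C
  have hap : ∀ C, HasParity U (par C) (hamCoef E ψ C) := fun C =>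
    (hamCoef_parity hU hE hψ hψ' C).congr_right (by rw [one_add_one_zmod, zero_add])
  have hρu : IsUnit (ρ x) := isUnit_of_body_ne_zero (hρ.body_ne_zero x hx)
  have h1 : ∀ A, ∑ B, dL A (ρ * E A B * dL B ψ) x = -dL A (ρ * hamCoef E ψ A) x := by
    intro A
    have hs : ∀ B, Smooth U (ρ * E A B * dL B ψ) := fun B =>
      (hρ.smooth.mul (hE.smooth A B)).mul (hψ.dL hU B)
    rw [← dL_sum _ _ fun B _ => (hs B).differentiableAt hU hx]
    have e : Set.EqOn (∑ B, ρ * E A B * dL B ψ) ((-1 : ℝ) • (ρ * hamCoef E ψ A)) U := by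
      intro y hy
      have := sum_mul_dL_odd hU hE hψ hψ' A hy
      simp only [Finset.sum_apply, Pi.mul_apply, mul_assoc, ← Finset.mul_sum, this, Pi.smul_apply,
        mul_neg, neg_one_smul]
    rw [dL_congr_on hU A e hx, dL_smul _ _ ((hρ.smooth.mul (ha A)).differentiableAt hU hx),
      neg_one_smul]
  have h2 : ∀ A, Ring.inverse (ρ x) * (sg (par A) • dL A (ρ * hamCoef E ψ A) x) =
      sg (par A) • dL A (hamCoef E ψ A) x +
        Ring.inverse (ρ x) * (hamCoef E ψ A x * dL A ρ x) := by
    intro A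
    have hρA := hρ.parity.dL hU hρ.smooth A x hx
    rw [zero_add] at hρA
    rw [dL_mul A (hρ.smooth.differentiableAt hU hx) ((ha A).differentiableAt hU hx),
      tw_of_mem (hρ.parity x hx), mul_zero, sg_zero, one_smul, smul_add, mul_add,
      mul_comm_of_mem hρA (hap A x hx), smul_smul, add_comm]
    congr 1
    · rw [mul_smul_comm, ← mul_assoc, Ring.inverse_mul_cancel _ hρu, one_mul]
    · congr 1
      generalize (par A : ZMod 2) = a
      rcases zmod_two_cases a with rfl | rfl <;> simp [sg_zero, sg_one]
  have h3 : oddLaplacian ρ E ψ x = ∑ A, -(1 / 2 : ℝ) •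
      (Ring.inverse (ρ x) * (sg (par A) • dL A (ρ * hamCoef E ψ A) x)) := by
    simp only [oddLaplacian, Finset.sum_apply, Pi.smul_apply, Pi.mul_apply]
    refine Finset.sum_congr rfl fun A _ => ?_
    rw [← Finset.smul_sum, ← Finset.mul_sum, h1 A, mul_neg, mul_smul_comm, smul_smul, smul_neg,
      ← neg_smul]
    congr 1; ring
  rw [h3, ← Finset.smul_sum]
  simp only [h2, Finset.sum_add_distrib, hamDiv, Finset.sum_apply, Pi.smul_apply,
    bracket_eq_hamCoef E ψ ρ, Finset.mul_sum]

end Bracket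

/-! ### Path-ordered exponentials of Hamiltonian vector fields -/

section Flow

variable {p q : Type} [Fintype p] [DecidableEq p] [Fintype q]

/-- A path-ordered exponential `𝒰` of `(ψ, ·)` for a smooth family of odd `ψ`, with inverse `𝒱`. -/
structure Flow (T : Set ℝ) (U : Set (p → ℝ)) (E : p ⊕ q → p ⊕ q → SFun p q) (ψ : ℝ → SFun p q)
    (𝒰 𝒱 : ℝ → SFun p q → SFun p q) : Prop where
  isOpen_time : IsOpen T
  ordConnected : T.OrdConnected
  zero_mem : (0 : ℝ) ∈ T
  isOpen : IsOpen U
  antisymplectic : IsAntisymplectic U E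
  smooth_gen : SmoothFamily T U ψ
  odd_gen : ∀ t ∈ T, HasParity U 1 (ψ t)
  exp : IsPathOrderedExp T U E ψ 𝒰
  congr_inv : ∀ t ∈ T, ∀ F G, Smooth U F → Set.EqOn F G U → Set.EqOn (𝒱 t F) (𝒱 t G) U
  smooth_inv : ∀ F, SmoothFamily T U F → SmoothFamily T U (fun t => 𝒱 t (F t))
  inv_exp : ∀ t ∈ T, ∀ F, Smooth U F → Set.EqOn (𝒱 t (𝒰 t F)) F U
  exp_inv : ∀ t ∈ T, ∀ F, Smooth U F → Set.EqOn (𝒰 t (𝒱 t F)) F U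

/-- The covariant derivative `d/dt - (ψ, ·)` of a family of superfunctions. -/
def nabla (E : p ⊕ q → p ⊕ q → SFun p q) (ψ : ℝ → SFun p q) (z : ℝ → SFun p q) (t : ℝ) :
    SFun p q := dtF z t - bracket E (ψ t) (z t)

namespace Flow

variable {T : Set ℝ} {U : Set (p → ℝ)} {E : p ⊕ q → p ⊕ q → SFun p q} {ψ : ℝ → SFun p q}
  {𝒰 𝒱 : ℝ → SFun p q → SFun p q} (h : Flow T U E ψ 𝒰 𝒱)

include h

theorem smooth_gen_at {t : ℝ} (ht : t ∈ T) : Smooth U (ψ t) := h.smooth_gen.smooth ht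

theorem smooth_exp {t : ℝ} (ht : t ∈ T) {F : SFun p q} (hF : Smooth U F) : Smooth U (𝒰 t F) :=
  (h.exp.smooth (fun _ => F) (SmoothFamily.const hF)).smooth ht

theorem smooth_inv_at {t : ℝ} (ht : t ∈ T) {F : SFun p q} (hF : Smooth U F) : Smooth U (𝒱 t F) :=
  (h.smooth_inv (fun _ => F) (SmoothFamily.const hF)).smooth ht

theorem inv_eq_of_exp_eq {t : ℝ} (ht : t ∈ T) {F G : SFun p q} (hF : Smooth U F)
    (hG : Set.EqOn (𝒰 t F) G U) : Set.EqOn (𝒱 t G) F U := by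
  intro y hy
  rw [← h.congr_inv t ht _ _ (h.smooth_exp ht hF) hG hy, h.inv_exp t ht F hF hy]

theorem inv_add {t : ℝ} (ht : t ∈ T) {F G : SFun p q} (hF : Smooth U F) (hG : Smooth U G) :
    Set.EqOn (𝒱 t (F + G)) (𝒱 t F + 𝒱 t G) U := by
  refine h.inv_eq_of_exp_eq ht ((h.smooth_inv_at ht hF).add (h.smooth_inv_at ht hG)) fun y hy => ?_
  rw [h.exp.map_add t ht _ _ (h.smooth_inv_at ht hF) (h.smooth_inv_at ht hG) y hy,
    h.exp_inv t ht F hF hy, h.exp_inv t ht G hG hy]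
  rfl

theorem inv_smul {t : ℝ} (ht : t ∈ T) {F : SFun p q} (hF : Smooth U F) (r : ℝ) :
    Set.EqOn (𝒱 t (r • F)) (r • 𝒱 t F) U := by
  refine h.inv_eq_of_exp_eq ht ((h.smooth_inv_at ht hF).smul r) fun y hy => ?_
  rw [h.exp.map_smul t ht _ _ (h.smooth_inv_at ht hF) y hy, h.exp_inv t ht F hF hy]
  rfl

theorem inv_zero_fun {t : ℝ} (ht : t ∈ T) : Set.EqOn (𝒱 t (0 : SFun p q)) 0 U := by
  intro y hy
  have := h.inv_smul ht (Smooth.zero (q := q) U) 0 hy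
  rw [zero_smul, zero_smul] at this
  exact this

theorem inv_sum {ι : Type*} (s : Finset ι) {t : ℝ} (ht : t ∈ T) {F : ι → SFun p q}
    (hF : ∀ i, Smooth U (F i)) : Set.EqOn (𝒱 t (∑ i ∈ s, F i)) (∑ i ∈ s, 𝒱 t (F i)) U := by
  classical
  induction s using Finset.induction_on with
  | empty => simpa using h.inv_zero_fun ht
  | insert i s hi ih =>
    intro y hy
    rw [Finset.sum_insert hi, Finset.sum_insert hi,
      h.inv_add ht (hF i) (Smooth.sum s fun j _ => hF j) hy, Pi.add_apply, ih hy, Pi.add_apply]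

theorem exp_zero_fun {t : ℝ} (ht : t ∈ T) : Set.EqOn (𝒰 t (0 : SFun p q)) 0 U := by
  intro y hy
  have := h.exp.map_smul t ht 0 0 (Smooth.zero (q := q) U) y hy
  rwa [zero_smul, zero_smul] at this

theorem exp_sum {ι : Type*} (s : Finset ι) {t : ℝ} (ht : t ∈ T) {F : ι → SFun p q}
    (hF : ∀ i, Smooth U (F i)) : Set.EqOn (𝒰 t (∑ i ∈ s, F i)) (∑ i ∈ s, 𝒰 t (F i)) U := by
  classical
  induction s using Finset.induction_on with
  | empty => simpa using h.exp_zero_fun ht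
  | insert i s hi ih =>
    intro y hy
    rw [Finset.sum_insert hi, Finset.sum_insert hi,
      h.exp.map_add t ht _ _ (hF i) (Smooth.sum s fun j _ => hF j) y hy, ih hy, Pi.add_apply]

theorem inv_init {F : SFun p q} (hF : Smooth U F) : Set.EqOn (𝒱 0 F) F U :=
  h.inv_eq_of_exp_eq h.zero_mem hF (h.exp.init F hF)

theorem smooth_nabla {z : ℝ → SFun p q} (hz : SmoothFamily T U z) :
    SmoothFamily T U (nabla E ψ z) :=
  (hz.dt h.isOpen_time h.isOpen).sub
    (h.smooth_gen.bracket h.isOpen_time h.isOpen h.antisymplectic.smooth hz)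

/-- Put f = 𝒱z, so that 𝒰f = z. The differential equation of 𝒰 reads z' = (ψ, z) + 𝒰f', hence 𝒰f' =
∇z. Pull-back by 𝒱 therefore removes the transport term from every evolution equation. -/
theorem hasDerivAt_inv {z : ℝ → SFun p q} (hz : SmoothFamily T U z) {t : ℝ} (ht : t ∈ T)
    {y : p → ℝ} (hy : y ∈ U) :
    HasDerivAt (fun s => 𝒱 s (z s) y) (𝒱 t (nabla E ψ z t) y) t := by
  set f : ℝ → SFun p q := fun s => 𝒱 s (z s) with hf
  have hfs : SmoothFamily T U f := h.smooth_inv z hz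
  have e : Set.EqOn (𝒰 t (dtF f t)) (nabla E ψ z t) U := by
    intro x hx
    have h1 := h.exp.deriv f hfs t ht x hx
    have h2 : (fun s => 𝒰 s (f s) x) =ᶠ[nhds t] fun s => z s x := by
      filter_upwards [h.isOpen_time.mem_nhds ht] with s hs
      exact h.exp_inv s hs (z s) (hz.smooth hs) hx
    have h3 : dtF z t x = bracket E (ψ t) (𝒰 t (f t)) x + 𝒰 t (dtF f t) x := by
      have h4 := h1.deriv
      rw [h2.deriv_eq] at h4
      exact h4
    rw [bracket_congr h.isOpen E (fun _ _ => rfl) (h.exp_inv t ht (z t) (hz.smooth ht)) hx] at h3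
    rw [nabla, Pi.sub_apply, h3, add_sub_cancel_left]
  rw [h.inv_eq_of_exp_eq ht ((hfs.dt h.isOpen_time h.isOpen).smooth ht) e hy]
  exact hfs.hasDerivAt h.isOpen_time h.isOpen ht hy

/-- The pull-back 𝒱z has derivative zero on the interval T, so it stays at its initial value. Every
structural property of 𝒰 is proved by exhibiting a family annihilated by ∇ with the right initial
value. -/
theorem eq_exp_of_nabla_eq_zero {z : ℝ → SFun p q} (hz : SmoothFamily T U z)
    (h0 : ∀ t ∈ T, Set.EqOn (nabla E ψ z t) 0 U) {t : ℝ} (ht : t ∈ T) :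
    Set.EqOn (z t) (𝒰 t (z 0)) U := by
  have e : Set.EqOn (𝒱 t (z t)) (z 0) U := by
    intro y hy
    have hd : ∀ s ∈ T, HasDerivAt (fun s => 𝒱 s (z s) y) 0 s := by
      intro s hs
      have h1 := h.hasDerivAt_inv hz hs hy
      have h2 := h.congr_inv s hs _ _ ((h.smooth_nabla hz).smooth hs) (h0 s hs) hy
      rwa [h2, h.inv_zero_fun hs hy] at h1
    have := h.isOpen_time.is_const_of_deriv_eq_zero h.ordConnected.isPreconnected
      (fun s hs => (hd s hs).differentiableAt.differentiableWithinAt)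
      (fun s hs => (hd s hs).deriv) ht h.zero_mem
    rw [this, h.inv_init (hz.smooth h.zero_mem) hy]
  intro y hy
  rw [← h.exp.congr t ht _ _ (h.smooth_inv_at ht (hz.smooth ht)) e hy,
    h.exp_inv t ht _ (hz.smooth ht) hy]

theorem smoothFamily_exp {F : SFun p q} (hF : Smooth U F) : SmoothFamily T U fun t => 𝒰 t F :=
  h.exp.smooth (fun _ => F) (SmoothFamily.const hF)

theorem nabla_exp {F : SFun p q} (hF : Smooth U F) {t : ℝ} (ht : t ∈ T) :
    Set.EqOn (nabla E ψ (fun t => 𝒰 t F) t) 0 U := by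
  intro y hy
  have h1 := h.exp.deriv (fun _ => F) (SmoothFamily.const hF) t ht y hy
  have h2 : (fun y => deriv (fun _ : ℝ => F y) t) = (0 : SFun p q) := by
    funext y; simp
  rw [h2, h.exp_zero_fun ht hy, Pi.zero_apply, add_zero] at h1
  rw [nabla, Pi.sub_apply, dtF, h1.deriv, sub_self]; rfl

theorem nabla_mul {z w : ℝ → SFun p q} (hz : SmoothFamily T U z) (hw : SmoothFamily T U w)
    {t : ℝ} (ht : t ∈ T) :
    Set.EqOn (nabla E ψ (fun t => z t * w t) t)
      (nabla E ψ z t * w t + z t * nabla E ψ w t) U := by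
  intro y hy
  have h1 : dtF (fun t => z t * w t) t y = dtF z t y * w t y + z t y * dtF w t y :=
    (hasDerivAt_grMul (hz.hasDerivAt h.isOpen_time h.isOpen ht hy)
      (hw.hasDerivAt h.isOpen_time h.isOpen ht hy)).deriv
  simp only [nabla, Pi.sub_apply, Pi.add_apply, Pi.mul_apply, h1]
  rw [bracket_odd_mul h.isOpen h.antisymplectic (h.smooth_gen_at ht) (h.odd_gen t ht)
    (hz.smooth ht) (hw.smooth ht) hy, sub_mul, mul_sub]
  abel

/-- For odd ψ the components of (ψ, ·) have the parity of their coordinate, so the twist of the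
component cancels the sign of the derivative. This is what makes 𝒰 preserve parity. -/
theorem nabla_tw {z : ℝ → SFun p q} (hz : SmoothFamily T U z) (e : ZMod 2) {t : ℝ} (ht : t ∈ T) :
    Set.EqOn (nabla E ψ (fun t => twF e (z t)) t) (twF e (nabla E ψ z t)) U := by
  intro y hy
  have h1 : dtF (fun t => twF e (z t)) t y = tw e (dtF z t y) := by
    have h2 := hasDerivAt_grLin (tw e).toLinearMap (hz.hasDerivAt h.isOpen_time h.isOpen ht hy)
    exact h2.deriv
  simp only [nabla, Pi.sub_apply, twF_apply, h1, map_sub]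
  congr 1
  rw [bracket_eq_hamCoef, bracket_eq_hamCoef, map_sum]
  refine Finset.sum_congr rfl fun B _ => ?_
  have hp := hamCoef_parity h.isOpen h.antisymplectic (h.smooth_gen_at ht) (h.odd_gen t ht) B y hy
  rw [dL_tw B e ((hz.smooth ht).differentiableAt h.isOpen hy), map_mul, tw_of_mem hp,
    one_add_one_zmod, zero_add, smul_mul_assoc, mul_smul_comm, mul_comm e]

/-- E does not depend on t, so d/dt obeys the Leibniz rule for the bracket; (ψ, ·) obeys it by the
Jacobi identity. -/
theorem nabla_bracket {z w : ℝ → SFun p q} (hz : SmoothFamily T U z) (hw : SmoothFamily T U w)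
    {t : ℝ} (ht : t ∈ T) :
    Set.EqOn (nabla E ψ (fun t => bracket E (z t) (w t)) t)
      (bracket E (nabla E ψ z t) (w t) + bracket E (z t) (nabla E ψ w t)) U := by
  intro y hy
  have hs := h.smooth_gen_at ht
  have hzt := hz.smooth ht
  have hwt := hw.smooth ht
  have hzd := (hz.dt h.isOpen_time h.isOpen).smooth ht
  have hwd := (hw.dt h.isOpen_time h.isOpen).smooth ht
  have h1 : dtF (fun t => bracket E (z t) (w t)) t y =
      bracket E (dtF z t) (w t) y + bracket E (z t) (dtF w t) y := by
    have : HasDerivAt (fun s => bracket E (z s) (w s) y)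
        (bracket E (dtF z t) (w t) y + bracket E (z t) (dtF w t) y) t := by
      simp only [bracket_apply, ← Finset.sum_add_distrib]
      refine HasDerivAt.fun_sum fun A _ => HasDerivAt.fun_sum fun B _ => ?_
      have d1 := hasDerivAt_dR h.isOpen_time h.isOpen hz A ht hy
      have d2 := hasDerivAt_dL h.isOpen_time h.isOpen hw B ht hy
      have d3 := hasDerivAt_grMul (hasDerivAt_grMul d1 (hasDerivAt_const t (E A B y))) d2
      exact d3.congr_deriv (by rw [mul_zero, add_zero])
    exact this.deriv
  simp only [nabla, Pi.sub_apply, Pi.add_apply, h1]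
  have hb1 := hs.bracket h.isOpen h.antisymplectic.smooth hzt
  have hb2 := hs.bracket h.isOpen h.antisymplectic.smooth hwt
  have sub_l : bracket E (dtF z t - bracket E (ψ t) (z t)) (w t) y =
      bracket E (dtF z t) (w t) y - bracket E (bracket E (ψ t) (z t)) (w t) y := by
    rw [eq_sub_iff_add_eq, ← bracket_add_left h.isOpen E _ (hzd.sub hb1) hb1 hy, sub_add_cancel]
  have sub_r : bracket E (z t) (dtF w t - bracket E (ψ t) (w t)) y =
      bracket E (z t) (dtF w t) y - bracket E (z t) (bracket E (ψ t) (w t)) y := by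
    rw [eq_sub_iff_add_eq, ← bracket_add_right h.isOpen E _ (hwd.sub hb2) hb2 hy, sub_add_cancel]
  rw [sub_l, sub_r, bracket_odd_bracket h.isOpen h.antisymplectic hs (h.odd_gen t ht) hzt hwt hy]
  abel

/-- Coordinate derivatives do not commute with ∇: the defect is the Jacobian of the Hamiltonian
vector field, whose supertrace will supply the divergence. -/
theorem nabla_dR {z : ℝ → SFun p q} (hz : SmoothFamily T U z) (B : p ⊕ q) {t : ℝ} (ht : t ∈ T)
    {y : p → ℝ} (hy : y ∈ U) :
    nabla E ψ (fun t => dR B (z t)) t y =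
      ∑ C, dR C (z t) y * dR B (hamCoef E (ψ t) C) y + dR B (nabla E ψ z t) y := by
  have hzd := (hz.dt h.isOpen_time h.isOpen).smooth ht
  have hb := (h.smooth_gen_at ht).bracket h.isOpen h.antisymplectic.smooth (hz.smooth ht)
  have h1 : dtF (fun t => dR B (z t)) t y = dR B (dtF z t) y :=
    (hasDerivAt_dR h.isOpen_time h.isOpen hz B ht hy).deriv
  have h2 : dR B (nabla E ψ z t) y = dR B (dtF z t) y - dR B (bracket E (ψ t) (z t)) y := by
    rw [dR_eq, nabla, dL_sub B (hzd.differentiableAt h.isOpen hy) (hb.differentiableAt h.isOpen hy),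
      map_sub, ← dR_eq, ← dR_eq]
  rw [h2, nabla, Pi.sub_apply, h1, dR_bracket_odd h.isOpen h.antisymplectic (h.smooth_gen_at ht)
    (h.odd_gen t ht) (hz.smooth ht) B hy]
  abel

/-- The product of two families annihilated by ∇ is again annihilated and starts at F * G. The same
pattern gives compatibility with the involution, the unit and the bracket. -/
theorem exp_mul {t : ℝ} (ht : t ∈ T) {F G : SFun p q} (hF : Smooth U F) (hG : Smooth U G) :
    Set.EqOn (𝒰 t (F * G)) (𝒰 t F * 𝒰 t G) U := by
  intro y hy
  have hz := (h.smoothFamily_exp hF).mul (h.smoothFamily_exp hG)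
  have h1 := h.eq_exp_of_nabla_eq_zero hz (fun s hs x hx => by
    rw [h.nabla_mul (h.smoothFamily_exp hF) (h.smoothFamily_exp hG) hs hx, Pi.add_apply,
      Pi.mul_apply, Pi.mul_apply, h.nabla_exp hF hs hx, h.nabla_exp hG hs hx]
    simp) ht hy
  rw [h1]
  refine h.exp.congr t ht _ _ (hF.mul hG) (fun x hx => ?_) hy
  rw [Pi.mul_apply, Pi.mul_apply, h.exp.init F hF hx, h.exp.init G hG hx]

theorem exp_tw {t : ℝ} (ht : t ∈ T) {F : SFun p q} (hF : Smooth U F) (e : ZMod 2) :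
    Set.EqOn (𝒰 t (twF e F)) (twF e (𝒰 t F)) U := by
  intro y hy
  have hz : SmoothFamily T U fun t => twF e (𝒰 t F) :=
    (h.smoothFamily_exp hF).lin (BV.tw e).toLinearMap
  have h1 := h.eq_exp_of_nabla_eq_zero hz (fun s hs x hx => by
    rw [h.nabla_tw (h.smoothFamily_exp hF) e hs hx, twF_apply, h.nabla_exp hF hs hx]
    simp) ht hy
  rw [h1]
  refine h.exp.congr t ht _ _ (hF.tw e) (fun x hx => ?_) hy
  rw [twF_apply, twF_apply, h.exp.init F hF hx]

theorem exp_parity {t : ℝ} (ht : t ∈ T) {F : SFun p q} (hF : Smooth U F) {e : ZMod 2}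
    (he : HasParity U e F) : HasParity U e (𝒰 t F) := by
  intro y hy
  have h1 : Set.EqOn (twF 1 F) (sg e • F) U := fun x hx => mem_grPart_iff.1 (he x hx)
  have h2 := h.exp.congr t ht _ _ (hF.tw 1) h1 hy
  rw [h.exp_tw ht hF 1 hy, h.exp.map_smul t ht _ F hF y hy] at h2
  exact mem_grPart_iff.2 h2

theorem exp_bracket {t : ℝ} (ht : t ∈ T) {F G : SFun p q} (hF : Smooth U F) (hG : Smooth U G) :
    Set.EqOn (𝒰 t (bracket E F G)) (bracket E (𝒰 t F) (𝒰 t G)) U := by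
  intro y hy
  have sF := h.smoothFamily_exp hF
  have sG := h.smoothFamily_exp hG
  have hz := sF.bracket h.isOpen_time h.isOpen h.antisymplectic.smooth sG
  have h1 := h.eq_exp_of_nabla_eq_zero hz (fun s hs x hx => by
    rw [h.nabla_bracket sF sG hs hx, Pi.add_apply,
      bracket_congr h.isOpen E (h.nabla_exp hF hs) (fun _ _ => rfl) hx,
      bracket_congr h.isOpen E (fun _ _ => rfl) (h.nabla_exp hG hs) hx]
    simp [bracket_apply, dR_eq, dL_zero]) ht hy
  rw [h1]
  exact h.exp.congr t ht _ _ (hF.bracket h.isOpen h.antisymplectic.smooth hG)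
    (fun x hx => (bracket_congr h.isOpen E (h.exp.init F hF) (h.exp.init G hG) hx).symm) hy

theorem isAnticanonical {t : ℝ} (ht : t ∈ T) : IsAnticanonical U E (𝒰 t) where
  smooth _ hF := h.smooth_exp ht hF
  parity _ _ hF he := h.exp_parity ht hF he
  map_mul _ _ hF hG := h.exp_mul ht hF hG
  map_bracket _ _ hF hG := h.exp_bracket ht hF hG

theorem inv_mul {t : ℝ} (ht : t ∈ T) {F G : SFun p q} (hF : Smooth U F) (hG : Smooth U G) :
    Set.EqOn (𝒱 t (F * G)) (𝒱 t F * 𝒱 t G) U := by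
  refine h.inv_eq_of_exp_eq ht ((h.smooth_inv_at ht hF).mul (h.smooth_inv_at ht hG)) fun y hy => ?_
  rw [h.exp_mul ht (h.smooth_inv_at ht hF) (h.smooth_inv_at ht hG) hy, Pi.mul_apply,
    h.exp_inv t ht F hF hy, h.exp_inv t ht G hG hy]
  rfl

theorem inv_tw {t : ℝ} (ht : t ∈ T) {F : SFun p q} (hF : Smooth U F) (e : ZMod 2) :
    Set.EqOn (𝒱 t (twF e F)) (twF e (𝒱 t F)) U := by
  refine h.inv_eq_of_exp_eq ht ((h.smooth_inv_at ht hF).tw e) fun y hy => ?_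
  rw [h.exp_tw ht (h.smooth_inv_at ht hF) e hy, twF_apply, h.exp_inv t ht F hF hy]
  rfl

theorem inv_parity {t : ℝ} (ht : t ∈ T) {F : SFun p q} (hF : Smooth U F) {e : ZMod 2}
    (he : HasParity U e F) : HasParity U e (𝒱 t F) := by
  intro y hy
  have h1 : Set.EqOn (twF 1 F) (sg e • F) U := fun x hx => mem_grPart_iff.1 (he x hx)
  have h2 := h.congr_inv t ht _ _ (hF.tw 1) h1 hy
  rw [h.inv_tw ht hF 1 hy, h.inv_smul ht hF _ hy] at h2
  exact mem_grPart_iff.2 h2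

theorem nabla_one {t : ℝ} : Set.EqOn (nabla E ψ (fun _ => 1) t) 0 U := by
  intro y _
  have hd : ∀ B : p ⊕ q, dL B (1 : SFun p q) y = 0 := by
    intro B
    cases B with
    | inl i => rw [dL_inl, show (1 : SFun p q) = fun _ => 1 from rfl]; simp
    | inr j =>
      rw [dL_inr, Pi.one_apply, ← map_one (algebraMap ℝ (Gr q)), iL_algebraMap]
  simp [nabla, dtF, bracket_apply, hd]

theorem exp_one {t : ℝ} (ht : t ∈ T) : Set.EqOn (𝒰 t (1 : SFun p q)) 1 U := by
  intro y hy
  exact (h.eq_exp_of_nabla_eq_zero (z := fun _ => 1) (SmoothFamily.const (Smooth.one U))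
    (fun _ _ => h.nabla_one) ht hy).symm

theorem inv_one {t : ℝ} (ht : t ∈ T) : Set.EqOn (𝒱 t (1 : SFun p q)) 1 U :=
  h.inv_eq_of_exp_eq ht (Smooth.one U) (h.exp_one ht)

end Flow
end Flow

/-! ### Linear differential equations depending smoothly on parameters -/

section CurryPath

variable {p : Type} [Fintype p] [DecidableEq p]

open Classical in
/-- A function of `(t, y)` as a function of `y` with values in paths over `[0, 1]`. -/
def curryPath {F : Type*} [NormedAddCommGroup F] (f : ℝ × (p → ℝ) → F) (y : p → ℝ) :
    C(Set.Icc (0 : ℝ) 1, F) :=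
  if h : Continuous fun t : Set.Icc (0 : ℝ) 1 => f (t, y) then ⟨_, h⟩ else 0

variable {F : Type*} [NormedAddCommGroup F] {T : Set ℝ} {U : Set (p → ℝ)}
  {f : ℝ × (p → ℝ) → F}

theorem curryPath_apply (hT : Set.Icc (0 : ℝ) 1 ⊆ T) (hf : ContinuousOn f (T ×ˢ U)) {y : p → ℝ}
    (hy : y ∈ U) (t : Set.Icc (0 : ℝ) 1) : curryPath f y t = f (t, y) := by
  have h : Continuous fun t : Set.Icc (0 : ℝ) 1 => f (t, y) :=
    hf.comp_continuous (by fun_prop) fun t => ⟨hT t.2, hy⟩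
  rw [curryPath, dif_pos h]; rfl

theorem continuousOn_curryPath (hT : Set.Icc (0 : ℝ) 1 ⊆ T) (hf : ContinuousOn f (T ×ˢ U)) :
    ContinuousOn (curryPath f) U := by
  rw [continuousOn_iff_continuous_domRestrict]
  refine ContinuousMap.continuous_of_continuous_uncurry _ ?_
  have : (Function.uncurry fun (x : U) (t : Set.Icc (0 : ℝ) 1) => U.domRestrict (curryPath f) x t) =
      fun z => f (z.2, z.1) := by
    funext z
    exact curryPath_apply hT hf z.1.2 z.2
  rw [this]
  exact hf.comp_continuous (by fun_prop) fun z => ⟨hT z.2.2, z.1.2⟩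

variable [NormedSpace ℝ F]

/-- Paths of linear maps as linear maps to paths. -/
def pathSwap (F : Type*) [NormedAddCommGroup F] [NormedSpace ℝ F] :
    C(Set.Icc (0 : ℝ) 1, (p → ℝ) →L[ℝ] F) →L[ℝ] ((p → ℝ) →L[ℝ] C(Set.Icc (0 : ℝ) 1, F)) :=
  ∑ i, (ContinuousLinearMap.smulRightL ℝ (p → ℝ) C(Set.Icc (0 : ℝ) 1, F)
    (ContinuousLinearMap.proj i)).comp (ContinuousLinearMap.compLeftContinuous ℝ _
      (ContinuousLinearMap.apply ℝ F (Pi.single i 1 : p → ℝ)))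

theorem pathSwap_apply (φ : C(Set.Icc (0 : ℝ) 1, (p → ℝ) →L[ℝ] F)) (v : p → ℝ)
    (t : Set.Icc (0 : ℝ) 1) : pathSwap F φ v t = φ t v := by
  conv_rhs => rw [← Finset.univ_sum_single v, map_sum]
  simp only [pathSwap, sum_apply, ContinuousMap.coe_sum, Finset.sum_apply]
  refine Finset.sum_congr rfl fun i _ => ?_
  have : (Pi.single i (v i) : p → ℝ) = v i • Pi.single i 1 := by
    rw [← Pi.single_smul, smul_eq_mul, mul_one]
  rw [this, map_smul]
  rfl

/-- The derivative of `f` in the second argument. -/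
def sndDeriv (f : ℝ × (p → ℝ) → F) (z : ℝ × (p → ℝ)) : (p → ℝ) →L[ℝ] F :=
  (fderiv ℝ f z).comp (ContinuousLinearMap.inr ℝ ℝ (p → ℝ))

theorem contDiffOn_sndDeriv (hT : IsOpen T) (hU : IsOpen U) (hf : ContDiffOn ℝ ∞ f (T ×ˢ U)) :
    ContDiffOn ℝ ∞ (sndDeriv f) (T ×ˢ U) :=
  (hf.fderiv_of_isOpen (hT.prod hU) (by simp)).clm_comp contDiffOn_const

/-- Continuity of the path-valued derivative bounds its variation on a small ball uniformly in t;
the mean value inequality at each fixed t then gives the sup-norm estimate. -/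
theorem hasFDerivAt_curryPath (hT : IsOpen T) (hT' : Set.Icc (0 : ℝ) 1 ⊆ T) (hU : IsOpen U)
    (hf : ContDiffOn ℝ ∞ f (T ×ˢ U)) {y : p → ℝ} (hy : y ∈ U) :
    HasFDerivAt (curryPath f) (pathSwap F (curryPath (sndDeriv f) y)) y := by
  have hs := (contDiffOn_sndDeriv hT hU hf).continuousOn
  have hc := continuousOn_curryPath hT' hs
  rw [hasFDerivAt_iff_isLittleO_nhds_zero, Asymptotics.isLittleO_iff]
  intro ε hε
  have hcy : ContinuousAt (curryPath (sndDeriv f)) y := hc.continuousAt (hU.mem_nhds hy)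
  obtain ⟨δ, hδ, hδ'⟩ := Metric.mem_nhds_iff.1
    (Filter.inter_mem (hU.mem_nhds hy) (hcy (Metric.closedBall_mem_nhds _ hε)))
  filter_upwards [Metric.ball_mem_nhds (0 : p → ℝ) hδ] with v hv
  have hyv : y + v ∈ Metric.ball y δ := by simpa [dist_eq_norm] using hv
  rw [ContinuousMap.norm_le _ (by positivity)]
  intro t
  have ht : (t : ℝ) ∈ T := hT' t.2
  have hd : ∀ z ∈ Metric.ball y δ,
      HasFDerivWithinAt (fun z => f (t, z)) (sndDeriv f (t, z)) (Metric.ball y δ) z := by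
    intro z hz
    have h1 : DifferentiableAt ℝ f ((t : ℝ), z) :=
      (hf.contDiffAt ((hT.prod hU).mem_nhds ⟨ht, (hδ' hz).1⟩)).differentiableAt (by simp)
    exact (h1.hasFDerivAt.comp z (hasFDerivAt_prodMk_right (t : ℝ) z)).hasFDerivWithinAt
  have hb : ∀ z ∈ Metric.ball y δ, ‖sndDeriv f (t, z) - sndDeriv f (t, y)‖ ≤ ε := by
    intro z hz
    have h1 : dist (curryPath (sndDeriv f) z) (curryPath (sndDeriv f) y) ≤ ε := (hδ' hz).2
    have h2 := (ContinuousMap.dist_le hε.le).1 h1 t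
    rwa [curryPath_apply hT' hs (hδ' hz).1, curryPath_apply hT' hs hy, dist_eq_norm] at h2
  have h3 := (convex_ball y δ).norm_image_sub_le_of_norm_hasFDerivWithin_le' hd hb
    (Metric.mem_ball_self hδ) hyv
  rw [add_sub_cancel_left] at h3
  rw [ContinuousMap.sub_apply, ContinuousMap.sub_apply, pathSwap_apply,
    curryPath_apply hT' hf.continuousOn (hδ' hyv).1, curryPath_apply hT' hf.continuousOn hy,
    curryPath_apply hT' hs hy]
  exact h3

/-- The induction runs over all value spaces at once, because the derivative is the path map of
`sndDeriv f`, with values in another space, followed by a fixed continuous linear map. -/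
theorem contDiffOn_curryPath_nat (n : ℕ) : ∀ {F : Type} [NormedAddCommGroup F] [NormedSpace ℝ F]
    {T : Set ℝ} {U : Set (p → ℝ)} {f : ℝ × (p → ℝ) → F}, IsOpen T → Set.Icc (0 : ℝ) 1 ⊆ T →
    IsOpen U → ContDiffOn ℝ ∞ f (T ×ˢ U) → ContDiffOn ℝ n (curryPath f) U := by
  induction n with
  | zero =>
    intro F _ _ T U f hT hT' hU hf
    exact contDiffOn_zero.2 (continuousOn_curryPath hT' hf.continuousOn)
  | succ n ih =>
    intro F _ _ T U f hT hT' hU hf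
    have hd : ∀ y ∈ U, HasFDerivAt (curryPath f) (pathSwap F (curryPath (sndDeriv f) y)) y :=
      fun y hy => hasFDerivAt_curryPath hT hT' hU hf hy
    rw [Nat.cast_succ, contDiffOn_succ_iff_fderiv_of_isOpen hU]
    refine ⟨fun y hy => (hd y hy).differentiableAt.differentiableWithinAt, by simp, ?_⟩
    have h1 := ih hT hT' hU (contDiffOn_sndDeriv hT hU hf)
    have h2 : ContDiff ℝ n (fun a => pathSwap (p := p) F a) := ContinuousLinearMap.contDiff _
    exact (h2.comp_contDiffOn h1).congr fun y hy => (hd y hy).fderiv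

theorem contDiffOn_curryPath {F : Type} [NormedAddCommGroup F] [NormedSpace ℝ F]
    {f : ℝ × (p → ℝ) → F} (hT : IsOpen T) (hT' : Set.Icc (0 : ℝ) 1 ⊆ T) (hU : IsOpen U)
    (hf : ContDiffOn ℝ ∞ f (T ×ˢ U)) : ContDiffOn ℝ ∞ (curryPath f) U :=
  contDiffOn_infty.2 fun n => contDiffOn_curryPath_nat n hT hT' hU hf

end CurryPath

/-! ### Inversion of bounded operators -/

section BanachOperators

variable {B : Type*} [NormedAddCommGroup B] [NormedSpace ℝ B] [CompleteSpace B]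

/-- 1 - L is a factor of the invertible 1 - Lⁿ, and it commutes with the other factor, the geometric
sum. -/
theorem isUnit_one_sub_of_norm_pow_lt_one (L : B →L[ℝ] B) {n : ℕ} (hn : ‖L ^ n‖ < 1) :
    IsUnit (1 - L) := by
  have h2 : IsUnit (1 - L ^ n) := isUnit_one_sub_of_norm_lt_one (R := B →L[ℝ] B) hn
  have hc : Commute (1 - L) (∑ i ∈ Finset.range n, L ^ i) :=
    Commute.sum_right _ _ _ fun i _ =>
      ((Commute.one_left _).sub_left ((Commute.refl _).pow_right i))
  rw [← mul_neg_geom_sum] at h2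
  exact (hc.isUnit_mul_iff.1 h2).1

theorem contDiffAt_clmInverse {L : B →L[ℝ] B} (hL : IsUnit L) :
    ContDiffAt ℝ ∞ (Ring.inverse : (B →L[ℝ] B) → (B →L[ℝ] B)) L := by
  obtain ⟨u, rfl⟩ := hL
  exact contDiffAt_ringInverse (R := B →L[ℝ] B) ℝ u

end BanachOperators

/-! ### Volterra operators and fundamental solutions -/

section Volterra

variable {F : Type} [NormedAddCommGroup F] [NormedSpace ℝ F]

/-- The primitive of a path that vanishes at `0`. -/
def primitive (φ : C(Set.Icc (0 : ℝ) 1, F)) (t : ℝ) : F :=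
  ∫ s in (0 : ℝ)..t, Set.IccExtend zero_le_one φ s

theorem hasDerivAt_primitive [CompleteSpace F] (φ : C(Set.Icc (0 : ℝ) 1, F)) (t : ℝ) :
    HasDerivAt (primitive φ) (Set.IccExtend zero_le_one φ t) t := by
  have hc : Continuous (Set.IccExtend (zero_le_one' ℝ) φ) := φ.continuous.Icc_extend'
  exact intervalIntegral.integral_hasDerivAt_right (hc.intervalIntegrable _ _)
    hc.stronglyMeasurable.stronglyMeasurableAtFilter hc.continuousAt

theorem intervalIntegrable_iccExtend (φ : C(Set.Icc (0 : ℝ) 1, F)) (a b : ℝ) :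
    IntervalIntegrable (Set.IccExtend (zero_le_one' ℝ) φ) MeasureTheory.volume a b :=
  (φ.continuous.Icc_extend' (h := zero_le_one' ℝ)).intervalIntegrable _ _

theorem norm_primitive_le (φ : C(Set.Icc (0 : ℝ) 1, F)) (t : Set.Icc (0 : ℝ) 1) :
    ‖primitive φ t‖ ≤ ‖φ‖ := by
  have h := intervalIntegral.norm_integral_le_of_norm_le_const (a := (0 : ℝ)) (b := t) (C := ‖φ‖)
    (f := Set.IccExtend (zero_le_one' ℝ) φ) fun s _ => φ.norm_coe_le_norm _
  refine h.trans ?_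
  rw [sub_zero, abs_of_nonneg t.2.1]
  exact mul_le_of_le_one_right (norm_nonneg _) t.2.2

/-- Integration of paths. -/
def volterra (F : Type) [NormedAddCommGroup F] [NormedSpace ℝ F] [CompleteSpace F] :
    C(Set.Icc (0 : ℝ) 1, F) →L[ℝ] C(Set.Icc (0 : ℝ) 1, F) :=
  LinearMap.mkContinuous
    { toFun := fun φ => ⟨fun t => primitive φ t,
        (continuous_iff_continuousAt.2 fun t =>
          (hasDerivAt_primitive φ t).continuousAt).comp continuous_subtype_val⟩
      map_add' := fun φ χ => by
        ext t
        exact intervalIntegral.integral_add (intervalIntegrable_iccExtend φ _ _)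
          (intervalIntegrable_iccExtend χ _ _)
      map_smul' := fun r φ => by
        ext t
        exact intervalIntegral.integral_smul r _ } 1 fun φ => by
    rw [one_mul, ContinuousMap.norm_le _ (norm_nonneg _)]
    exact fun t => norm_primitive_le φ t

theorem volterra_apply [CompleteSpace F] (φ : C(Set.Icc (0 : ℝ) 1, F)) (t : Set.Icc (0 : ℝ) 1) :
    volterra F φ t = primitive φ t := rfl

variable {𝔸 : Type} [NormedRing 𝔸] [NormedAlgebra ℝ 𝔸] [CompleteSpace 𝔸]

/-- The operator `φ ↦ ∫ a φ`. -/
def volterraMul (𝔸 : Type) [NormedRing 𝔸] [NormedAlgebra ℝ 𝔸] [CompleteSpace 𝔸] :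
    C(Set.Icc (0 : ℝ) 1, 𝔸) →L[ℝ] (C(Set.Icc (0 : ℝ) 1, 𝔸) →L[ℝ] C(Set.Icc (0 : ℝ) 1, 𝔸)) :=
  (ContinuousLinearMap.compL ℝ _ _ _ (volterra 𝔸)).comp
    (ContinuousLinearMap.mul ℝ C(Set.Icc (0 : ℝ) 1, 𝔸))

theorem volterraMul_apply (a φ : C(Set.Icc (0 : ℝ) 1, 𝔸)) :
    volterraMul 𝔸 a φ = volterra 𝔸 (a * φ) := rfl

/-- Keeping the bound pointwise in t is what lets each integration of sⁿ contribute a factor 1/(n +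
1), and so produces the factorial. -/
theorem norm_volterraMul_pow_le (a φ : C(Set.Icc (0 : ℝ) 1, 𝔸)) (n : ℕ)
    (t : Set.Icc (0 : ℝ) 1) :
    ‖((volterraMul 𝔸 a) ^ n) φ t‖ ≤ ‖a‖ ^ n * (t : ℝ) ^ n / n.factorial * ‖φ‖ := by
  induction n generalizing t with
  | zero => simpa using φ.norm_coe_le_norm t
  | succ n ih =>
    set χ := ((volterraMul 𝔸 a) ^ n) φ with hχ
    rw [pow_succ', mul_apply_eq_comp, volterraMul_apply, volterra_apply, primitive]
    have h1 : ∀ s ∈ Set.Ioc (0 : ℝ) t, ‖Set.IccExtend (zero_le_one' ℝ) (a * χ) s‖ ≤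
        ‖a‖ ^ (n + 1) / n.factorial * ‖φ‖ * s ^ n := by
      intro s hs
      have hs' : s ∈ Set.Icc (0 : ℝ) 1 := ⟨hs.1.le, hs.2.trans t.2.2⟩
      rw [Set.IccExtend_of_mem _ _ hs', ContinuousMap.mul_apply]
      calc ‖a ⟨s, hs'⟩ * χ ⟨s, hs'⟩‖ ≤ ‖a ⟨s, hs'⟩‖ * ‖χ ⟨s, hs'⟩‖ := norm_mul_le _ _
        _ ≤ ‖a‖ * (‖a‖ ^ n * s ^ n / n.factorial * ‖φ‖) :=
          mul_le_mul (a.norm_coe_le_norm _) (ih ⟨s, hs'⟩) (norm_nonneg _) (norm_nonneg _)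
        _ = _ := by ring
    have h2 := intervalIntegral.norm_integral_le_of_norm_le (a := (0 : ℝ)) (b := t) t.2.1
      (f := Set.IccExtend (zero_le_one' ℝ) (a * χ)) (μ := MeasureTheory.volume)
      (MeasureTheory.ae_of_all _ h1)
      ((by fun_prop : Continuous fun s : ℝ => ‖a‖ ^ (n + 1) / n.factorial * ‖φ‖ * s ^ n).intervalIntegrable _ _)
    refine h2.trans (le_of_eq ?_)
    rw [intervalIntegral.integral_const_mul, integral_pow, Nat.factorial_succ]
    have : (n.factorial : ℝ) ≠ 0 := by positivity
    push_cast
    field_simp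
    ring

theorem isUnit_one_sub_volterraMul (a : C(Set.Icc (0 : ℝ) 1, 𝔸)) :
    IsUnit (1 - volterraMul 𝔸 a) := by
  have hn : ∃ n : ℕ, ‖(volterraMul 𝔸 a) ^ n‖ < 1 := by
    have h1 := (FloorSemiring.tendsto_pow_div_factorial_atTop ‖a‖).eventually
      (gt_mem_nhds one_pos)
    obtain ⟨n, hn⟩ := h1.exists
    refine ⟨n, lt_of_le_of_lt ?_ hn⟩
    refine ContinuousLinearMap.opNorm_le_bound _ (by positivity) fun φ => ?_
    rw [ContinuousMap.norm_le _ (by positivity)]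
    intro t
    refine (norm_volterraMul_pow_le a φ n t).trans ?_
    gcongr
    exact mul_le_of_le_one_right (by positivity) (pow_le_one₀ t.2.1 t.2.2)
  obtain ⟨n, hn⟩ := hn
  exact isUnit_one_sub_of_norm_pow_lt_one _ hn

/-- The integral equation r = 1 + ∫ A r is solved by the resolvent of a Volterra operator on
continuous paths. Smooth dependence on y comes from smoothness of y ↦ A(·, y) as a path-valued map
and of operator inversion. -/
theorem exists_fundamental_solution {p : Type} [Fintype p] [DecidableEq p] {T : Set ℝ}
    {U : Set (p → ℝ)} (hT : IsOpen T) (hT' : Set.Icc (0 : ℝ) 1 ⊆ T) (hU : IsOpen U)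
    {A : ℝ × (p → ℝ) → 𝔸} (hA : ContDiffOn ℝ ∞ A (T ×ˢ U)) :
    ∃ r : ℝ → (p → ℝ) → 𝔸, ContDiffOn ℝ ∞ (r 1) U ∧ ∀ y ∈ U, r 0 y = 1 ∧
      ∀ t ∈ Set.Icc (0 : ℝ) 1, HasDerivAt (fun s => r s y) (A (t, y) * r t y) t := by
  set R : (p → ℝ) → C(Set.Icc (0 : ℝ) 1, 𝔸) := fun y =>
    Ring.inverse (1 - volterraMul 𝔸 (curryPath A y)) 1 with hR
  have hRs : ContDiffOn ℝ ∞ R U := by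
    intro y hy
    have hL : ContDiff ℝ ∞ (fun a => volterraMul 𝔸 a) := ContinuousLinearMap.contDiff _
    have h1 : ContDiffWithinAt ℝ ∞ (fun y => 1 - volterraMul 𝔸 (curryPath A y)) U y :=
      contDiffWithinAt_const.sub
        ((hL.comp_contDiffOn (contDiffOn_curryPath hT hT' hU hA)) y hy)
    have h2 := contDiffAt_clmInverse (isUnit_one_sub_volterraMul (curryPath A y))
    exact (h2.comp_contDiffWithinAt y h1).clm_apply contDiffWithinAt_const
  have hReq : ∀ y, R y = 1 + volterra 𝔸 (curryPath A y * R y) := by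
    intro y
    have h1 := Ring.mul_inverse_cancel _ (isUnit_one_sub_volterraMul (curryPath A y))
    have h2 := congrArg (fun L : C(Set.Icc (0 : ℝ) 1, 𝔸) →L[ℝ] C(Set.Icc (0 : ℝ) 1, 𝔸) => L 1) h1
    have h3 : R y - volterra 𝔸 (curryPath A y * R y) = 1 := h2
    rw [← h3, sub_add_cancel]
  -- On [0, 1] this is R y. The primitive is defined for all real t because the integrand is
  -- extended by constants, so the derivative is two-sided at 0 and 1 as well.
  refine ⟨fun t y => 1 + primitive (curryPath A y * R y) t, ?_, fun y hy => ⟨?_, fun t ht => ?_⟩⟩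
  · have hL : ContDiff ℝ ∞ (fun φ : C(Set.Icc (0 : ℝ) 1, 𝔸) => φ ⟨1, by simp⟩) :=
      ContinuousLinearMap.contDiff
        (ContinuousMap.evalCLM ℝ (⟨1, by simp⟩ : Set.Icc (0 : ℝ) 1) : C(Set.Icc (0 : ℝ) 1, 𝔸) →L[ℝ] 𝔸)
    have h1 : ContDiffOn ℝ ∞ (fun y => R y ⟨1, by simp⟩) U := hL.comp_contDiffOn hRs
    refine h1.congr fun y _ => ?_
    conv_rhs => rw [hReq y]
    rfl
  · simp [primitive]
  · have h1 := (hasDerivAt_primitive (curryPath A y * R y) t).const_add 1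
    refine h1.congr_deriv ?_
    rw [Set.IccExtend_of_mem _ _ ht, ContinuousMap.mul_apply,
      curryPath_apply hT' hA.continuousOn hy]
    congr 1
    conv_lhs => rw [hReq y]
    rfl

end Volterra

/-! ### Linear systems over the Grassmann algebra -/

section LinearSystem

variable {ι p q : Type} [Fintype ι] [DecidableEq ι] [Fintype p] [DecidableEq p] [Fintype q]

/-- A matrix over the Grassmann algebra as an operator on column vectors. -/
def matOp (ι q : Type) [Fintype ι] [Fintype q] :
    (ι → ι → Gr q) →ₗ[ℝ] ((ι → Gr q) →L[ℝ] (ι → Gr q)) where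
  toFun M := ContinuousLinearMap.pi fun i =>
    ∑ j, (grMulL q (M i j)).comp (ContinuousLinearMap.proj (R := ℝ) (φ := fun _ : ι => Gr q) j)
  map_add' M N := by
    ext v i
    simp [grMulL_apply, Finset.sum_add_distrib]
  map_smul' r M := by
    ext v i
    simp [grMulL_apply, Finset.smul_sum]

theorem matOp_apply (M : ι → ι → Gr q) (v : ι → Gr q) (i : ι) :
    matOp ι q M v i = ∑ j, M i j * v j := by
  simp [matOp, grMulL_apply]

/-- `g` solves `g' = m g` on `[0, 1]`. -/
def SolvesSystem (m : ι → ι → ℝ → Gr q) (g : ι → ℝ → Gr q) : Prop :=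
  ∀ i, ∀ t ∈ Set.Icc (0 : ℝ) 1, HasDerivAt (g i) (∑ j, m i j t * g j t) t

/-- The operator norm of the coefficients is bounded on the compact interval, which gives one
Lipschitz constant for the uniqueness theorem. -/
theorem SolvesSystem.eq {m : ι → ι → ℝ → Gr q}
    (hm : ∀ i j, ContinuousOn (m i j) (Set.Icc 0 1)) {g g' : ι → ℝ → Gr q}
    (hg : SolvesSystem m g) (hg' : SolvesSystem m g') (h0 : ∀ i, g i 0 = g' i 0) {t : ℝ}
    (ht : t ∈ Set.Icc (0 : ℝ) 1) (i : ι) : g i t = g' i t := by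
  set A : ℝ → (ι → Gr q) →L[ℝ] (ι → Gr q) := fun t => matOp ι q fun i j => m i j t with hA
  have hAc : ContinuousOn A (Set.Icc 0 1) :=
    (LinearMap.toContinuousLinearMap (matOp ι q)).continuous.comp_continuousOn
      (continuousOn_pi.2 fun i => continuousOn_pi.2 fun j => hm i j)
  obtain ⟨K, hK⟩ := isCompact_Icc.exists_bound_of_continuousOn hAc
  have hK' : ∀ t ∈ Set.Ico (0 : ℝ) 1, LipschitzOnWith K.toNNReal (fun v => A t v) Set.univ := by
    intro t ht
    refine LipschitzWith.lipschitzOnWith ((A t).lipschitz.weaken ?_)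
    rw [← NNReal.coe_le_coe, Real.coe_toNNReal']
    exact (hK t ⟨ht.1, ht.2.le⟩).trans (le_max_left _ _)
  have hd : ∀ {g : ι → ℝ → Gr q}, SolvesSystem m g → ∀ t ∈ Set.Icc (0 : ℝ) 1,
      HasDerivAt (fun t i => g i t) (A t fun i => g i t) t := by
    intro g hg t ht
    refine hasDerivAt_pi.2 fun i => (hg i t ht).congr_deriv ?_
    rw [hA, matOp_apply]
  have key := ODE_solution_unique_of_mem_Icc_right (v := fun t v => A t v) (s := fun _ => Set.univ)
    (f := fun t i => g i t) (g := fun t i => g' i t) hK'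
    (fun t ht => (hd hg t ht).continuousAt.continuousWithinAt)
    (fun t ht => (hd hg t ⟨ht.1, ht.2.le⟩).hasDerivWithinAt) (fun _ _ => trivial)
    (fun t ht => (hd hg' t ht).continuousAt.continuousWithinAt)
    (fun t ht => (hd hg' t ⟨ht.1, ht.2.le⟩).hasDerivWithinAt) (fun _ _ => trivial) (funext h0)
  exact congrFun (key ht) i

theorem SmoothFamily.continuousOn_time {T : Set ℝ} {U : Set (p → ℝ)} {F : ℝ → SFun p q}
    (hF : SmoothFamily T U F) (hT : Set.Icc (0 : ℝ) 1 ⊆ T) {y : p → ℝ} (hy : y ∈ U) :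
    ContinuousOn (fun t => F t y) (Set.Icc 0 1) := by
  have h1 : ContinuousOn (fun z : ℝ × (p → ℝ) => F z.1 z.2) (T ×ˢ U) := ContDiffOn.continuousOn hF
  exact h1.comp (f := fun t : ℝ => (t, y)) (by fun_prop) fun t ht => ⟨hT ht, hy⟩

/-- The fundamental solution at time `1` of a linear system over the Grassmann algebra. -/
theorem exists_transport {T : Set ℝ} {U : Set (p → ℝ)} (hT : IsOpen T)
    (hT' : Set.Icc (0 : ℝ) 1 ⊆ T) (hU : IsOpen U) {m : ι → ι → ℝ → SFun p q}
    (hm : ∀ i j, SmoothFamily T U (m i j)) :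
    ∃ R : ι → ι → SFun p q, (∀ i j, Smooth U (R i j)) ∧ ∀ y ∈ U,
      (∀ g : ι → ℝ → Gr q, SolvesSystem (fun i j t => m i j t y) g →
        ∀ i, g i 1 = ∑ j, R i j y * g j 0) ∧
      ∀ v : ι → Gr q, ∃ g : ι → ℝ → Gr q, SolvesSystem (fun i j t => m i j t y) g ∧
        ∀ i, g i 0 = v i := by
  have hA : ContDiffOn ℝ ∞ (fun z : ℝ × (p → ℝ) => matOp ι q fun i j => m i j z.1 z.2) (T ×ˢ U) := by
    have h1 : ContDiff ℝ ∞ (fun M => matOp ι q M) :=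
      (LinearMap.toContinuousLinearMap (matOp ι q)).contDiff
    exact h1.comp_contDiffOn (contDiffOn_pi.2 fun i => contDiffOn_pi.2 fun j => hm i j)
  obtain ⟨r, hr1, hr2⟩ := exists_fundamental_solution (𝔸 := (ι → Gr q) →L[ℝ] (ι → Gr q))
    hT hT' hU hA
  have hsol : ∀ y ∈ U, ∀ w : ι → Gr q,
      SolvesSystem (fun i j t => m i j t y) fun i t => r t y w i := by
    intro y hy w i t ht
    have h1 := ((hr2 y hy).2 t ht).clm_apply (hasDerivAt_const t w)
    have h2 := hasDerivAt_pi.1 h1 i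
    refine h2.congr_deriv ?_
    simp [matOp_apply]
  have hinit : ∀ y ∈ U, ∀ w : ι → Gr q, r 0 y w = w := by
    intro y hy w
    rw [(hr2 y hy).1]; rfl
  refine ⟨fun i j y => r 1 y (Pi.single j 1) i, fun i j => ?_, fun y hy => ⟨fun g hg i => ?_,
    fun v => ⟨fun i t => r t y v i, hsol y hy v, fun i => congrFun (hinit y hy v) i⟩⟩⟩
  · exact contDiffOn_pi.1 (hr1.clm_apply contDiffOn_const) i
  -- The coefficients act from the left and the constants g j 0 multiply from the right, so this
  -- combination of column solutions solves the same system with the same initial value.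
  · have hsum : SolvesSystem (fun i j t => m i j t y)
        fun i t => ∑ j, r t y (Pi.single j 1) i * g j 0 := by
      intro i t ht
      have h1 : ∀ j, HasDerivAt (fun t => r t y (Pi.single j 1) i * g j 0)
          ((∑ k, m i k t y * r t y (Pi.single j 1) k) * g j 0) t := fun j =>
        (hasDerivAt_grMul (hsol y hy (Pi.single j 1) i t ht)
          (hasDerivAt_const t (g j 0))).congr_deriv (by rw [mul_zero, add_zero])
      refine (HasDerivAt.fun_sum fun j _ => h1 j).congr_deriv ?_
      simp only [Finset.sum_mul, Finset.mul_sum, mul_assoc]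
      exact Finset.sum_comm
    refine hg.eq (fun i j => (hm i j).continuousOn_time hT' hy) hsum (fun i => ?_)
      (Set.right_mem_Icc.2 zero_le_one) i
    simp [hinit y hy, Pi.single_apply]

theorem SolvesSystem.reverse {m : ι → ι → ℝ → Gr q} {g : ι → ℝ → Gr q} (hg : SolvesSystem m g) :
    SolvesSystem (fun i j t => -m i j (1 - t)) fun i t => g i (1 - t) := by
  intro i t ht
  have h1 : HasDerivAt (fun t : ℝ => 1 - t) (-1) t := by
    simpa using (hasDerivAt_id t).const_sub 1
  have h2 := (hg i (1 - t) ⟨by linarith [ht.2], by linarith [ht.1]⟩).scomp t h1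
  refine h2.congr_deriv ?_
  rw [neg_one_smul, ← Finset.sum_neg_distrib]
  simp

/-- Transport matrices are invertible, with smooth inverse, and respect parity. -/
theorem exists_transport_inverse {T : Set ℝ} {U : Set (p → ℝ)} (hT : IsOpen T)
    (hT' : Set.Icc (0 : ℝ) 1 ⊆ T) (hU : IsOpen U) {m : ι → ι → ℝ → SFun p q}
    (hm : ∀ i j, SmoothFamily T U (m i j)) (e : ι → ZMod 2)
    (he : ∀ i j, ∀ t ∈ Set.Icc (0 : ℝ) 1, HasParity U (e i + e j) (m i j t)) :
    ∃ R S : ι → ι → SFun p q, (∀ i j, Smooth U (R i j)) ∧ (∀ i j, Smooth U (S i j)) ∧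
      (∀ i j, HasParity U (e i + e j) (R i j)) ∧
      (∀ y ∈ U, ∀ i k, ∑ j, R i j y * S j k y = if i = k then 1 else 0) ∧
      (∀ y ∈ U, ∀ i k, ∑ j, S i j y * R j k y = if i = k then 1 else 0) ∧
      ∀ y ∈ U, ∀ g : ι → ℝ → Gr q, SolvesSystem (fun i j t => m i j t y) g →
        (∀ i, g i 1 = ∑ j, R i j y * g j 0) ∧ ∀ i, g i 0 = ∑ j, S i j y * g j 1 := by
  obtain ⟨R, hR, hR'⟩ := exists_transport hT hT' hU hm
  -- The inverse transport is the transport of the time-reversed system, which gives it the same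
  -- smoothness without inverting a matrix.
  set T' : Set ℝ := (fun t => 1 - t) ⁻¹' T with hTdef
  have hTo : IsOpen T' := hT.preimage (by fun_prop)
  have hT'' : Set.Icc (0 : ℝ) 1 ⊆ T' := fun t ht =>
    hT' ⟨by linarith [ht.2], by linarith [ht.1]⟩
  have hm' : ∀ i j, SmoothFamily T' U fun t => -m i j (1 - t) := by
    intro i j
    have h1 : ContDiffOn ℝ ∞ (fun z : ℝ × (p → ℝ) => ((1 - z.1, z.2) : ℝ × (p → ℝ))) (T' ×ˢ U) := by
      fun_prop
    exact (ContDiffOn.comp (g := fun z : ℝ × (p → ℝ) => m i j z.1 z.2) (hm i j) h1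
      fun z hz => ⟨hz.1, hz.2⟩).neg
  obtain ⟨S, hS, hS'⟩ := exists_transport hTo hT'' hU hm'
  have hSg : ∀ y ∈ U, ∀ g : ι → ℝ → Gr q, SolvesSystem (fun i j t => m i j t y) g →
      ∀ i, g i 0 = ∑ j, S i j y * g j 1 := by
    intro y hy g hg i
    have := (hS' y hy).1 _ hg.reverse i
    simpa using this
  have hRS : ∀ y ∈ U, ∀ i k, ∑ j, R i j y * S j k y = if i = k then 1 else 0 := by
    intro y hy i k
    obtain ⟨g, hg, hg0⟩ := (hS' y hy).2 (Pi.single k 1)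
    have hrev : SolvesSystem (fun i j t => m i j t y) fun i t => g i (1 - t) := by
      have := hg.reverse
      simpa using this
    have h1 := (hR' y hy).1 _ hrev i
    have h2 : ∀ j, g j 1 = S j k y := by
      intro j
      rw [(hS' y hy).1 g hg j]
      simp [hg0, Pi.single_apply]
    have h3 : g i 0 = ∑ j, R i j y * g j 1 := by simpa using h1
    rw [hg0] at h3
    simp only [h2] at h3
    rw [← h3, Pi.single_apply]
  have hSR : ∀ y ∈ U, ∀ i k, ∑ j, S i j y * R j k y = if i = k then 1 else 0 := by
    intro y hy i k
    obtain ⟨g, hg, hg0⟩ := (hR' y hy).2 (Pi.single k 1)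
    have h1 := hSg y hy g hg i
    have h2 : ∀ j, g j 1 = R j k y := by
      intro j
      rw [(hR' y hy).1 g hg j]
      simp [hg0, Pi.single_apply]
    rw [hg0] at h1
    simp only [h2] at h1
    rw [← h1, Pi.single_apply]
  refine ⟨R, S, hR, hS, fun i k y hy => ?_, hRS, hSR,
    fun y hy g hg => ⟨(hR' y hy).1 g hg, hSg y hy g hg⟩⟩
  obtain ⟨g, hg, hg0⟩ := (hR' y hy).2 (Pi.single k 1)
  have h2 : ∀ j, g j 1 = R j k y := by
    intro j
    rw [(hR' y hy).1 g hg j]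
    simp [hg0, Pi.single_apply]
  -- Twisting the k-th column with these signs yields another solution, because the coefficients
  -- have parity e i + e j, and the initial column k is unchanged. Uniqueness then reads off the
  -- parity of R.
  have htw : SolvesSystem (fun i j t => m i j t y) fun i t => sg (e i + e k) • tw 1 (g i t) := by
    intro i t ht
    have h1 := (hasDerivAt_grLin (tw 1).toLinearMap (hg i t ht)).const_smul (sg (e i + e k))
    refine h1.congr_deriv ?_
    rw [AlgHom.toLinearMap_apply, map_sum, Finset.smul_sum]
    refine Finset.sum_congr rfl fun j _ => ?_
    rw [map_mul, mem_grPart_iff.1 (he i j t ht y hy), smul_mul_assoc, smul_smul, mul_smul_comm]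
    congr 1
    have key : ∀ a b c : ZMod 2, a + b + (c + b) = a + c := by decide
    rw [← sg_add, add_comm (e i + e k), ← key (e j) (e i) (e k)]
    congr 1
    ring
  have h3 := htw.eq (fun i j => (hm i j).continuousOn_time hT' hy) hg (fun j => by
    rw [hg0]
    by_cases hjk : j = k
    · subst hjk; simp [zmod_add_self, sg_zero]
    · simp [hjk]) (Set.right_mem_Icc.2 zero_le_one) i
  rw [h2] at h3
  rw [mem_grPart_iff]
  calc tw 1 (R i k y) = sg (e i + e k) • sg (e i + e k) • tw 1 (R i k y) := by
        rw [smul_smul, sg_mul_self, one_smul]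
    _ = sg (e i + e k) • R i k y := by rw [h3]

end LinearSystem

/-! ### Inverses in Grassmann algebras -/

section Inverse

variable {q : Type} [Fintype q]

/-- The coordinate norm need not be submultiplicative, so smoothness of inversion is taken from the
Banach algebra of operators, into which the Grassmann algebra embeds by left multiplication. -/
theorem contDiffAt_grInverse {x : Gr q} (hx : IsUnit x) :
    ContDiffAt ℝ ∞ (Ring.inverse : Gr q → Gr q) x := by
  have hmul : ∀ x y : Gr q, grMulL q x * grMulL q y = grMulL q (x * y) := by
    intro x y
    ext z
    simp [grMulL_apply, mul_assoc]
  have hone : grMulL q (1 : Gr q) = 1 := by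
    ext z
    simp [grMulL_apply]
  have hu : ∀ x : Gr q, IsUnit x → IsUnit (grMulL q x) ∧
      Ring.inverse x = Ring.inverse (grMulL q x) 1 := by
    intro x hx
    have h1 : grMulL q x * grMulL q (Ring.inverse x) = 1 := by
      rw [hmul, Ring.mul_inverse_cancel x hx, hone]
    have h2 : grMulL q (Ring.inverse x) * grMulL q x = 1 := by
      rw [hmul, Ring.inverse_mul_cancel x hx, hone]
    refine ⟨⟨⟨_, _, h1, h2⟩, rfl⟩, ?_⟩
    rw [show Ring.inverse (grMulL q x) = grMulL q (Ring.inverse x) from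
      Ring.inverse_unit ⟨_, _, h1, h2⟩, grMulL_apply, mul_one]
  have hcont : ContDiffAt ℝ ∞ (fun x => Ring.inverse (grMulL q x) (1 : Gr q)) x :=
    ((contDiffAt_clmInverse (hu x hx).1).comp x (grMulL q).contDiff.contDiffAt).clm_apply
      contDiffAt_const
  have hopen : ∀ᶠ y in nhds x, IsUnit y := by
    have hb : Continuous fun y : Gr q => body y := (grLin (body (q := q)).toLinearMap).continuous
    have hx' : body x ≠ 0 := (hx.map body).ne_zero
    filter_upwards [hb.continuousAt.eventually_ne hx'] with y hy
    exact isUnit_of_body_ne_zero hy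
  exact hcont.congr_of_eventuallyEq (hopen.mono fun y hy => (hu y hy).2)

theorem inverse_mem_grPart_zero {x : Gr q} (hx : x ∈ grPart q 0) :
    Ring.inverse x ∈ grPart q 0 := by
  by_cases hu : IsUnit x
  · rw [mem_grPart_iff, sg_zero, one_smul]
    rw [mem_grPart_iff, sg_zero, one_smul] at hx
    have h1 : tw 1 (Ring.inverse x) * x = 1 := by
      nth_rewrite 2 [← hx]
      rw [← map_mul, Ring.inverse_mul_cancel x hu, map_one]
    rw [← mul_one (tw 1 (Ring.inverse x)), ← Ring.mul_inverse_cancel x hu, ← mul_assoc, h1, one_mul]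
  · rw [Ring.inverse_non_unit x hu]
    exact zero_mem _

variable {E : Type*} [NormedAddCommGroup E] [NormedSpace ℝ E]

theorem contDiffOn_grInverse {s : Set E} {f : E → Gr q} (hf : ContDiffOn ℝ ∞ f s)
    (hu : ∀ x ∈ s, IsUnit (f x)) : ContDiffOn ℝ ∞ (fun x => Ring.inverse (f x)) s := fun x hx =>
  (contDiffAt_grInverse (hu x hx)).comp_contDiffWithinAt x (hf x hx)

theorem hasDerivAt_grInverse {f : ℝ → Gr q} {f' : Gr q} {t : ℝ} (hf : HasDerivAt f f' t)
    (hu : IsUnit (f t)) :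
    HasDerivAt (fun s => Ring.inverse (f s))
      (-(Ring.inverse (f t) * f' * Ring.inverse (f t))) t := by
  have h1 : DifferentiableAt ℝ (fun s => Ring.inverse (f s)) t :=
    ((contDiffAt_grInverse hu).differentiableAt (by simp)).comp t hf.differentiableAt
  refine h1.hasDerivAt.congr_deriv ?_
  have h2 := hasDerivAt_grMul h1.hasDerivAt hf
  have h3 : (fun s => Ring.inverse (f s) * f s) =ᶠ[nhds t] fun _ => 1 := by
    have hb : Continuous fun y : Gr q => body y := (grLin (body (q := q)).toLinearMap).continuous
    have hx' : body (f t) ≠ 0 := (hu.map body).ne_zero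
    filter_upwards [(hb.continuousAt.comp hf.continuousAt).eventually_ne hx'] with s hs
    exact Ring.inverse_mul_cancel _ (isUnit_of_body_ne_zero hs)
  have h4 := h2.unique ((hasDerivAt_const t (1 : Gr q)).congr_of_eventuallyEq h3)
  have h5 := congrArg (· * Ring.inverse (f t)) h4
  simp only [add_mul, zero_mul, mul_assoc, Ring.mul_inverse_cancel _ hu, mul_one] at h5
  rw [eq_neg_of_add_eq_zero_left h5, mul_assoc]

end Inverse

/-! ### Functoriality in the generators -/

section GrMap

variable {q q' : Type}

theorem tw_map (e : ZMod 2) (φ : (q → ℝ) →ₗ[ℝ] (q' → ℝ)) (x : Gr q) :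
    tw e (ExteriorAlgebra.map φ x) = ExteriorAlgebra.map φ (tw e x) := by
  rcases zmod_two_cases e with rfl | rfl
  · rfl
  have h : ((tw 1).comp (ExteriorAlgebra.map φ) : Gr q →ₐ[ℝ] Gr q') =
      (ExteriorAlgebra.map φ).comp (tw 1) := by
    apply ExteriorAlgebra.hom_ext
    ext v
    simp [tw_one_ι]
  exact congrArg (fun f : Gr q →ₐ[ℝ] Gr q' => f x) h

theorem map_mem_grPart (φ : (q → ℝ) →ₗ[ℝ] (q' → ℝ)) {e : ZMod 2} {x : Gr q}
    (hx : x ∈ grPart q e) : ExteriorAlgebra.map φ x ∈ grPart q' e := by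
  rw [mem_grPart_iff, tw_map, mem_grPart_iff.1 hx, map_smul]

theorem iL_map {φ : (q → ℝ) →ₗ[ℝ] (q' → ℝ)} {i : q} {j : q'} (h : ∀ v, φ v j = v i) (x : Gr q) :
    iL j (ExteriorAlgebra.map φ x) = ExteriorAlgebra.map φ (iL i x) := by
  induction x using CliffordAlgebra.left_induction with
  | algebraMap r =>
    change iL j (ExteriorAlgebra.map φ (algebraMap ℝ (Gr q) r)) =
      ExteriorAlgebra.map φ (iL i (algebraMap ℝ (Gr q) r))
    rw [AlgHom.commutes, iL_algebraMap, iL_algebraMap, map_zero]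
  | add x x' hx hx' => rw [map_add, map_add, hx, hx', map_add, map_add]
  | ι_mul x m hx =>
    change iL j (ExteriorAlgebra.map φ (ExteriorAlgebra.ι ℝ m * x)) =
      ExteriorAlgebra.map φ (iL i (ExteriorAlgebra.ι ℝ m * x))
    rw [map_mul, ExteriorAlgebra.map_apply_ι, iL_ι_mul, iL_ι_mul, hx, h, map_sub, map_smul, map_mul,
      ExteriorAlgebra.map_apply_ι]

theorem iL_map_eq_zero {φ : (q → ℝ) →ₗ[ℝ] (q' → ℝ)} {j : q'} (h : ∀ v, φ v j = 0) (x : Gr q) :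
    iL j (ExteriorAlgebra.map φ x) = 0 := by
  induction x using CliffordAlgebra.left_induction with
  | algebraMap r =>
    change iL j (ExteriorAlgebra.map φ (algebraMap ℝ (Gr q) r)) = 0
    rw [AlgHom.commutes, iL_algebraMap]
  | add x x' hx hx' => rw [map_add, map_add, hx, hx', add_zero]
  | ι_mul x m hx =>
    change iL j (ExteriorAlgebra.map φ (ExteriorAlgebra.ι ℝ m * x)) = 0
    rw [map_mul, ExteriorAlgebra.map_apply_ι, iL_ι_mul, hx, h, zero_smul, mul_zero, sub_zero]

end GrMap

/-! ### Lift and restriction -/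

section LiftRestrict

variable {a b : ℕ} {U : Set (CIdx a b → ℝ)} {W : Set (CIdx a b ⊕ CIdx a b → ℝ)}

theorem extendByZero_inl (v : CIdx a b → ℝ) (i : CIdx a b) :
    Function.ExtendByZero.linearMap ℝ (Sum.inl : CIdx a b → CIdx a b ⊕ CIdx a b) v (Sum.inl i) =
      v i := by
  simp only [Function.ExtendByZero.linearMap_apply]
  exact Function.Injective.extend_apply Sum.inl_injective v 0 i

theorem extendByZero_inr (v : CIdx a b → ℝ) (i : CIdx a b) :
    Function.ExtendByZero.linearMap ℝ (Sum.inl : CIdx a b → CIdx a b ⊕ CIdx a b) v (Sum.inr i) =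
      0 := by
  simp only [Function.ExtendByZero.linearMap_apply]
  exact Function.extend_apply' v (0 : CIdx a b ⊕ CIdx a b → ℝ) (Sum.inr i)
    (fun ⟨_, h⟩ => Sum.inl_ne_inr h)

theorem restrict_apply (f : SFun₁ a b) (x : CIdx a b → ℝ) :
    restrict f x = ExteriorAlgebra.map (LinearMap.funLeft ℝ ℝ Sum.inl) (f (zeroSection x)) := rfl

theorem restrict_mul (f g : SFun₁ a b) : restrict (f * g) = restrict f * restrict g := by
  funext x; simp [restrict_apply]

theorem restrict_add (f g : SFun₁ a b) : restrict (f + g) = restrict f + restrict g := by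
  funext x; simp [restrict_apply]

theorem restrict_smul (r : ℝ) (f : SFun₁ a b) : restrict (r • f) = r • restrict f := by
  funext x; simp [restrict_apply]

theorem restrict_sum {ι : Type*} (s : Finset ι) (f : ι → SFun₁ a b) :
    restrict (∑ i ∈ s, f i) = ∑ i ∈ s, restrict (f i) := by
  funext x; simp [restrict_apply]

theorem restrict_tw (e : ZMod 2) (f : SFun₁ a b) : restrict (twF e f) = twF e (restrict f) := by
  funext x; simp [restrict_apply, tw_map]

theorem restrict_congr (hUW : ∀ x ∈ U, zeroSection x ∈ W) {f g : SFun₁ a b} (h : Set.EqOn f g W) :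
    Set.EqOn (restrict f) (restrict g) U := fun x hx => by
  rw [restrict_apply, restrict_apply, h (hUW x hx)]

theorem restrict_parity (hUW : ∀ x ∈ U, zeroSection x ∈ W) {f : SFun₁ a b} {e : ZMod 2}
    (hf : HasParity W e f) : HasParity U e (restrict f) := fun x hx =>
  map_mem_grPart _ (hf _ (hUW x hx))

/-- The zero section as a continuous linear map. -/
def zeroSectionL (a b : ℕ) : (CIdx a b → ℝ) →L[ℝ] (CIdx a b ⊕ CIdx a b → ℝ) :=
  ContinuousLinearMap.pi (Sum.elim (fun i => ContinuousLinearMap.proj i) fun _ => 0)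

theorem zeroSectionL_apply (x : CIdx a b → ℝ) : zeroSectionL a b x = zeroSection x := by
  funext i
  cases i <;> rfl

theorem zeroSection_single (i : CIdx a b) :
    zeroSection (Pi.single i (1 : ℝ)) = Pi.single (Sum.inl i) 1 := by
  funext j
  cases j with
  | inl j => simp [zeroSection, Pi.single_apply]
  | inr j => simp [zeroSection]

theorem SmoothFamily.restrict {T : Set ℝ} (hUW : ∀ x ∈ U, zeroSection x ∈ W) {F : ℝ → SFun₁ a b}
    (hF : SmoothFamily T W F) : SmoothFamily T U fun t => restrict (F t) := by
  have h1 : ContDiff ℝ ∞ fun z : ℝ × (CIdx a b → ℝ) => (z.1, zeroSectionL a b z.2) := by fun_prop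
  have h2 : ContDiffOn ℝ ∞ (fun z : ℝ × (CIdx a b → ℝ) => F z.1 (zeroSectionL a b z.2)) (T ×ˢ U) :=
    ContDiffOn.comp (g := fun z : ℝ × (CIdx a b ⊕ CIdx a b → ℝ) => F z.1 z.2) hF h1.contDiffOn
      fun z hz => ⟨hz.1, by
        have h2 := hUW _ hz.2
        rw [← zeroSectionL_apply] at h2
        exact h2⟩
  have h3 := contDiffOn_grLin (ExteriorAlgebra.map (LinearMap.funLeft ℝ ℝ
    (Sum.inl : CIdx a b → CIdx a b ⊕ CIdx a b))).toLinearMap h2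
  refine ContDiffOn.congr h3 fun z _ => ?_
  rw [zeroSectionL_apply]; rfl

theorem Smooth.restrict (hUW : ∀ x ∈ U, zeroSection x ∈ W) {f : SFun₁ a b} (hf : Smooth W f) :
    Smooth U (restrict f) :=
  (SmoothFamily.restrict (T := Set.univ) hUW (SmoothFamily.const hf)).smooth (Set.mem_univ (0 : ℝ))

theorem restrict_dL_gam (A : Coord₀ a b) {f : SFun₁ a b} {x : CIdx a b → ℝ}
    (hf : DifferentiableAt ℝ f (zeroSection x)) :
    restrict (dL (gam A) f) x = dL A (restrict f) x := by
  cases A with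
  | inl i =>
    have h1 : HasFDerivAt (fun x => f (zeroSectionL a b x))
        ((fderiv ℝ f (zeroSection x)).comp (zeroSectionL a b)) x := by
      have h2 := (zeroSectionL a b).hasFDerivAt (x := x)
      have h3 : HasFDerivAt f (fderiv ℝ f (zeroSection x)) (zeroSectionL a b x) := by
        rw [zeroSectionL_apply]; exact hf.hasFDerivAt
      exact h3.comp x h2
    have h4 := fderiv_grLin (ExteriorAlgebra.map (LinearMap.funLeft ℝ ℝ
      (Sum.inl : CIdx a b → CIdx a b ⊕ CIdx a b))).toLinearMap h1.differentiableAt (Pi.single i 1)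
    have h5 : BV.restrict f = fun x => (ExteriorAlgebra.map (LinearMap.funLeft ℝ ℝ
        (Sum.inl : CIdx a b → CIdx a b ⊕ CIdx a b))).toLinearMap (f (zeroSectionL a b x)) := by
      funext x; rw [zeroSectionL_apply]; rfl
    rw [dL_inl, h5, h4, h1.fderiv, ContinuousLinearMap.comp_apply, zeroSectionL_apply,
      zeroSection_single]
    rfl
  | inr j =>
    rw [dL_inr, restrict_apply, restrict_apply, iL_map (i := Sum.inl j) (fun v => rfl)]
    rfl

theorem restrict_lift (f : SFun₀ a b) : restrict (lift f) = f := by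
  funext x
  have h : ((LinearMap.funLeft ℝ ℝ (Sum.inl : CIdx a b → CIdx a b ⊕ CIdx a b)).comp
      (Function.ExtendByZero.linearMap ℝ Sum.inl)) = LinearMap.id := by
    apply LinearMap.ext
    intro v
    funext i
    exact extendByZero_inl v i
  change ExteriorAlgebra.map _ (ExteriorAlgebra.map _ (f x)) = f x
  rw [← AlgHom.comp_apply, ExteriorAlgebra.map_comp_map, h, ExteriorAlgebra.map_id]
  rfl

theorem lift_parity (hWU : ∀ y ∈ W, (fun i => y (Sum.inl i)) ∈ U) {f : SFun₀ a b} {e : ZMod 2}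
    (hf : HasParity U e f) : HasParity W e (lift f) := fun y hy =>
  map_mem_grPart _ (hf _ (hWU y hy))

theorem Smooth.lift (hWU : ∀ y ∈ W, (fun i => y (Sum.inl i)) ∈ U) {f : SFun₀ a b}
    (hf : Smooth U f) : Smooth W (lift f) := by
  have h1 : ContDiff ℝ ∞ fun (y : CIdx a b ⊕ CIdx a b → ℝ) (i : CIdx a b) => y (Sum.inl i) := by
    fun_prop
  exact contDiffOn_grLin (ExteriorAlgebra.map (Function.ExtendByZero.linearMap ℝ
    (Sum.inl : CIdx a b → CIdx a b ⊕ CIdx a b))).toLinearMap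
    (ContDiffOn.comp (g := f) hf h1.contDiffOn hWU)

theorem dL_lift_eq_zero {A : Coord₁ a b} (hA : (∃ i, A = Sum.inl (Sum.inr i)) ∨
    ∃ i, A = Sum.inr (Sum.inr i)) (hU : IsOpen U) {f : SFun₀ a b} (hf : Smooth U f)
    {y : CIdx a b ⊕ CIdx a b → ℝ} (hy : (fun i => y (Sum.inl i)) ∈ U) : dL A (lift f) y = 0 := by
  rcases hA with ⟨i, rfl⟩ | ⟨j, rfl⟩
  · set P : (CIdx a b ⊕ CIdx a b → ℝ) →L[ℝ] (CIdx a b → ℝ) :=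
      ContinuousLinearMap.pi fun i => ContinuousLinearMap.proj (Sum.inl i) with hP
    have h1 : HasFDerivAt (fun y => f (P y)) ((fderiv ℝ f (P y)).comp P) y :=
      (hf.differentiableAt hU hy).hasFDerivAt.comp y P.hasFDerivAt
    have h4 := fderiv_grLin (ExteriorAlgebra.map (Function.ExtendByZero.linearMap ℝ
      (Sum.inl : CIdx a b → CIdx a b ⊕ CIdx a b))).toLinearMap h1.differentiableAt
      (Pi.single (Sum.inr i) 1)
    have h6 : P (Pi.single (Sum.inr i) 1) = 0 := by
      funext k
      simp [hP]
    rw [dL_inl]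
    refine h4.trans ?_
    rw [h1.fderiv, ContinuousLinearMap.comp_apply, h6, map_zero, map_zero]
  · rw [dL_inr]
    exact iL_map_eq_zero (fun v => extendByZero_inr v j) _

theorem lam_mem (α : CIdx a b) : (∃ i, (lam α : Coord₁ a b) = Sum.inl (Sum.inr i)) ∨
    ∃ i, (lam α : Coord₁ a b) = Sum.inr (Sum.inr i) := by
  cases α with
  | inl i => exact Or.inl ⟨_, rfl⟩
  | inr i => exact Or.inr ⟨_, rfl⟩

theorem par_gam (A : Coord₀ a b) : par (gam A) = par A := by cases A <;> rfl

theorem par_lam (α : CIdx a b) : par (lam α : Coord₁ a b) = eps α := by cases α <;> rfl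

theorem par_lamStar (α : CIdx a b) : par (lamStar α : Coord₁ a b) = eps α + 1 := by
  cases α <;> rfl

end LiftRestrict

/-! ### The Planck number -/

section Planck

variable {p q : Type} [Fintype p] [DecidableEq p] [Fintype q] [DecidableEq q]

theorem smooth_coordFun (U : Set (p → ℝ)) (A : p ⊕ q) : Smooth U (coordFun A : SFun p q) := by
  cases A with
  | inl i =>
    exact contDiffOn_algebraMap (E := p → ℝ) (f := fun x => x i)
      (ContDiff.contDiffOn (by fun_prop))
  | inr j => exact contDiffOn_const

theorem dL_coordFun (A C : p ⊕ q) (x : p → ℝ) :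
    dL A (coordFun C : SFun p q) x = if A = C then 1 else 0 := by
  cases C with
  | inl i =>
    cases A with
    | inl k =>
      set L : ℝ →L[ℝ] Gr q := LinearMap.toContinuousLinearMap (Algebra.linearMap ℝ (Gr q)) with hL
      set P : (p → ℝ) →L[ℝ] ℝ := ContinuousLinearMap.proj i with hP
      rw [dL_inl]
      change fderiv ℝ (fun x : p → ℝ => (L.comp P) x) x _ = _
      rw [ContinuousLinearMap.fderiv]
      by_cases hik : k = i
      · subst hik; simp [hL, hP]
      · simp [hik, hL, hP, Ne.symm hik]
    | inr k => rw [dL_inr]; exact (iL_algebraMap k (x i)).trans (by simp)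
  | inr j =>
    cases A with
    | inl k =>
      rw [dL_inl]
      change fderiv ℝ (fun _ : p → ℝ => (ExteriorAlgebra.ι ℝ (Pi.single j 1) : Gr q)) x _ = _
      simp
    | inr k =>
      rw [dL_inr]
      refine (iL_ι k _).trans ?_
      by_cases hik : k = j
      · subst hik; simp
      · simp [hik]

theorem coordFun_mem (A : p ⊕ q) (x : p → ℝ) : (coordFun A : SFun p q) x ∈ grPart q (par A) := by
  cases A with
  | inl i => exact algebraMap_mem_grPart _
  | inr j =>
    rw [par_inr, mem_grPart_iff, sg_one, neg_one_smul]
    exact tw_one_ι _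

/-- The commutator of ∂_A with z^C ∂_C. Passing ∂_A over z^C and over ∂_C gives the same sign twice,
so none remains. -/
theorem dL_coordFun_mul_dL {W : Set (p → ℝ)} (hW : IsOpen W) {g : SFun p q} (hg : Smooth W g)
    (A C : p ⊕ q) {y : p → ℝ} (hy : y ∈ W) :
    dL A (coordFun C * dL C g) y =
      (if A = C then dL A g y else 0) + coordFun C y * dL C (dL A g) y := by
  rw [dL_mul A ((smooth_coordFun W C).differentiableAt hW hy)
    ((hg.dL hW C).differentiableAt hW hy), dL_coordFun, tw_of_mem (coordFun_mem C y),
    dL_dL_comm hW hg A C hy, smul_mul_smul_comm, sg_mul_self, one_smul]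
  congr 1
  split_ifs with h
  · rw [h, one_mul]
  · rw [zero_mul]

end Planck

/-! ### Planck number selection rules on the zero section -/

section PlanckRestrict

variable {a b : ℕ} {U : Set (CIdx a b → ℝ)} {W : Set (CIdx a b ⊕ CIdx a b → ℝ)}

theorem lam_injective : Function.Injective (lam : CIdx a b → Coord₁ a b) := by
  rintro (i | i) (j | j) h <;> simp_all [lam]

theorem lamStar_injective : Function.Injective (lamStar : CIdx a b → Coord₁ a b) := by
  rintro (i | i) (j | j) h <;> simp_all [lamStar]

theorem lam_ne_lamStar (α β : CIdx a b) : (lam α : Coord₁ a b) ≠ lamStar β := by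
  rcases α with i | i <;> rcases β with j | j <;> simp [lam, lamStar]

theorem planckOp_apply (g : SFun₁ a b) (y : CIdx a b ⊕ CIdx a b → ℝ) :
    planckOp g y = ∑ α, (coordFun (lam α) y * dL (lam α) g y -
      coordFun (lamStar α) y * dL (lamStar α) g y) := by
  simp [planckOp]

theorem restrict_planckOp (g : SFun₁ a b) (x : CIdx a b → ℝ) : restrict (planckOp g) x = 0 := by
  have h1 : ∀ α, restrict (coordFun (lam α) : SFun₁ a b) x = 0 := by
    intro α
    rw [restrict_apply]
    rcases α with i | j
    · simp [lam, coordFun, zeroSection]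
    · simp only [lam, coordFun, Sum.elim_inr, ExteriorAlgebra.map_apply_ι]
      convert map_zero (ExteriorAlgebra.ι ℝ : (CIdx a b → ℝ) →ₗ[ℝ] Gr (CIdx a b))
      funext k
      simp [LinearMap.funLeft_apply]
  have h2 : ∀ α, restrict (coordFun (lamStar α) : SFun₁ a b) x = 0 := by
    intro α
    rw [restrict_apply]
    rcases α with j | i
    · simp only [lamStar, coordFun, Sum.elim_inl, ExteriorAlgebra.map_apply_ι]
      convert map_zero (ExteriorAlgebra.ι ℝ : (CIdx a b → ℝ) →ₗ[ℝ] Gr (CIdx a b))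
      funext k
      simp [LinearMap.funLeft_apply]
    · simp [lamStar, coordFun, zeroSection]
  rw [restrict_apply, planckOp_apply, map_sum]
  refine Finset.sum_eq_zero fun α _ => ?_
  rw [map_sub, map_mul, map_mul]
  simp only [restrict_apply] at h1 h2
  rw [h1, h2, zero_mul, zero_mul, sub_zero]

/-- `g` is an eigenfunction on `W` of the Planck number operator. -/
def PlanckEigen (W : Set (CIdx a b ⊕ CIdx a b → ℝ)) (k : ℝ) (g : SFun₁ a b) : Prop :=
  ∀ y ∈ W, planckOp g y = k • g y

/-- Each term of the Planck operator has a factor λ or λ*, so its value on the zero section is 0;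
for k ≠ 0 the eigenvalue equation forces the function itself to vanish there. -/
theorem PlanckEigen.restrict_eq_zero {k : ℝ} {g : SFun₁ a b} (h : PlanckEigen W k g) (hk : k ≠ 0)
    (hUW : ∀ x ∈ U, zeroSection x ∈ W) : Set.EqOn (restrict g) 0 U := by
  intro x hx
  have h1 : Set.EqOn (planckOp g) (k • g) W := h
  have h2 := restrict_congr hUW h1 hx
  rw [restrict_planckOp, restrict_smul] at h2
  exact (smul_eq_zero.1 h2.symm).resolve_left hk

/-- The extra sum is the commutator of ∂_A with the Planck operator; it makes ∂_λ lower and ∂_λ*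
raise the eigenvalue by one. -/
theorem dL_planckOp (hW : IsOpen W) {g : SFun₁ a b} (hg : Smooth W g) (A : Coord₁ a b)
    {y : CIdx a b ⊕ CIdx a b → ℝ} (hy : y ∈ W) :
    dL A (planckOp g) y = planckOp (dL A g) y +
      ∑ α, ((if A = lam α then dL A g y else 0) - if A = lamStar α then dL A g y else 0) := by
  have hs : ∀ C, Smooth W (coordFun C * dL C g) := fun C =>
    (smooth_coordFun W C).mul (hg.dL hW C)
  rw [planckOp, dL_sum _ _ fun α _ => ((hs (lam α)).sub (hs (lamStar α))).differentiableAt hW hy,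
    planckOp_apply, ← Finset.sum_add_distrib]
  refine Finset.sum_congr rfl fun α _ => ?_
  rw [dL_sub _ ((hs _).differentiableAt hW hy) ((hs _).differentiableAt hW hy),
    dL_coordFun_mul_dL hW hg _ _ hy, dL_coordFun_mul_dL hW hg _ _ hy]
  abel

theorem PlanckEigen.dL_lam {k : ℝ} {g : SFun₁ a b} (h : PlanckEigen W k g) (hW : IsOpen W)
    (hg : Smooth W g) (β : CIdx a b) : PlanckEigen W (k - 1) (dL (lam β) g) := by
  intro y hy
  have h1 : Set.EqOn (planckOp g) (k • g) W := h
  have h2 := dL_congr_on hW (lam β) h1 hy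
  rw [dL_smul _ _ (hg.differentiableAt hW hy), dL_planckOp hW hg _ hy] at h2
  simp only [lam_injective.eq_iff, lam_ne_lamStar, if_false, sub_zero, Finset.sum_ite_eq,
    Finset.mem_univ, if_true] at h2
  rw [sub_smul, one_smul, ← h2, add_sub_cancel_right]

theorem PlanckEigen.dL_lamStar {k : ℝ} {g : SFun₁ a b} (h : PlanckEigen W k g) (hW : IsOpen W)
    (hg : Smooth W g) (β : CIdx a b) : PlanckEigen W (k + 1) (dL (lamStar β) g) := by
  intro y hy
  have h1 : Set.EqOn (planckOp g) (k • g) W := h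
  have h2 := dL_congr_on hW (lamStar β) h1 hy
  rw [dL_smul _ _ (hg.differentiableAt hW hy), dL_planckOp hW hg _ hy] at h2
  simp only [lamStar_injective.eq_iff, (lam_ne_lamStar _ _).symm, if_false, zero_sub,
    Finset.sum_neg_distrib, Finset.sum_ite_eq, Finset.mem_univ, if_true] at h2
  rw [add_smul, one_smul, ← h2, neg_add_cancel_right]

end PlanckRestrict

/-! ### The evolution of the action -/

section Series

variable {a b : ℕ} {W : Set (CIdx a b ⊕ CIdx a b → ℝ)}

/-- Pointwise evaluation of a series. -/
def evS (y : CIdx a b ⊕ CIdx a b → ℝ) :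
    Series a b →+* PowerSeries (Gr (CIdx a b ⊕ CIdx a b)) :=
  PowerSeries.map (Pi.evalRingHom _ y)

theorem coeff_evS (y : CIdx a b ⊕ CIdx a b → ℝ) (F : Series a b) (n : ℕ) :
    PowerSeries.coeff n (evS y F) = PowerSeries.coeff n F y := by
  rw [evS, PowerSeries.coeff_map]; rfl

/-- All coefficients are smooth on `W`. -/
def SmoothS (W : Set (CIdx a b ⊕ CIdx a b → ℝ)) (F : Series a b) : Prop :=
  ∀ n, Smooth W (PowerSeries.coeff n F)

/-- All coefficients have parity `e` on `W`. -/
def ParityS (W : Set (CIdx a b ⊕ CIdx a b → ℝ)) (e : ZMod 2) (F : Series a b) : Prop :=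
  ∀ n, HasParity W e (PowerSeries.coeff n F)

theorem coeff_mapCoeff (D : SFun₁ a b → SFun₁ a b) (F : Series a b) (n : ℕ) :
    PowerSeries.coeff n (mapCoeff D F) = D (PowerSeries.coeff n F) := by
  rw [mapCoeff, PowerSeries.coeff_mk]

theorem SmoothS.mul {F G : Series a b} (hF : SmoothS W F) (hG : SmoothS W G) :
    SmoothS W (F * G) := fun n => by
  rw [PowerSeries.coeff_mul]
  exact Smooth.sum _ fun i _ => (hF _).mul (hG _)

theorem ParityS.mul {F G : Series a b} {d e : ZMod 2} (hF : ParityS W d F) (hG : ParityS W e G) :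
    ParityS W (d + e) (F * G) := fun n => by
  rw [PowerSeries.coeff_mul]
  exact HasParity.sum _ fun i _ => (hF _).mul (hG _)

theorem ParityS.congr_right {F : Series a b} {d e : ZMod 2} (hF : ParityS W d F) (h : d = e) :
    ParityS W e F := h ▸ hF

theorem SmoothS.C {c : SFun₁ a b} (hc : Smooth W c) : SmoothS W (PowerSeries.C c) := fun n => by
  rw [PowerSeries.coeff_C]
  split_ifs
  · exact hc
  · exact Smooth.zero _

theorem ParityS.C {c : SFun₁ a b} {e : ZMod 2} (hc : HasParity W e c) :
    ParityS W e (PowerSeries.C c) := fun n => by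
  rw [PowerSeries.coeff_C]
  split_ifs
  · exact hc
  · exact fun _ _ => zero_mem _

theorem SmoothS.dL (hW : IsOpen W) {F : Series a b} (hF : SmoothS W F) (A : Coord₁ a b) :
    SmoothS W (mapCoeff (dL A) F) := fun n => by
  rw [coeff_mapCoeff]
  exact (hF n).dL hW A

theorem ParityS.dL (hW : IsOpen W) {F : Series a b} {e : ZMod 2} (hF : SmoothS W F)
    (hF' : ParityS W e F) (A : Coord₁ a b) : ParityS W (e + par A) (mapCoeff (dL A) F) := fun n => by
  rw [coeff_mapCoeff]
  exact (hF' n).dL hW (hF n) A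

theorem SmoothS.X_mul {F : Series a b} (hF : SmoothS W F) : SmoothS W (PowerSeries.X * F) :=
  fun n => by
  cases n with
  | zero => rw [PowerSeries.coeff_zero_X_mul]; exact Smooth.zero _
  | succ n => rw [PowerSeries.coeff_succ_X_mul]; exact hF n

theorem evS_mul_comm {F G : Series a b} {d e : ZMod 2} (hF : ParityS W d F) (hG : ParityS W e G)
    {y : CIdx a b ⊕ CIdx a b → ℝ} (hy : y ∈ W) :
    evS y (F * G) = sg (d * e) • evS y (G * F) := by
  ext n
  rw [PowerSeries.coeff_smul, coeff_evS, coeff_evS, PowerSeries.coeff_mul, PowerSeries.coeff_mul,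
    Finset.sum_apply, Finset.sum_apply, ← Finset.Nat.sum_antidiagonal_swap, Finset.smul_sum]
  refine Finset.sum_congr rfl fun i _ => ?_
  exact mul_comm_of_mem (hF _ y hy) (hG _ y hy)

theorem evS_dL_mul (hW : IsOpen W) {F G : Series a b} (hF : SmoothS W F) (hG : SmoothS W G)
    {d : ZMod 2} (hF' : ParityS W d F) (A : Coord₁ a b) {y : CIdx a b ⊕ CIdx a b → ℝ}
    (hy : y ∈ W) :
    evS y (mapCoeff (dL A) (F * G)) = evS y (mapCoeff (dL A) F * G) +
      sg (par A * d) • evS y (F * mapCoeff (dL A) G) := by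
  ext n
  rw [map_add, PowerSeries.coeff_smul, coeff_evS, coeff_evS, coeff_evS, coeff_mapCoeff,
    PowerSeries.coeff_mul, PowerSeries.coeff_mul, PowerSeries.coeff_mul,
    dL_sum _ _ fun i _ => ((hF _).mul (hG _)).differentiableAt hW hy, Finset.sum_apply,
    Finset.sum_apply, Finset.smul_sum, ← Finset.sum_add_distrib]
  refine Finset.sum_congr rfl fun i _ => ?_
  rw [dL_mul A ((hF _).differentiableAt hW hy) ((hG _).differentiableAt hW hy),
    tw_of_mem (hF' _ y hy), smul_mul_assoc, coeff_mapCoeff, coeff_mapCoeff]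
  rfl

theorem mapCoeff_X_mul (A : Coord₁ a b) (F : Series a b) :
    mapCoeff (dL A) (PowerSeries.X * F) = PowerSeries.X * mapCoeff (dL A) F := by
  ext1 n
  rw [coeff_mapCoeff]
  cases n with
  | zero =>
    rw [PowerSeries.coeff_zero_X_mul, PowerSeries.coeff_zero_X_mul]
    funext y; exact dL_zero A y
  | succ n => rw [PowerSeries.coeff_succ_X_mul, PowerSeries.coeff_succ_X_mul, coeff_mapCoeff]

theorem evS_dL_sub (hW : IsOpen W) {F G : Series a b} (hF : SmoothS W F) (hG : SmoothS W G)
    (A : Coord₁ a b) {y : CIdx a b ⊕ CIdx a b → ℝ} (hy : y ∈ W) :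
    evS y (mapCoeff (dL A) (F - G)) = evS y (mapCoeff (dL A) F) - evS y (mapCoeff (dL A) G) := by
  ext n
  rw [map_sub, coeff_evS, coeff_evS, coeff_evS, coeff_mapCoeff, coeff_mapCoeff, coeff_mapCoeff,
    map_sub, dL_sub _ ((hF _).differentiableAt hW hy) ((hG _).differentiableAt hW hy)]

theorem mapCoeff_dL_one (A : Coord₁ a b) : mapCoeff (dL A) (1 : Series a b) = 0 := by
  ext1 n
  rw [coeff_mapCoeff, map_zero, PowerSeries.coeff_one]
  funext y
  split_ifs
  · cases A with
    | inl i =>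
      rw [dL_inl]
      change fderiv ℝ (fun _ => (1 : Gr (CIdx a b ⊕ CIdx a b))) y _ = _
      simp
    | inr j =>
      rw [dL_inr]
      have := iL_algebraMap j 1
      rwa [map_one] at this
  · exact dL_zero A y

/-- The two first order terms in `[∂_A c ∂_B, ψ]` acting on a Boltzmann factor. -/
def pairing (A B : Coord₁ a b) (c f ψ : SFun₁ a b) : SFun₁ a b :=
  c * dL B f * dL A ψ + dL A f * (c * dL B ψ)

/-- Noncommutative core of [∂_A c ∂_B, ψ] behind a Boltzmann factor. Terms without a derivative of ψ
drop out because π and w u are odd and anticommute with ψ; left over are the second-order term at η²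
and two first-order terms at η. -/
theorem boltzmann_pair_algebra {S : Type*} [Ring S] {η α π u v w κ ψ : S}
    (h1 : π * ψ + ψ * π = 0) (h2 : w * u * ψ + ψ * (w * u) = 0) (hη : ∀ z, z * η = η * z) :
    η * (η * α - (π * ψ + u * v)) - w * (η * κ - u * ψ) + ψ * (η * -π - w * -u) =
      η * (η * α) - η * (u * v + w * κ) := by
  have h3 : η * (η * α - (π * ψ + u * v)) - w * (η * κ - u * ψ) + ψ * (η * -π - w * -u) =
      η * (η * α) - η * (u * v + w * κ) - η * (π * ψ + ψ * π) + (w * u * ψ + ψ * (w * u)) +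
        (η * w - w * η) * κ + (η * ψ - ψ * η) * π := by noncomm_ring
  rw [h3, h1, h2, hη, hη, sub_self, sub_self]
  simp

/-- Parity is known only on W, so the graded commutations are performed after evaluation at a point.
There u = c ∂_B X has parity `par A` + 1, so that ∂_A passes it without a sign. -/
theorem evS_pair (hW : IsOpen W) {X Ψ : Series a b} (hX : SmoothS W X) (hX' : ParityS W 0 X)
    (hΨ : SmoothS W Ψ) (hΨ' : ParityS W 1 Ψ) (A B : Coord₁ a b) {c : SFun₁ a b}
    (hc : Smooth W c) (hc' : HasParity W (par A + par B + 1) c) {y : CIdx a b ⊕ CIdx a b → ℝ}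
    (hy : y ∈ W) :
    evS y (boltzmannD X A (PowerSeries.C c * boltzmannD X B Ψ) +
        Ψ * boltzmannD X A (PowerSeries.C c * boltzmannD X B 1)) =
      PowerSeries.X * (PowerSeries.X *
        evS y (mapCoeff (dL A) (PowerSeries.C c * mapCoeff (dL B) Ψ))) -
      PowerSeries.X * evS y (PowerSeries.C c * mapCoeff (dL B) X * mapCoeff (dL A) Ψ +
        mapCoeff (dL A) X * (PowerSeries.C c * mapCoeff (dL B) Ψ)) := by
  set C : Series a b := PowerSeries.C c with hC
  have hCs : SmoothS W C := SmoothS.C hc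
  have hCp : ParityS W (par A + par B + 1) C := ParityS.C hc'
  have hXBs := hX.dL hW B
  have hXBp := hX'.dL hW hX B
  have hXAp := hX'.dL hW hX A
  have hus : SmoothS W (C * mapCoeff (dL B) X) := hCs.mul hXBs
  have hup : ParityS W (par A + 1) (C * mapCoeff (dL B) X) := by
    refine (hCp.mul hXBp).congr_right ?_
    generalize (par A : ZMod 2) = r
    generalize (par B : ZMod 2) = s
    revert r s; decide
  have hpp : ParityS W 1 (mapCoeff (dL A) (C * mapCoeff (dL B) X)) := by
    refine (hup.dL hW hus A).congr_right ?_
    generalize (par A : ZMod 2) = r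
    revert r; decide
  have hwu : ParityS W 1 (mapCoeff (dL A) X * (C * mapCoeff (dL B) X)) := by
    refine (hXAp.mul hup).congr_right ?_
    generalize (par A : ZMod 2) = r
    revert r; decide
  have hanti : ∀ {P : Series a b}, ParityS W 1 P → evS y P * evS y Ψ + evS y Ψ * evS y P = 0 := by
    intro P hP
    rw [← map_mul, ← map_mul, evS_mul_comm hP hΨ' hy, mul_one, sg_one, neg_one_smul, neg_add_cancel]
  have hsgn : sg (par A * (par A + 1)) = 1 := by
    generalize (par A : ZMod 2) = r
    rcases zmod_two_cases r with rfl | rfl <;> simp [sg_zero, one_add_one_zmod]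
  have hXc : ∀ F : PowerSeries (Gr (CIdx a b ⊕ CIdx a b)),
      F * PowerSeries.X = PowerSeries.X * F := fun F => PowerSeries.X_mul.symm
  have hXs : ∀ F : Series a b, F * PowerSeries.X = PowerSeries.X * F := fun F => PowerSeries.X_mul.symm
  have hevX : evS y (PowerSeries.X : Series a b) = PowerSeries.X := PowerSeries.map_X _
  have e1 : C * boltzmannD X B Ψ =
      PowerSeries.X * (C * mapCoeff (dL B) Ψ) - C * mapCoeff (dL B) X * Ψ := by
    rw [boltzmannD, mul_sub, ← mul_assoc, ← mul_assoc, ← mul_assoc, hXs]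
  have e2 : C * boltzmannD X B 1 = -(C * mapCoeff (dL B) X) := by
    rw [boltzmannD, mapCoeff_dL_one, mul_zero, mul_one, zero_sub, mul_neg]
  have h0 : SmoothS W (0 : Series a b) := fun n => by rw [map_zero]; exact Smooth.zero _
  have e3 : evS y (mapCoeff (dL A) (-(C * mapCoeff (dL B) X))) =
      -evS y (mapCoeff (dL A) (C * mapCoeff (dL B) X)) := by
    have h1 := evS_dL_sub hW h0 hus A hy
    have h2 : mapCoeff (dL A) (0 : Series a b) = 0 := by
      ext1 n
      rw [coeff_mapCoeff, map_zero]
      funext y; exact dL_zero A y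
    rwa [zero_sub, h2, map_zero, zero_sub] at h1
  have e4 := evS_dL_mul hW hus hΨ hup A hy
  rw [hsgn, one_smul] at e4
  have a1 := hanti hpp
  have a2 := hanti hwu
  rw [e1, e2, boltzmannD, boltzmannD]
  simp only [map_add, map_sub, map_mul, map_neg, hevX] at a1 a2 e3 e4 ⊢
  have e5 := evS_dL_sub hW ((hCs.mul (hΨ.dL hW B)).X_mul) (hus.mul hΨ) A hy
  rw [mapCoeff_X_mul, map_mul, hevX, e4] at e5
  rw [e5, e3]
  exact boltzmann_pair_algebra a1 a2 hXc

theorem coeff_zero_mul_series (F G : Series a b) : PowerSeries.coeff 0 (F * G) =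
    PowerSeries.coeff 0 F * PowerSeries.coeff 0 G := by
  rw [PowerSeries.coeff_mul]; simp

theorem coeff_one_mul_series (F G : Series a b) : PowerSeries.coeff 1 (F * G) =
    PowerSeries.coeff 0 F * PowerSeries.coeff 1 G +
      PowerSeries.coeff 1 F * PowerSeries.coeff 0 G := by
  rw [PowerSeries.coeff_mul]; simp [Finset.Nat.antidiagonal_succ]

theorem coeff_zero_pair (A B : Coord₁ a b) (c : SFun₁ a b) (X Ψ : Series a b) :
    PowerSeries.coeff 0 (PowerSeries.C c * mapCoeff (dL B) X * mapCoeff (dL A) Ψ +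
        mapCoeff (dL A) X * (PowerSeries.C c * mapCoeff (dL B) Ψ)) =
      pairing A B c (PowerSeries.coeff 0 X) (PowerSeries.coeff 0 Ψ) := by
  simp only [map_add, coeff_zero_mul_series, PowerSeries.coeff_zero_C, coeff_mapCoeff, pairing]

theorem coeff_one_pair (A B : Coord₁ a b) (c : SFun₁ a b) (X Ψ : Series a b) :
    PowerSeries.coeff 1 (PowerSeries.C c * mapCoeff (dL B) X * mapCoeff (dL A) Ψ +
        mapCoeff (dL A) X * (PowerSeries.C c * mapCoeff (dL B) Ψ)) =
      pairing A B c (PowerSeries.coeff 0 X) (PowerSeries.coeff 1 Ψ) +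
      pairing A B c (PowerSeries.coeff 1 X) (PowerSeries.coeff 0 Ψ) := by
  simp only [map_add, coeff_one_mul_series, PowerSeries.coeff_C_mul, coeff_mapCoeff, pairing]
  abel

theorem coeff_one_shift (P Q : PowerSeries (Gr (CIdx a b ⊕ CIdx a b))) :
    PowerSeries.coeff 1 (PowerSeries.X * (PowerSeries.X * P) - PowerSeries.X * Q) =
      -PowerSeries.coeff 0 Q := by
  rw [map_sub, PowerSeries.coeff_succ_X_mul, PowerSeries.coeff_succ_X_mul,
    PowerSeries.coeff_zero_X_mul, zero_sub]

theorem coeff_two_shift (P Q : PowerSeries (Gr (CIdx a b ⊕ CIdx a b))) :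
    PowerSeries.coeff 2 (PowerSeries.X * (PowerSeries.X * P) - PowerSeries.X * Q) =
      PowerSeries.coeff 0 P - PowerSeries.coeff 1 Q := by
  rw [map_sub, PowerSeries.coeff_succ_X_mul, PowerSeries.coeff_succ_X_mul,
    PowerSeries.coeff_succ_X_mul]

end Series

/-! ### Evolution of the action at the first two orders in η -/

section Evolution

variable {a b : ℕ} {U : Set (CIdx a b → ℝ)} {W : Set (CIdx a b ⊕ CIdx a b → ℝ)}
  {E : Coord₀ a b → Coord₀ a b → SFun₀ a b} {ρ : SFun₀ a b}

/-- The commutator `[Δ₍₁₎, ·]` of a generator with an action, to first order in derivatives. -/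
def pairing₁ (ρ : SFun₀ a b) (E : Coord₀ a b → Coord₀ a b → SFun₀ a b) (f ψ : SFun₁ a b) :
    SFun₁ a b :=
  (∑ A, ∑ B, (sg (par A) / 2) • (lift (fun x => Ring.inverse (ρ x)) *
    pairing (gam A) (gam B) (lift (ρ * E A B)) f ψ)) +
  ∑ α, sg (eps α) • pairing (lam α) (lamStar α) 1 f ψ

/-- The first-level odd Laplacian on superfunctions. -/
def laplacian₁ (ρ : SFun₀ a b) (E : Coord₀ a b → Coord₀ a b → SFun₀ a b) (ψ : SFun₁ a b) :
    SFun₁ a b :=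
  (∑ A, ∑ B, (sg (par A) / 2) • (lift (fun x => Ring.inverse (ρ x)) *
    dL (gam A) (lift (ρ * E A B) * dL (gam B) ψ))) +
  ∑ α, sg (eps α) • dL (lam α) (dL (lamStar α) ψ)

variable (hU : IsOpen U) (hW : IsOpen W) (hUW : ∀ x ∈ U, zeroSection x ∈ W)
  (hWU : ∀ y ∈ W, (fun i => y (Sum.inl i)) ∈ U) (hE : IsAntisymplectic U E) (hρ : IsDensity U ρ)

include hρ in
theorem smooth_inverse_density : Smooth U fun x => Ring.inverse (ρ x) :=
  contDiffOn_grInverse hρ.smooth fun x hx => isUnit_of_body_ne_zero (hρ.body_ne_zero x hx)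

include hρ in
theorem inverse_density_parity : HasParity U 0 fun x => Ring.inverse (ρ x) := fun x hx =>
  inverse_mem_grPart_zero (hρ.parity x hx)

include hρ hE in
theorem smooth_density_mul (A B : Coord₀ a b) : Smooth U (ρ * E A B) :=
  hρ.smooth.mul (hE.smooth A B)

include hρ hE in
theorem density_mul_parity (A B : Coord₀ a b) : HasParity U (par A + par B + 1) (ρ * E A B) :=
  (hρ.parity.mul (hE.parity A B)).congr_right (zero_add _)

include hW hWU hE hρ in
-- The prefactor 1/ρ is even and passes through Ψ, so each pair of derivatives in Δ₍₁₎ reduces to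
-- `evS_pair`; the multiplier part is the case c = 1, whose parity condition is ε_α + (ε_α + 1) + 1
-- = 0.
theorem evS_commutator {X Ψ : Series a b} (hX : SmoothS W X) (hX' : ParityS W 0 X)
    (hΨ : SmoothS W Ψ) (hΨ' : ParityS W 1 Ψ) {y : CIdx a b ⊕ CIdx a b → ℝ} (hy : y ∈ W) :
    evS y (boltzmannLaplacian ρ E X Ψ + Ψ * boltzmannLaplacian ρ E X 1) =
      (∑ A, ∑ B, (sg (par A) / 2) •
        (PowerSeries.C (lift (fun x => Ring.inverse (ρ x)) y) *
          (PowerSeries.X * (PowerSeries.X * evS y (mapCoeff (dL (gam A))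
            (PowerSeries.C (lift (ρ * E A B)) * mapCoeff (dL (gam B)) Ψ))) -
          PowerSeries.X * evS y
            (PowerSeries.C (lift (ρ * E A B)) * mapCoeff (dL (gam B)) X * mapCoeff (dL (gam A)) Ψ +
              mapCoeff (dL (gam A)) X *
                (PowerSeries.C (lift (ρ * E A B)) * mapCoeff (dL (gam B)) Ψ))))) +
      ∑ α, sg (eps α) • (PowerSeries.X * (PowerSeries.X * evS y (mapCoeff (dL (lam α))
            (PowerSeries.C 1 * mapCoeff (dL (lamStar α)) Ψ))) -
          PowerSeries.X * evS y
            (PowerSeries.C 1 * mapCoeff (dL (lamStar α)) X * mapCoeff (dL (lam α)) Ψ +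
              mapCoeff (dL (lam α)) X * (PowerSeries.C 1 * mapCoeff (dL (lamStar α)) Ψ))) := by
  have hsmul : ∀ (r : ℝ) (F : Series a b), evS y (r • F) = r • evS y F := by
    intro r F
    ext n
    rw [PowerSeries.coeff_smul, coeff_evS, coeff_evS, PowerSeries.coeff_smul]
    rfl
  have hCr : ∀ F : Series a b, evS y (Ψ * (PowerSeries.C (lift fun x => Ring.inverse (ρ x)) * F)) =
      evS y (PowerSeries.C (lift fun x => Ring.inverse (ρ x)) * (Ψ * F)) := by
    intro F
    rw [← mul_assoc, ← mul_assoc, map_mul, map_mul _ _ F,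
      evS_mul_comm hΨ' (ParityS.C (lift_parity hWU (inverse_density_parity hρ))) hy, mul_zero,
      sg_zero, one_smul]
  have hCe : ∀ f : SFun₁ a b, evS y (PowerSeries.C f) = PowerSeries.C (f y) := fun f =>
    PowerSeries.map_C _ _
  have hpair := fun (A B : Coord₁ a b) (c : SFun₁ a b) (hc : Smooth W c)
    (hc' : HasParity W (par A + par B + 1) c) => evS_pair hW hX hX' hΨ hΨ' A B hc hc' hy
  rw [boltzmannLaplacian, boltzmannLaplacian, oddLaplacian₁, oddLaplacian₁, mul_add,
    add_add_add_comm, Finset.mul_sum, Finset.mul_sum, ← Finset.sum_add_distrib,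
    ← Finset.sum_add_distrib, map_add, map_sum, map_sum]
  congr 1
  · refine Finset.sum_congr rfl fun A _ => ?_
    rw [Finset.mul_sum, ← Finset.sum_add_distrib, map_sum]
    refine Finset.sum_congr rfl fun B _ => ?_
    rw [mul_smul_comm, ← smul_add, hsmul, map_add, hCr, ← map_add, ← mul_add, map_mul, hCe,
      hpair (gam A) (gam B) _ ((smooth_density_mul hE hρ A B).lift hWU) ?_]
    rw [par_gam, par_gam]
    exact lift_parity hWU (density_mul_parity hE hρ A B)
  · refine Finset.sum_congr rfl fun α _ => ?_
    have h1 := hpair (lam α) (lamStar α) 1 (Smooth.one _) (by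
      rw [par_lam, par_lamStar, add_assoc, add_assoc, one_add_one_zmod, add_zero, zmod_add_self]
      exact fun _ _ => one_mem_grPart)
    rw [mul_smul_comm, ← smul_add, hsmul]
    rw [← h1, map_one, one_mul, one_mul]

variable {T : Set ℝ} {Ψ X : ℝ → Series a b}

include hW hWU hE hρ in
theorem IsExactDeformation.deriv_zero (hX : IsExactDeformation T W ρ E Ψ X) {t : ℝ} (ht : t ∈ T)
    {y : CIdx a b ⊕ CIdx a b → ℝ} (hy : y ∈ W) :
    dtF (fun t => PowerSeries.coeff 0 (X t)) t y =
      -pairing₁ ρ E (PowerSeries.coeff 0 (X t)) (PowerSeries.coeff 0 (Ψ t)) y := by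
  -- The left-hand side of the equation is -η dX/dt, so its coefficient 1 contains the derivative of
  -- coefficient 0 of X. The function Δ₍₁₎Ψ carries η² and is absent here.
  have h1 := hX.evolution t ht 1 y hy
  rw [map_neg, map_neg, Pi.neg_apply, Pi.neg_apply, neg_inj, PowerSeries.coeff_succ_X_mul,
    ← coeff_evS, ← coeff_evS, evS_commutator hW hWU hE hρ (fun n => (hX.smooth n).smooth ht)
      (hX.even t ht) (fun n => (hX.smooth_gen n).smooth ht) (hX.odd_gen t ht) hy, coeff_evS] at h1
  rw [dt, PowerSeries.coeff_mk] at h1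
  refine h1.trans ?_
  rw [map_add, map_sum, map_sum, pairing₁, Pi.add_apply, Finset.sum_apply, Finset.sum_apply,
    neg_add, ← Finset.sum_neg_distrib, ← Finset.sum_neg_distrib]
  congr 1
  · refine Finset.sum_congr rfl fun A _ => ?_
    rw [map_sum, Finset.sum_apply, ← Finset.sum_neg_distrib]
    refine Finset.sum_congr rfl fun B _ => ?_
    rw [PowerSeries.coeff_smul, PowerSeries.coeff_C_mul, coeff_one_shift, coeff_evS,
      coeff_zero_pair, mul_neg, smul_neg]
    rfl
  · refine Finset.sum_congr rfl fun α _ => ?_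
    rw [PowerSeries.coeff_smul, coeff_one_shift, coeff_evS, coeff_zero_pair, smul_neg]
    rfl

include hW hWU hE hρ in
theorem IsExactDeformation.deriv_one (hX : IsExactDeformation T W ρ E Ψ X) {t : ℝ} (ht : t ∈ T)
    {y : CIdx a b ⊕ CIdx a b → ℝ} (hy : y ∈ W) :
    dtF (fun t => PowerSeries.coeff 1 (X t)) t y =
      laplacian₁ ρ E (PowerSeries.coeff 0 (Ψ t)) y -
      (pairing₁ ρ E (PowerSeries.coeff 0 (X t)) (PowerSeries.coeff 1 (Ψ t)) y +
      pairing₁ ρ E (PowerSeries.coeff 1 (X t)) (PowerSeries.coeff 0 (Ψ t)) y) := by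
  -- Coefficient 2 carries the derivative of coefficient 1 of X, and the second-order term enters
  -- with the η⁰-part of Ψ.
  have h1 := hX.evolution t ht 2 y hy
  rw [map_neg, map_neg, Pi.neg_apply, Pi.neg_apply, neg_inj, PowerSeries.coeff_succ_X_mul,
    ← coeff_evS, ← coeff_evS, evS_commutator hW hWU hE hρ (fun n => (hX.smooth n).smooth ht)
      (hX.even t ht) (fun n => (hX.smooth_gen n).smooth ht) (hX.odd_gen t ht) hy, coeff_evS] at h1
  rw [dt, PowerSeries.coeff_mk] at h1
  refine h1.trans ?_
  have hz : ∀ (A B : Coord₁ a b) (c : SFun₁ a b), PowerSeries.coeff 0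
      (mapCoeff (dL A) (PowerSeries.C c * mapCoeff (dL B) (Ψ t))) =
        dL A (c * dL B (PowerSeries.coeff 0 (Ψ t))) := by
    intro A B c
    rw [coeff_mapCoeff, PowerSeries.coeff_C_mul, coeff_mapCoeff]
  rw [map_add, map_sum, map_sum, pairing₁, pairing₁, laplacian₁, Pi.add_apply, Pi.add_apply,
    Pi.add_apply, add_add_add_comm, add_sub_add_comm, Finset.sum_apply, Finset.sum_apply,
    Finset.sum_apply, Finset.sum_apply, Finset.sum_apply, Finset.sum_apply,
    ← Finset.sum_add_distrib, ← Finset.sum_add_distrib, ← Finset.sum_sub_distrib,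
    ← Finset.sum_sub_distrib]
  congr 1
  · refine Finset.sum_congr rfl fun A _ => ?_
    rw [map_sum, Finset.sum_apply, Finset.sum_apply, Finset.sum_apply,
      ← Finset.sum_add_distrib, ← Finset.sum_sub_distrib]
    refine Finset.sum_congr rfl fun B _ => ?_
    rw [PowerSeries.coeff_smul, PowerSeries.coeff_C_mul, coeff_two_shift, coeff_evS, coeff_evS,
      coeff_one_pair, hz, mul_sub, smul_sub, Pi.add_apply, mul_add, smul_add]
    rfl
  · refine Finset.sum_congr rfl fun α _ => ?_
    rw [PowerSeries.coeff_smul, coeff_two_shift, coeff_evS, coeff_evS, coeff_one_pair, hz, smul_sub,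
      one_mul, Pi.add_apply, smul_add]
    rfl

end Evolution

/-! ### Restriction of the evolution equation -/

section SymmetricPairing

variable {p q : Type} [Fintype p] [DecidableEq p] [Fintype q] {U : Set (p → ℝ)}
  {E : p ⊕ q → p ⊕ q → SFun p q} {ρ : SFun p q}

/-- The two first-order terms of the commutator agree after summation, by skewness of E, and
contribute -½ (ψ, f) each; ρ cancels. The twist by e accommodates f of either parity, in particular
a λ^α-derivative of the action. -/
theorem sum_pairing_eq_bracket (hU : IsOpen U) (hE : IsAntisymplectic U E) (hρ : IsDensity U ρ)
    {ψ f : SFun p q} {e : ZMod 2} (hψ : Smooth U ψ) (hψ' : HasParity U 1 ψ) (hf : Smooth U f)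
    (hf' : HasParity U e f) {x : p → ℝ} (hx : x ∈ U) :
    ∑ A, ∑ B, (sg (par A) / 2) • (Ring.inverse (ρ x) *
      ((ρ * E A B) x * dL B f x * tw e (dL A ψ x) +
        dL A f x * tw e ((ρ * E A B) x * dL B ψ x))) = -bracket E ψ f x := by
  have hρu : IsUnit (ρ x) := isUnit_of_body_ne_zero (hρ.body_ne_zero x hx)
  have hρe := hρ.parity x hx
  have hψA := fun A => hψ'.dL hU hψ A x hx
  have hfA := fun A => hf'.dL hU hf A x hx
  have h1 : ∀ A B, (sg (par A) / 2) • (Ring.inverse (ρ x) *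
      ((ρ * E A B) x * dL B f x * tw e (dL A ψ x) +
        dL A f x * tw e ((ρ * E A B) x * dL B ψ x))) =
      -(1 / 2 : ℝ) • (dR A ψ x * E A B x * dL B f x) +
        (sg (par A) / 2) • (dL A f x * tw e (E A B x * dL B ψ x)) := by
    intro A B
    rw [mul_add, smul_add]
    congr 1
    · have hx1 : E A B x * dL B f x ∈ grPart q (par A + 1 + e) := by
        have key : ∀ r s e : ZMod 2, r + s + 1 + (e + s) = r + 1 + e := by decide
        rw [← key (par A) (par B) e]
        exact mul_mem_grPart (hE.parity A B x hx) (hfA B)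
      rw [Pi.mul_apply, mul_assoc, mul_assoc, ← mul_assoc (Ring.inverse (ρ x)),
        Ring.inverse_mul_cancel _ hρu, one_mul, ← mul_assoc, tw_of_mem (hψA A), mul_smul_comm,
        mul_comm_of_mem hx1 (hψA A), dR_eq, tw_of_mem (hψA A), smul_mul_assoc, smul_mul_assoc,
        mul_assoc, smul_smul, smul_smul, smul_smul]
      congr 1
      generalize (par A : ZMod 2) = r
      rcases zmod_two_cases r with rfl | rfl <;> rcases zmod_two_cases e with rfl | rfl <;>
        simp [sg_zero, sg_one, one_add_one_zmod] <;> norm_num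
    · rw [Pi.mul_apply, mul_assoc, map_mul _ (ρ x), tw_of_mem hρe, mul_zero, sg_zero, one_smul,
        ← mul_assoc (dL A f x), ← mul_comm_of_even hρe, mul_assoc, ← mul_assoc,
        Ring.inverse_mul_cancel _ hρu, one_mul]
  have h2 : ∀ A, ∑ B, (sg (par A) / 2) • (dL A f x * tw e (E A B x * dL B ψ x)) =
      -(1 / 2 : ℝ) • (hamCoef E ψ A x * dL A f x) := by
    intro A
    have ha : hamCoef E ψ A x ∈ grPart q (par A) := by
      have := hamCoef_parity hU hE hψ hψ' A x hx
      rwa [one_add_one_zmod, zero_add] at this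
    rw [← Finset.smul_sum, ← Finset.mul_sum, ← map_sum, sum_mul_dL_odd hU hE hψ hψ' A hx, map_neg,
      tw_of_mem ha, mul_neg, mul_smul_comm, mul_comm_of_mem (hfA A) ha, smul_neg, smul_smul,
      smul_smul, ← neg_smul]
    congr 1
    generalize (par A : ZMod 2) = r
    rcases zmod_two_cases r with rfl | rfl <;> rcases zmod_two_cases e with rfl | rfl <;>
      simp [sg_zero, sg_one, one_add_one_zmod] <;> norm_num
  simp only [h1, Finset.sum_add_distrib, h2]
  rw [← Finset.smul_sum, ← bracket_eq_hamCoef]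
  simp only [← Finset.smul_sum]
  rw [← bracket_apply, ← add_smul]
  norm_num

end SymmetricPairing

/-! ### Evolution of the constraints and of the quantum correction -/

section RestrictedEvolution

variable {a b : ℕ} {U : Set (CIdx a b → ℝ)} {W : Set (CIdx a b ⊕ CIdx a b → ℝ)}
  {E : Coord₀ a b → Coord₀ a b → SFun₀ a b} {ρ : SFun₀ a b}
  (hU : IsOpen U) (hW : IsOpen W) (hUW : ∀ x ∈ U, zeroSection x ∈ W)
  (hWU : ∀ y ∈ W, (fun i => y (Sum.inl i)) ∈ U) (hE : IsAntisymplectic U E) (hρ : IsDensity U ρ)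

theorem Smooth.pairing (hW : IsOpen W) (A B : Coord₁ a b) {c f ψ : SFun₁ a b} (hc : Smooth W c)
    (hf : Smooth W f) (hψ : Smooth W ψ) : Smooth W (pairing A B c f ψ) :=
  ((hc.mul (hf.dL hW B)).mul (hψ.dL hW A)).add ((hf.dL hW A).mul (hc.mul (hψ.dL hW B)))

include hW hWU hE hρ in
theorem smooth_pairing₁ {f ψ : SFun₁ a b} (hf : Smooth W f) (hψ : Smooth W ψ) :
    Smooth W (pairing₁ ρ E f ψ) := by
  refine Smooth.add (Smooth.sum _ fun A _ => Smooth.sum _ fun B _ => Smooth.smul ?_ _)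
    (Smooth.sum _ fun α _ => (Smooth.pairing hW _ _ (Smooth.one _) hf hψ).smul _)
  exact ((smooth_inverse_density hρ).lift hWU).mul
    (Smooth.pairing hW _ _ ((smooth_density_mul hE hρ A B).lift hWU) hf hψ)

include hW hUW in
theorem restrict_pairing_gam (A B : Coord₀ a b) (c : SFun₀ a b) {f ψ : SFun₁ a b}
    (hf : Smooth W f) (hψ : Smooth W ψ) {x : CIdx a b → ℝ} (hx : x ∈ U) :
    restrict (pairing (gam A) (gam B) (lift c) f ψ) x =
      c x * dL B (restrict f) x * dL A (restrict ψ) x +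
        dL A (restrict f) x * (c x * dL B (restrict ψ) x) := by
  have hfx := hf.differentiableAt hW (hUW x hx)
  have hψx := hψ.differentiableAt hW (hUW x hx)
  simp only [pairing, restrict_add, restrict_mul, restrict_lift, Pi.add_apply, Pi.mul_apply,
    restrict_dL_gam _ hfx, restrict_dL_gam _ hψx]

include hU hW hUW hE hρ in
theorem restrict_pairing₁ {f ψ : SFun₁ a b} (hf : Smooth W f) (hf' : HasParity W 0 f)
    (hψ : Smooth W ψ) (hψ' : HasParity W 1 ψ)
    (hlam : ∀ α, Set.EqOn (restrict (dL (lam α) ψ)) 0 U) {x : CIdx a b → ℝ} (hx : x ∈ U) :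
    restrict (pairing₁ ρ E f ψ) x = -bracket E (restrict ψ) (restrict f) x +
      ∑ α, sg (eps α) • (restrict (dL (lam α) f) x * restrict (dL (lamStar α) ψ) x) := by
  rw [← sum_pairing_eq_bracket hU hE hρ (hψ.restrict hUW) (restrict_parity hUW hψ')
    (hf.restrict hUW) (restrict_parity hUW hf') hx]
  simp only [pairing₁, restrict_add, restrict_sum, restrict_smul, restrict_mul, restrict_lift,
    Pi.add_apply, Finset.sum_apply, Pi.smul_apply, Pi.mul_apply,
    restrict_pairing_gam hW hUW _ _ _ hf hψ hx, tw_zero]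
  congr 1
  refine Finset.sum_congr rfl fun α _ => ?_
  rw [pairing, one_mul, one_mul, restrict_add, restrict_mul, restrict_mul, Pi.add_apply,
    Pi.mul_apply, Pi.mul_apply, hlam α hx, Pi.zero_apply, mul_zero, zero_add]

theorem restrict_dR (A : Coord₁ a b) (f : SFun₁ a b) :
    restrict (dR A f) = twF (par A) (restrict (dL A f)) := by
  rw [← restrict_tw]
  congr 1
  funext y
  exact dR_eq A f y

include hW hUW in
theorem restrict_dR_mul (A : Coord₁ a b) {f g : SFun₁ a b} (hf : Smooth W f) (hg : Smooth W g)
    {x : CIdx a b → ℝ} (hx : x ∈ U) :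
    restrict (dR A (f * g)) x = restrict f x * restrict (dR A g) x +
      restrict (dR A f) x * tw (par A) (restrict g x) := by
  rw [restrict_apply, dR_mul A (hf.differentiableAt hW (hUW x hx))
    (hg.differentiableAt hW (hUW x hx)), map_add, map_mul, map_mul, ← tw_map]
  rfl

include hW hUW in
theorem restrict_dR_add (A : Coord₁ a b) {f g : SFun₁ a b} (hf : Smooth W f) (hg : Smooth W g)
    {x : CIdx a b → ℝ} (hx : x ∈ U) :
    restrict (dR A (f + g)) x = restrict (dR A f) x + restrict (dR A g) x := by
  rw [restrict_apply, dR_add A (hf.differentiableAt hW (hUW x hx))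
    (hg.differentiableAt hW (hUW x hx)), map_add]
  rfl

include hW hUW in
theorem restrict_dR_smul (A : Coord₁ a b) (r : ℝ) {f : SFun₁ a b} (hf : Smooth W f)
    {x : CIdx a b → ℝ} (hx : x ∈ U) :
    restrict (dR A (r • f)) x = r • restrict (dR A f) x := by
  rw [restrict_apply, dR_smul A r (hf.differentiableAt hW (hUW x hx)), map_smul]
  rfl

include hW hUW in
theorem restrict_dR_sum {ι : Type*} (s : Finset ι) (A : Coord₁ a b) {f : ι → SFun₁ a b}
    (hf : ∀ i, Smooth W (f i)) {x : CIdx a b → ℝ} (hx : x ∈ U) :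
    restrict (dR A (∑ i ∈ s, f i)) x = ∑ i ∈ s, restrict (dR A (f i)) x := by
  rw [restrict_apply, dR_sum s A fun i _ => (hf i).differentiableAt hW (hUW x hx), map_sum]
  rfl

include hU hUW hWU in
theorem restrict_dR_lam_lift (α : CIdx a b) {f : SFun₀ a b} (hf : Smooth U f)
    {x : CIdx a b → ℝ} (hx : x ∈ U) : restrict (dR (lam α) (lift f)) x = 0 := by
  rw [restrict_apply, dR_eq, dL_lift_eq_zero (lam_mem α) hU hf (hWU _ (hUW x hx)), map_zero,
    map_zero]

include hW hUW in
theorem restrict_dR_dL_gam (α : CIdx a b) (A : Coord₀ a b) {f : SFun₁ a b} (hf : Smooth W f)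
    {x : CIdx a b → ℝ} (hx : x ∈ U) :
    restrict (dR (lam α) (dL (gam A) f)) x = dL A (restrict (dR (lam α) f)) x := by
  rw [← restrict_dL_gam A ((hf.dR hW _).differentiableAt hW (hUW x hx)), restrict_apply,
    restrict_apply, dR_dL_comm hW hf _ _ (hUW x hx)]

include hU hW hUW hWU hE hρ in
-- The three vanishing hypotheses say that ψ has no terms linear in λ, linear in λ*, or quadratic in
-- λ. What the λ^α-derivative leaves on the zero section is the bracket with the restriction of ψ
-- and the λλ*-coefficient of ψ multiplying ∂_λ f.
theorem restrict_dR_pairing₁ {f ψ : SFun₁ a b} (hf : Smooth W f) (hf' : HasParity W 0 f)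
    (hψ : Smooth W ψ) (hψ' : HasParity W 1 ψ)
    (hlam : ∀ α, Set.EqOn (restrict (dL (lam α) ψ)) 0 U)
    (hstar : ∀ α, Set.EqOn (restrict (dL (lamStar α) ψ)) 0 U)
    (hlam2 : ∀ α β, Set.EqOn (restrict (dL (lam α) (dL (lam β) ψ))) 0 U) (α : CIdx a b)
    {x : CIdx a b → ℝ} (hx : x ∈ U) :
    restrict (dR (lam α) (pairing₁ ρ E f ψ)) x =
      -bracket E (restrict ψ) (restrict (dR (lam α) f)) x +
      ∑ β, sg (eps β) •
        (restrict (dL (lam β) f) x * restrict (dR (lam α) (dL (lamStar β) ψ)) x) := by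
  have hdR : ∀ α, Set.EqOn (restrict (dR (lam α) ψ)) 0 U := by
    intro α y hy
    rw [restrict_dR, twF_apply, hlam α hy, Pi.zero_apply, map_zero]
  have hdRA : ∀ A, restrict (dR (lam α) (dL (gam A) ψ)) x = 0 := by
    intro A
    rw [restrict_dR_dL_gam hW hUW α A hψ hx, dL_congr_on hU A (hdR α) hx]
    exact dL_zero A x
  have hfp : HasParity U (eps α) (restrict (dR (lam α) f)) := by
    have := restrict_parity hUW (hf'.dR hW hf (lam α))
    rwa [par_lam, zero_add] at this
  have hcs := fun A B => (smooth_density_mul hE hρ A B).lift hWU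
  have hrs := (smooth_inverse_density hρ).lift hWU
  have hfx := hf.differentiableAt hW (hUW x hx)
  have hψx := hψ.differentiableAt hW (hUW x hx)
  have hg : ∀ A B, restrict (dR (lam α) (lift (fun x => Ring.inverse (ρ x)) *
      pairing (gam A) (gam B) (lift (ρ * E A B)) f ψ)) x =
      Ring.inverse (ρ x) *
      ((ρ * E A B) x * dL B (restrict (dR (lam α) f)) x * tw (eps α) (dL A (restrict ψ) x) +
        dL A (restrict (dR (lam α) f)) x * tw (eps α) ((ρ * E A B) x * dL B (restrict ψ) x)) := by
    intro A B
    have s1 := (hcs A B).mul (hf.dL hW (gam B))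
    have s2 := (hcs A B).mul (hψ.dL hW (gam B))
    rw [restrict_dR_mul hW hUW _ hrs (Smooth.pairing hW _ _ (hcs A B) hf hψ) hx,
      restrict_dR_lam_lift hU hUW hWU α (smooth_inverse_density hρ) hx, zero_mul, add_zero,
      restrict_lift, pairing, restrict_dR_add hW hUW _ (s1.mul (hψ.dL hW _))
      ((hf.dL hW _).mul s2) hx, restrict_dR_mul hW hUW _ s1 (hψ.dL hW _) hx,
      restrict_dR_mul hW hUW _ (hf.dL hW _) s2 hx,
      restrict_dR_mul hW hUW _ (hcs A B) (hf.dL hW _) hx,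
      restrict_dR_mul hW hUW _ (hcs A B) (hψ.dL hW _) hx,
      restrict_dR_lam_lift hU hUW hWU α (smooth_density_mul hE hρ A B) hx, hdRA, hdRA]
    simp only [zero_mul, mul_zero, add_zero, zero_add]
    rw [restrict_dR_dL_gam hW hUW α A hf hx, restrict_dR_dL_gam hW hUW α B hf hx, restrict_mul,
      Pi.mul_apply, restrict_lift, restrict_dL_gam _ hψx, restrict_dL_gam _ hψx, par_lam]
  have hl : ∀ β, restrict (dR (lam α) (pairing (lam β) (lamStar β) 1 f ψ)) x =
      restrict (dL (lam β) f) x * restrict (dR (lam α) (dL (lamStar β) ψ)) x := by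
    intro β
    have s1 := hf.dL hW (lamStar β)
    have s2 := hψ.dL hW (lamStar β)
    have h0 : restrict (dR (lam α) (dL (lam β) ψ)) x = 0 := by
      rw [restrict_dR, twF_apply, hlam2 α β hx, Pi.zero_apply, map_zero]
    rw [pairing, one_mul, one_mul, restrict_dR_add hW hUW _ (s1.mul (hψ.dL hW _))
      ((hf.dL hW _).mul s2) hx, restrict_dR_mul hW hUW _ s1 (hψ.dL hW _) hx,
      restrict_dR_mul hW hUW _ (hf.dL hW _) s2 hx, h0, hlam β hx, hstar β hx, Pi.zero_apply,
      map_zero, mul_zero, mul_zero, mul_zero, add_zero, add_zero, zero_add]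
  have hgs : ∀ A B, Smooth W (lift (fun x => Ring.inverse (ρ x)) *
      pairing (gam A) (gam B) (lift (ρ * E A B)) f ψ) := fun A B =>
    hrs.mul (Smooth.pairing hW _ _ (hcs A B) hf hψ)
  have hls : ∀ β, Smooth W (pairing (lam β) (lamStar β) 1 f ψ) := fun β =>
    Smooth.pairing hW _ _ (Smooth.one _) hf hψ
  rw [← sum_pairing_eq_bracket hU hE hρ (hψ.restrict hUW) (restrict_parity hUW hψ')
    ((hf.dR hW _).restrict hUW) hfp hx, pairing₁, restrict_dR_add hW hUW _
    (Smooth.sum _ fun A _ => Smooth.sum _ fun B _ => (hgs A B).smul _)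
    (Smooth.sum _ fun β _ => (hls β).smul _) hx,
    restrict_dR_sum hW hUW _ _ (fun A => Smooth.sum _ fun B _ => (hgs A B).smul _) hx,
    restrict_dR_sum hW hUW _ _ (fun β => (hls β).smul _) hx]
  congr 1
  · refine Finset.sum_congr rfl fun A _ => ?_
    rw [restrict_dR_sum hW hUW _ _ (fun B => (hgs A B).smul _) hx]
    refine Finset.sum_congr rfl fun B _ => ?_
    rw [restrict_dR_smul hW hUW _ _ (hgs A B) hx, hg]
  · refine Finset.sum_congr rfl fun β _ => ?_
    rw [restrict_dR_smul hW hUW _ _ (hls β) hx, hl]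

include hU hW hUW hWU hE hρ in
theorem restrict_laplacian₁ {ψ : SFun₁ a b} (hψ : Smooth W ψ) {x : CIdx a b → ℝ} (hx : x ∈ U) :
    restrict (laplacian₁ ρ E ψ) x = oddLaplacian ρ E (restrict ψ) x +
      ∑ α, sg (eps α) • restrict (dL (lam α) (dL (lamStar α) ψ)) x := by
  simp only [laplacian₁, restrict_add, restrict_sum, restrict_smul, restrict_mul, restrict_lift,
    Pi.add_apply, Finset.sum_apply, Pi.smul_apply, Pi.mul_apply, oddLaplacian]
  congr 1
  refine Finset.sum_congr rfl fun A _ => Finset.sum_congr rfl fun B _ => ?_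
  have hs : Smooth W (lift (ρ * E A B) * dL (gam B) ψ) :=
    ((smooth_density_mul hE hρ A B).lift hWU).mul (hψ.dL hW _)
  have he : Set.EqOn (restrict (lift (ρ * E A B) * dL (gam B) ψ)) (ρ * E A B * dL B (restrict ψ))
      U := by
    intro y hy
    rw [restrict_mul, restrict_lift, Pi.mul_apply, Pi.mul_apply,
      restrict_dL_gam B (hψ.differentiableAt hW (hUW y hy))]
    rfl
  rw [restrict_dL_gam A (hs.differentiableAt hW (hUW x hx)), dL_congr_on hU A he hx]

theorem dtF_restrict {T : Set ℝ} (hT : IsOpen T) (hW : IsOpen W) (hUW : ∀ x ∈ U, zeroSection x ∈ W)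
    {F : ℝ → SFun₁ a b} (hF : SmoothFamily T W F) {t : ℝ} (ht : t ∈ T) {x : CIdx a b → ℝ}
    (hx : x ∈ U) : dtF (fun t => restrict (F t)) t x = restrict (dtF F t) x :=
  (hasDerivAt_grLin (ExteriorAlgebra.map (LinearMap.funLeft ℝ ℝ
    (Sum.inl : CIdx a b → CIdx a b ⊕ CIdx a b))).toLinearMap
    (hF.hasDerivAt hT hW ht (hUW x hx))).deriv

/-- The generator of the rotation of the constraints. -/
def rotGen (Ψ : ℝ → Series a b) (α β : CIdx a b) (t : ℝ) : SFun₀ a b :=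
  -sg (eps α * eps β + eps β) •
    restrict (dR (lam α) (dL (lamStar β) (PowerSeries.coeff 0 (Ψ t))))

/-- The coefficients of the constraints in the evolution of the quantum correction. -/
def shiftGen (Ψ : ℝ → Series a b) (β : CIdx a b) (t : ℝ) : SFun₀ a b :=
  -sg (eps β) • restrict (dL (lamStar β) (PowerSeries.coeff 1 (Ψ t)))

variable {T : Set ℝ} {Ψ X : ℝ → Series a b} (hT : IsOpen T)
  (hX : IsExactDeformation T W ρ E Ψ X)

include hT hW hUW hX

theorem smooth_rotGen (α β : CIdx a b) : SmoothFamily T U (rotGen Ψ α β) :=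
  (SmoothFamily.restrict hUW (((hX.smooth_gen 0).dL hT hW _).dR hT hW _)).smul _

theorem smooth_shiftGen (β : CIdx a b) : SmoothFamily T U (shiftGen Ψ β) :=
  (SmoothFamily.restrict hUW ((hX.smooth_gen 1).dL hT hW _)).smul _

theorem rotGen_parity (α β : CIdx a b) {t : ℝ} (ht : t ∈ T) :
    HasParity U (eps α + eps β) (rotGen Ψ α β t) := by
  have hs := (hX.smooth_gen 0).smooth ht
  refine ((restrict_parity hUW (((hX.odd_gen t ht 0).dL hW hs (lamStar β)).dR hW
    (hs.dL hW _) (lam α))).congr_right ?_).smul _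
  rw [par_lam, par_lamStar]
  generalize (eps α) = r
  generalize (eps β) = s
  revert r s; decide

theorem smooth_constraint (α : CIdx a b) : SmoothFamily T U fun t => constraint (X t) α :=
  SmoothFamily.restrict hUW ((hX.smooth 0).dR hT hW _)

theorem smooth_quantumH : SmoothFamily T U fun t => quantumH (X t) :=
  SmoothFamily.restrict hUW (hX.smooth 1)

theorem constraint_parity (α : CIdx a b) {t : ℝ} (ht : t ∈ T) :
    HasParity U (eps α) (constraint (X t) α) := by
  have := restrict_parity hUW ((hX.even t ht 0).dR hW ((hX.smooth 0).smooth ht) (lam α))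
  rwa [zero_add, par_lam] at this

theorem planckEigen_gen (n : ℕ) {t : ℝ} (ht : t ∈ T) :
    PlanckEigen W (-n) (PowerSeries.coeff n (Ψ t)) := by
  intro y hy
  have := hX.planck_gen t ht n y hy
  rw [Int.cast_zero, zero_smul] at this
  rw [neg_smul, eq_neg_of_add_eq_zero_left this]

theorem restrict_dL_lam_action (β : CIdx a b) {t : ℝ} (ht : t ∈ T) {x : CIdx a b → ℝ}
    (hx : x ∈ U) : restrict (dL (lam β) (PowerSeries.coeff 0 (X t))) x =
      sg (eps β) • constraint (X t) β x := by
  have h1 : restrict (dL (lam β) (PowerSeries.coeff 0 (X t))) x =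
      tw (eps β) (constraint (X t) β x) := by
    rw [constraint, restrict_dR, twF_apply, par_lam, tw_tw_self]
  rw [h1, tw_of_mem (constraint_parity hW hUW hT hX β ht x hx)]
  congr 1
  generalize (eps β) = r
  rcases zmod_two_cases r with rfl | rfl <;> simp

include hU hWU hE hρ

/-- The λ^α-derivative of the classical evolution at the zero section. The bracket term is absorbed
by ∇, and the λλ*-part of the generator rotates the constraints among themselves. -/
theorem nabla_constraint (α : CIdx a b) {t : ℝ} (ht : t ∈ T) :
    Set.EqOn (nabla E (fun t => restrict (PowerSeries.coeff 0 (Ψ t)))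
      (fun t => constraint (X t) α) t) (∑ β, rotGen Ψ α β t * constraint (X t) β) U := by
  intro x hx
  have hs := (hX.smooth_gen 0).smooth ht
  have hpl : PlanckEigen W 0 (PowerSeries.coeff 0 (Ψ t)) := by
    simpa using planckEigen_gen hW hUW hT hX 0 ht
  -- The η⁰-part of Ψ has Planck eigenvalue 0, so these derivatives have eigenvalues -1, 1 and -2
  -- and vanish on the zero section. The mixed λλ*-derivative has eigenvalue 0 and survives.
  have hlam : ∀ α, Set.EqOn (restrict (dL (lam α) (PowerSeries.coeff 0 (Ψ t)))) 0 U := fun α =>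
    (hpl.dL_lam hW hs α).restrict_eq_zero (by norm_num) hUW
  have hstar : ∀ α, Set.EqOn (restrict (dL (lamStar α) (PowerSeries.coeff 0 (Ψ t)))) 0 U :=
    fun α => (hpl.dL_lamStar hW hs α).restrict_eq_zero (by norm_num) hUW
  have hlam2 : ∀ α β, Set.EqOn (restrict (dL (lam α) (dL (lam β) (PowerSeries.coeff 0 (Ψ t))))) 0
      U := fun α β =>
    ((hpl.dL_lam hW hs β).dL_lam hW (hs.dL hW _) α).restrict_eq_zero (by norm_num) hUW
  have h1 : Set.EqOn (dtF (fun t => dR (lam α) (PowerSeries.coeff 0 (X t))) t)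
      (-dR (lam α) (pairing₁ ρ E (PowerSeries.coeff 0 (X t)) (PowerSeries.coeff 0 (Ψ t)))) W := by
    intro y hy
    have e1 : Set.EqOn (dtF (fun t => PowerSeries.coeff 0 (X t)) t)
        ((-1 : ℝ) • pairing₁ ρ E (PowerSeries.coeff 0 (X t)) (PowerSeries.coeff 0 (Ψ t))) W := by
      intro z hz
      rw [hX.deriv_zero hW hWU hE hρ ht hz, Pi.smul_apply, neg_one_smul]
    have e2 : dtF (fun t => dR (lam α) (PowerSeries.coeff 0 (X t))) t y = _ :=
      (hasDerivAt_dR hT hW (hX.smooth 0) (lam α) ht hy).deriv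
    rw [e2, dR_congr_on hW _ e1 hy, dR_smul _ _ ((smooth_pairing₁ hW hWU hE hρ
      ((hX.smooth 0).smooth ht) hs).differentiableAt hW hy), neg_one_smul]
    rfl
  have h2 := dtF_restrict hT hW hUW ((hX.smooth 0).dR hT hW (lam α)) ht hx
  have h3 := restrict_congr hUW h1 hx
  have h4 := restrict_dR_pairing₁ hU hW hUW hWU hE hρ ((hX.smooth 0).smooth ht) (hX.even t ht 0)
    hs (hX.odd_gen t ht 0) hlam hstar hlam2 α hx
  have h5 : restrict (-dR (lam α) (pairing₁ ρ E (PowerSeries.coeff 0 (X t))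
      (PowerSeries.coeff 0 (Ψ t)))) x = -restrict (dR (lam α) (pairing₁ ρ E
      (PowerSeries.coeff 0 (X t)) (PowerSeries.coeff 0 (Ψ t)))) x := map_neg _ _
  have h6 : dtF (fun t => constraint (X t) α) t x = _ := h2
  rw [nabla, Pi.sub_apply, h6, h3, h5, h4, neg_add, neg_neg]
  change _ - bracket E _ (constraint (X t) α) x = _
  rw [show restrict (dR (lam α) (PowerSeries.coeff 0 (X t))) = constraint (X t) α from rfl,
    add_sub_cancel_left, Finset.sum_apply, ← Finset.sum_neg_distrib]
  refine Finset.sum_congr rfl fun β _ => ?_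
  have hM : restrict (dR (lam α) (dL (lamStar β) (PowerSeries.coeff 0 (Ψ t)))) x ∈
      grPart _ (eps α + eps β) := by
    have h7 := rotGen_parity hW hUW hT hX α β ht x hx
    have h8 := Submodule.smul_mem _ (-sg (eps α * eps β + eps β)) h7
    rwa [rotGen, Pi.smul_apply, smul_smul, neg_mul_neg, sg_mul_self, one_smul] at h8
  rw [restrict_dL_lam_action hW hUW hT hX β ht hx, smul_mul_assoc, smul_smul, sg_mul_self, one_smul,
    mul_comm_of_mem (constraint_parity hW hUW hT hX β ht x hx) hM, Pi.mul_apply, rotGen,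
    Pi.smul_apply, smul_mul_assoc, ← neg_smul]
  congr 2
  generalize (eps α) = r
  generalize (eps β) = s
  rcases zmod_two_cases r with rfl | rfl <;> rcases zmod_two_cases s with rfl | rfl <;>
    simp [one_add_one_zmod]

/-- Three sources remain at this order: Δ of the restricted generator, the λλ*-part of Δ₍₁₎, which
is minus the supertrace of the very matrix that rotates the constraints, and the λ*-derivative of
the next coefficient of Ψ multiplied by constraints. -/
theorem nabla_quantumH {t : ℝ} (ht : t ∈ T) {x : CIdx a b → ℝ} (hx : x ∈ U) :
    nabla E (fun t => restrict (PowerSeries.coeff 0 (Ψ t))) (fun t => quantumH (X t)) t x =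
      oddLaplacian ρ E (restrict (PowerSeries.coeff 0 (Ψ t))) x -
      ∑ α, sg (eps α) • rotGen Ψ α α t x + ∑ β, shiftGen Ψ β t x * constraint (X t) β x := by
  have hs := (hX.smooth_gen 0).smooth ht
  have hs1 := (hX.smooth_gen 1).smooth ht
  have hpl : PlanckEigen W 0 (PowerSeries.coeff 0 (Ψ t)) := by
    simpa using planckEigen_gen hW hUW hT hX 0 ht
  have hpl1 : PlanckEigen W (-1) (PowerSeries.coeff 1 (Ψ t)) := by
    simpa using planckEigen_gen hW hUW hT hX 1 ht
  have hlam : ∀ α, Set.EqOn (restrict (dL (lam α) (PowerSeries.coeff 0 (Ψ t)))) 0 U := fun α =>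
    (hpl.dL_lam hW hs α).restrict_eq_zero (by norm_num) hUW
  have hstar : ∀ α, Set.EqOn (restrict (dL (lamStar α) (PowerSeries.coeff 0 (Ψ t)))) 0 U :=
    fun α => (hpl.dL_lamStar hW hs α).restrict_eq_zero (by norm_num) hUW
  have hlam1 : ∀ α, Set.EqOn (restrict (dL (lam α) (PowerSeries.coeff 1 (Ψ t)))) 0 U := fun α =>
    (hpl1.dL_lam hW hs1 α).restrict_eq_zero (by norm_num) hUW
  have hz1 : Set.EqOn (restrict (PowerSeries.coeff 1 (Ψ t))) 0 U :=
    hpl1.restrict_eq_zero (by norm_num) hUW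
  -- The η-coefficient of Ψ has Planck eigenvalue -1 and vanishes on the zero section, so no bracket
  -- with the classical action occurs.
  have hb0 : bracket E (restrict (PowerSeries.coeff 1 (Ψ t)))
      (restrict (PowerSeries.coeff 0 (X t))) x = 0 := by
    rw [bracket_congr hU E hz1 (fun _ _ => rfl) hx, bracket_apply]
    refine Finset.sum_eq_zero fun A _ => Finset.sum_eq_zero fun B _ => ?_
    rw [dR_eq, dL_zero, map_zero, zero_mul, zero_mul]
  have h1 : Set.EqOn (dtF (fun t => PowerSeries.coeff 1 (X t)) t)
      (laplacian₁ ρ E (PowerSeries.coeff 0 (Ψ t)) +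
      (-1 : ℝ) • (pairing₁ ρ E (PowerSeries.coeff 0 (X t)) (PowerSeries.coeff 1 (Ψ t)) +
      pairing₁ ρ E (PowerSeries.coeff 1 (X t)) (PowerSeries.coeff 0 (Ψ t)))) W := by
    intro y hy
    rw [hX.deriv_one hW hWU hE hρ ht hy, sub_eq_add_neg, neg_one_smul]
    rfl
  have h2 : dtF (fun t => quantumH (X t)) t x = _ := dtF_restrict hT hW hUW (hX.smooth 1) ht hx
  have h3 := restrict_congr hUW h1 hx
  rw [restrict_add, restrict_smul, restrict_add, Pi.add_apply, Pi.smul_apply, Pi.add_apply,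
    restrict_laplacian₁ hU hW hUW hWU hE hρ hs hx,
    restrict_pairing₁ hU hW hUW hE hρ ((hX.smooth 0).smooth ht) (hX.even t ht 0)
      hs1 (hX.odd_gen t ht 1) hlam1 hx,
    restrict_pairing₁ hU hW hUW hE hρ ((hX.smooth 1).smooth ht) (hX.even t ht 1)
      hs (hX.odd_gen t ht 0) hlam hx, hb0, neg_zero, zero_add] at h3
  have h4 : ∑ α, sg (eps α) • (restrict (dL (lam α) (PowerSeries.coeff 1 (X t))) x *
      restrict (dL (lamStar α) (PowerSeries.coeff 0 (Ψ t))) x) = 0 :=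
    Finset.sum_eq_zero fun α _ => by rw [hstar α hx, Pi.zero_apply, mul_zero, smul_zero]
  -- Diagonal entries are even, so the twist between right and left λ-derivatives acts trivially on
  -- them.
  have h5 : ∀ α, rotGen Ψ α α t x =
      -restrict (dL (lam α) (dL (lamStar α) (PowerSeries.coeff 0 (Ψ t)))) x := by
    intro α
    have h6 := rotGen_parity hW hUW hT hX α α ht x hx
    rw [zmod_add_self] at h6
    have h8 := tw_of_mem (d := eps α) h6
    rw [mul_zero, sg_zero, one_smul] at h8
    rw [← h8, rotGen, Pi.smul_apply, map_smul, restrict_dR, twF_apply, par_lam, tw_tw_self]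
    have : sg (eps α * eps α + eps α) = 1 := by
      generalize (eps α) = r
      rcases zmod_two_cases r with rfl | rfl <;> simp [sg_zero, one_add_one_zmod]
    rw [this, neg_one_smul]
  have h7 : ∀ β, shiftGen Ψ β t x * constraint (X t) β x =
      -(constraint (X t) β x * restrict (dL (lamStar β) (PowerSeries.coeff 1 (Ψ t))) x) := by
    intro β
    have hp := restrict_parity hUW ((hX.odd_gen t ht 1).dL hW hs1 (lamStar β)) x hx
    have e : 1 + par (lamStar β : Coord₁ a b) = eps β := by
      rw [par_lamStar]
      generalize (eps β) = r
      revert r; decide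
    rw [e] at hp
    rw [shiftGen, Pi.smul_apply, smul_mul_assoc,
      mul_comm_of_mem hp (constraint_parity hW hUW hT hX β ht x hx), smul_smul, ← neg_one_smul ℝ]
    congr 1
    generalize (eps β) = r
    rcases zmod_two_cases r with rfl | rfl <;> simp [sg_zero, sg_one]
  rw [nabla, Pi.sub_apply, h2, h3, h4, add_zero]
  have h8 : ∀ β, sg (eps β) • (restrict (dL (lam β) (PowerSeries.coeff 0 (X t))) x *
      restrict (dL (lamStar β) (PowerSeries.coeff 1 (Ψ t))) x) =
      constraint (X t) β x * restrict (dL (lamStar β) (PowerSeries.coeff 1 (Ψ t))) x := by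
    intro β
    rw [restrict_dL_lam_action hW hUW hT hX β ht hx, smul_mul_assoc, smul_smul, sg_mul_self,
      one_smul]
  simp only [h5, h7, h8, smul_neg, Finset.sum_neg_distrib, neg_one_smul]
  change _ - bracket E _ (restrict (PowerSeries.coeff 1 (X t))) x = _
  abel

end RestrictedEvolution

/-! ### Matrices over the Grassmann algebra -/

section MatrixInverse

variable {ι q : Type} [Fintype ι] [DecidableEq ι] [Fintype q]

/-- The body of a matrix. -/
def bodyMat (M : Matrix ι ι (Gr q)) : Matrix ι ι ℝ := M.map body

theorem bodyMat_apply (M : Matrix ι ι (Gr q)) (i j : ι) : bodyMat M i j = body (M i j) := rfl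

theorem bodyMat_mul (M N : Matrix ι ι (Gr q)) : bodyMat (M * N) = bodyMat M * bodyMat N := by
  ext i j
  simp [bodyMat_apply, Matrix.mul_apply]

theorem bodyMat_one : bodyMat (1 : Matrix ι ι (Gr q)) = 1 := by
  ext i j
  rw [bodyMat_apply, Matrix.one_apply, Matrix.one_apply]
  split_ifs <;> simp

/-- Lifting the inverse of the body gives an inverse on either side up to a matrix K without body.
The entries of K^k have degree at least k, so K is nilpotent and both errors can be inverted. -/
theorem isUnit_matrix_of_body {M : Matrix ι ι (Gr q)} (hM : IsUnit (bodyMat M)) : IsUnit M := by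
  have key : ∀ K : Matrix ι ι (Gr q), bodyMat K = 0 → IsUnit (1 - K) := by
    intro K hK
    have hpow : ∀ k i j, (K ^ k) i j ∈ soulPow q k := by
      intro k
      induction k with
      | zero => exact fun i j => mem_soulPow_zero _
      | succ k ih =>
        intro i j
        rw [pow_succ, Matrix.mul_apply]
        exact Submodule.sum_mem _ fun l _ => mul_mem_soulPow (ih i l)
          (mem_soulPow_one (congrFun (congrFun hK l) j))
    refine IsNilpotent.isUnit_one_sub ⟨Fintype.card q + 1, ?_⟩
    ext i j
    exact soulPow_eq_zero (hpow _ i j)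
  set N : Matrix ι ι (Gr q) := ((bodyMat M)⁻¹).map (algebraMap ℝ (Gr q)) with hN
  have hNb : bodyMat N = (bodyMat M)⁻¹ := by
    ext i j
    simp [bodyMat_apply, hN]
  have hdet := (Matrix.isUnit_iff_isUnit_det _).1 hM
  have h1 : IsUnit (M * N) := by
    have := key (1 - M * N) (by
      ext i j
      have h := bodyMat_mul M N
      rw [hNb, Matrix.mul_nonsing_inv _ hdet] at h
      have h' := congrFun (congrFun h i) j
      have h'' := congrFun (congrFun (bodyMat_one (ι := ι) (q := q)) i) j
      rw [bodyMat_apply] at h' h''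
      rw [bodyMat_apply, Matrix.sub_apply, map_sub, h', h'', sub_self]; rfl)
    rwa [sub_sub_cancel] at this
  have h2 : IsUnit (N * M) := by
    have := key (1 - N * M) (by
      ext i j
      have h := bodyMat_mul N M
      rw [hNb, Matrix.nonsing_inv_mul _ hdet] at h
      have h' := congrFun (congrFun h i) j
      have h'' := congrFun (congrFun (bodyMat_one (ι := ι) (q := q)) i) j
      rw [bodyMat_apply] at h' h''
      rw [bodyMat_apply, Matrix.sub_apply, map_sub, h', h'', sub_self]; rfl)
    rwa [sub_sub_cancel] at this
  have e1 : M * (N * Ring.inverse (M * N)) = 1 := by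
    rw [← mul_assoc, Ring.mul_inverse_cancel _ h1]
  have e2 : (Ring.inverse (N * M) * N) * M = 1 := by
    rw [mul_assoc, Ring.inverse_mul_cancel _ h2]
  have e3 := left_inv_eq_right_inv e2 e1
  exact ⟨⟨M, _, e1, e3 ▸ e2⟩, rfl⟩

theorem isUnit_bodyMat {M : Matrix ι ι (Gr q)} (hM : IsUnit M) : IsUnit (bodyMat M) := by
  obtain ⟨u, rfl⟩ := hM
  have h1 := bodyMat_mul (u : Matrix ι ι (Gr q)) (u⁻¹ : (Matrix ι ι (Gr q))ˣ)
  have h2 := bodyMat_mul ((u⁻¹ : (Matrix ι ι (Gr q))ˣ) : Matrix ι ι (Gr q)) u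
  rw [Units.mul_inv, bodyMat_one] at h1
  rw [Units.inv_mul, bodyMat_one] at h2
  exact ⟨⟨_, _, h1.symm, h2.symm⟩, rfl⟩

theorem isUnit_matrix_iff {M : Matrix ι ι (Gr q)} : IsUnit M ↔ (bodyMat M).det ≠ 0 := by
  rw [← isUnit_iff_ne_zero, ← Matrix.isUnit_iff_isUnit_det]
  exact ⟨isUnit_bodyMat, isUnit_matrix_of_body⟩

theorem isUnit_of_mul_eq_one {M N : Matrix ι ι (Gr q)} (h : M * N = 1) : IsUnit M := by
  refine isUnit_matrix_of_body ?_
  rw [Matrix.isUnit_iff_isUnit_det]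
  refine Matrix.isUnit_det_of_right_inverse (B := bodyMat N) ?_
  rw [← bodyMat_mul, h, bodyMat_one]

theorem continuousOn_det_bodyMat {X : Type*} [TopologicalSpace X] {s : Set X}
    {M : X → Matrix ι ι (Gr q)} (hM : ∀ i j, ContinuousOn (fun x => M x i j) s) :
    ContinuousOn (fun x => (bodyMat (M x)).det) s := by
  have hb : Continuous fun y : Gr q => body y := (grLin (body (q := q)).toLinearMap).continuous
  refine Continuous.comp_continuousOn (g := fun A : Matrix ι ι ℝ => A.det)
    (f := fun x => bodyMat (M x)) (Continuous.matrix_det continuous_id) ?_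
  exact continuousOn_pi.2 fun i => continuousOn_pi.2 fun j => hb.comp_continuousOn (hM i j)

/-- A matrix as an operator on column vectors. -/
def matL (M : Matrix ι ι (Gr q)) : (ι → Gr q) →L[ℝ] (ι → Gr q) := matOp ι q fun i j => M i j

theorem matL_apply (M : Matrix ι ι (Gr q)) (v : ι → Gr q) (i : ι) :
    matL M v i = ∑ j, M i j * v j := matOp_apply _ v i

theorem inverse_apply_eq_matL {M : Matrix ι ι (Gr q)} (hM : IsUnit M) (i j : ι) :
    IsUnit (matL M) ∧
      (Ring.inverse M) i j = Ring.inverse (matL M) (Pi.single j 1) i := by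
  have hmul : ∀ M N : Matrix ι ι (Gr q), matL M * matL N = matL (M * N) := by
    intro M N
    ext v i
    change matL M (matL N v) i = _
    simp only [matL_apply, Matrix.mul_apply, Finset.mul_sum, Finset.sum_mul, mul_assoc]
    exact Finset.sum_comm
  have hone : matL (1 : Matrix ι ι (Gr q)) = 1 := by
    ext v i
    rw [matL_apply]
    simp [Matrix.one_apply]
  have h1 : matL M * matL (Ring.inverse M) = 1 := by
    rw [hmul, Ring.mul_inverse_cancel M hM, hone]
  have h2 : matL (Ring.inverse M) * matL M = 1 := by
    rw [hmul, Ring.inverse_mul_cancel M hM, hone]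
  refine ⟨⟨⟨_, _, h1, h2⟩, rfl⟩, ?_⟩
  rw [show Ring.inverse (matL M) = matL (Ring.inverse M) from
    Ring.inverse_unit ⟨_, _, h1, h2⟩, matL_apply]
  simp [Pi.single_apply]

theorem contDiffOn_matInverse {E : Type*} [NormedAddCommGroup E] [NormedSpace ℝ E] {s : Set E}
    {M : E → Matrix ι ι (Gr q)} (hM : ∀ i j, ContDiffOn ℝ ∞ (fun x => M x i j) s)
    (hu : ∀ x ∈ s, IsUnit (M x)) (i j : ι) :
    ContDiffOn ℝ ∞ (fun x => (Ring.inverse (M x)) i j) s := by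
  have h1 : ContDiffOn ℝ ∞ (fun x => matL (M x)) s := by
    have h1 : ContDiff ℝ ∞ (fun M => matOp ι q M) :=
      (LinearMap.toContinuousLinearMap (matOp ι q)).contDiff
    exact h1.comp_contDiffOn (contDiffOn_pi.2 fun i => contDiffOn_pi.2 fun j => hM i j)
  have h2 : ContDiffOn ℝ ∞ (fun x => Ring.inverse (matL (M x))) s := by
    intro x hx
    have h0 := contDiffAt_clmInverse (inverse_apply_eq_matL (hu x hx) i j).1
    exact h0.comp_contDiffWithinAt x (h1 x hx)
  have h3 := contDiffOn_pi.1 (h2.clm_apply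
    (contDiffOn_const (c := (Pi.single j 1 : ι → Gr q)))) i
  exact h3.congr fun x hx => (inverse_apply_eq_matL (hu x hx) i j).2

/-- Entrywise derivative of a path of matrices. -/
def HasMatDeriv {κ ν : Type} (M : ℝ → Matrix κ ν (Gr q)) (M' : Matrix κ ν (Gr q)) (t : ℝ) : Prop :=
  ∀ i j, HasDerivAt (fun s => M s i j) (M' i j) t

theorem HasMatDeriv.mul {κ ν : Type} {M : ℝ → Matrix κ ι (Gr q)} {M' : Matrix κ ι (Gr q)}
    {N : ℝ → Matrix ι ν (Gr q)} {N' : Matrix ι ν (Gr q)} {t : ℝ} (hM : HasMatDeriv M M' t)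
    (hN : HasMatDeriv N N' t) : HasMatDeriv (fun s => M s * N s) (M' * N t + M t * N') t := by
  intro i j
  simp only [Matrix.mul_apply, Matrix.add_apply, ← Finset.sum_add_distrib]
  exact HasDerivAt.fun_sum fun k _ => hasDerivAt_grMul (hM i k) (hN k j)

theorem HasMatDeriv.sub {κ ν : Type} {M N : ℝ → Matrix κ ν (Gr q)} {M' N' : Matrix κ ν (Gr q)}
    {t : ℝ} (hM : HasMatDeriv M M' t) (hN : HasMatDeriv N N' t) :
    HasMatDeriv (fun s => M s - N s) (M' - N') t := fun i j => (hM i j).sub (hN i j)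

theorem HasMatDeriv.eventually_isUnit {M : ℝ → Matrix ι ι (Gr q)} {M' : Matrix ι ι (Gr q)} {t : ℝ}
    (hM : HasMatDeriv M M' t) (hu : IsUnit (M t)) : ∀ᶠ s in nhds t, IsUnit (M s) := by
  have hb : Continuous fun y : Gr q => body y := (grLin (body (q := q)).toLinearMap).continuous
  have h1 : ContinuousAt (fun s => (bodyMat (M s)).det) t := by
    refine ContinuousAt.comp (g := fun A : Matrix ι ι ℝ => A.det) (f := fun x => bodyMat (M x))
      (Continuous.matrix_det continuous_id).continuousAt ?_
    exact continuousAt_pi.2 fun i => continuousAt_pi.2 fun j =>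
      hb.continuousAt.comp (f := fun s => M s i j) (hM i j).continuousAt
  filter_upwards [h1.eventually_ne (isUnit_matrix_iff.1 hu)] with s hs
  exact isUnit_matrix_iff.2 hs

/-- Differentiability is obtained from inversion of operators; the value then follows by
differentiating M⁻¹ M = 1, which holds for nearby times. -/
theorem HasMatDeriv.inverse {M : ℝ → Matrix ι ι (Gr q)} {M' : Matrix ι ι (Gr q)} {t : ℝ}
    (hM : HasMatDeriv M M' t) (hu : IsUnit (M t)) :
    HasMatDeriv (fun s => Ring.inverse (M s))
      (-(Ring.inverse (M t) * M' * Ring.inverse (M t))) t := by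
  have hev := hM.eventually_isUnit hu
  have hd : ∀ i j, DifferentiableAt ℝ (fun s => (Ring.inverse (M s)) i j) t := by
    intro i j
    have h1 : DifferentiableAt ℝ (fun s => matL (M s)) t := by
      refine (LinearMap.toContinuousLinearMap (matOp ι q)).differentiableAt.comp t ?_
      exact differentiableAt_pi.2 fun i => differentiableAt_pi.2 fun j =>
        (hM i j).differentiableAt
    have h2 : DifferentiableAt ℝ (fun s => Ring.inverse (matL (M s))) t := by
      have h0 := (contDiffAt_clmInverse (inverse_apply_eq_matL hu i j).1).differentiableAt (by simp)
      exact h0.comp t h1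
    have h3 := differentiableAt_pi.1 (h2.clm_apply
      (differentiableAt_const (Pi.single j 1 : ι → Gr q))) i
    refine h3.congr_of_eventuallyEq (hev.mono fun s hs => (inverse_apply_eq_matL hs i j).2)
  set N' : Matrix ι ι (Gr q) := Matrix.of fun i j => deriv (fun s => (Ring.inverse (M s)) i j) t
  have hN : HasMatDeriv (fun s => Ring.inverse (M s)) N' t := fun i j => (hd i j).hasDerivAt
  have h4 := hN.mul hM
  have h5 : N' * M t + Ring.inverse (M t) * M' = 0 := by
    ext i j
    refine (h4 i j).unique ((hasDerivAt_const t ((1 : Matrix ι ι (Gr q)) i j)).congr_of_eventuallyEq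
      (hev.mono fun s hs => ?_))
    simp only [Ring.inverse_mul_cancel _ hs]
  have h6 : N' = -(Ring.inverse (M t) * M' * Ring.inverse (M t)) := by
    have h7 := congrArg (· * Ring.inverse (M t)) h5
    simp only [add_mul, zero_mul, mul_assoc, Ring.mul_inverse_cancel _ hu, mul_one] at h7
    rw [eq_neg_of_add_eq_zero_left h7, mul_assoc]
  rw [← h6]
  exact hN

end MatrixInverse

/-! ### Determinants of even matrices -/

section EvenDet

variable {m q : Type} [Fintype m] [DecidableEq m] [Fintype q]

/-- Differentiation rules imply Jacobi's formula for the determinant. -/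
theorem det_pointDeriv {K S : Type*} [CommRing K] {t : S} {D : (S → K) → K → Prop}
    (hmul : ∀ f f' g g', D f f' → D g g' → D (fun s => f s * g s) (f' * g t + f t * g'))
    (hadd : ∀ f f' g g', D f f' → D g g' → D (fun s => f s + g s) (f' + g'))
    (hint : ∀ n : ℤ, D (fun _ => n) 0) {M : S → Matrix m m K} {M' : Matrix m m K}
    (h : ∀ i j, D (fun s => M s i j) (M' i j)) :
    D (fun s => (M s).det) ((M t).adjugate * M').trace := by
  have hprod : ∀ (s : Finset m) (f : m → S → K) (f' : m → K), (∀ i, D (f i) (f' i)) →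
      D (fun x => ∏ i ∈ s, f i x) (∑ i ∈ s, (f' i * ∏ j ∈ s.erase i, f j t)) := by
    intro s f f' hf
    induction s using Finset.induction_on with
    | empty => simpa using hint 1
    | insert i s hi ih =>
      have h1 := hmul _ _ _ _ (hf i) ih
      simp only [Finset.prod_insert hi, Finset.sum_insert hi]
      convert h1 using 1
      rw [Finset.erase_insert hi, Finset.mul_sum]
      congr 1
      refine Finset.sum_congr rfl fun j hj => ?_
      have hij : j ≠ i := fun h => hi (h ▸ hj)
      rw [Finset.erase_insert_of_ne hij.symm, Finset.prod_insert (fun h => hi (Finset.mem_of_mem_erase h))]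
      ring
  have hsum : ∀ {α : Type _} (s : Finset α) (f : α → S → K) (f' : α → K), (∀ i, D (f i) (f' i)) →
      D (fun x => ∑ i ∈ s, f i x) (∑ i ∈ s, f' i) := by
    intro α s f f' hf
    classical
    induction s using Finset.induction_on with
    | empty => simpa using hint 0
    | insert i s hi ih =>
      simp only [Finset.sum_insert hi]
      exact hadd _ _ _ _ (hf i) ih
  have h1 := hsum Finset.univ (fun (σ : Equiv.Perm m) s => ((σ.sign : ℤ) : K) * ∏ i, M s (σ i) i) _
    fun σ => hmul _ _ _ _ (hint σ.sign) (hprod Finset.univ (fun i s => M s (σ i) i)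
      (fun i => M' (σ i) i) fun i => h _ _)
  simp only [Matrix.det_apply']
  convert h1 using 1
  -- By Cramer's rule a diagonal entry is the determinant with column i replaced by that of M'.
  -- Summing over i reproduces the product rule for the Leibniz expansion.
  have h2 : ∀ i, ((M t).adjugate * M') i i =
      ∑ σ : Equiv.Perm m, ((σ.sign : ℤ) : K) * (M' (σ i) i * ∏ j ∈ Finset.univ.erase i, M t (σ j) j) := by
    intro i
    have h3 : ((M t).adjugate * M') i i = Matrix.cramer (M t) (fun k => M' k i) i := by
      rw [Matrix.cramer_eq_adjugate_mulVec]; rfl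
    rw [h3, Matrix.cramer_apply, Matrix.det_apply']
    refine Finset.sum_congr rfl fun σ _ => ?_
    rw [← Finset.mul_prod_erase _ _ (Finset.mem_univ i), Matrix.updateCol_self]
    congr 2
    refine Finset.prod_congr rfl fun j hj => ?_
    rw [Matrix.updateCol_ne (Finset.ne_of_mem_erase hj)]
  simp only [Matrix.trace, Matrix.diag_apply, h2, zero_mul, zero_add]
  rw [Finset.sum_comm]
  simp only [Finset.mul_sum]

/-- The even part of an element, as an element of the even subalgebra. -/
def toEven (x : Gr q) : GrEven q := ⟨grProj 0 x, grProj_mem 0 x⟩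

theorem coe_toEven {x : Gr q} (hx : x ∈ grPart q 0) : (toEven x : Gr q) = x := grProj_of_mem hx

theorem toEven_sum {ι : Type*} (s : Finset ι) (f : ι → Gr q) :
    toEven (∑ i ∈ s, f i) = ∑ i ∈ s, toEven (f i) := by
  apply Subtype.ext
  rw [AddSubmonoidClass.coe_finsetSum]
  exact map_sum (grProj 0) f s

theorem toEven_mul {x y : Gr q} (hx : x ∈ grPart q 0) (hy : y ∈ grPart q 0) :
    toEven (x * y) = toEven x * toEven y := by
  apply Subtype.ext
  have hxy : x * y ∈ grPart q 0 := by simpa using mul_mem_grPart hx hy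
  rw [coe_toEven hxy]
  change x * y = (toEven x : Gr q) * (toEven y : Gr q)
  rw [coe_toEven hx, coe_toEven hy]

theorem evenDet_eq {M : Matrix m m (Gr q)} (hM : ∀ i j, M i j ∈ grPart q 0) :
    evenDet M = ((Matrix.of fun i j => toEven (M i j)).det : GrEven q) := by
  have hM' : ∀ i j, M i j ∈ GrEven q := hM
  rw [evenDet, dif_pos hM']
  congr 2
  ext i j
  exact (coe_toEven (hM i j)).symm

theorem evenDet_mem {M : Matrix m m (Gr q)} (hM : ∀ i j, M i j ∈ grPart q 0) :
    evenDet M ∈ grPart q 0 := by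
  rw [evenDet_eq hM]
  exact Subtype.property _

theorem body_evenDet {M : Matrix m m (Gr q)} (hM : ∀ i j, M i j ∈ grPart q 0) :
    body (evenDet M) = (bodyMat M).det := by
  have h := RingHom.map_det ((body (q := q)).toRingHom.comp (GrEven q).subtype)
    (Matrix.of fun i j => toEven (M i j))
  rw [evenDet_eq hM]
  refine h.trans ?_
  congr 1
  ext i j
  change body (toEven (M i j) : Gr q) = _
  rw [coe_toEven (hM i j), bodyMat_apply]

/-- Jacobi's formula. -/
theorem hasDerivAt_evenDet {M : ℝ → Matrix m m (Gr q)} {Y M' : Matrix m m (Gr q)} {t : ℝ}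
    (hM : ∀ᶠ s in nhds t, ∀ i j, M s i j ∈ grPart q 0) (hY : ∀ i j, Y i j ∈ grPart q 0)
    (hd : HasMatDeriv M M' t) (hM' : M' = Y * M t) :
    HasDerivAt (fun s => evenDet (M s)) (evenDet (M t) * Y.trace) t := by
  -- The determinant is formed in the commutative ring of even elements while derivatives are taken
  -- in the full algebra; the abstract relation D connects the two.
  have h := det_pointDeriv (K := GrEven q) (t := t) (S := ℝ)
    (D := fun f f' => HasDerivAt (fun s => (f s : Gr q)) (f' : Gr q) t)
    (fun f f' g g' hf hg => hasDerivAt_grMul hf hg) (fun f f' g g' hf hg => hf.add hg)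
    (fun n => hasDerivAt_const _ _) (M := fun s => Matrix.of fun i j => toEven (M s i j))
    (M' := Matrix.of fun i j => toEven (M' i j))
    (fun i j => hasDerivAt_grLin (grProj 0) (hd i j))
  have hMt := hM.self_of_nhds
  refine (h.congr_of_eventuallyEq (hM.mono fun s hs => evenDet_eq hs)).congr_deriv ?_
  have h2 : (Matrix.of fun i j => toEven (M' i j)) =
      (Matrix.of fun i j => toEven (Y i j)) * (Matrix.of fun i j => toEven (M t i j)) := by
    ext1 i j
    rw [hM', Matrix.of_apply, Matrix.mul_apply, Matrix.mul_apply, toEven_sum]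
    exact Finset.sum_congr rfl fun k _ => toEven_mul (hY i k) (hMt k j)
  rw [h2, ← mul_assoc, Matrix.trace_mul_comm, ← mul_assoc, Matrix.mul_adjugate, smul_mul_assoc,
    one_mul, Matrix.trace_smul, evenDet_eq hMt]
  change _ * _ = _ * _
  congr 1
  rw [Matrix.trace, AddSubmonoidClass.coe_finsetSum]
  exact Finset.sum_congr rfl fun i _ => coe_toEven (hY i i)

end EvenDet

/-! ### Even supermatrices -/

section SuperMatrix

variable {ι q : Type} [Fintype ι] [DecidableEq ι] [Fintype q]

/-- The entries have parity `π i + π j`. -/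
def SuperEven (π : ι → ZMod 2) (M : Matrix ι ι (Gr q)) : Prop :=
  ∀ i j, M i j ∈ grPart q (π i + π j)

/-- The supertrace. -/
def str (π : ι → ZMod 2) (M : Matrix ι ι (Gr q)) : Gr q := ∑ i, sg (π i) • M i i

variable {π : ι → ZMod 2}

theorem str_add (M N : Matrix ι ι (Gr q)) : str π (M + N) = str π M + str π N := by
  simp [str, Finset.sum_add_distrib]

theorem SuperEven.mul {M N : Matrix ι ι (Gr q)} (hM : SuperEven π M) (hN : SuperEven π N) :
    SuperEven π (M * N) := by
  intro i j
  rw [Matrix.mul_apply]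
  refine Submodule.sum_mem _ fun k _ => ?_
  have key : ∀ r s u : ZMod 2, r + s + (s + u) = r + u := by decide
  rw [← key (π i) (π k) (π j)]
  exact mul_mem_grPart (hM i k) (hN k j)

theorem SuperEven.add {M N : Matrix ι ι (Gr q)} (hM : SuperEven π M) (hN : SuperEven π N) :
    SuperEven π (M + N) := fun i j => add_mem (hM i j) (hN i j)

theorem str_mul_comm {M N : Matrix ι ι (Gr q)} (hM : SuperEven π M) (hN : SuperEven π N) :
    str π (M * N) = str π (N * M) := by
  simp only [str, Matrix.mul_apply, Finset.smul_sum]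
  rw [Finset.sum_comm]
  refine Finset.sum_congr rfl fun j _ => Finset.sum_congr rfl fun i _ => ?_
  rw [mul_comm_of_mem (hM i j) (hN j i), smul_smul]
  congr 1
  generalize π i = r
  generalize π j = s
  rcases zmod_two_cases r with rfl | rfl <;> rcases zmod_two_cases s with rfl | rfl <;>
    simp [sg_zero, sg_one, one_add_one_zmod]

/-- Twisting the entries of the inverse by the expected signs gives another left inverse, and
inverses are unique. -/
theorem SuperEven.inverse {M : Matrix ι ι (Gr q)} (hM : SuperEven π M) (hu : IsUnit M) :
    SuperEven π (Ring.inverse M) := by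
  set N : Matrix ι ι (Gr q) := Matrix.of fun i j => sg (π i + π j) • tw 1 ((Ring.inverse M) i j)
    with hN
  have h1 : N * M = 1 := by
    ext i j
    have h2 := congrArg (tw 1) (congrFun (congrFun (Ring.inverse_mul_cancel M hu) i) j)
    rw [Matrix.mul_apply, map_sum] at h2
    have h3 : (N * M) i j = sg (π i + π j) • tw 1 ((1 : Matrix ι ι (Gr q)) i j) := by
      rw [← h2, Matrix.mul_apply, Finset.smul_sum]
      refine Finset.sum_congr rfl fun k _ => ?_
      rw [map_mul, mem_grPart_iff.1 (hM k j), hN, Matrix.of_apply, smul_mul_assoc, mul_smul_comm,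
        smul_smul]
      congr 1
      have key : ∀ r s u : ZMod 2, r + s = r + u + (s + u) := by decide
      rw [← sg_add, key (π i) (π k) (π j)]
    rw [h3, Matrix.one_apply]
    split_ifs with hij
    · subst hij; rw [map_one, zmod_add_self, sg_zero, one_smul]
    · rw [map_zero, smul_zero]
  have h2 : N = Ring.inverse M := by
    rw [← mul_one N, ← Ring.mul_inverse_cancel M hu, ← mul_assoc, h1, one_mul]
  intro i j
  rw [mem_grPart_iff]
  calc tw 1 ((Ring.inverse M) i j)
      = sg (π i + π j) • N i j := by
        rw [hN, Matrix.of_apply, smul_smul, sg_mul_self, one_smul]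
    _ = _ := by rw [h2]

end SuperMatrix

/-! ### The superdeterminant and its derivative -/

section Berezinian

variable {m n q : Type} [Fintype m] [DecidableEq m] [Fintype n] [DecidableEq n] [Fintype q]

theorem SuperEven.block₁₁ {M : Matrix (m ⊕ n) (m ⊕ n) (Gr q)} (hM : SuperEven par M) (i j : m) :
    M.toBlocks₁₁ i j ∈ grPart q 0 := hM (Sum.inl i) (Sum.inl j)

theorem SuperEven.block₁₂ {M : Matrix (m ⊕ n) (m ⊕ n) (Gr q)} (hM : SuperEven par M) (i : m)
    (j : n) : M.toBlocks₁₂ i j ∈ grPart q 1 := hM (Sum.inl i) (Sum.inr j)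

theorem SuperEven.block₂₁ {M : Matrix (m ⊕ n) (m ⊕ n) (Gr q)} (hM : SuperEven par M) (i : n)
    (j : m) : M.toBlocks₂₁ i j ∈ grPart q 1 := hM (Sum.inr i) (Sum.inl j)

theorem SuperEven.block₂₂ {M : Matrix (m ⊕ n) (m ⊕ n) (Gr q)} (hM : SuperEven par M) (i j : n) :
    M.toBlocks₂₂ i j ∈ grPart q 0 := hM (Sum.inr i) (Sum.inr j)

theorem mul_mem_entries {ι κ ν : Type} [Fintype κ] {d e : ZMod 2} {M : Matrix ι κ (Gr q)}
    {N : Matrix κ ν (Gr q)} (hM : ∀ i j, M i j ∈ grPart q d) (hN : ∀ i j, N i j ∈ grPart q e)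
    (i : ι) (j : ν) : (M * N) i j ∈ grPart q (d + e) := by
  rw [Matrix.mul_apply]
  exact Submodule.sum_mem _ fun k _ => mul_mem_grPart (hM i k) (hN k j)

theorem inverse_entries_even {ι : Type} [Fintype ι] [DecidableEq ι] {M : Matrix ι ι (Gr q)}
    (hM : ∀ i j, M i j ∈ grPart q 0) (hu : IsUnit M) (i j : ι) :
    (Ring.inverse M) i j ∈ grPart q 0 := by
  have h : SuperEven (fun _ => 0) M := fun i j => by simpa using hM i j
  simpa using h.inverse hu i j

/-- The Schur complement of the odd-odd block. -/
def schur (M : Matrix (m ⊕ n) (m ⊕ n) (Gr q)) : Matrix m m (Gr q) :=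
  M.toBlocks₁₁ - M.toBlocks₁₂ * Ring.inverse M.toBlocks₂₂ * M.toBlocks₂₁

/-- Off-diagonal blocks are odd and have no body, so the body of M is block diagonal and the block
of the inverse inverts it. -/
theorem SuperEven.isUnit_block₂₂ {M : Matrix (m ⊕ n) (m ⊕ n) (Gr q)} (hM : SuperEven par M)
    (hu : IsUnit M) : IsUnit M.toBlocks₂₂ := by
  refine isUnit_matrix_of_body ?_
  rw [Matrix.isUnit_iff_isUnit_det]
  refine Matrix.isUnit_det_of_right_inverse (B := bodyMat (Ring.inverse M).toBlocks₂₂) ?_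
  ext i j
  have h1 := congrFun (congrFun (Ring.mul_inverse_cancel M hu) (Sum.inr i)) (Sum.inr j)
  have h2 := congrArg body h1
  rw [Matrix.mul_apply, Fintype.sum_sum_type, map_add, map_sum, map_sum] at h2
  have h3 : ∑ k, body (M (Sum.inr i) (Sum.inl k) * (Ring.inverse M) (Sum.inl k) (Sum.inr j)) = 0 :=
    Finset.sum_eq_zero fun k _ => by rw [map_mul, body_of_odd (x := M (Sum.inr i) (Sum.inl k)) (hM.block₂₁ i k), zero_mul]
  rw [h3, zero_add] at h2
  simp only [map_mul] at h2
  rw [Matrix.mul_apply]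
  refine h2.trans ?_
  rw [Matrix.one_apply, Matrix.one_apply]
  simp only [Sum.inr.injEq]
  split_ifs <;> simp

theorem SuperEven.isUnit_block₁₁ {M : Matrix (m ⊕ n) (m ⊕ n) (Gr q)} (hM : SuperEven par M)
    (hu : IsUnit M) : IsUnit M.toBlocks₁₁ := by
  refine isUnit_matrix_of_body ?_
  rw [Matrix.isUnit_iff_isUnit_det]
  refine Matrix.isUnit_det_of_right_inverse (B := bodyMat (Ring.inverse M).toBlocks₁₁) ?_
  ext i j
  have h1 := congrFun (congrFun (Ring.mul_inverse_cancel M hu) (Sum.inl i)) (Sum.inl j)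
  have h2 := congrArg body h1
  rw [Matrix.mul_apply, Fintype.sum_sum_type, map_add, map_sum, map_sum] at h2
  have h3 : ∑ k, body (M (Sum.inl i) (Sum.inr k) * (Ring.inverse M) (Sum.inr k) (Sum.inl j)) = 0 :=
    Finset.sum_eq_zero fun k _ => by rw [map_mul, body_of_odd (x := M (Sum.inl i) (Sum.inr k)) (hM.block₁₂ i k), zero_mul]
  rw [h3, add_zero] at h2
  simp only [map_mul] at h2
  rw [Matrix.mul_apply]
  refine h2.trans ?_
  rw [Matrix.one_apply, Matrix.one_apply]
  simp only [Sum.inl.injEq]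
  split_ifs <;> simp

theorem schur_even {M : Matrix (m ⊕ n) (m ⊕ n) (Gr q)} (hM : SuperEven par M)
    (hD : IsUnit M.toBlocks₂₂) (i j : m) : schur M i j ∈ grPart q 0 := by
  have h := mul_mem_entries (mul_mem_entries hM.block₁₂ (inverse_entries_even hM.block₂₂ hD))
    hM.block₂₁ i j
  exact sub_mem (hM.block₁₁ i j) h

theorem body_sdet_ne_zero {M : Matrix (m ⊕ n) (m ⊕ n) (Gr q)} (hM : SuperEven par M)
    (hu : IsUnit M) : body (sdet M) ≠ 0 := by
  have hD := hM.isUnit_block₂₂ hu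
  have hD' : body (evenDet M.toBlocks₂₂) ≠ 0 := by
    rw [body_evenDet hM.block₂₂]
    exact isUnit_matrix_iff.1 hD
  have h1 : body (Ring.inverse (evenDet M.toBlocks₂₂)) ≠ 0 := by
    have h2 := Ring.mul_inverse_cancel _ (isUnit_of_body_ne_zero hD')
    have h3 := congrArg body h2
    rw [map_mul, map_one] at h3
    exact right_ne_zero_of_mul_eq_one h3
  have h4 : body (evenDet (schur M)) ≠ 0 := by
    rw [body_evenDet (schur_even hM hD)]
    have h5 : bodyMat (schur M) = bodyMat M.toBlocks₁₁ := by
      ext i j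
      rw [bodyMat_apply, schur, Matrix.sub_apply, map_sub, Matrix.mul_apply, map_sum,
        Finset.sum_eq_zero, sub_zero, bodyMat_apply]
      intro k _
      rw [map_mul, body_of_odd (hM.block₂₁ k j), mul_zero]
    rw [h5]
    exact isUnit_matrix_iff.1 (hM.isUnit_block₁₁ hu)
  rw [sdet, map_mul]
  exact mul_ne_zero h4 h1

theorem sdet_even {M : Matrix (m ⊕ n) (m ⊕ n) (Gr q)} (hM : SuperEven par M)
    (hu : IsUnit M) : sdet M ∈ grPart q 0 := by
  have h := mul_mem_grPart (evenDet_mem (schur_even hM (hM.isUnit_block₂₂ hu)))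
    (inverse_mem_grPart_zero (evenDet_mem hM.block₂₂))
  rwa [add_zero] at h

theorem trace_mul_add_trace_mul_of_odd {P : Matrix m n (Gr q)} {R : Matrix n m (Gr q)}
    (hP : ∀ i j, P i j ∈ grPart q 1) (hR : ∀ i j, R i j ∈ grPart q 1) :
    (P * R).trace + (R * P).trace = 0 := by
  simp only [Matrix.trace, Matrix.diag_apply, Matrix.mul_apply]
  rw [Finset.sum_comm, ← Finset.sum_add_distrib]
  refine Finset.sum_eq_zero fun j _ => ?_
  rw [← Finset.sum_add_distrib]
  refine Finset.sum_eq_zero fun i _ => ?_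
  rw [mul_comm_of_mem (hP i j) (hR j i), mul_one, sg_one, neg_one_smul, neg_add_cancel]

theorem str_par (X : Matrix (m ⊕ n) (m ⊕ n) (Gr q)) :
    str par X = X.toBlocks₁₁.trace - X.toBlocks₂₂.trace := by
  rw [str, Fintype.sum_sum_type, sub_eq_add_neg, Matrix.trace, Matrix.trace,
    ← Finset.sum_neg_distrib]
  congr 1 <;> refine Finset.sum_congr rfl fun i _ => ?_
  · rw [par_inl, sg_zero, one_smul]; rfl
  · rw [par_inr, sg_one, neg_one_smul]; rfl

/-- The derivative of the superdeterminant. -/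
theorem hasDerivAt_sdet {M : ℝ → Matrix (m ⊕ n) (m ⊕ n) (Gr q)}
    {X M' : Matrix (m ⊕ n) (m ⊕ n) (Gr q)} {t : ℝ} (hM : ∀ᶠ s in nhds t, SuperEven par (M s))
    (hu : IsUnit (M t)) (hX : SuperEven par X) (hd : HasMatDeriv M M' t) (hM' : M' = X * M t) :
    HasDerivAt (fun s => sdet (M s)) (sdet (M t) * str par X) t := by
  have hMt := hM.self_of_nhds
  have dA : HasMatDeriv (fun s => (M s).toBlocks₁₁) M'.toBlocks₁₁ t := fun i j => hd _ _
  have dB : HasMatDeriv (fun s => (M s).toBlocks₁₂) M'.toBlocks₁₂ t := fun i j => hd _ _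
  have dC : HasMatDeriv (fun s => (M s).toBlocks₂₁) M'.toBlocks₂₁ t := fun i j => hd _ _
  have dD : HasMatDeriv (fun s => (M s).toBlocks₂₂) M'.toBlocks₂₂ t := fun i j => hd _ _
  have hD := hMt.isUnit_block₂₂ hu
  have dQ := dA.sub ((dB.mul (dD.inverse hD)).mul dC)
  have eD : ∀ᶠ s in nhds t, IsUnit (M s).toBlocks₂₂ := dD.eventually_isUnit hD
  have eQ : ∀ᶠ s in nhds t, ∀ i j, schur (M s) i j ∈ grPart q 0 := by
    filter_upwards [hM, eD] with s h1 h2 using schur_even h1 h2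
  have hA' : M'.toBlocks₁₁ = X.toBlocks₁₁ * (M t).toBlocks₁₁ + X.toBlocks₁₂ * (M t).toBlocks₂₁ := by
    ext i j; simp [hM', Matrix.toBlocks₁₁, Matrix.toBlocks₁₂, Matrix.toBlocks₂₁, Matrix.mul_apply]
  have hB' : M'.toBlocks₁₂ = X.toBlocks₁₁ * (M t).toBlocks₁₂ + X.toBlocks₁₂ * (M t).toBlocks₂₂ := by
    ext i j; simp [hM', Matrix.toBlocks₁₁, Matrix.toBlocks₁₂, Matrix.toBlocks₂₂, Matrix.mul_apply]
  have hC' : M'.toBlocks₂₁ = X.toBlocks₂₁ * (M t).toBlocks₁₁ + X.toBlocks₂₂ * (M t).toBlocks₂₁ := by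
    ext i j; simp [hM', Matrix.toBlocks₁₁, Matrix.toBlocks₂₂, Matrix.toBlocks₂₁, Matrix.mul_apply]
  have hD' : M'.toBlocks₂₂ = X.toBlocks₂₁ * (M t).toBlocks₁₂ + X.toBlocks₂₂ * (M t).toBlocks₂₂ := by
    ext i j; simp [hM', Matrix.toBlocks₁₂, Matrix.toBlocks₂₂, Matrix.toBlocks₂₁, Matrix.mul_apply]
  set A := (M t).toBlocks₁₁ with hA
  set B := (M t).toBlocks₁₂ with hB
  set C := (M t).toBlocks₂₁ with hC
  set D := (M t).toBlocks₂₂ with hDdef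
  set I := Ring.inverse D with hI
  have hDI : D * I = 1 := Ring.mul_inverse_cancel D hD
  have hID : I * D = 1 := Ring.inverse_mul_cancel D hD
  have hDI' : ∀ {k : Type} (N : Matrix n k (Gr q)), D * (I * N) = N := fun N => by
    rw [← Matrix.mul_assoc, hDI, Matrix.one_mul]
  have hIe := inverse_entries_even hMt.block₂₂ hD
  -- When M' = X M, the Schur complement and the odd-odd block also evolve by left multiplication,
  -- with Y₁ and Y₂. Jacobi's formula applies to each, and tr Y₁ - tr Y₂ = str X because the traces
  -- of products of two odd blocks taken in opposite orders cancel.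
  set Y₁ := X.toBlocks₁₁ - B * I * X.toBlocks₂₁ with hY₁
  set Y₂ := X.toBlocks₂₁ * (B * I) + X.toBlocks₂₂ with hY₂
  have hBI : ∀ i j, (B * I) i j ∈ grPart q 1 := fun i j => by
    have := mul_mem_entries hMt.block₁₂ hIe i j
    rwa [add_zero] at this
  have hY₁e : ∀ i j, Y₁ i j ∈ grPart q 0 := fun i j =>
    sub_mem (hX.block₁₁ i j) (mul_mem_entries hBI hX.block₂₁ i j)
  have hY₂e : ∀ i j, Y₂ i j ∈ grPart q 0 := fun i j =>
    add_mem (mul_mem_entries hX.block₂₁ hBI i j) (hX.block₂₂ i j)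
  have hQeq : M'.toBlocks₁₁ - ((M'.toBlocks₁₂ * I + B * -(I * M'.toBlocks₂₂ * I)) * C +
      B * I * M'.toBlocks₂₁) = Y₁ * (A - B * I * C) := by
    rw [hA', hB', hC', hD', hY₁]
    simp only [Matrix.add_mul, Matrix.mul_add, Matrix.sub_mul, Matrix.mul_sub, Matrix.neg_mul,
      Matrix.mul_neg, Matrix.mul_assoc, hDI']
    abel
  have hDeq : M'.toBlocks₂₂ = Y₂ * D := by
    rw [hD', hY₂]
    simp only [Matrix.add_mul, Matrix.mul_assoc, hID, Matrix.mul_one]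
  have d1 := hasDerivAt_evenDet (M := fun s => schur (M s)) eQ hY₁e dQ hQeq
  have d2 := hasDerivAt_evenDet (M := fun s => (M s).toBlocks₂₂)
    (hM.mono fun s hs => hs.block₂₂) hY₂e dD hDeq
  have hdD : IsUnit (evenDet D) := isUnit_of_body_ne_zero (by
    rw [body_evenDet hMt.block₂₂]
    exact isUnit_matrix_iff.1 hD)
  have d3 := hasDerivAt_grMul d1 (hasDerivAt_grInverse d2 hdD)
  refine d3.congr_deriv ?_
  have ht1 : Y₁.trace ∈ grPart q 0 := Submodule.sum_mem _ fun i _ => hY₁e i i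
  have ht2 : Y₂.trace ∈ grPart q 0 := Submodule.sum_mem _ fun i _ => hY₂e i i
  have h5 : str par X = Y₁.trace - Y₂.trace := by
    have h6 := trace_mul_add_trace_mul_of_odd hBI hX.block₂₁
    rw [str_par, hY₁, hY₂, Matrix.trace_sub, Matrix.trace_add, eq_neg_of_add_eq_zero_left h6]
    abel
  have h7 : sdet (M t) = evenDet (schur (M t)) * Ring.inverse (evenDet D) := rfl
  rw [h5, h7]
  change evenDet (schur (M t)) * Y₁.trace * Ring.inverse (evenDet D) +
    evenDet (schur (M t)) * -(Ring.inverse (evenDet D) * (evenDet D * Y₂.trace) *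
      Ring.inverse (evenDet D)) = _
  rw [← mul_assoc (Ring.inverse (evenDet D)), Ring.inverse_mul_cancel _ hdD, one_mul,
    mul_comm_of_even ht2, mul_assoc, mul_comm_of_even ht1, mul_neg, mul_sub, mul_assoc, mul_assoc]
  abel

end Berezinian

/-! ### The logarithm -/

section Log

variable {q : Type} [Fintype q]

/-- The geometric series may stop before the power `Fintype.card q`: the remainder s^card * d
already has degree at least card + 1, since d has no body either. -/
theorem log_series_mul {s d : Gr q} (hs : body s = 0) (hd : body d = 0) :
    (1 + s) * ∑ k ∈ Finset.range (Fintype.card q), (-1 : ℝ) ^ k • (s ^ k * d) = d := by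
  have h1 : ∑ k ∈ Finset.range (Fintype.card q), (-1 : ℝ) ^ k • (s ^ k * d) =
      (∑ k ∈ Finset.range (Fintype.card q), (-s) ^ k) * d := by
    rw [Finset.sum_mul]
    refine Finset.sum_congr rfl fun k _ => ?_
    rw [← smul_mul_assoc, ← neg_one_smul ℝ s, smul_pow]
  have h2 : (-s) ^ Fintype.card q * d = 0 := soulPow_eq_zero
    (mul_mem_soulPow (pow_mem_soulPow (by rw [map_neg, hs, neg_zero]) _) (mem_soulPow_one hd))
  have h3 := mul_neg_geom_sum (-s) (Fintype.card q)
  rw [sub_neg_eq_add] at h3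
  rw [h1, ← mul_assoc, h3, sub_mul, one_mul, h2, sub_zero]

/-- The common algebra of all logarithmic derivatives: r is the derivative of the logarithm of the
body, and the sum is the differentiated logarithmic series. It serves time derivatives and, with r =
0, contractions. -/
theorem log_derivative_unique {a d d' : Gr q} (ha : body a ≠ 0) {r : ℝ}
    (hd : body ((body a)⁻¹ • d' - (r / body a) • a) = 0)
    (h : d = algebraMap ℝ (Gr q) r + ∑ k ∈ Finset.range (Fintype.card q),
      (-1 : ℝ) ^ k • (((body a)⁻¹ • a - 1) ^ k * ((body a)⁻¹ • d' - (r / body a) • a))) :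
    d = Ring.inverse a * d' := by
  have hs : body ((body a)⁻¹ • a - 1) = 0 := by simp [ha]
  have h1 := log_series_mul hs hd
  rw [add_sub_cancel] at h1
  set w := ∑ k ∈ Finset.range (Fintype.card q),
      (-1 : ℝ) ^ k • (((body a)⁻¹ • a - 1) ^ k * ((body a)⁻¹ • d' - (r / body a) • a)) with hw
  have h2 : a * w = d' - r • a := by
    have h3 := congrArg (fun x => body a • x) h1
    simp only [← smul_mul_assoc, smul_sub, smul_smul, mul_inv_cancel₀ ha, one_smul] at h3
    rw [h3, mul_div_cancel₀ _ ha]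
  have h4 : w = Ring.inverse a * d' - r • 1 := by
    have hu := isUnit_of_body_ne_zero ha
    have h5 := congrArg (fun x => Ring.inverse a * x) h2
    simp only [← mul_assoc, Ring.inverse_mul_cancel a hu, one_mul, mul_sub, mul_smul_comm] at h5
    exact h5
  rw [h, h4, Algebra.algebraMap_eq_smul_one]
  abel

theorem hasDerivAt_grPow_even {f : ℝ → Gr q} {f' : Gr q} {t : ℝ} (hf : HasDerivAt f f' t)
    (he : f t ∈ grPart q 0) (k : ℕ) :
    HasDerivAt (fun s => f s ^ (k + 1)) (((k : ℝ) + 1) • (f t ^ k * f')) t := by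
  induction k with
  | zero => simpa using hf
  | succ k ih =>
    have h := hasDerivAt_grMul ih hf
    simp only [pow_succ _ (k + 1)]
    refine h.congr_deriv ?_
    rw [smul_mul_assoc, mul_assoc, ← mul_comm_of_even he, ← mul_assoc, ← pow_succ]
    push_cast
    rw [add_smul ((k : ℝ) + 1) 1, one_smul]

theorem hasDerivAt_grLog {f : ℝ → Gr q} {f' : Gr q} {t : ℝ} (hf : HasDerivAt f f' t)
    (he : f t ∈ grPart q 0) (hb : body (f t) ≠ 0) :
    HasDerivAt (fun s => grLog (f s)) (Ring.inverse (f t) * f') t := by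
  have h1 : HasDerivAt (fun s => body (f s)) (body f') t := hasDerivAt_grLin body.toLinearMap hf
  have h2 : HasDerivAt (fun s => Real.log (body (f s))) (body f' / body (f t)) t := h1.log hb
  have h3 : HasDerivAt (fun s => algebraMap ℝ (Gr q) (Real.log (body (f s))))
      (algebraMap ℝ (Gr q) (body f' / body (f t))) t :=
    (LinearMap.toContinuousLinearMap (Algebra.linearMap ℝ (Gr q))).hasFDerivAt.comp_hasDerivAt t h2
  have h4 : HasDerivAt (fun s => (body (f s))⁻¹ • f s - 1)
      ((body (f t))⁻¹ • f' - (body f' / body (f t) / body (f t)) • f t) t := by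
    refine (((h1.inv hb).smul hf).sub_const 1).congr_deriv ?_
    rw [sub_eq_add_neg, ← neg_smul]
    congr 2
    field_simp
  have hse : (body (f t))⁻¹ • f t - 1 ∈ grPart q 0 :=
    sub_mem (Submodule.smul_mem _ _ he) one_mem_grPart
  have h5 := h3.add (HasDerivAt.fun_sum (u := Finset.range (Fintype.card q)) fun k _ =>
    (hasDerivAt_grPow_even h4 hse k).const_smul ((-1 : ℝ) ^ k / (k + 1)))
  refine h5.congr_deriv (log_derivative_unique hb (r := body f' / body (f t)) ?_ ?_)
  · rw [map_sub, map_smul, map_smul, smul_eq_mul, smul_eq_mul]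
    field_simp
    ring
  · congr 1
    refine Finset.sum_congr rfl fun k _ => ?_
    rw [smul_smul]
    congr 1
    have : (k : ℝ) + 1 ≠ 0 := by positivity
    field_simp

theorem iL_pow_even {a : Gr q} (ha : a ∈ grPart q 0) (j : q) (k : ℕ) :
    iL j (a ^ (k + 1)) = ((k : ℝ) + 1) • (a ^ k * iL j a) := by
  induction k with
  | zero => simp
  | succ k ih =>
    have hk : ∀ k : ℕ, tw 1 (a ^ k) = a ^ k := fun k => by
      rw [map_pow, mem_grPart_iff.1 ha, sg_zero, one_smul]
    rw [pow_succ _ (k + 1), iL_mul, ih, hk, smul_mul_assoc, mul_assoc, ← mul_comm_of_even ha,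
      ← mul_assoc, ← pow_succ]
    push_cast
    rw [add_smul ((k : ℝ) + 1) 1, one_smul]

theorem iL_grLog {a : Gr q} (ha : a ∈ grPart q 0) (hb : body a ≠ 0) (j : q) :
    iL j (grLog a) = Ring.inverse a * iL j a := by
  have hodd : body (iL j a) = 0 := body_of_odd (by simpa using iL_mem ha j)
  have hse : (body a)⁻¹ • a - 1 ∈ grPart q 0 :=
    sub_mem (Submodule.smul_mem _ _ ha) one_mem_grPart
  refine log_derivative_unique hb (r := 0) ?_ ?_
  · simp [hodd]
  · have h1 : iL j (1 : Gr q) = 0 := by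
      have := iL_algebraMap j 1
      rwa [map_one] at this
    rw [grLog, map_add, iL_algebraMap, map_zero, map_sum]
    congr 1
    refine Finset.sum_congr rfl fun k _ => ?_
    rw [map_smul, iL_pow_even hse, smul_smul, map_sub, map_smul, h1, sub_zero, zero_div, zero_smul,
      sub_zero]
    congr 1
    have : (k : ℝ) + 1 ≠ 0 := by positivity
    field_simp

theorem contDiffOn_grLog {E : Type*} [NormedAddCommGroup E] [NormedSpace ℝ E] {s : Set E}
    {f : E → Gr q} (hf : ContDiffOn ℝ ∞ f s) (hb : ∀ x ∈ s, body (f x) ≠ 0) :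
    ContDiffOn ℝ ∞ (fun x => grLog (f x)) s := by
  have hbs : ContDiffOn ℝ ∞ (fun x => body (f x)) s := contDiffOn_grLin body.toLinearMap hf
  have h1 : ContDiffOn ℝ ∞ (fun x => (body (f x))⁻¹ • f x - 1) s :=
    ((hbs.inv hb).smul hf).sub contDiffOn_const
  exact (contDiffOn_algebraMap (hbs.log hb)).add
    (ContDiffOn.sum fun k _ => (contDiffOn_grPow h1 (k + 1)).const_smul _)

end Log

/-! ### Logarithms under coordinate derivatives and flows -/

section LogFlow

variable {p q : Type} [Fintype p] [DecidableEq p] [Fintype q]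

/-- For an even coordinate, restricting to a coordinate line reduces the claim to the derivative in
one real variable. -/
theorem dL_grLog {U : Set (p → ℝ)} (hU : IsOpen U) {f : SFun p q} (hf : Smooth U f)
    (he : HasParity U 0 f) (hb : ∀ x ∈ U, body (f x) ≠ 0) (A : p ⊕ q) {x : p → ℝ} (hx : x ∈ U) :
    dL A (fun x => grLog (f x)) x = Ring.inverse (f x) * dL A f x := by
  cases A with
  | inl i =>
    have hs : Smooth U fun x => grLog (f x) := contDiffOn_grLog hf hb
    have hline : HasDerivAt (fun s : ℝ => x + s • (Pi.single i 1 : p → ℝ)) (Pi.single i 1) 0 := by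
      simpa using ((hasDerivAt_id (0 : ℝ)).smul_const (Pi.single i 1 : p → ℝ)).const_add x
    have h0 : x + (0 : ℝ) • (Pi.single i 1 : p → ℝ) = x := by simp
    have h1 : HasDerivAt (fun s : ℝ => f (x + s • (Pi.single i 1 : p → ℝ)))
        (fderiv ℝ f x (Pi.single i 1)) 0 := by
      refine HasFDerivAt.comp_hasDerivAt (l := f) 0 ?_ hline
      rw [h0]; exact (hf.differentiableAt hU hx).hasFDerivAt
    have h2 : HasDerivAt (fun s : ℝ => grLog (f (x + s • (Pi.single i 1 : p → ℝ))))
        (fderiv ℝ (fun x => grLog (f x)) x (Pi.single i 1)) 0 := by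
      refine HasFDerivAt.comp_hasDerivAt (l := fun x => grLog (f x)) 0 ?_ hline
      rw [h0]; exact (hs.differentiableAt hU hx).hasFDerivAt
    have h3 := hasDerivAt_grLog h1 (by rw [h0]; exact he x hx) (by rw [h0]; exact hb x hx)
    rw [h0] at h3
    exact h2.unique h3
  | inr j => exact iL_grLog (he x hx) (hb x hx) j

namespace Flow

variable {T : Set ℝ} {U : Set (p → ℝ)} {E : p ⊕ q → p ⊕ q → SFun p q} {ψ : ℝ → SFun p q}
  {𝒰 𝒱 : ℝ → SFun p q → SFun p q} (h : Flow T U E ψ 𝒰 𝒱)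

include h

theorem nabla_grLog {z : ℝ → SFun p q} (hz : SmoothFamily T U z)
    (he : ∀ t ∈ T, HasParity U 0 (z t)) (hb : ∀ t ∈ T, ∀ x ∈ U, body (z t x) ≠ 0) {t : ℝ}
    (ht : t ∈ T) {y : p → ℝ} (hy : y ∈ U) :
    nabla E ψ (fun t y => grLog (z t y)) t y = Ring.inverse (z t y) * nabla E ψ z t y := by
  have h1 : dtF (fun t y => grLog (z t y)) t y = _ :=
    (hasDerivAt_grLog (hz.hasDerivAt h.isOpen_time h.isOpen ht hy) (he t ht y hy)
      (hb t ht y hy)).deriv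
  rw [nabla, nabla, Pi.sub_apply, Pi.sub_apply, h1, mul_sub, bracket_eq_hamCoef,
    bracket_eq_hamCoef, Finset.mul_sum]
  congr 1
  refine Finset.sum_congr rfl fun B _ => ?_
  rw [dL_grLog h.isOpen (hz.smooth ht) (he t ht) (hb t ht) B hy, ← mul_assoc, ← mul_assoc,
    mul_comm_of_even (inverse_mem_grPart_zero (he t ht y hy))]

theorem exp_inverse {t : ℝ} (ht : t ∈ T) {f : SFun p q} (hf : Smooth U f)
    (hu : ∀ x ∈ U, IsUnit (f x)) {x : p → ℝ} (hx : x ∈ U) :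
    IsUnit (𝒰 t f x) ∧ 𝒰 t (fun y => Ring.inverse (f y)) x = Ring.inverse (𝒰 t f x) := by
  set g : SFun p q := fun y => Ring.inverse (f y) with hg
  have hgs : Smooth U g := contDiffOn_grInverse hf hu
  have h1 : 𝒰 t f x * 𝒰 t g x = 1 := by
    have e : Set.EqOn (f * g) 1 U := fun y hy => Ring.mul_inverse_cancel _ (hu y hy)
    have := h.exp.congr t ht _ _ (hf.mul hgs) e hx
    rw [h.exp_mul ht hf hgs hx, h.exp_one ht hx] at this
    exact this
  have h2 : 𝒰 t g x * 𝒰 t f x = 1 := by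
    have e : Set.EqOn (g * f) 1 U := fun y hy => Ring.inverse_mul_cancel _ (hu y hy)
    have := h.exp.congr t ht _ _ (hgs.mul hf) e hx
    rw [h.exp_mul ht hgs hf hx, h.exp_one ht hx] at this
    exact this
  exact ⟨⟨⟨_, _, h1, h2⟩, rfl⟩, (Ring.inverse_unit ⟨_, _, h1, h2⟩).symm⟩

/-- By the chain rule ∇ ln a = a⁻¹ ∇a, so the logarithm of a family annihilated by ∇ is annihilated
as well. -/
theorem exp_grLog {t : ℝ} (ht : t ∈ T) {f : SFun p q} (hf : Smooth U f) (he : HasParity U 0 f)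
    (hb : ∀ x ∈ U, body (f x) ≠ 0) :
    Set.EqOn (𝒰 t fun y => grLog (f y)) (fun y => grLog (𝒰 t f y)) U := by
  have hs := h.smoothFamily_exp hf
  have hb' : ∀ t ∈ T, ∀ x ∈ U, body (𝒰 t f x) ≠ 0 := fun t ht x hx =>
    ((h.exp_inverse ht hf (fun x hx => isUnit_of_body_ne_zero (hb x hx)) hx).1.map body).ne_zero
  have he' : ∀ t ∈ T, HasParity U 0 (𝒰 t f) := fun t ht => h.exp_parity ht hf he
  have hz : SmoothFamily T U fun t y => grLog (𝒰 t f y) :=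
    contDiffOn_grLog (E := ℝ × (p → ℝ)) hs fun z hz => hb' z.1 hz.1 z.2 hz.2
  have h1 := h.eq_exp_of_nabla_eq_zero hz (fun s hs' y hy => by
    rw [h.nabla_grLog hs he' hb' hs' hy, h.nabla_exp hf hs' hy, Pi.zero_apply, mul_zero]) ht
  have h2 : Set.EqOn (fun y => grLog (𝒰 0 f y)) (fun y => grLog (f y)) U := fun y hy =>
    congrArg grLog (h.exp.init f hf hy)
  intro y hy
  rw [h1 hy, h.exp.congr t ht _ _ (hz.smooth h.zero_mem) h2 hy]

end Flow
end LogFlow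

/-! ### Smooth determinants and local characters -/

section SmoothDet

variable {q m : Type} [Fintype q] [Fintype m] [DecidableEq m]
variable {E : Type*} [NormedAddCommGroup E] [NormedSpace ℝ E]

/-- Functions with even values that are smooth on `s`. -/
def smoothEven (q : Type) [Fintype q] (s : Set E) : Subring (E → GrEven q) where
  carrier := {u | ContDiffOn ℝ ∞ (fun x => (u x : Gr q)) s}
  mul_mem' hu hv := contDiffOn_grMul hu hv
  one_mem' := contDiffOn_const (c := (1 : Gr q))
  add_mem' hu hv := ContDiffOn.add hu hv
  zero_mem' := contDiffOn_const (c := (0 : Gr q))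
  neg_mem' hu := ContDiffOn.neg hu

/-- A matrix of functions with even smooth entries as a matrix over a commutative ring. -/
def smoothEvenMat {s : Set E} (M : E → Matrix m m (Gr q))
    (hM : ∀ i j, ContDiffOn ℝ ∞ (fun x => M x i j) s) : Matrix m m (smoothEven q s) :=
  Matrix.of fun i j => ⟨fun x => toEven (M x i j),
    show ContDiffOn ℝ ∞ (fun x => grProj 0 (M x i j)) s from contDiffOn_grLin (grProj 0) (hM i j)⟩

/-- Evaluation at a point is a ring homomorphism, so the determinant over the ring of smooth even
functions is the pointwise one. This yields smoothness and compatibility with homomorphisms without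
expanding the determinant. -/
theorem smoothEvenMat_det {s : Set E} {M : E → Matrix m m (Gr q)}
    (hM : ∀ i j, ContDiffOn ℝ ∞ (fun x => M x i j) s) {x : E}
    (he : ∀ i j, M x i j ∈ grPart q 0) :
    evenDet (M x) = (((smoothEvenMat M hM).det : E → GrEven q) x : Gr q) := by
  have h := RingHom.map_det ((Pi.evalRingHom (fun _ : E => GrEven q) x).comp
    (smoothEven q s).subtype) (smoothEvenMat M hM)
  rw [evenDet_eq he]
  exact congrArg Subtype.val h.symm

theorem contDiffOn_evenDet {s : Set E} {M : E → Matrix m m (Gr q)}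
    (hM : ∀ i j, ContDiffOn ℝ ∞ (fun x => M x i j) s) (he : ∀ x ∈ s, ∀ i j, M x i j ∈ grPart q 0) :
    ContDiffOn ℝ ∞ (fun x => evenDet (M x)) s :=
  ContDiffOn.congr (smoothEvenMat M hM).det.2 fun x hx => smoothEvenMat_det hM (he x hx)

theorem contDiffOn_matMul {κ ι ν : Type} [Fintype ι] {s : Set E} {M : E → Matrix κ ι (Gr q)}
    {N : E → Matrix ι ν (Gr q)} (hM : ∀ i j, ContDiffOn ℝ ∞ (fun x => M x i j) s)
    (hN : ∀ i j, ContDiffOn ℝ ∞ (fun x => N x i j) s) (i : κ) (j : ν) :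
    ContDiffOn ℝ ∞ (fun x => (M x * N x) i j) s := by
  simp only [Matrix.mul_apply]
  exact ContDiffOn.sum fun k _ => contDiffOn_grMul (hM i k) (hN k j)

theorem isUnit_evenDet {M : Matrix m m (Gr q)} (hM : ∀ i j, M i j ∈ grPart q 0) (hu : IsUnit M) :
    IsUnit (evenDet M) :=
  isUnit_of_body_ne_zero (by rw [body_evenDet hM]; exact isUnit_matrix_iff.1 hu)

variable {n : Type} [Fintype n] [DecidableEq n]

theorem contDiffOn_schur {s : Set E} {M : E → Matrix (m ⊕ n) (m ⊕ n) (Gr q)}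
    (hM : ∀ i j, ContDiffOn ℝ ∞ (fun x => M x i j) s)
    (hu : ∀ x ∈ s, IsUnit (M x).toBlocks₂₂) (i j : m) :
    ContDiffOn ℝ ∞ (fun x => schur (M x) i j) s := by
  have h1 := contDiffOn_matInverse (M := fun x => (M x).toBlocks₂₂)
    (fun i j => hM (Sum.inr i) (Sum.inr j)) hu
  exact (hM (Sum.inl i) (Sum.inl j)).sub (contDiffOn_matMul
    (M := fun x => (M x).toBlocks₁₂ * Ring.inverse (M x).toBlocks₂₂)
    (N := fun x => (M x).toBlocks₂₁)
    (contDiffOn_matMul (M := fun x => (M x).toBlocks₁₂)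
      (N := fun x => Ring.inverse (M x).toBlocks₂₂)
      (fun i j => hM (Sum.inl i) (Sum.inr j)) h1) (fun i j => hM (Sum.inr i) (Sum.inl j)) i j)

theorem contDiffOn_sdet {s : Set E} {M : E → Matrix (m ⊕ n) (m ⊕ n) (Gr q)}
    (hM : ∀ i j, ContDiffOn ℝ ∞ (fun x => M x i j) s) (he : ∀ x ∈ s, SuperEven par (M x))
    (hu : ∀ x ∈ s, IsUnit (M x)) : ContDiffOn ℝ ∞ (fun x => sdet (M x)) s := by
  have hD : ∀ x ∈ s, IsUnit (M x).toBlocks₂₂ := fun x hx => (he x hx).isUnit_block₂₂ (hu x hx)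
  exact contDiffOn_grMul
    (contDiffOn_evenDet (contDiffOn_schur hM hD) fun x hx => schur_even (he x hx) (hD x hx))
    (contDiffOn_grInverse (contDiffOn_evenDet (M := fun x => (M x).toBlocks₂₂)
      (fun i j => hM (Sum.inr i) (Sum.inr j)) fun x hx => (he x hx).block₂₂)
      fun x hx => isUnit_evenDet (he x hx).block₂₂ (hD x hx))

end SmoothDet

/-! ### Even homomorphisms commute with inverses and superdeterminants -/

section LocalChar

variable {p q : Type} [Fintype p] [DecidableEq p] [Fintype q]

/-- A unital even algebra homomorphism from the superfunctions on `V` to the Grassmann algebra. -/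
structure LocalChar (V : Set (p → ℝ)) (χ : SFun p q → Gr q) : Prop where
  congr : ∀ F G, Smooth V F → Set.EqOn F G V → χ F = χ G
  map_add : ∀ F G, Smooth V F → Smooth V G → χ (F + G) = χ F + χ G
  map_mul : ∀ F G, Smooth V F → Smooth V G → χ (F * G) = χ F * χ G
  map_smul : ∀ (r : ℝ) F, Smooth V F → χ (r • F) = r • χ F
  map_one : χ 1 = 1
  parity : ∀ F e, Smooth V F → HasParity V e F → χ F ∈ grPart q e

/-- Entrywise application of a map to a matrix of superfunctions. -/
def mapMat {κ ν : Type} (χ : SFun p q → Gr q) (M : (p → ℝ) → Matrix κ ν (Gr q)) :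
    Matrix κ ν (Gr q) := Matrix.of fun i j => χ fun x => M x i j

namespace LocalChar

variable {V : Set (p → ℝ)} {χ : SFun p q → Gr q} (h : LocalChar V χ)
include h

theorem map_zero : χ 0 = 0 := by
  have := h.map_smul 0 0 (Smooth.zero V)
  rwa [zero_smul, zero_smul] at this

theorem map_sub {F G : SFun p q} (hF : Smooth V F) (hG : Smooth V G) : χ (F - G) = χ F - χ G := by
  rw [sub_eq_add_neg, ← neg_one_smul ℝ G, h.map_add _ _ hF (hG.smul _), h.map_smul _ _ hG,
    neg_one_smul, ← sub_eq_add_neg]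

theorem map_sum {ι : Type*} (s : Finset ι) {F : ι → SFun p q} (hF : ∀ i, Smooth V (F i)) :
    χ (∑ i ∈ s, F i) = ∑ i ∈ s, χ (F i) := by
  classical
  induction s using Finset.induction_on with
  | empty => simpa using h.map_zero
  | insert i s hi ih =>
    rw [Finset.sum_insert hi, Finset.sum_insert hi,
      h.map_add _ _ (hF i) (Smooth.sum s fun i _ => hF i), ih]

theorem map_inverse {f : SFun p q} (hf : Smooth V f) (hu : ∀ x ∈ V, IsUnit (f x)) :
    IsUnit (χ f) ∧ χ (fun x => Ring.inverse (f x)) = Ring.inverse (χ f) := by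
  set g : SFun p q := fun y => Ring.inverse (f y) with hg
  have hgs : Smooth V g := contDiffOn_grInverse hf hu
  have h1 : χ f * χ g = 1 := by
    rw [← h.map_mul _ _ hf hgs, ← h.map_one]
    exact h.congr _ _ (hf.mul hgs) fun y hy => Ring.mul_inverse_cancel _ (hu y hy)
  have h2 : χ g * χ f = 1 := by
    rw [← h.map_mul _ _ hgs hf, ← h.map_one]
    exact h.congr _ _ (hgs.mul hf) fun y hy => Ring.inverse_mul_cancel _ (hu y hy)
  exact ⟨⟨⟨_, _, h1, h2⟩, rfl⟩, (Ring.inverse_unit ⟨_, _, h1, h2⟩).symm⟩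

theorem mapMat_mul {κ ι ν : Type} [Fintype ι] {M : (p → ℝ) → Matrix κ ι (Gr q)}
    {N : (p → ℝ) → Matrix ι ν (Gr q)} (hM : ∀ i j, Smooth V fun x => M x i j)
    (hN : ∀ i j, Smooth V fun x => N x i j) :
    mapMat χ (fun x => M x * N x) = mapMat χ M * mapMat χ N := by
  ext i j
  have e : (fun x => (M x * N x) i j) =
      ∑ k, (fun x => M x i k) * (fun x => N x k j : SFun p q) := by
    ext x
    simp [Matrix.mul_apply]
  change χ (fun x => (M x * N x) i j) = _
  rw [e, h.map_sum _ fun k => (hM i k).mul (hN k j), Matrix.mul_apply]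
  exact Finset.sum_congr rfl fun k _ => h.map_mul _ _ (hM i k) (hN k j)

theorem mapMat_congr {κ ν : Type} {M N : (p → ℝ) → Matrix κ ν (Gr q)}
    (hM : ∀ i j, Smooth V fun x => M x i j) (hMN : ∀ x ∈ V, M x = N x) :
    mapMat χ M = mapMat χ N := by
  ext i j
  exact h.congr _ _ (hM i j) fun x hx => by rw [hMN x hx]

theorem mapMat_one {ι : Type} [DecidableEq ι] :
    mapMat χ (fun _ => (1 : Matrix ι ι (Gr q))) = 1 := by
  ext i j
  by_cases hij : i = j
  · subst hij
    rw [Matrix.one_apply_eq]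
    refine Eq.trans ?_ h.map_one
    change χ _ = χ _
    congr 1; ext x; simp
  · rw [Matrix.one_apply_ne hij]
    refine Eq.trans ?_ h.map_zero
    change χ _ = χ _
    congr 1; ext x; simp [hij]

theorem mapMat_inverse {ι : Type} [Fintype ι] [DecidableEq ι] {M : (p → ℝ) → Matrix ι ι (Gr q)}
    (hM : ∀ i j, Smooth V fun x => M x i j) (hu : ∀ x ∈ V, IsUnit (M x)) :
    IsUnit (mapMat χ M) ∧
      mapMat χ (fun x => Ring.inverse (M x)) = Ring.inverse (mapMat χ M) := by
  have hN : ∀ i j, Smooth V fun x => (Ring.inverse (M x)) i j := contDiffOn_matInverse hM hu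
  have h1 : mapMat χ M * mapMat χ (fun x => Ring.inverse (M x)) = 1 := by
    rw [← h.mapMat_mul hM hN, ← h.mapMat_one]
    exact h.mapMat_congr (contDiffOn_matMul hM hN) fun y hy => Ring.mul_inverse_cancel _ (hu y hy)
  have h2 : mapMat χ (fun x => Ring.inverse (M x)) * mapMat χ M = 1 := by
    rw [← h.mapMat_mul hN hM, ← h.mapMat_one]
    exact h.mapMat_congr (contDiffOn_matMul hN hM) fun y hy => Ring.inverse_mul_cancel _ (hu y hy)
  exact ⟨⟨⟨_, _, h1, h2⟩, rfl⟩, (Ring.inverse_unit ⟨_, _, h1, h2⟩).symm⟩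

/-- The induced homomorphism on even superfunctions. -/
def evenHom : smoothEven q V →+* GrEven q where
  toFun u := ⟨χ fun x => ((u : (p → ℝ) → GrEven q) x : Gr q),
    h.parity _ 0 u.2 fun x _ => ((u : (p → ℝ) → GrEven q) x).2⟩
  map_one' := Subtype.ext h.map_one
  map_mul' u v := Subtype.ext (h.map_mul _ _ u.2 v.2)
  map_zero' := Subtype.ext h.map_zero
  map_add' u v := Subtype.ext (h.map_add _ _ u.2 v.2)

theorem map_evenDet {m : Type} [Fintype m] [DecidableEq m] {M : (p → ℝ) → Matrix m m (Gr q)}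
    (hM : ∀ i j, Smooth V fun x => M x i j) (he : ∀ x ∈ V, ∀ i j, M x i j ∈ grPart q 0) :
    χ (fun x => evenDet (M x)) = evenDet (mapMat χ M) := by
  have h1 := RingHom.map_det h.evenHom (smoothEvenMat M hM)
  have he' : ∀ i j, mapMat χ M i j ∈ grPart q 0 := fun i j =>
    h.parity _ 0 (hM i j) fun x hx => he x hx i j
  rw [evenDet_eq he', h.congr _ _ (contDiffOn_evenDet hM he)
    fun x hx => smoothEvenMat_det hM (he x hx)]
  refine (congrArg Subtype.val h1).trans (congrArg (fun A => ((Matrix.det A : GrEven q) : Gr q)) ?_)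
  ext i j
  change χ (fun x => (toEven (M x i j) : Gr q)) = (toEven (mapMat χ M i j) : Gr q)
  rw [coe_toEven (he' i j)]
  exact (h.congr _ _ (hM i j) fun x hx => (coe_toEven (he x hx i j)).symm).symm

/-- The superdeterminant is built from products, matrix inverses and even determinants, all of which
remain smooth on V; the homomorphism passes through each of them. -/
theorem map_sdet {m n : Type} [Fintype m] [DecidableEq m] [Fintype n] [DecidableEq n]
    {M : (p → ℝ) → Matrix (m ⊕ n) (m ⊕ n) (Gr q)}
    (hM : ∀ i j, Smooth V fun x => M x i j) (he : ∀ x ∈ V, SuperEven par (M x))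
    (hu : ∀ x ∈ V, IsUnit (M x)) :
    χ (fun x => sdet (M x)) = sdet (mapMat χ M) := by
  have hD : ∀ x ∈ V, IsUnit (M x).toBlocks₂₂ := fun x hx => (he x hx).isUnit_block₂₂ (hu x hx)
  have h22 : ∀ i j, Smooth V fun x => (M x).toBlocks₂₂ i j := fun i j => hM (Sum.inr i) (Sum.inr j)
  have h12 : ∀ i j, Smooth V fun x => (M x).toBlocks₁₂ i j := fun i j => hM (Sum.inl i) (Sum.inr j)
  have h21 : ∀ i j, Smooth V fun x => (M x).toBlocks₂₁ i j := fun i j => hM (Sum.inr i) (Sum.inl j)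
  have h11 : ∀ i j, Smooth V fun x => (M x).toBlocks₁₁ i j := fun i j => hM (Sum.inl i) (Sum.inl j)
  have hI : ∀ i j, Smooth V fun x => (Ring.inverse (M x).toBlocks₂₂) i j :=
    contDiffOn_matInverse h22 hD
  have hs := contDiffOn_schur hM hD
  have hse : ∀ x ∈ V, ∀ i j, schur (M x) i j ∈ grPart q 0 := fun x hx =>
    schur_even (he x hx) (hD x hx)
  have hd := contDiffOn_evenDet h22 fun x hx => (he x hx).block₂₂
  have hdu : ∀ x ∈ V, IsUnit (evenDet (M x).toBlocks₂₂) := fun x hx =>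
    isUnit_evenDet (he x hx).block₂₂ (hD x hx)
  have e1 := h.map_mul _ _ (contDiffOn_evenDet hs hse) (contDiffOn_grInverse hd hdu)
  refine e1.trans ?_
  have e2 : mapMat χ (fun x => schur (M x)) = schur (mapMat χ M) := by
    have a1 : mapMat χ (fun x => schur (M x)) = mapMat χ (fun x => (M x).toBlocks₁₁) -
        mapMat χ (fun x => (M x).toBlocks₁₂ * Ring.inverse (M x).toBlocks₂₂ *
          (M x).toBlocks₂₁) := by
      ext i j
      exact h.map_sub (h11 i j) (contDiffOn_matMul (contDiffOn_matMul h12 hI) h21 i j)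
    rw [a1, h.mapMat_mul (contDiffOn_matMul h12 hI) h21, h.mapMat_mul h12 hI,
      (h.mapMat_inverse h22 hD).2]
    rfl
  rw [h.map_evenDet hs hse, (h.map_inverse hd hdu).2,
    h.map_evenDet h22 fun x hx => (he x hx).block₂₂, e2]
  rfl

end LocalChar
end LocalChar

/-! ### Locality of path-ordered exponentials -/

section Locality

variable {p q : Type} [Fintype p] [DecidableEq p] [Fintype q]

/-- The point of which an algebra homomorphism remembers the coordinates, after evaluation at `x`. -/
def basePoint (Φ : SFun p q → SFun p q) (x : p → ℝ) : p → ℝ :=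
  fun i => body (Φ (fun y => algebraMap ℝ (Gr q) (y i)) x)

theorem smooth_ofReal {U : Set (p → ℝ)} {r : (p → ℝ) → ℝ} (hr : ContDiffOn ℝ ∞ r U) :
    Smooth U (fun y => algebraMap ℝ (Gr q) (r y)) := contDiffOn_algebraMap hr

theorem Smooth.body {U : Set (p → ℝ)} {f : SFun p q} (hf : Smooth U f) :
    ContDiffOn ℝ ∞ (fun y => body (f y)) U := contDiffOn_grLin BV.body.toLinearMap hf

theorem Smooth.pow {U : Set (p → ℝ)} {f : SFun p q} (hf : Smooth U f) (n : ℕ) : Smooth U (f ^ n) :=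
  contDiffOn_grPow hf n

theorem pow_eq_zero_of_body {s : Gr q} (hs : body s = 0) : s ^ (Fintype.card q + 1) = 0 :=
  soulPow_eq_zero (pow_mem_soulPow hs _)

/-- Multiplication of a superfunction by a real function. -/
def cut (β : (p → ℝ) → ℝ) (u : SFun p q) : SFun p q := fun y => β y • u y

theorem smooth_cut {U V : Set (p → ℝ)} (hV : IsOpen V) {β : (p → ℝ) → ℝ} (hβ : ContDiff ℝ ∞ β)
    (hs : tsupport β ⊆ V) {u : SFun p q} (hu : Smooth V u) : Smooth U (cut β u) := by
  intro y _
  refine ContDiffAt.contDiffWithinAt ?_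
  by_cases hy : y ∈ V
  · exact hβ.contDiffAt.smul (hu.contDiffAt (hV.mem_nhds hy))
  · have h1 : β =ᶠ[nhds y] 0 := notMem_tsupport_iff_eventuallyEq.1 fun h => hy (hs h)
    have h2 : cut β u =ᶠ[nhds y] fun _ => (0 : Gr q) := by
      filter_upwards [h1] with z hz
      simp [cut, hz]
    exact contDiffAt_const.congr_of_eventuallyEq h2

namespace Flow

variable {T : Set ℝ} {U : Set (p → ℝ)} {E : p ⊕ q → p ⊕ q → SFun p q} {ψ : ℝ → SFun p q}
  {𝒰 𝒱 : ℝ → SFun p q → SFun p q} (h : Flow T U E ψ 𝒰 𝒱)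

include h

theorem exp_pow {t : ℝ} (ht : t ∈ T) {f : SFun p q} (hf : Smooth U f) (n : ℕ) {x : p → ℝ}
    (hx : x ∈ U) : 𝒰 t (f ^ n) x = 𝒰 t f x ^ n := by
  induction n with
  | zero => rw [pow_zero, pow_zero, h.exp_one ht hx, Pi.one_apply]
  | succ n ih => rw [pow_succ, pow_succ, h.exp_mul ht (hf.pow n) hf hx, Pi.mul_apply, ih]

theorem exp_sub {t : ℝ} (ht : t ∈ T) {f g : SFun p q} (hf : Smooth U f) (hg : Smooth U g)
    {x : p → ℝ} (hx : x ∈ U) : 𝒰 t (f - g) x = 𝒰 t f x - 𝒰 t g x := by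
  rw [sub_eq_add_neg, ← neg_one_smul ℝ g, h.exp.map_add t ht _ _ hf (hg.smul _) x hx,
    h.exp.map_smul t ht _ _ hg x hx, neg_one_smul, ← sub_eq_add_neg]

theorem exp_algebraMap {t : ℝ} (ht : t ∈ T) (r : ℝ) {x : p → ℝ} (hx : x ∈ U) :
    𝒰 t (fun _ => algebraMap ℝ (Gr q) r) x = algebraMap ℝ (Gr q) r := by
  have e : (fun _ => algebraMap ℝ (Gr q) r : SFun p q) = r • 1 := by
    ext y; simp [Algebra.algebraMap_eq_smul_one]
  rw [e, h.exp.map_smul t ht _ _ (Smooth.one U) x hx, h.exp_one ht hx,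
    Algebra.algebraMap_eq_smul_one, Pi.one_apply]

/-- 𝒰 is multiplicative, so it sends nilpotent superfunctions to nilpotent ones. -/
theorem body_exp_eq_zero {t : ℝ} (ht : t ∈ T) {f : SFun p q} (hf : Smooth U f)
    (hb : ∀ y ∈ U, body (f y) = 0) {x : p → ℝ} (hx : x ∈ U) : body (𝒰 t f x) = 0 := by
  have h1 : Set.EqOn (f ^ (Fintype.card q + 1)) 0 U := fun y hy => pow_eq_zero_of_body (hb y hy)
  have h2 := h.exp.congr t ht _ _ (hf.pow _) h1 hx
  rw [h.exp_pow ht hf _ hx, h.exp_zero_fun ht hx] at h2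
  have h3 := congrArg body h2
  rw [map_pow, Pi.zero_apply, map_zero] at h3
  exact pow_eq_zero_iff (Nat.succ_ne_zero _) |>.1 h3

theorem exists_body_eq_zero {t : ℝ} (ht : t ∈ T) {f : SFun p q} (hf : Smooth U f) {x : p → ℝ}
    (hx : x ∈ U) (h0 : body (𝒰 t f x) = 0) : ∃ y ∈ U, body (f y) = 0 := by
  by_contra! hn
  exact ((h.exp_inverse ht hf (fun y hy => isUnit_of_body_ne_zero (hn y hy)) hx).1.map
    body).ne_zero h0

/-- The sum of squares trick for characters of smooth function algebras. By `body_exp_eq_zero` only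
the real function body f matters. Let c be the body of its image. The image of (body f - c)² + Σ
(y_i - φ_i)² has no body, so this function vanishes somewhere in U; that point must be φ, and body f
equals c there. -/
theorem body_exp {t : ℝ} (ht : t ∈ T) {x : p → ℝ} (hx : x ∈ U) {f : SFun p q} (hf : Smooth U f) :
    basePoint (𝒰 t) x ∈ U ∧ body (𝒰 t f x) = body (f (basePoint (𝒰 t) x)) := by
  set φ := basePoint (𝒰 t) x with hφ
  set fr : SFun p q := fun y => algebraMap ℝ (Gr q) (body (f y)) with hfr
  have hfrs : Smooth U fr := smooth_ofReal hf.body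
  have h1 : body (𝒰 t f x) = body (𝒰 t fr x) := by
    have := h.body_exp_eq_zero ht (hf.sub hfrs) (fun y _ => by simp [hfr]) hx
    rw [h.exp_sub ht hf hfrs hx, map_sub] at this
    linarith
  set c := body (𝒰 t fr x) with hc
  have hconst : ∀ r : ℝ, Smooth U (fun _ => algebraMap ℝ (Gr q) r : SFun p q) :=
    fun r => contDiffOn_const
  have hco : ∀ i, Smooth U (fun y => algebraMap ℝ (Gr q) (y i) : SFun p q) := fun i =>
    smooth_ofReal (contDiff_apply ℝ ℝ i).contDiffOn
  set g : SFun p q := (fr - fun _ => algebraMap ℝ (Gr q) c) ^ 2 +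
    ∑ i, ((fun y => algebraMap ℝ (Gr q) (y i)) - fun _ => algebraMap ℝ (Gr q) (φ i)) ^ 2 with hg
  have hgs : Smooth U g := ((hfrs.sub (hconst c)).pow 2).add
    (Smooth.sum _ fun i _ => ((hco i).sub (hconst _)).pow 2)
  have h2 : body (𝒰 t g x) = 0 := by
    rw [h.exp.map_add t ht _ _ ((hfrs.sub (hconst c)).pow 2)
      (Smooth.sum _ fun i _ => ((hco i).sub (hconst _)).pow 2) x hx,
      h.exp_sum _ ht (fun i => ((hco i).sub (hconst _)).pow 2) hx,
      h.exp_pow ht (hfrs.sub (hconst c)) 2 hx, h.exp_sub ht hfrs (hconst c) hx,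
      h.exp_algebraMap ht c hx, Finset.sum_apply]
    have h3 : ∀ i, 𝒰 t (((fun y => algebraMap ℝ (Gr q) (y i)) -
        fun _ => algebraMap ℝ (Gr q) (φ i)) ^ 2) x =
        (𝒰 t (fun y => algebraMap ℝ (Gr q) (y i)) x - algebraMap ℝ (Gr q) (φ i)) ^ 2 := fun i => by
      rw [h.exp_pow ht ((hco i).sub (hconst _)) 2 hx, h.exp_sub ht (hco i) (hconst _) hx,
        h.exp_algebraMap ht _ hx]
    simp only [h3, map_add, map_pow, map_sub, map_sum, AlgHom.commutes, Algebra.algebraMap_self,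
      RingHom.id_apply, ← hc]
    simp [hφ, basePoint]
  obtain ⟨y, hy, hy0⟩ := h.exists_body_eq_zero ht hgs hx h2
  have h4 : (body (f y) - c) ^ 2 + ∑ i, (y i - φ i) ^ 2 = 0 := by
    rw [← hy0]
    simp [hg, hfr]
  have h5 : 0 ≤ ∑ i, (y i - φ i) ^ 2 := Finset.sum_nonneg fun i _ => sq_nonneg _
  have h6 : ∑ i, (y i - φ i) ^ 2 = 0 := le_antisymm (by nlinarith [sq_nonneg (body (f y) - c)]) h5
  have h7 : y = φ := by
    ext i
    have := (Finset.sum_eq_zero_iff_of_nonneg fun i _ => sq_nonneg (y i - φ i)).1 h6 i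
      (Finset.mem_univ i)
    exact sub_eq_zero.1 (pow_eq_zero_iff two_ne_zero |>.1 this)
  have h8 : body (f y) = c := by
    rw [h6, add_zero] at h4
    exact sub_eq_zero.1 (pow_eq_zero_iff two_ne_zero |>.1 h4)
  rw [← h7]
  exact ⟨hy, by rw [h1, h8]⟩

theorem basePoint_mem {t : ℝ} (ht : t ∈ T) {x : p → ℝ} (hx : x ∈ U) : basePoint (𝒰 t) x ∈ U :=
  (h.body_exp ht hx (Smooth.one U)).1

theorem continuousOn_basePoint {t : ℝ} (ht : t ∈ T) : ContinuousOn (basePoint (𝒰 t)) U :=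
  continuousOn_pi.2 fun i => (h.smooth_exp ht
    (smooth_ofReal (contDiff_apply ℝ ℝ i).contDiffOn)).body.continuousOn

/-- Let g = 1 - β for a bump β supported where f vanishes. Then f = f gⁿ for every n, while g
vanishes at the base point, so its image has no body and is nilpotent. -/
theorem exp_eq_zero_of_eventually {t : ℝ} (ht : t ∈ T) {x : p → ℝ} (hx : x ∈ U) {f : SFun p q}
    (hf : Smooth U f) (h0 : ∀ᶠ y in nhds (basePoint (𝒰 t) x), f y = 0) : 𝒰 t f x = 0 := by
  obtain ⟨r, hr, hball⟩ := Metric.eventually_nhds_iff_ball.1 h0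
  set β : ContDiffBump (basePoint (𝒰 t) x) := ⟨r / 4, r / 2, by positivity, by linarith⟩ with hβ
  set g : SFun p q := fun y => algebraMap ℝ (Gr q) (1 - β y) with hg
  have hgs : Smooth U g := smooth_ofReal (contDiff_const.sub β.contDiff).contDiffOn
  have h1 : Set.EqOn (f * g ^ (Fintype.card q + 1)) f U := by
    intro y _
    by_cases hy : y ∈ Metric.ball (basePoint (𝒰 t) x) r
    · simp [hball y hy]
    · have : β y = 0 := β.zero_of_le_dist (by
        rw [Metric.mem_ball, not_lt] at hy
        change r / 2 ≤ _
        linarith)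
      simp [hg, this]
  have h2 : body (𝒰 t g x) = 0 := by
    rw [(h.body_exp ht hx hgs).2]
    have : β (basePoint (𝒰 t) x) = 1 := β.eventuallyEq_one.self_of_nhds
    simp [hg, this]
  rw [← h.exp.congr t ht _ _ (hf.mul (hgs.pow _)) h1 hx, h.exp_mul ht hf (hgs.pow _) hx,
    Pi.mul_apply, h.exp_pow ht hgs _ hx, pow_eq_zero_of_body h2, mul_zero]

theorem exp_congr_of_eventually {t : ℝ} (ht : t ∈ T) {x : p → ℝ} (hx : x ∈ U) {f g : SFun p q}
    (hf : Smooth U f) (hg : Smooth U g) (h0 : f =ᶠ[nhds (basePoint (𝒰 t) x)] g) :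
    𝒰 t f x = 𝒰 t g x := by
  refine sub_eq_zero.1 ?_
  rw [← h.exp_sub ht hf hg hx]
  refine h.exp_eq_zero_of_eventually ht hx (hf.sub hg) ?_
  filter_upwards [h0] with y hy
  rw [Pi.sub_apply, hy, sub_self]

/-- The evaluation of a path-ordered exponential at a point, for superfunctions defined near the
base point. -/
theorem localChar {t : ℝ} (ht : t ∈ T) {x : p → ℝ} (hx : x ∈ U) {V : Set (p → ℝ)} (hV : IsOpen V)
    {β : (p → ℝ) → ℝ} (hβ : ContDiff ℝ ∞ β) (hs : tsupport β ⊆ V)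
    (h1 : β =ᶠ[nhds (basePoint (𝒰 t) x)] 1) : LocalChar V fun u => 𝒰 t (cut β u) x where
  congr F G hF hFG := by
    have e : cut β F = cut β G := by
      ext1 y
      by_cases hy : y ∈ V
      · rw [cut, cut, hFG hy]
      · have : β y = 0 := image_eq_zero_of_notMem_tsupport fun h => hy (hs h)
        rw [cut, cut, this, zero_smul, zero_smul]
    rw [e]
  map_add F G hF hG := by
    rw [← h.exp.map_add t ht _ _ (smooth_cut hV hβ hs hF) (smooth_cut hV hβ hs hG) x hx]
    congr 1
    ext1 y
    exact smul_add _ _ _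
  map_mul F G hF hG := by
    have e := h.exp_mul ht (smooth_cut hV hβ hs hF) (smooth_cut hV hβ hs hG) hx
    refine Eq.trans ?_ e
    -- The functions cut by β and by β² differ, but they have the same germ at the base point, where
    -- β is 1, and only that germ counts.
    refine h.exp_congr_of_eventually ht hx (smooth_cut hV hβ hs (hF.mul hG))
      ((smooth_cut hV hβ hs hF).mul (smooth_cut hV hβ hs hG)) ?_
    filter_upwards [h1] with y hy
    simp [cut, hy]
  map_smul r F hF := by
    rw [← h.exp.map_smul t ht _ _ (smooth_cut hV hβ hs hF) x hx]
    congr 1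
    ext1 y
    exact smul_comm (β y) r (F y)
  map_one := by
    rw [h.exp_congr_of_eventually ht hx (smooth_cut hV hβ hs (Smooth.one V)) (Smooth.one U) ?_,
      h.exp_one ht hx, Pi.one_apply]
    filter_upwards [h1] with y hy
    simp [cut, hy]
  parity F e hF he := by
    refine h.exp_parity ht (smooth_cut hV hβ hs hF) (fun y _ => ?_) x hx
    by_cases hy : y ∈ V
    · exact Submodule.smul_mem _ _ (he y hy)
    · have : β y = 0 := image_eq_zero_of_notMem_tsupport fun h => hy (hs h)
      rw [cut, this, zero_smul]
      exact Submodule.zero_mem _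

theorem exp_cut {t : ℝ} (ht : t ∈ T) {x : p → ℝ} (hx : x ∈ U) {V : Set (p → ℝ)} (hV : IsOpen V)
    (hVU : V ⊆ U) {β : (p → ℝ) → ℝ} (hβ : ContDiff ℝ ∞ β) (hs : tsupport β ⊆ V)
    (h1 : β =ᶠ[nhds (basePoint (𝒰 t) x)] 1) {f : SFun p q} (hf : Smooth U f) :
    𝒰 t (cut β f) x = 𝒰 t f x := by
  refine h.exp_congr_of_eventually ht hx (smooth_cut hV hβ hs (ContDiffOn.mono hf hVU)) hf ?_
  filter_upwards [h1] with y hy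
  simp [cut, hy]

/-- The logarithm of a cut-off function is undefined where the cut-off vanishes. Adding the constant
r with weight 1 - β, where r has the sign of body f, gives a function on all of U with nowhere
vanishing body and with the germ of f at the base point. -/
theorem exp_cut_grLog {t : ℝ} (ht : t ∈ T) {x : p → ℝ} (hx : x ∈ U) {V : Set (p → ℝ)}
    (hV : IsOpen V) {β : (p → ℝ) → ℝ} (hβ : ContDiff ℝ ∞ β) (hs : tsupport β ⊆ V)
    (h1 : β =ᶠ[nhds (basePoint (𝒰 t) x)] 1) (h01 : ∀ y, β y ∈ Set.Icc (0 : ℝ) 1) {f : SFun p q}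
    (hf : Smooth V f) (he : HasParity V 0 f) {r : ℝ} (hr : ∀ y ∈ V, 0 < r * body (f y)) :
    𝒰 t (cut β fun y => grLog (f y)) x = grLog (𝒰 t (cut β f) x) := by
  have hbV : ∀ y ∈ V, body (f y) ≠ 0 := fun y hy h0 => by
    have := hr y hy
    rw [h0, mul_zero] at this
    exact this.false
  set z : SFun p q := cut β f + fun y => algebraMap ℝ (Gr q) ((1 - β y) * r) with hz
  have hcs := smooth_cut (U := U) hV hβ hs hf
  have hzs : Smooth U z := hcs.add
    (smooth_ofReal ((contDiff_const.sub hβ).mul contDiff_const).contDiffOn)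
  have hze : HasParity U 0 z := by
    intro y _
    refine Submodule.add_mem (grPart q 0) (x := cut β f y) ?_ (algebraMap_mem_grPart _)
    by_cases hy : y ∈ V
    · exact Submodule.smul_mem _ _ (he y hy)
    · have : β y = 0 := image_eq_zero_of_notMem_tsupport fun h => hy (hs h)
      rw [cut, this, zero_smul]
      exact Submodule.zero_mem _
  by_cases hVe : V = ∅
  · exfalso
    have h2 : β (basePoint (𝒰 t) x) = 1 := h1.self_of_nhds
    have h3 : β (basePoint (𝒰 t) x) = 0 :=
      image_eq_zero_of_notMem_tsupport fun h => by simpa [hVe] using hs h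
    linarith
  obtain ⟨y₀, hy₀⟩ := Set.nonempty_iff_ne_empty.2 hVe
  have hr0 : r ≠ 0 := fun h0 => by
    have := hr y₀ hy₀
    rw [h0, zero_mul] at this
    exact this.false
  have hzb : ∀ y ∈ U, body (z y) ≠ 0 := by
    intro y _ h0
    have h2 : r * body (z y) = β y * (r * body (f y)) + (1 - β y) * (r * r) := by
      simp [hz, cut]; ring
    have hrr : 0 < r * r := mul_self_pos.2 hr0
    rw [h0, mul_zero] at h2
    by_cases hy : y ∈ V
    · have h3 := hr y hy
      rcases (h01 y).1.eq_or_lt with h4 | h4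
      · rw [← h4] at h2; linarith
      · have := mul_pos h4 h3
        have := mul_nonneg (sub_nonneg.2 (h01 y).2) hrr.le
        linarith
    · have : β y = 0 := image_eq_zero_of_notMem_tsupport fun h => hy (hs h)
      rw [this] at h2
      linarith
  have e1 : z =ᶠ[nhds (basePoint (𝒰 t) x)] cut β f := by
    filter_upwards [h1] with y hy
    simp [hz, hy]
  have e2 : (fun y => grLog (z y)) =ᶠ[nhds (basePoint (𝒰 t) x)] cut β fun y => grLog (f y) := by
    filter_upwards [h1] with y hy
    simp [hz, hy, cut]
  rw [← h.exp_congr_of_eventually ht hx hzs hcs e1,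
    ← h.exp_congr_of_eventually ht hx (contDiffOn_grLog hzs hzb)
      (smooth_cut hV hβ hs (contDiffOn_grLog hf hbV)) e2, h.exp_grLog ht hzs hze hzb hx]

end Flow
end Locality

/-! ### Deformed frames -/

section Frame

variable {a b : ℕ}

/-- The constraint at a given position of `{F;G}`, if there is one. -/
def conIdx : Coord₀ a b → Option (CIdx a b)
  | Sum.inl (Sum.inl i) => some (Sum.inl i)
  | Sum.inl (Sum.inr _) => none
  | Sum.inr (Sum.inl _) => none
  | Sum.inr (Sum.inr j) => some (Sum.inr j)

/-- The position of a constraint in `{F;G}`. -/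
def conPos : CIdx a b → Coord₀ a b :=
  Sum.elim (fun i => Sum.inl (Sum.inl i)) (fun j => Sum.inr (Sum.inr j))

theorem conIdx_conPos (α : CIdx a b) : conIdx (conPos α) = some α := by
  rcases α with i | j <;> rfl

theorem par_conPos (α : CIdx a b) : par (conPos α) = eps α := by
  rcases α with i | j <;> rfl

theorem barGamma_conPos (F G : CIdx a b → SFun₀ a b) (α : CIdx a b) :
    barGamma F G (conPos α) = G α := by
  rcases α with i | j <;> rfl

theorem conIdx_cases (A : Coord₀ a b) :
    (∃ α, A = conPos α) ∨ (conIdx A = none ∧ ∃ α, par A = eps α + 1 ∧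
      ∀ F G : CIdx a b → SFun₀ a b, barGamma F G A = F α) := by
  rcases A with (i | j) | (i | j)
  · exact Or.inl ⟨Sum.inl i, rfl⟩
  · exact Or.inr ⟨rfl, Sum.inr j, one_add_one_zmod.symm, fun _ _ => rfl⟩
  · exact Or.inr ⟨rfl, Sum.inl i, (zero_add 1).symm, fun _ _ => rfl⟩
  · exact Or.inl ⟨Sum.inr j, rfl⟩

theorem sum_conPos {V : Type*} [AddCommMonoid V] (f : Coord₀ a b → V)
    (hf : ∀ C, conIdx C = none → f C = 0) : ∑ C, f C = ∑ β, f (conPos β) := by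
  rw [Fintype.sum_sum_type, Fintype.sum_sum_type, Fintype.sum_sum_type, Fintype.sum_sum_type]
  simp only [hf (Sum.inl (Sum.inr _)) rfl, hf (Sum.inr (Sum.inl _)) rfl, Finset.sum_const_zero,
    add_zero, zero_add]
  rfl

/-- A matrix acting on the constraints, extended by zero to `{F;G}`. -/
def hat {V : Type*} [Zero V] (M : CIdx a b → CIdx a b → V) (A C : Coord₀ a b) : V :=
  (conIdx A).elim 0 fun α => (conIdx C).elim 0 fun β => M α β

theorem hat_conPos {V : Type*} [Zero V] (M : CIdx a b → CIdx a b → V) (α β : CIdx a b) :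
    hat M (conPos α) (conPos β) = M α β := by simp [hat, conIdx_conPos]

theorem hat_left {V : Type*} [Zero V] (M : CIdx a b → CIdx a b → V) {A : Coord₀ a b}
    (hA : conIdx A = none) (C : Coord₀ a b) : hat M A C = 0 := by simp [hat, hA]

theorem hat_right {V : Type*} [Zero V] (M : CIdx a b → CIdx a b → V) (A : Coord₀ a b)
    {C : Coord₀ a b} (hC : conIdx C = none) : hat M A C = 0 := by
  rcases h : conIdx A with _ | α <;> simp [hat, hC, h]

/-- Families of functions `F`, constraints `G` and quantum corrections `H` with covariant
derivatives `0`, `M G` and `Δψ - str M + ν G`. -/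
structure DeformedFrame (T : Set ℝ) (U : Set (CIdx a b → ℝ)) (ρ : SFun₀ a b)
    (E : Coord₀ a b → Coord₀ a b → SFun₀ a b) (ψ : ℝ → SFun₀ a b)
    (F G : ℝ → CIdx a b → SFun₀ a b) (M : CIdx a b → CIdx a b → ℝ → SFun₀ a b)
    (H : ℝ → SFun₀ a b) (ν : CIdx a b → ℝ → SFun₀ a b) : Prop where
  density : IsDensity U ρ
  smooth_F : ∀ α, SmoothFamily T U fun t => F t α
  smooth_G : ∀ α, SmoothFamily T U fun t => G t α
  smooth_M : ∀ α β, SmoothFamily T U (M α β)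
  smooth_H : SmoothFamily T U H
  smooth_ν : ∀ α, SmoothFamily T U (ν α)
  parity_F : ∀ α, ∀ t ∈ T, HasParity U (eps α + 1) (F t α)
  parity_G : ∀ α, ∀ t ∈ T, HasParity U (eps α) (G t α)
  parity_M : ∀ α β, ∀ t ∈ T, HasParity U (eps α + eps β) (M α β t)
  nabla_F : ∀ α, ∀ t ∈ T, Set.EqOn (nabla E ψ (fun t => F t α) t) 0 U
  nabla_G : ∀ α, ∀ t ∈ T,
    Set.EqOn (nabla E ψ (fun t => G t α) t) (∑ β, M α β t * G t β) U
  nabla_H : ∀ t ∈ T, ∀ x ∈ U, nabla E ψ H t x = oddLaplacian ρ E (ψ t) x -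
    ∑ α, sg (eps α) • M α α t x + ∑ β, ν β t x * G t β x

/-- The pull-back of the Jacobian matrix. -/
def pullJac (𝒱 : ℝ → SFun₀ a b → SFun₀ a b) (F G : ℝ → CIdx a b → SFun₀ a b) (t : ℝ)
    (y : CIdx a b → ℝ) : Matrix (Coord₀ a b) (Coord₀ a b) (Gr (CIdx a b)) :=
  Matrix.of fun A B => 𝒱 t (dR B (barGamma (F t) (G t) A)) y

/-- The pull-back of the matrix of antibrackets. -/
def pullBr (𝒱 : ℝ → SFun₀ a b → SFun₀ a b) (E : Coord₀ a b → Coord₀ a b → SFun₀ a b)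
    (F G : ℝ → CIdx a b → SFun₀ a b) (t : ℝ) (y : CIdx a b → ℝ) :
    Matrix (CIdx a b) (CIdx a b) (Gr (CIdx a b)) :=
  Matrix.of fun α β => 𝒱 t (bracket E (F t α) (G t β)) y

/-- The pull-back of the Jacobian matrix of a Hamiltonian vector field. -/
def pullHam (𝒱 : ℝ → SFun₀ a b → SFun₀ a b) (E : Coord₀ a b → Coord₀ a b → SFun₀ a b)
    (ψ : ℝ → SFun₀ a b) (t : ℝ) (y : CIdx a b → ℝ) :
    Matrix (Coord₀ a b) (Coord₀ a b) (Gr (CIdx a b)) :=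
  Matrix.of fun C B => 𝒱 t (dR B (hamCoef E (ψ t) C)) y

/-- The pull-back of the rotation of the constraints, acting on `{F;G}`. -/
def pullRot (𝒱 : ℝ → SFun₀ a b → SFun₀ a b) (M : CIdx a b → CIdx a b → ℝ → SFun₀ a b) (t : ℝ)
    (y : CIdx a b → ℝ) : Matrix (Coord₀ a b) (Coord₀ a b) (Gr (CIdx a b)) :=
  Matrix.of fun A C => 𝒱 t (hat (fun α β => M α β t) A C) y

/-- The pull-back of the rotation of the constraints, acting from the right. -/
def pullRotRight (𝒱 : ℝ → SFun₀ a b → SFun₀ a b) (M : CIdx a b → CIdx a b → ℝ → SFun₀ a b)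
    (t : ℝ) (y : CIdx a b → ℝ) : Matrix (CIdx a b) (CIdx a b) (Gr (CIdx a b)) :=
  Matrix.of fun γ β => sg ((eps β + eps γ) * eps γ) • 𝒱 t (M β γ t) y

/-- The coefficients of the constraints in the derivative of the Jacobian matrix. -/
def jacCoef (𝒱 : ℝ → SFun₀ a b → SFun₀ a b) (M : CIdx a b → CIdx a b → ℝ → SFun₀ a b)
    (A B : Coord₀ a b) (β : CIdx a b) (t : ℝ) : SFun₀ a b :=
  sg (par B * eps β) • 𝒱 t (dR B (hat (fun α β => M α β t) A (conPos β)))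

/-- The coefficients of the constraints in the derivative of the matrix of antibrackets. -/
def brCoef (𝒱 : ℝ → SFun₀ a b → SFun₀ a b) (E : Coord₀ a b → Coord₀ a b → SFun₀ a b)
    (F : ℝ → CIdx a b → SFun₀ a b) (M : CIdx a b → CIdx a b → ℝ → SFun₀ a b)
    (α β γ : CIdx a b) (t : ℝ) : SFun₀ a b :=
  𝒱 t (bracket E (F t α) (M β γ t))

namespace DeformedFrame

variable {T : Set ℝ} {U : Set (CIdx a b → ℝ)} {ρ : SFun₀ a b}
  {E : Coord₀ a b → Coord₀ a b → SFun₀ a b} {ψ : ℝ → SFun₀ a b}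
  {F G : ℝ → CIdx a b → SFun₀ a b} {M : CIdx a b → CIdx a b → ℝ → SFun₀ a b}
  {H : ℝ → SFun₀ a b} {ν : CIdx a b → ℝ → SFun₀ a b} {𝒰 𝒱 : ℝ → SFun₀ a b → SFun₀ a b}
  (D : DeformedFrame T U ρ E ψ F G M H ν) (h : Flow T U E ψ 𝒰 𝒱)

include D

theorem smooth_barGamma (A : Coord₀ a b) :
    SmoothFamily T U fun t => barGamma (F t) (G t) A := by
  rcases conIdx_cases A with ⟨α, rfl⟩ | ⟨_, α, _, hα⟩
  · simpa only [barGamma_conPos] using D.smooth_G α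
  · simpa only [hα] using D.smooth_F α

theorem parity_barGamma (A : Coord₀ a b) {t : ℝ} (ht : t ∈ T) :
    HasParity U (par A) (barGamma (F t) (G t) A) := by
  rcases conIdx_cases A with ⟨α, rfl⟩ | ⟨_, α, hp, hα⟩
  · rw [barGamma_conPos, par_conPos]; exact D.parity_G α t ht
  · rw [hα, hp]; exact D.parity_F α t ht

theorem smooth_hat (A C : Coord₀ a b) : SmoothFamily T U fun t => hat (fun α β => M α β t) A C := by
  rcases conIdx_cases A with ⟨α, rfl⟩ | ⟨hA, -⟩
  · rcases conIdx_cases C with ⟨β, rfl⟩ | ⟨hC, -⟩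
    · simpa only [hat_conPos] using D.smooth_M α β
    · simpa only [hat_right _ _ hC] using SmoothFamily.const (Smooth.zero U)
  · simpa only [hat_left _ hA] using SmoothFamily.const (Smooth.zero U)

theorem parity_hat (A C : Coord₀ a b) {t : ℝ} (ht : t ∈ T) :
    HasParity U (par A + par C) (hat (fun α β => M α β t) A C) := by
  have hz : ∀ e, HasParity U e (0 : SFun₀ a b) := fun e x _ => Submodule.zero_mem _
  rcases conIdx_cases A with ⟨α, rfl⟩ | ⟨hA, -⟩
  · rcases conIdx_cases C with ⟨β, rfl⟩ | ⟨hC, -⟩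
    · rw [hat_conPos, par_conPos, par_conPos]; exact D.parity_M α β t ht
    · rw [hat_right _ _ hC]; exact hz _
  · rw [hat_left _ hA]; exact hz _

include h

/-- Extending M by zero to the positions of F puts ∇F = 0 and ∇G = M G into one matrix equation for
{F;G}. -/
theorem nabla_barGamma (A : Coord₀ a b) {t : ℝ} (ht : t ∈ T) :
    Set.EqOn (nabla E ψ (fun t => barGamma (F t) (G t) A) t)
      (∑ C, hat (fun α β => M α β t) A C * barGamma (F t) (G t) C) U := by
  rw [sum_conPos _ fun C hC => by rw [hat_right _ _ hC, zero_mul]]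
  rcases conIdx_cases A with ⟨α, rfl⟩ | ⟨hA, α, _, hα⟩
  · simp only [barGamma_conPos, hat_conPos]
    exact D.nabla_G α t ht
  · simp only [hat_left _ hA, zero_mul, Finset.sum_const_zero, hα]
    exact D.nabla_F α t ht

theorem hasDerivAt_pullG {t : ℝ} (ht : t ∈ T) {y : CIdx a b → ℝ} (hy : y ∈ U) (α : CIdx a b) :
    HasDerivAt (fun s => 𝒱 s (G s α) y) (∑ β, 𝒱 t (M α β t) y * 𝒱 t (G t β) y) t := by
  refine (h.hasDerivAt_inv (D.smooth_G α) ht hy).congr_deriv ?_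
  have hM := fun β => (D.smooth_M α β).smooth ht
  have hG := fun β => (D.smooth_G β).smooth ht
  rw [h.congr_inv t ht _ _ ((h.smooth_nabla (D.smooth_G α)).smooth ht) (D.nabla_G α t ht) hy,
    h.inv_sum _ ht (fun β => (hM β).mul (hG β)) hy, Finset.sum_apply]
  exact Finset.sum_congr rfl fun β _ => h.inv_mul ht (hM β) (hG β) hy

/-- The right factor comes from the commutator of ∂_B with the vector field, the left factor from
the rotation of the constraints. The remainder is the derivative falling on M, and there only
constraints multiply. -/
theorem hasMatDeriv_pullJac {t : ℝ} (ht : t ∈ T) {y : CIdx a b → ℝ} (hy : y ∈ U) :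
    HasMatDeriv (fun s => pullJac 𝒱 F G s y)
      (pullJac 𝒱 F G t y * pullHam 𝒱 E ψ t y + pullRot 𝒱 M t y * pullJac 𝒱 F G t y +
        Matrix.of fun A B => ∑ β, jacCoef 𝒱 M A B β t y * 𝒱 t (G t β) y) t := by
  intro A B
  have hf := fun A => (D.smooth_barGamma A).smooth ht
  have hm := fun C => (D.smooth_hat A C).smooth ht
  have hfR := fun A => (hf A).dR h.isOpen B
  have hmR := fun C => (hm C).dR h.isOpen B
  have hfC := fun C => (hf A).dR h.isOpen C
  have hN := fun C => (Smooth.hamCoef h.isOpen h.antisymplectic (h.smooth_gen_at ht) C).dR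
    h.isOpen B
  have hzf := (D.smooth_barGamma A).dR h.isOpen_time h.isOpen B
  refine (h.hasDerivAt_inv hzf ht hy).congr_deriv ?_
  have e : Set.EqOn (nabla E ψ (fun t => dR B (barGamma (F t) (G t) A)) t)
      ((∑ C, dR C (barGamma (F t) (G t) A) * dR B (hamCoef E (ψ t) C)) +
        ((∑ C, hat (fun α β => M α β t) A C * dR B (barGamma (F t) (G t) C)) +
        ∑ C, dR B (hat (fun α β => M α β t) A C) * twF (par B) (barGamma (F t) (G t) C))) U := by
    intro x hx
    rw [h.nabla_dR (D.smooth_barGamma A) B ht hx,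
      dR_congr_on h.isOpen B (D.nabla_barGamma h A ht) hx,
      dR_sum _ _ fun C _ => ((hm C).mul (hf C)).differentiableAt h.isOpen hx,
      Pi.add_apply, Pi.add_apply, Finset.sum_apply, Finset.sum_apply, Finset.sum_apply]
    refine congrArg₂ _ rfl ?_
    rw [← Finset.sum_add_distrib]
    exact Finset.sum_congr rfl fun C _ => dR_mul B ((hm C).differentiableAt h.isOpen hx)
      ((hf C).differentiableAt h.isOpen hx)
  have s1 := fun C => (hfC C).mul (hN C)
  have s2 := fun C => (hm C).mul (hfR C)
  have s3 := fun C => (hmR C).mul ((hf C).tw (par B))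
  rw [h.congr_inv t ht _ _ ((h.smooth_nabla hzf).smooth ht) e hy,
    h.inv_add ht (Smooth.sum _ fun C _ => s1 C)
      ((Smooth.sum _ fun C _ => s2 C).add (Smooth.sum _ fun C _ => s3 C)) hy, Pi.add_apply,
    h.inv_add ht (Smooth.sum _ fun C _ => s2 C) (Smooth.sum _ fun C _ => s3 C) hy, Pi.add_apply,
    h.inv_sum _ ht s1 hy, h.inv_sum _ ht s2 hy, h.inv_sum _ ht s3 hy, Finset.sum_apply,
    Finset.sum_apply, Finset.sum_apply, ← add_assoc]
  simp only [Matrix.add_apply, Matrix.mul_apply, Matrix.of_apply]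
  congr 1
  · congr 1
    · exact Finset.sum_congr rfl fun C _ => h.inv_mul ht (hfC C) (hN C) hy
    · exact Finset.sum_congr rfl fun C _ => h.inv_mul ht (hm C) (hfR C) hy
  · rw [sum_conPos _ fun C hC => ?_]
    · refine Finset.sum_congr rfl fun β _ => ?_
      have hp := h.inv_parity ht ((D.smooth_G β).smooth ht) (D.parity_G β t ht) y hy
      rw [h.inv_mul ht (hmR _) ((hf _).tw _) hy, Pi.mul_apply, h.inv_tw ht (hf _) _ hy,
        barGamma_conPos, twF_apply, tw_of_mem hp, jacCoef, Pi.smul_apply, smul_mul_assoc,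
        mul_smul_comm]
    · have hz : dR B (hat (fun α β => M α β t) A C) = 0 := by
        rw [hat_right _ _ hC]
        ext1 x
        rw [dR_eq, dL_zero, map_zero]
        rfl
      rw [hz, zero_mul, h.inv_zero_fun ht hy]
      rfl

/-- Since ∇F = 0, only the second entry contributes, through (F, M G). The Leibniz rule gives a
right multiplication by a signed transpose of M and a remainder (F, M) G. -/
theorem hasMatDeriv_pullBr {t : ℝ} (ht : t ∈ T) {y : CIdx a b → ℝ} (hy : y ∈ U) :
    HasMatDeriv (fun s => pullBr 𝒱 E F G s y)
      (pullBr 𝒱 E F G t y * pullRotRight 𝒱 M t y +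
        Matrix.of fun α β => ∑ γ, brCoef 𝒱 E F M α β γ t y * 𝒱 t (G t γ) y) t := by
  intro α β
  have hU := h.isOpen
  have hE := h.antisymplectic
  have hF := fun α => (D.smooth_F α).smooth ht
  have hG := fun α => (D.smooth_G α).smooth ht
  have hM := fun α β => (D.smooth_M α β).smooth ht
  have hz := (D.smooth_F α).bracket h.isOpen_time hU hE.smooth (D.smooth_G β)
  refine (h.hasDerivAt_inv hz ht hy).congr_deriv ?_
  have e : Set.EqOn (nabla E ψ (fun t => bracket E (F t α) (G t β)) t)
      ((∑ γ, bracket E (F t α) (G t γ) * (sg ((eps β + eps γ) * eps γ) • M β γ t)) +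
        ∑ γ, bracket E (F t α) (M β γ t) * G t γ) U := by
    intro x hx
    rw [h.nabla_bracket (D.smooth_F α) (D.smooth_G β) ht hx, Pi.add_apply,
      bracket_congr hU E (D.nabla_F α t ht) (fun _ _ => rfl) hx,
      bracket_congr hU E (fun _ _ => rfl) (D.nabla_G β t ht) hx,
      bracket_sum_right _ hU E _ (fun γ _ => (hM β γ).mul (hG γ)) hx, Pi.add_apply,
      Finset.sum_apply, Finset.sum_apply, ← Finset.sum_add_distrib]
    have h0 : bracket E (0 : SFun₀ a b) (G t β) x = 0 := by
      rw [bracket_apply]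
      refine Finset.sum_eq_zero fun A _ => Finset.sum_eq_zero fun B _ => ?_
      rw [dR_eq, dL_zero, map_zero, zero_mul, zero_mul]
    rw [h0, zero_add]
    refine Finset.sum_congr rfl fun γ _ => ?_
    have hp := D.parity_M β γ t ht x hx
    have hb := HasParity.bracket hU hE (hF α) (hG γ) (D.parity_F α t ht) (D.parity_G γ t ht) x hx
    rw [bracket_mul_right hU hE (hF α) (D.parity_F α t ht) (hM β γ) (hG γ) hx, add_comm,
      Pi.mul_apply, Pi.mul_apply, Pi.smul_apply, tw_of_mem hp, smul_mul_assoc,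
      mul_comm_of_mem hp hb, smul_smul, mul_smul_comm]
    congr 2
    generalize eps α = u
    generalize eps β = v
    generalize eps γ = w
    rcases zmod_two_cases u with rfl | rfl <;> rcases zmod_two_cases v with rfl | rfl <;>
      rcases zmod_two_cases w with rfl | rfl <;> simp [sg_zero, sg_one, one_add_one_zmod]
  have hb := fun γ => Smooth.bracket hU hE.smooth (hF α) (hG γ)
  have hbM := fun γ => Smooth.bracket hU hE.smooth (hF α) (hM β γ)
  have s1 := fun γ => (hb γ).mul ((hM β γ).smul (sg ((eps β + eps γ) * eps γ)))
  have s2 := fun γ => (hbM γ).mul (hG γ)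
  rw [h.congr_inv t ht _ _ ((h.smooth_nabla hz).smooth ht) e hy,
    h.inv_add ht (Smooth.sum _ fun C _ => s1 C) (Smooth.sum _ fun C _ => s2 C) hy, Pi.add_apply,
    h.inv_sum _ ht s1 hy, h.inv_sum _ ht s2 hy, Finset.sum_apply, Finset.sum_apply]
  simp only [Matrix.add_apply, Matrix.mul_apply, Matrix.of_apply]
  congr 1
  · refine Finset.sum_congr rfl fun γ _ => ?_
    rw [h.inv_mul ht (hb γ) ((hM β γ).smul _) hy, Pi.mul_apply, h.inv_smul ht (hM β γ) _ hy]
    rfl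
  · exact Finset.sum_congr rfl fun γ _ => h.inv_mul ht (hbM γ) (hG γ) hy

end DeformedFrame
end Frame

/-! ### Non-vanishing of determinants along linear flows -/

section BodyDet

/-- Uniqueness backwards in time: a solution that vanishes at t coincides with the zero solution on
[0, t]. -/
theorem ne_zero_of_linear {d c : ℝ → ℝ} (hc : ContinuousOn c (Set.Icc 0 1))
    (hd : ∀ t ∈ Set.Icc (0 : ℝ) 1, HasDerivAt d (c t * d t) t) (h0 : d 0 ≠ 0) {t : ℝ}
    (ht : t ∈ Set.Icc (0 : ℝ) 1) : d t ≠ 0 := by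
  intro hdt
  obtain ⟨K, hK⟩ := isCompact_Icc.exists_bound_of_continuousOn hc
  have hsub : Set.Icc 0 t ⊆ Set.Icc (0 : ℝ) 1 := Set.Icc_subset_Icc_right ht.2
  have h1 := ODE_solution_unique_of_mem_Icc_left (v := fun s x => c s * x) (s := fun _ => Set.univ)
    (K := K.toNNReal) (f := d) (g := fun _ => 0) (a := 0) (b := t)
    (fun s hs => by
      refine LipschitzWith.lipschitzOnWith (LipschitzWith.of_dist_le_mul fun x y => ?_)
      rw [Real.dist_eq, Real.dist_eq, ← mul_sub, abs_mul]
      exact mul_le_mul_of_nonneg_right ((hK s (hsub (Set.Ioc_subset_Icc_self hs))).trans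
        (Real.le_coe_toNNReal K)) (abs_nonneg _))
    (fun s hs => (hd s (hsub hs)).continuousAt.continuousWithinAt)
    (fun s hs => (hd s (hsub (Set.Ioc_subset_Icc_self hs))).hasDerivWithinAt)
    (fun s _ => Set.mem_univ _) continuousOn_const
    (fun s _ => ((hasDerivAt_const s (0 : ℝ)).congr_deriv (mul_zero _).symm).hasDerivWithinAt)
    (fun s _ => Set.mem_univ _) hdt
  exact h0 (h1 ⟨le_rfl, ht.1⟩)

variable {ι q : Type} [Fintype ι] [DecidableEq ι] [Fintype q]

/-- Liouville's formula for the bodies: as Z has no body, the determinant of the body of M is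
multiplied by tr N + tr P under differentiation, so it cannot reach zero. -/
theorem isUnit_of_linear_flow {M N P Z : ℝ → Matrix ι ι (Gr q)}
    (hN : ∀ i j, ContinuousOn (fun t => N t i j) (Set.Icc 0 1))
    (hP : ∀ i j, ContinuousOn (fun t => P t i j) (Set.Icc 0 1))
    (hM : ∀ t ∈ Set.Icc (0 : ℝ) 1, HasMatDeriv M (M t * N t + P t * M t + Z t) t)
    (hZ : ∀ t ∈ Set.Icc (0 : ℝ) 1, bodyMat (Z t) = 0) (h0 : IsUnit (M 0)) {t : ℝ}
    (ht : t ∈ Set.Icc (0 : ℝ) 1) : IsUnit (M t) := by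
  rw [isUnit_matrix_iff] at h0 ⊢
  have hb : ∀ {Q : ℝ → Matrix ι ι (Gr q)} (i : ι), ContinuousOn (fun t => Q t i i) (Set.Icc 0 1) →
      ContinuousOn (fun t => bodyMat (Q t) i i) (Set.Icc 0 1) := fun i hQ =>
    (grLin body.toLinearMap).continuous.comp_continuousOn hQ
  refine ne_zero_of_linear (d := fun t => (bodyMat (M t)).det)
    (c := fun t => (bodyMat (N t)).trace + (bodyMat (P t)).trace) ?_ (fun s hs => ?_) h0 ht
  · exact (continuousOn_finsetSum _ fun i _ => hb i (hN i i)).add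
      (continuousOn_finsetSum _ fun i _ => hb i (hP i i))
  · have h1 := det_pointDeriv (K := ℝ) (t := s) (S := ℝ) (D := fun f f' => HasDerivAt f f' s)
      (fun f f' g g' hf hg => hf.mul hg) (fun f f' g g' hf hg => hf.add hg)
      (fun n => hasDerivAt_const _ _) (M := fun s => bodyMat (M s))
      (M' := bodyMat (M s * N s + P s * M s + Z s))
      (fun i j => hasDerivAt_grLin body.toLinearMap (hM s hs i j))
    refine h1.congr_deriv ?_
    have h2 : bodyMat (M s * N s + P s * M s + Z s) =
        bodyMat (M s) * bodyMat (N s) + bodyMat (P s) * bodyMat (M s) := by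
      rw [← bodyMat_mul, ← bodyMat_mul]
      ext i j
      have h3 : body (Z s i j) = 0 := congrFun (congrFun (hZ s hs) i) j
      simp [bodyMat_apply, h3]
    rw [h2, mul_add, Matrix.trace_add, ← mul_assoc, Matrix.adjugate_mul, ← mul_assoc,
      Matrix.trace_mul_comm (Matrix.adjugate _ * _), ← mul_assoc, Matrix.mul_adjugate,
      smul_mul_assoc, one_mul, smul_mul_assoc, one_mul, Matrix.trace_smul, Matrix.trace_smul,
      smul_eq_mul, smul_eq_mul]
    ring

/-- The coefficient of the constraint `α` in a supertrace. -/
def strCoef {κ : Type} (π : ι → ZMod 2) (e : κ → ZMod 2) (z : ι → ι → κ → Gr q)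
    (K : Matrix ι ι (Gr q)) (α : κ) : Gr q :=
  ∑ i, sg (π i) • ∑ j, z i j α * tw (e α) (K j i)

/-- Moves the constraints to the right through K at the cost of a twist, so that the remainder stays
in the form of a combination of constraints. -/
theorem str_mul_eq_sum {κ : Type} [Fintype κ] (π : ι → ZMod 2) {e : κ → ZMod 2}
    (z : ι → ι → κ → Gr q) {g : κ → Gr q} (hg : ∀ α, g α ∈ grPart q (e α))
    (K : Matrix ι ι (Gr q)) :
    str π ((Matrix.of fun i j => ∑ α, z i j α * g α) * K) =
      ∑ α, strCoef π e z K α * g α := by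
  have h1 : ∀ i j α, z i j α * g α * K j i = z i j α * tw (e α) (K j i) * g α := by
    intro i j α
    rw [mul_assoc, mul_assoc, mul_eq_mul_tw (tw (e α) (K j i)) (hg α), tw_tw_self]
  simp only [str, strCoef, Matrix.mul_apply, Matrix.of_apply, Finset.sum_mul, h1, smul_mul_assoc]
  rw [Finset.sum_comm]
  refine Finset.sum_congr rfl fun i _ => ?_
  rw [← Finset.smul_sum, Finset.sum_comm]

/-- The logarithmic derivative M' M⁻¹ is M N M⁻¹ + P + Z M⁻¹, and cyclicity of the supertrace
removes the conjugation of N. -/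
theorem hasDerivAt_sdet_flow {m n : Type} [Fintype m] [DecidableEq m] [Fintype n] [DecidableEq n]
    {M : ℝ → Matrix (m ⊕ n) (m ⊕ n) (Gr q)} {N P Z : Matrix (m ⊕ n) (m ⊕ n) (Gr q)} {t : ℝ}
    (hM : ∀ᶠ s in nhds t, SuperEven par (M s)) (hu : IsUnit (M t)) (hN : SuperEven par N)
    (hP : SuperEven par P) (hZ : SuperEven par Z)
    (hd : HasMatDeriv M (M t * N + P * M t + Z) t) :
    HasDerivAt (fun s => sdet (M s))
      (sdet (M t) * (str par N + str par P + str par (Z * Ring.inverse (M t)))) t := by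
  have hMt := hM.self_of_nhds
  have hI := hMt.inverse hu
  have h1 : ∀ K : Matrix (m ⊕ n) (m ⊕ n) (Gr q), K * Ring.inverse (M t) * M t = K := fun K => by
    rw [mul_assoc, Ring.inverse_mul_cancel _ hu, mul_one]
  have h2 := hasDerivAt_sdet hM hu
    (X := M t * (N * Ring.inverse (M t)) + P + Z * Ring.inverse (M t))
    (((hMt.mul (hN.mul hI)).add hP).add (hZ.mul hI)) hd (by
      rw [add_mul, add_mul, h1, mul_assoc (M t), h1])
  rwa [str_add, str_add, str_mul_comm hMt (hN.mul hI), h1] at h2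

theorem hasDerivAt_grLog_ratio {u v w : ℝ → Gr q} {A B w' : Gr q} {t : ℝ}
    (hu : HasDerivAt u (u t * A) t) (hv : HasDerivAt v (v t * B) t) (hw : HasDerivAt w w' t)
    (hue : u t ∈ grPart q 0) (hve : v t ∈ grPart q 0) (hwe : w t ∈ grPart q 0)
    (hub : body (u t) ≠ 0) (hvb : body (v t) ≠ 0) (hwb : body (w t) ≠ 0) :
    HasDerivAt (fun s => grLog (u s * v s * Ring.inverse (w s)))
      (A + B - Ring.inverse (w t) * w') t := by
  have hwu := isUnit_of_body_ne_zero hwb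
  have hwi := inverse_mem_grPart_zero hwe
  have hiu : IsUnit (Ring.inverse (w t)) := hwu.ringInverse
  have hse : u t * v t * Ring.inverse (w t) ∈ grPart q 0 := by
    simpa using mul_mem_grPart (mul_mem_grPart hue hve) hwi
  have hsb : body (u t * v t * Ring.inverse (w t)) ≠ 0 := by
    rw [map_mul, map_mul]
    exact mul_ne_zero (mul_ne_zero hub hvb) (hiu.map body).ne_zero
  refine (hasDerivAt_grLog (hasDerivAt_grMul (hasDerivAt_grMul hu hv) (hasDerivAt_grInverse hw hwu))
    hse hsb).congr_deriv ?_
  have h1 : (u t * A * v t + u t * (v t * B)) * Ring.inverse (w t) +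
      u t * v t * -(Ring.inverse (w t) * w' * Ring.inverse (w t)) =
      u t * v t * Ring.inverse (w t) * (A + B - Ring.inverse (w t) * w') := by
    rw [mul_assoc (u t) A, ← mul_comm_of_even hve A, ← mul_comm_of_even hwi,
      ← mul_comm_of_even hwi (Ring.inverse (w t) * w')]
    have h2 := mul_comm_of_even hwi (u t)
    have h3 := mul_comm_of_even hwi (v t)
    simp only [mul_add, mul_sub, ← mul_assoc, h2]
    rw [mul_assoc (u t) _ (v t), h3]
    simp only [← mul_assoc, mul_neg]
    abel
  rw [h1, ← mul_assoc, Ring.inverse_mul_cancel _ (isUnit_of_body_ne_zero hsb), one_mul]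

end BodyDet

/-! ### The pulled back square root formula -/

namespace Flow

variable {p q : Type} [Fintype p] [DecidableEq p] [Fintype q]
  {T : Set ℝ} {U : Set (p → ℝ)} {E : p ⊕ q → p ⊕ q → SFun p q} {ψ : ℝ → SFun p q}
  {𝒰 𝒱 : ℝ → SFun p q → SFun p q} (h : Flow T U E ψ 𝒰 𝒱)

include h

theorem inv_inverse {t : ℝ} (ht : t ∈ T) {f : SFun p q} (hf : Smooth U f)
    (hu : ∀ x ∈ U, IsUnit (f x)) {x : p → ℝ} (hx : x ∈ U) :
    IsUnit (𝒱 t f x) ∧ 𝒱 t (fun y => Ring.inverse (f y)) x = Ring.inverse (𝒱 t f x) := by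
  set g : SFun p q := fun y => Ring.inverse (f y) with hg
  have hgs : Smooth U g := contDiffOn_grInverse hf hu
  have h1 : 𝒱 t f x * 𝒱 t g x = 1 := by
    have e : Set.EqOn (f * g) 1 U := fun y hy => Ring.mul_inverse_cancel _ (hu y hy)
    have := h.congr_inv t ht _ _ (hf.mul hgs) e hx
    rw [h.inv_mul ht hf hgs hx, h.inv_one ht hx] at this
    exact this
  have h2 : 𝒱 t g x * 𝒱 t f x = 1 := by
    have e : Set.EqOn (g * f) 1 U := fun y hy => Ring.inverse_mul_cancel _ (hu y hy)
    have := h.congr_inv t ht _ _ (hgs.mul hf) e hx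
    rw [h.inv_mul ht hgs hf hx, h.inv_one ht hx] at this
    exact this
  exact ⟨⟨⟨_, _, h1, h2⟩, rfl⟩, (Ring.inverse_unit ⟨_, _, h1, h2⟩).symm⟩

theorem inv_sub {t : ℝ} (ht : t ∈ T) {f g : SFun p q} (hf : Smooth U f) (hg : Smooth U g)
    {x : p → ℝ} (hx : x ∈ U) : 𝒱 t (f - g) x = 𝒱 t f x - 𝒱 t g x := by
  rw [sub_eq_add_neg, ← neg_one_smul ℝ g, h.inv_add ht hf (hg.smul _) hx, Pi.add_apply,
    h.inv_smul ht hg _ hx, neg_one_smul, Pi.neg_apply, ← sub_eq_add_neg]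

theorem hasDerivAt_inv_const {F : SFun p q} (hF : Smooth U F) {t : ℝ} (ht : t ∈ T) {y : p → ℝ}
    (hy : y ∈ U) : HasDerivAt (fun s => 𝒱 s F y) (-𝒱 t (bracket E (ψ t) F) y) t := by
  have hb := Smooth.bracket h.isOpen h.antisymplectic.smooth (h.smooth_gen_at ht) hF
  refine (h.hasDerivAt_inv (SmoothFamily.const hF) ht hy).congr_deriv ?_
  have e : nabla E ψ (fun _ => F) t = (-1 : ℝ) • bracket E (ψ t) F := by
    ext1 x
    have : dtF (fun _ => F) t x = 0 := (hasDerivAt_const t (F x)).deriv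
    rw [nabla, Pi.sub_apply, this, zero_sub, neg_one_smul, Pi.neg_apply]
  rw [e, h.inv_smul ht hb _ hy, neg_one_smul, Pi.neg_apply]

end Flow

namespace DeformedFrame

variable {a b : ℕ} {T : Set ℝ} {U : Set (CIdx a b → ℝ)} {ρ : SFun₀ a b}
  {E : Coord₀ a b → Coord₀ a b → SFun₀ a b} {ψ : ℝ → SFun₀ a b}
  {F G : ℝ → CIdx a b → SFun₀ a b} {M : CIdx a b → CIdx a b → ℝ → SFun₀ a b}
  {H : ℝ → SFun₀ a b} {ν : CIdx a b → ℝ → SFun₀ a b} {𝒰 𝒱 : ℝ → SFun₀ a b → SFun₀ a b}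
  (D : DeformedFrame T U ρ E ψ F G M H ν) (h : Flow T U E ψ 𝒰 𝒱)

include D h

theorem smooth_pullJac (A B : Coord₀ a b) :
    SmoothFamily T U fun t y => pullJac 𝒱 F G t y A B :=
  h.smooth_inv _ ((D.smooth_barGamma A).dR h.isOpen_time h.isOpen B)

theorem smooth_pullBr (α β : CIdx a b) : SmoothFamily T U fun t y => pullBr 𝒱 E F G t y α β :=
  h.smooth_inv _ ((D.smooth_F α).bracket h.isOpen_time h.isOpen h.antisymplectic.smooth
    (D.smooth_G β))

theorem superEven_pullJac {t : ℝ} (ht : t ∈ T) {y : CIdx a b → ℝ} (hy : y ∈ U) :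
    SuperEven par (pullJac 𝒱 F G t y) := fun A B =>
  h.inv_parity ht (((D.smooth_barGamma A).smooth ht).dR h.isOpen B)
    ((D.parity_barGamma A ht).dR h.isOpen ((D.smooth_barGamma A).smooth ht) B) y hy

theorem superEven_pullBr {t : ℝ} (ht : t ∈ T) {y : CIdx a b → ℝ} (hy : y ∈ U) :
    SuperEven par (pullBr 𝒱 E F G t y) := fun α β => by
  have hF := (D.smooth_F α).smooth ht
  have hG := (D.smooth_G β).smooth ht
  have := h.inv_parity ht (Smooth.bracket h.isOpen h.antisymplectic.smooth hF hG)
    (HasParity.bracket h.isOpen h.antisymplectic hF hG (D.parity_F α t ht) (D.parity_G β t ht)) y hy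
  have key : ∀ u v : ZMod 2, u + 1 + v + 1 = u + v := by decide
  rwa [key] at this

theorem superEven_pullHam {t : ℝ} (ht : t ∈ T) {y : CIdx a b → ℝ} (hy : y ∈ U) :
    SuperEven par (pullHam 𝒱 E ψ t y) := fun C B => by
  have hs := Smooth.hamCoef h.isOpen h.antisymplectic (h.smooth_gen_at ht) C
  have hp := hamCoef_parity h.isOpen h.antisymplectic (h.smooth_gen_at ht) (h.odd_gen t ht) C
  rw [one_add_one_zmod, zero_add] at hp
  exact h.inv_parity ht (hs.dR h.isOpen B) (hp.dR h.isOpen hs B) y hy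

theorem superEven_pullRot {t : ℝ} (ht : t ∈ T) {y : CIdx a b → ℝ} (hy : y ∈ U) :
    SuperEven par (pullRot 𝒱 M t y) := fun A C =>
  h.inv_parity ht ((D.smooth_hat A C).smooth ht) (D.parity_hat A C ht) y hy

theorem superEven_pullRotRight {t : ℝ} (ht : t ∈ T) {y : CIdx a b → ℝ} (hy : y ∈ U) :
    SuperEven par (pullRotRight 𝒱 M t y) := fun γ β =>
  Submodule.smul_mem _ _ (by
    have := h.inv_parity ht ((D.smooth_M β γ).smooth ht) (D.parity_M β γ t ht) y hy
    rwa [add_comm] at this)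

theorem smooth_jacCoef (A B : Coord₀ a b) (β : CIdx a b) :
    SmoothFamily T U (jacCoef 𝒱 M A B β) :=
  (h.smooth_inv _ ((D.smooth_hat A (conPos β)).dR h.isOpen_time h.isOpen B)).smul _

theorem smooth_brCoef (α β γ : CIdx a b) : SmoothFamily T U (brCoef 𝒱 E F M α β γ) :=
  h.smooth_inv _ ((D.smooth_F α).bracket h.isOpen_time h.isOpen h.antisymplectic.smooth
    (D.smooth_M β γ))

theorem pullG_mem {t : ℝ} (ht : t ∈ T) {y : CIdx a b → ℝ} (hy : y ∈ U) (α : CIdx a b) :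
    𝒱 t (G t α) y ∈ grPart (CIdx a b) (eps α) :=
  h.inv_parity ht ((D.smooth_G α).smooth ht) (D.parity_G α t ht) y hy

theorem superEven_jacCoef {t : ℝ} (ht : t ∈ T) {y : CIdx a b → ℝ} (hy : y ∈ U) :
    SuperEven par (Matrix.of fun A B => ∑ β, jacCoef 𝒱 M A B β t y * 𝒱 t (G t β) y) := by
  intro A B
  rw [Matrix.of_apply]
  refine Submodule.sum_mem _ fun β _ => ?_
  have hs := (D.smooth_hat A (conPos β)).smooth ht
  have h1 := h.inv_parity ht (hs.dR h.isOpen B) ((D.parity_hat A (conPos β) ht).dR h.isOpen hs B)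
    y hy
  have h2 := mul_mem_grPart (Submodule.smul_mem _ (sg (par B * eps β)) h1) (D.pullG_mem h ht hy β)
  rw [par_conPos] at h2
  have key : ∀ u v w : ZMod 2, u + w + v + w = u + v := by decide
  rwa [key] at h2

theorem superEven_brCoef {t : ℝ} (ht : t ∈ T) {y : CIdx a b → ℝ} (hy : y ∈ U) :
    SuperEven par (Matrix.of fun α β => ∑ γ, brCoef 𝒱 E F M α β γ t y * 𝒱 t (G t γ) y) := by
  intro α β
  rw [Matrix.of_apply]
  refine Submodule.sum_mem _ fun γ _ => ?_
  have hF := (D.smooth_F α).smooth ht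
  have hM := (D.smooth_M β γ).smooth ht
  have h1 := h.inv_parity ht (Smooth.bracket h.isOpen h.antisymplectic.smooth hF hM)
    (HasParity.bracket h.isOpen h.antisymplectic hF hM (D.parity_F α t ht) (D.parity_M β γ t ht))
    y hy
  have h2 := mul_mem_grPart h1 (D.pullG_mem h ht hy γ)
  have key : ∀ u v w : ZMod 2, u + 1 + (v + w) + 1 + w = u + v := by decide
  rwa [key] at h2

theorem str_pullRot {t : ℝ} (ht : t ∈ T) {y : CIdx a b → ℝ} (hy : y ∈ U) :
    str par (pullRot 𝒱 M t y) = ∑ α, sg (eps α) • 𝒱 t (M α α t) y := by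
  rw [str, sum_conPos]
  · exact Finset.sum_congr rfl fun α _ => by
      rw [par_conPos, pullRot, Matrix.of_apply, hat_conPos]
  · intro C hC
    rw [pullRot, Matrix.of_apply, hat_left _ hC, h.inv_zero_fun ht hy, Pi.zero_apply, smul_zero]

theorem str_pullRotRight (t : ℝ) (y : CIdx a b → ℝ) :
    str par (pullRotRight 𝒱 M t y) = ∑ α, sg (eps α) • 𝒱 t (M α α t) y := by
  refine Finset.sum_congr rfl fun α _ => ?_
  rw [pullRotRight, Matrix.of_apply, zmod_add_self, zero_mul, sg_zero, one_smul]
  rfl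

/-- The diagonal derivatives are even, so left and right ones agree and the supertrace is the
divergence. -/
theorem str_pullHam {t : ℝ} (ht : t ∈ T) {y : CIdx a b → ℝ} (hy : y ∈ U) :
    str par (pullHam 𝒱 E ψ t y) = 𝒱 t (hamDiv E (ψ t)) y := by
  have hs := fun C => Smooth.hamCoef h.isOpen h.antisymplectic (h.smooth_gen_at ht) C
  have e : ∀ C, Set.EqOn (dR C (hamCoef E (ψ t) C)) (dL C (hamCoef E (ψ t) C)) U := by
    intro C x hx
    have hp := hamCoef_parity h.isOpen h.antisymplectic (h.smooth_gen_at ht) (h.odd_gen t ht) C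
    rw [one_add_one_zmod, zero_add] at hp
    rw [dR_eq, tw_of_mem (hp.dL h.isOpen (hs C) C x hx), zmod_add_self, mul_zero, sg_zero, one_smul]
  rw [hamDiv, h.inv_sum _ ht (fun C => ((hs C).dL h.isOpen C).smul _) hy, Finset.sum_apply, str]
  refine Finset.sum_congr rfl fun C _ => ?_
  rw [h.inv_smul ht ((hs C).dL h.isOpen C) _ hy, Pi.smul_apply, pullHam, Matrix.of_apply,
    h.congr_inv t ht _ _ ((hs C).dR h.isOpen C) (e C) hy]

theorem body_pull_density {t : ℝ} (ht : t ∈ T) {y : CIdx a b → ℝ} (hy : y ∈ U) :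
    body (𝒱 t ρ y) ≠ 0 :=
  ((h.inv_inverse ht D.density.smooth
    (fun x hx => isUnit_of_body_ne_zero (D.density.body_ne_zero x hx)) hy).1.map body).ne_zero

theorem hasDerivAt_pullH {t : ℝ} (ht : t ∈ T) {y : CIdx a b → ℝ} (hy : y ∈ U) :
    HasDerivAt (fun s => 𝒱 s (H s) y)
      (-(1 / 2 : ℝ) • (str par (pullHam 𝒱 E ψ t y) +
          Ring.inverse (𝒱 t ρ y) * 𝒱 t (bracket E (ψ t) ρ) y) -
        ∑ α, sg (eps α) • 𝒱 t (M α α t) y + ∑ β, 𝒱 t (ν β t) y * 𝒱 t (G t β) y) t := by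
  refine (h.hasDerivAt_inv D.smooth_H ht hy).congr_deriv ?_
  have hU := h.isOpen
  have hE := h.antisymplectic
  have hψ := h.smooth_gen_at ht
  have hρu : ∀ x ∈ U, IsUnit (ρ x) := fun x hx =>
    isUnit_of_body_ne_zero (D.density.body_ne_zero x hx)
  have hri : Smooth U fun x => Ring.inverse (ρ x) := contDiffOn_grInverse D.density.smooth hρu
  have hbr := Smooth.bracket hU hE.smooth hψ D.density.smooth
  have hdiv : Smooth U (hamDiv E (ψ t)) :=
    Smooth.sum _ fun C _ => ((Smooth.hamCoef hU hE hψ C).dL hU C).smul _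
  have hM := fun α => ((D.smooth_M α α).smooth ht).smul (sg (eps α))
  have hν := fun β => ((D.smooth_ν β).smooth ht).mul ((D.smooth_G β).smooth ht)
  have e : Set.EqOn (nabla E ψ H t) ((-(1 / 2 : ℝ)) • (hamDiv E (ψ t) +
      (fun x => Ring.inverse (ρ x)) * bracket E (ψ t) ρ) - (∑ α, sg (eps α) • M α α t) +
        ∑ β, ν β t * G t β) U := by
    intro x hx
    rw [D.nabla_H t ht x hx, oddLaplacian_odd hU hE D.density hψ (h.odd_gen t ht) hx]
    simp only [Pi.add_apply, Pi.sub_apply, Finset.sum_apply, Pi.smul_apply, Pi.mul_apply]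
  have hL := (hdiv.add (hri.mul hbr)).smul (-(1 / 2 : ℝ))
  rw [h.congr_inv t ht _ _ ((h.smooth_nabla D.smooth_H).smooth ht) e hy,
    h.inv_add ht (hL.sub (Smooth.sum _ fun α _ => hM α)) (Smooth.sum _ fun β _ => hν β) hy,
    Pi.add_apply, h.inv_sub ht hL (Smooth.sum _ fun α _ => hM α) hy,
    h.inv_smul ht (hdiv.add (hri.mul hbr)) _ hy, Pi.smul_apply,
    h.inv_add ht hdiv (hri.mul hbr) hy, Pi.add_apply, h.inv_mul ht hri hbr hy, Pi.mul_apply,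
    (h.inv_inverse ht D.density.smooth hρu hy).2, h.inv_sum _ ht hM hy, h.inv_sum _ ht hν hy,
    Finset.sum_apply, Finset.sum_apply, D.str_pullHam h ht hy]
  congr 2
  · exact Finset.sum_congr rfl fun α _ => h.inv_smul ht ((D.smooth_M α α).smooth ht) _ hy
  · funext β
    exact h.inv_mul ht ((D.smooth_ν β).smooth ht) ((D.smooth_G β).smooth ht) hy

end DeformedFrame

/-! ### Integrating the pulled back formula along the deformation -/

section PulledFormula

variable {a b : ℕ}

/-- The pull-back of `sdet(∂{F;G}/∂Γ) sdet(F,G) / ρ`. -/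
def pullRatio (𝒱 : ℝ → SFun₀ a b → SFun₀ a b) (ρ : SFun₀ a b)
    (E : Coord₀ a b → Coord₀ a b → SFun₀ a b) (F G : ℝ → CIdx a b → SFun₀ a b) (t : ℝ) :
    SFun₀ a b := fun y =>
  sdet (pullJac 𝒱 F G t y) * sdet (pullBr 𝒱 E F G t y) * Ring.inverse (𝒱 t ρ y)

/-- The coefficients of the constraints in the derivative of `H + ln √(pullRatio)`. -/
def logCoef (𝒱 : ℝ → SFun₀ a b → SFun₀ a b) (E : Coord₀ a b → Coord₀ a b → SFun₀ a b)
    (F G : ℝ → CIdx a b → SFun₀ a b) (M : CIdx a b → CIdx a b → ℝ → SFun₀ a b)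
    (ν : CIdx a b → ℝ → SFun₀ a b) (α : CIdx a b) (t : ℝ) : SFun₀ a b := fun y =>
  𝒱 t (ν α t) y + (1 / 2 : ℝ) •
    (strCoef par eps (fun A B β => jacCoef 𝒱 M A B β t y) (Ring.inverse (pullJac 𝒱 F G t y)) α +
      strCoef par eps (fun β γ δ => brCoef 𝒱 E F M β γ δ t y)
        (Ring.inverse (pullBr 𝒱 E F G t y)) α)

theorem smoothFamily_strCoef {p q ι κ : Type} [Fintype p] [DecidableEq p] [Fintype q] [Fintype ι]
    [DecidableEq ι] {T : Set ℝ} {V : Set (p → ℝ)} (π : ι → ZMod 2) (e : κ → ZMod 2)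
    {z : ι → ι → κ → ℝ → SFun p q} {M : ℝ → (p → ℝ) → Matrix ι ι (Gr q)}
    (hz : ∀ i j α, SmoothFamily T V (z i j α))
    (hM : ∀ i j, SmoothFamily T V fun t y => M t y i j)
    (hu : ∀ t ∈ T, ∀ y ∈ V, IsUnit (M t y)) (α : κ) :
    SmoothFamily T V fun t y => strCoef π e (fun i j β => z i j β t y) (Ring.inverse (M t y)) α := by
  have hI : ∀ i j, SmoothFamily T V fun t y => (Ring.inverse (M t y)) i j := fun i j =>
    contDiffOn_matInverse (E := ℝ × (p → ℝ)) (M := fun x => M x.1 x.2) hM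
      (fun x hx => hu x.1 hx.1 x.2 hx.2) i j
  have h1 := SmoothFamily.sum Finset.univ fun i _ => (SmoothFamily.sum Finset.univ fun j _ =>
    (hz i j α).mul ((hI j i).lin (tw (e α)).toLinearMap)).smul (sg (π i))
  refine h1.congr fun t _ y _ => ?_
  simp only [Finset.sum_apply, Pi.smul_apply, Pi.mul_apply]
  rfl

namespace DeformedFrame

variable {T : Set ℝ} {U : Set (CIdx a b → ℝ)} {ρ : SFun₀ a b}
  {E : Coord₀ a b → Coord₀ a b → SFun₀ a b} {ψ : ℝ → SFun₀ a b}
  {F G : ℝ → CIdx a b → SFun₀ a b} {M : CIdx a b → CIdx a b → ℝ → SFun₀ a b}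
  {H : ℝ → SFun₀ a b} {ν : CIdx a b → ℝ → SFun₀ a b} {𝒰 𝒱 : ℝ → SFun₀ a b → SFun₀ a b}
  (D : DeformedFrame T U ρ E ψ F G M H ν) (h : Flow T U E ψ 𝒰 𝒱)

include D h

theorem pullRatio_even {t : ℝ} (ht : t ∈ T) {y : CIdx a b → ℝ} (hy : y ∈ U)
    (huJ : IsUnit (pullJac 𝒱 F G t y)) (huB : IsUnit (pullBr 𝒱 E F G t y)) :
    pullRatio 𝒱 ρ E F G t y ∈ grPart (CIdx a b) 0 := by
  have := mul_mem_grPart (mul_mem_grPart (sdet_even (D.superEven_pullJac h ht hy) huJ)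
    (sdet_even (D.superEven_pullBr h ht hy) huB)) (inverse_mem_grPart_zero
      (h.inv_parity ht D.density.smooth D.density.parity y hy))
  rw [add_zero, add_zero] at this
  exact this

theorem body_pullRatio {t : ℝ} (ht : t ∈ T) {y : CIdx a b → ℝ} (hy : y ∈ U)
    (huJ : IsUnit (pullJac 𝒱 F G t y)) (huB : IsUnit (pullBr 𝒱 E F G t y)) :
    body (pullRatio 𝒱 ρ E F G t y) ≠ 0 := by
  rw [pullRatio, map_mul, map_mul]
  exact mul_ne_zero (mul_ne_zero (body_sdet_ne_zero (D.superEven_pullJac h ht hy) huJ)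
    (body_sdet_ne_zero (D.superEven_pullBr h ht hy) huB))
    ((isUnit_of_body_ne_zero (D.body_pull_density h ht hy)).ringInverse.map body).ne_zero

theorem smooth_pullRatio {t : ℝ} (ht : t ∈ T) {V : Set (CIdx a b → ℝ)} (hV : V ⊆ U)
    (hu : ∀ y ∈ V, IsUnit (pullJac 𝒱 F G t y) ∧ IsUnit (pullBr 𝒱 E F G t y)) :
    Smooth V (pullRatio 𝒱 ρ E F G t) :=
  contDiffOn_grMul (contDiffOn_grMul
    (contDiffOn_sdet (fun A B => ((D.smooth_pullJac h A B).smooth ht).mono hV)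
      (fun _ hy => D.superEven_pullJac h ht (hV hy)) fun y hy => (hu y hy).1)
    (contDiffOn_sdet (fun α β => ((D.smooth_pullBr h α β).smooth ht).mono hV)
      (fun _ hy => D.superEven_pullBr h ht (hV hy)) fun y hy => (hu y hy).2))
    (contDiffOn_grInverse ((h.smooth_inv_at ht D.density.smooth).mono hV) fun _ hy =>
      isUnit_of_body_ne_zero (D.body_pull_density h ht (hV hy)))

/-- The decisive cancellation. Half of (str N + str M) + str M + ρ⁻¹(ψ,ρ), from the two
superdeterminants and the density, is opposite to the derivative of H up to constraints: the
divergence cancels Δψ, and the two copies of str M cancel the supertrace in H. -/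
theorem hasDerivAt_log {t : ℝ} (ht : t ∈ T) {y : CIdx a b → ℝ} (hy : y ∈ U)
    (huJ : IsUnit (pullJac 𝒱 F G t y)) (huB : IsUnit (pullBr 𝒱 E F G t y)) :
    HasDerivAt (fun s => 𝒱 s (H s) y + (1 / 2 : ℝ) • grLog (pullRatio 𝒱 ρ E F G s y))
      (∑ α, logCoef 𝒱 E F G M ν α t y * 𝒱 t (G t α) y) t := by
  have hT := h.isOpen_time.mem_nhds ht
  have hJ := D.superEven_pullJac h ht hy
  have hB := D.superEven_pullBr h ht hy
  have h1 := hasDerivAt_sdet_flow (Filter.mem_of_superset hT fun s hs =>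
    D.superEven_pullJac h hs hy) huJ (D.superEven_pullHam h ht hy) (D.superEven_pullRot h ht hy)
    (D.superEven_jacCoef h ht hy) (D.hasMatDeriv_pullJac h ht hy)
  have h2 := hasDerivAt_sdet_flow (P := 0) (Filter.mem_of_superset hT fun s hs =>
    D.superEven_pullBr h hs hy) huB (D.superEven_pullRotRight h ht hy)
    (fun i j => Submodule.zero_mem _) (D.superEven_brCoef h ht hy) (by
      rw [zero_mul, add_zero]; exact D.hasMatDeriv_pullBr h ht hy)
  have h0 : str par (0 : Matrix (CIdx a b) (CIdx a b) (Gr (CIdx a b))) = 0 := by simp [str]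
  have h3 := hasDerivAt_grLog_ratio h1 h2 (h.hasDerivAt_inv_const D.density.smooth ht hy)
    (sdet_even hJ huJ) (sdet_even hB huB) (h.inv_parity ht D.density.smooth D.density.parity y hy)
    (body_sdet_ne_zero hJ huJ) (body_sdet_ne_zero hB huB) (D.body_pull_density h ht hy)
  refine ((D.hasDerivAt_pullH h ht hy).add (h3.const_smul (1 / 2 : ℝ))).congr_deriv ?_
  rw [h0, str_mul_eq_sum par _ (D.pullG_mem h ht hy), str_mul_eq_sum par _ (D.pullG_mem h ht hy),
    D.str_pullRot h ht hy, D.str_pullRotRight h t y]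
  have h4 : ∑ α, logCoef 𝒱 E F G M ν α t y * 𝒱 t (G t α) y =
      (∑ α, 𝒱 t (ν α t) y * 𝒱 t (G t α) y) + (1 / 2 : ℝ) •
        ((∑ α, strCoef par eps (fun A B β => jacCoef 𝒱 M A B β t y)
          (Ring.inverse (pullJac 𝒱 F G t y)) α * 𝒱 t (G t α) y) +
        ∑ α, strCoef par eps (fun β γ δ => brCoef 𝒱 E F M β γ δ t y)
          (Ring.inverse (pullBr 𝒱 E F G t y)) α * 𝒱 t (G t α) y) := by
    rw [← Finset.sum_add_distrib, Finset.smul_sum, ← Finset.sum_add_distrib]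
    exact Finset.sum_congr rfl fun α _ => by
      rw [logCoef, add_mul, smul_mul_assoc, add_mul]
  rw [h4, mul_neg]
  module

theorem smooth_logCoef {T' : Set ℝ} {V : Set (CIdx a b → ℝ)} (hT : T' ⊆ T) (hV : V ⊆ U)
    (hu : ∀ t ∈ T', ∀ y ∈ V, IsUnit (pullJac 𝒱 F G t y) ∧ IsUnit (pullBr 𝒱 E F G t y))
    (α : CIdx a b) : SmoothFamily T' V (logCoef 𝒱 E F G M ν α) :=
  ((h.smooth_inv _ (D.smooth_ν α)).mono hT hV).add
    (((smoothFamily_strCoef par eps (fun A B β => (D.smooth_jacCoef h A B β).mono hT hV)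
      (fun A B => (D.smooth_pullJac h A B).mono hT hV) (fun t ht y hy => (hu t ht y hy).1) α).add
    (smoothFamily_strCoef par eps (fun β γ δ => (D.smooth_brCoef h β γ δ).mono hT hV)
      (fun β γ => (D.smooth_pullBr h β γ).mono hT hV)
      (fun t ht y hy => (hu t ht y hy).2) α)).smul (1 / 2))

omit D in
theorem _root_.BV.Flow.Icc_subset (h1 : (1 : ℝ) ∈ T) : Set.Icc (0 : ℝ) 1 ⊆ T :=
  h.ordConnected.out h.zero_mem h1

theorem solvesSystem_pullG (h1 : (1 : ℝ) ∈ T) {y : CIdx a b → ℝ} (hy : y ∈ U) :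
    SolvesSystem (fun α β t => 𝒱 t (M α β t) y) fun α t => 𝒱 t (G t α) y := fun α _ ht =>
  D.hasDerivAt_pullG h (h.Icc_subset h1 ht) hy α

theorem exists_rotation (h1 : (1 : ℝ) ∈ T) :
    ∃ R S : CIdx a b → CIdx a b → SFun₀ a b, (∀ α β, Smooth U (R α β)) ∧
      (∀ α β, Smooth U (S α β)) ∧ (∀ α β, HasParity U (eps α + eps β) (R α β)) ∧
      (∀ y ∈ U, ∀ i k, ∑ j, R i j y * S j k y = if i = k then 1 else 0) ∧
      (∀ y ∈ U, ∀ i k, ∑ j, S i j y * R j k y = if i = k then 1 else 0) ∧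
      ∀ y ∈ U, (∀ α, 𝒱 1 (G 1 α) y = ∑ β, R α β y * G 0 β y) ∧
        ∀ α, G 0 α y = ∑ β, S α β y * 𝒱 1 (G 1 β) y := by
  obtain ⟨R, S, hR, hS, hRp, hRS, hSR, hsol⟩ := exists_transport_inverse h.isOpen_time
    (h.Icc_subset h1) h.isOpen (m := fun α β t => 𝒱 t (M α β t))
    (fun α β => h.smooth_inv _ (D.smooth_M α β)) eps fun α β t ht =>
      h.inv_parity (h.Icc_subset h1 ht) ((D.smooth_M α β).smooth (h.Icc_subset h1 ht))
        (D.parity_M α β t (h.Icc_subset h1 ht))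
  refine ⟨R, S, hR, hS, hRp, hRS, hSR, fun y hy => ?_⟩
  have h2 := hsol y hy _ (D.solvesSystem_pullG h h1 hy)
  have h3 : ∀ α, 𝒱 0 (G 0 α) y = G 0 α y := fun α =>
    h.inv_init ((D.smooth_G α).smooth h.zero_mem) hy
  simpa only [h3] using h2

/-- Vanishing at time 1 is carried to time 0 by the inverse transport, and from there to all times,
since the bodies solve a homogeneous linear system of their own. -/
theorem body_pullG (h1 : (1 : ℝ) ∈ T) {y : CIdx a b → ℝ} (hy : y ∈ U)
    (hb : ∀ i : Fin a, body (𝒱 1 (G 1 (Sum.inl i)) y) = 0) {t : ℝ} (ht : t ∈ Set.Icc (0 : ℝ) 1)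
    (α : CIdx a b) : body (𝒱 t (G t α) y) = 0 := by
  have hb1 : ∀ α, body (𝒱 1 (G 1 α) y) = 0 := by
    rintro (i | j)
    · exact hb i
    · exact body_of_odd (D.pullG_mem h h1 hy (Sum.inr j))
  have hb0 : ∀ α, body (𝒱 0 (G 0 α) y) = 0 := by
    obtain ⟨R, S, -, -, -, -, -, hRS⟩ := D.exists_rotation h h1
    intro α
    rw [h.inv_init ((D.smooth_G α).smooth h.zero_mem) hy, (hRS y hy).2 α, map_sum]
    exact Finset.sum_eq_zero fun β _ => by rw [map_mul, hb1, mul_zero]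
  have hsol : SolvesSystem (fun α β t => algebraMap ℝ (Gr (CIdx a b)) (body (𝒱 t (M α β t) y)))
      fun α t => algebraMap ℝ (Gr (CIdx a b)) (body (𝒱 t (G t α) y)) := by
    intro α s hs
    have h2 := hasDerivAt_grLin ((Algebra.linearMap ℝ (Gr (CIdx a b))).comp body.toLinearMap)
      (D.solvesSystem_pullG h h1 hy α s hs)
    refine h2.congr_deriv ?_
    simp
  have hz : SolvesSystem (fun α β t => algebraMap ℝ (Gr (CIdx a b)) (body (𝒱 t (M α β t) y)))
      fun (_ : CIdx a b) _ => (0 : Gr (CIdx a b)) := fun α s _ =>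
    (hasDerivAt_const s 0).congr_deriv (by simp)
  have h3 := hsol.eq (fun α β => (LinearMap.toContinuousLinearMap
      ((Algebra.linearMap ℝ (Gr (CIdx a b))).comp body.toLinearMap)).continuous.comp_continuousOn
      ((h.smooth_inv _ (D.smooth_M α β)).continuousOn_time (h.Icc_subset h1) hy)) hz
      (fun α => by rw [hb0, map_zero]) ht α
  simpa using congrArg body h3

/-- At such a point the O(G) remainders have no body, which is exactly the hypothesis of
`isUnit_of_linear_flow`. Away from the constraint surface this argument is not available. -/
theorem isUnit_pull (h1 : (1 : ℝ) ∈ T) {y : CIdx a b → ℝ} (hy : y ∈ U)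
    (hb : ∀ i : Fin a, body (𝒱 1 (G 1 (Sum.inl i)) y) = 0)
    (h0 : IsUnit (pullJac 𝒱 F G 0 y) ∧ IsUnit (pullBr 𝒱 E F G 0 y)) {t : ℝ}
    (ht : t ∈ Set.Icc (0 : ℝ) 1) :
    IsUnit (pullJac 𝒱 F G t y) ∧ IsUnit (pullBr 𝒱 E F G t y) := by
  have hI := h.Icc_subset h1
  have hz : ∀ {ι : Type} (z : ι → ι → CIdx a b → ℝ → SFun₀ a b), ∀ t ∈ Set.Icc (0 : ℝ) 1,
      (Matrix.of fun i j => ∑ β, z i j β t y * 𝒱 t (G t β) y).map body = 0 := by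
    intro ι z t ht
    ext i j
    simp [D.body_pullG h h1 hy hb ht]
  constructor
  · refine isUnit_of_linear_flow (M := fun t => pullJac 𝒱 F G t y)
      (N := fun t => pullHam 𝒱 E ψ t y) (P := fun t => pullRot 𝒱 M t y) ?_ ?_
      (fun t ht => D.hasMatDeriv_pullJac h (hI ht) hy) (hz _) h0.1 ht
    · exact fun C B => (h.smooth_inv _ (SmoothFamily.dR h.isOpen_time h.isOpen
        (SmoothFamily.sum _ fun A _ => (h.smooth_gen.dR h.isOpen_time h.isOpen A).mul
          (SmoothFamily.const (h.antisymplectic.smooth A C))) B)).continuousOn_time hI hy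
    · exact fun A C => (h.smooth_inv _ (D.smooth_hat A C)).continuousOn_time hI hy
  · refine isUnit_of_linear_flow (M := fun t => pullBr 𝒱 E F G t y)
      (N := fun t => pullRotRight 𝒱 M t y) (P := fun _ => 0) ?_ (fun _ _ => continuousOn_const)
      (fun t ht => by rw [zero_mul, add_zero]; exact D.hasMatDeriv_pullBr h (hI ht) hy)
      (hz _) h0.2 ht
    exact fun γ β => ((h.smooth_inv _ (D.smooth_M β γ)).smul _).continuousOn_time hI hy

/-- Nonvanishing of the product of the two body determinants is an open condition in (t, y);
compactness of [0, 1] turns it into one neighbourhood valid for all times. -/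
theorem exists_tube (h1 : (1 : ℝ) ∈ T) {y : CIdx a b → ℝ} (hy : y ∈ U)
    (hu : ∀ t ∈ Set.Icc (0 : ℝ) 1, IsUnit (pullJac 𝒱 F G t y) ∧ IsUnit (pullBr 𝒱 E F G t y)) :
    ∃ (T' : Set ℝ) (V : Set (CIdx a b → ℝ)), IsOpen T' ∧ IsOpen V ∧ Set.Icc (0 : ℝ) 1 ⊆ T' ∧
      y ∈ V ∧ T' ⊆ T ∧ V ⊆ U ∧
      ∀ t ∈ T', ∀ y ∈ V, IsUnit (pullJac 𝒱 F G t y) ∧ IsUnit (pullBr 𝒱 E F G t y) := by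
  have cJ := continuousOn_det_bodyMat (s := T ×ˢ U)
    (M := fun z : ℝ × (CIdx a b → ℝ) => pullJac 𝒱 F G z.1 z.2)
    fun A B => ContDiffOn.continuousOn (D.smooth_pullJac h A B)
  have cB := continuousOn_det_bodyMat (s := T ×ˢ U)
    (M := fun z : ℝ × (CIdx a b → ℝ) => pullBr 𝒱 E F G z.1 z.2)
    fun A B => ContDiffOn.continuousOn (D.smooth_pullBr h A B)
  have hO := (cJ.mul cB).isOpen_inter_preimage (h.isOpen_time.prod h.isOpen) isOpen_compl_singleton
    (t := {0}ᶜ)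
  obtain ⟨T', V, hT', hV, hIT, hyV, hTV⟩ := generalized_tube_lemma (isCompact_Icc (a := (0 : ℝ))
    (b := 1)) (isCompact_singleton (x := y)) hO (by
      rintro ⟨t, y'⟩ ⟨ht, rfl⟩
      exact ⟨⟨h.Icc_subset h1 ht, hy⟩, mul_ne_zero (isUnit_matrix_iff.1 (hu t ht).1)
        (isUnit_matrix_iff.1 (hu t ht).2)⟩)
  have hyV' : y ∈ V := hyV rfl
  refine ⟨T', V, hT', hV, hIT, hyV', fun t ht => (hTV (Set.mk_mem_prod ht hyV')).1.1,
    fun z hz => (hTV (Set.mk_mem_prod (hIT ⟨le_rfl, zero_le_one⟩) hz)).1.2, fun t ht z hz => ?_⟩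
  have h2 := (hTV (Set.mk_mem_prod ht hz)).2
  exact ⟨isUnit_matrix_iff.2 (left_ne_zero_of_mul h2), isUnit_matrix_iff.2 (right_ne_zero_of_mul h2)⟩

theorem exists_transport_log (h1 : (1 : ℝ) ∈ T) {T' : Set ℝ} {V : Set (CIdx a b → ℝ)}
    (hT'o : IsOpen T') (hV : IsOpen V) (hIT : Set.Icc (0 : ℝ) 1 ⊆ T') (hT' : T' ⊆ T) (hVU : V ⊆ U)
    (hu : ∀ t ∈ T', ∀ y ∈ V, IsUnit (pullJac 𝒱 F G t y) ∧ IsUnit (pullBr 𝒱 E F G t y)) :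
    ∃ r : CIdx a b → SFun₀ a b, (∀ α, Smooth V (r α)) ∧ ∀ y ∈ V,
      𝒱 1 (H 1) y + (1 / 2 : ℝ) • grLog (pullRatio 𝒱 ρ E F G 1 y) =
        𝒱 0 (H 0) y + (1 / 2 : ℝ) • grLog (pullRatio 𝒱 ρ E F G 0 y) + ∑ α, r α y * G 0 α y := by
  -- Adjoining H + ln √(…) as an extra component to the constraints makes the pair a solution of one
  -- linear system. The column of the extra component is zero, since it drives nothing.
  set m : CIdx a b ⊕ Unit → CIdx a b ⊕ Unit → ℝ → SFun₀ a b := fun i j =>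
    Sum.elim (fun β => Sum.elim (fun α t => 𝒱 t (M α β t))
      (fun _ t => logCoef 𝒱 E F G M ν β t) i) (fun _ _ => 0) j with hm
  have hms : ∀ i j, SmoothFamily T' V (m i j) := by
    rintro (α | _) (β | _)
    · exact (h.smooth_inv _ (D.smooth_M α β)).mono hT' hVU
    · exact SmoothFamily.const (Smooth.zero V)
    · exact D.smooth_logCoef h hT' hVU hu β
    · exact SmoothFamily.const (Smooth.zero V)
  obtain ⟨R, hR, hsol⟩ := exists_transport hT'o hIT hV hms
  refine ⟨fun α => R (Sum.inr ()) (Sum.inl α), fun α => hR _ _, fun y hy => ?_⟩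
  have hyU := hVU hy
  have hs1 : SolvesSystem (fun i j t => m i j t y) (Sum.elim (fun α t => 𝒱 t (G t α) y)
      fun _ t => 𝒱 t (H t) y + (1 / 2 : ℝ) • grLog (pullRatio 𝒱 ρ E F G t y)) := by
    rintro (α | _) t ht
    · refine (D.solvesSystem_pullG h h1 hyU α t ht).congr_deriv ?_
      simp [hm]
    · refine (D.hasDerivAt_log h (hT' (hIT ht)) hyU (hu t (hIT ht) y hy).1
        (hu t (hIT ht) y hy).2).congr_deriv ?_
      simp [hm]
  -- The constant vector (0, 1) is also a solution and shows that the diagonal entry of the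
  -- transport for the extra component is 1. Its change is therefore a smooth combination of the
  -- initial constraints.
  have hs2 : SolvesSystem (fun i j t => m i j t y)
      (Sum.elim (fun _ _ => 0) fun _ _ => (1 : Gr (CIdx a b))) := by
    rintro (α | _) t ht
    · exact (hasDerivAt_const t 0).congr_deriv (by simp [hm])
    · exact (hasDerivAt_const t 1).congr_deriv (by simp [hm])
  have e1 := (hsol y hy).1 _ hs1 (Sum.inr ())
  have e2 := (hsol y hy).1 _ hs2 (Sum.inr ())
  rw [Fintype.sum_sum_type] at e1 e2
  simp only [Sum.elim_inl, Sum.elim_inr, Finset.univ_unique,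
    Finset.sum_singleton, mul_zero, Finset.sum_const_zero, zero_add, mul_one] at e1 e2
  rw [e1, ← e2, one_mul, add_comm]
  congr 1
  exact Finset.sum_congr rfl fun α _ => by
    rw [h.inv_init ((D.smooth_G α).smooth h.zero_mem) hyU]

/-- The initial formula is itself a statement about the pulled back quantities at time 0, where 𝒱 is
the identity. Transport adds only multiples of G at time 0, and these are multiples of the pulled
back final constraints. -/
theorem exists_pulled_formula (h1 : (1 : ℝ) ∈ T) {c : ℝ}
    (hi : SquareRootFormula U ρ E (F 0) (G 0) (H 0) c) {y₀ : CIdx a b → ℝ} (hy₀ : y₀ ∈ U)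
    (hb : ∀ i : Fin a, body (𝒱 1 (G 1 (Sum.inl i)) y₀) = 0) :
    ∃ V ⊆ U, IsOpen V ∧ y₀ ∈ V ∧
      (∀ y ∈ V, IsUnit (pullJac 𝒱 F G 1 y) ∧ IsUnit (pullBr 𝒱 E F G 1 y)) ∧
      ∃ r : CIdx a b → SFun₀ a b, (∀ α, Smooth V (r α)) ∧ ∀ y ∈ V,
        𝒱 1 (H 1) y = algebraMap ℝ (Gr (CIdx a b)) c -
          (1 / 2 : ℝ) • grLog (pullRatio 𝒱 ρ E F G 1 y) + ∑ α, r α y * 𝒱 1 (G 1 α) y := by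
  have hI := h.Icc_subset h1
  have hz := h.zero_mem
  obtain ⟨R, S, -, hS, -, -, -, hRS⟩ := D.exists_rotation h h1
  have hb0 : ∀ i : Fin a, body (G 0 (Sum.inl i) y₀) = 0 := fun i => by
    rw [← h.inv_init ((D.smooth_G _).smooth hz) hy₀]
    exact D.body_pullG h h1 hy₀ hb ⟨le_rfl, zero_le_one⟩ _
  obtain ⟨V₀, hV₀U, hV₀, hyV₀, hu₀, k, hk, hform⟩ := hi y₀ hy₀ hb0
  have eJ : ∀ y ∈ U, pullJac 𝒱 F G 0 y = jacobian (F 0) (G 0) y := fun y hy => by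
    ext A B
    exact h.inv_init (((D.smooth_barGamma A).smooth hz).dR h.isOpen B) hy
  have eB : ∀ y ∈ U, pullBr 𝒱 E F G 0 y = bracketMatrix E (F 0) (G 0) y := fun y hy => by
    ext α β
    exact h.inv_init (Smooth.bracket h.isOpen h.antisymplectic.smooth ((D.smooth_F α).smooth hz)
      ((D.smooth_G β).smooth hz)) hy
  obtain ⟨T', V₁, hT'o, hV₁, hIT, hyV₁, hT', hV₁U, hu₁⟩ := D.exists_tube h h1 hy₀ fun t ht =>
    D.isUnit_pull h h1 hy₀ hb (by rw [eJ y₀ hy₀, eB y₀ hy₀]; exact hu₀ y₀ hyV₀) ht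
  set V := V₀ ∩ V₁ with hV
  have hVU : V ⊆ U := fun y hy => hV₀U hy.1
  have hVo : IsOpen V := hV₀.inter hV₁
  obtain ⟨r, hr, hlog⟩ := D.exists_transport_log h h1 hT'o hVo hIT hT' hVU
    fun t ht y hy => hu₁ t ht y hy.2
  refine ⟨V, hVU, hVo, ⟨hyV₀, hyV₁⟩, fun y hy => hu₁ 1 (hIT ⟨zero_le_one, le_rfl⟩) y hy.2,
    -- The coefficient r comes from the transport and the twisted k from the initial formula, with
    -- the constraint moved to the right; S expresses the initial constraints through the pulled
    -- back final ones.
    fun β => ∑ α, (r α + twF (eps α) (k α)) * S α β, fun β => Smooth.sum _ fun α _ =>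
      ((hr α).add (((hk α).mono Set.inter_subset_left).tw _)).mul ((hS α β).mono hVU),
    fun y hy => ?_⟩
  have hyU := hVU hy
  have e1 := hlog y hy
  have e2 : pullRatio 𝒱 ρ E F G 0 y = sdet (jacobian (F 0) (G 0) y) *
      sdet (bracketMatrix E (F 0) (G 0) y) * Ring.inverse (ρ y) := by
    rw [pullRatio, eJ y hyU, eB y hyU, h.inv_init D.density.smooth hyU]
  have e3 : ∑ α, G 0 α y * k α y = ∑ α, tw (eps α) (k α y) * G 0 α y :=
    Finset.sum_congr rfl fun α _ => by
      rw [mul_eq_mul_tw (tw (eps α) (k α y)) (D.parity_G α 0 hz y hyU), tw_tw_self]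
  have e4 : ∑ β, (∑ α, (r α + twF (eps α) (k α)) * S α β) y * 𝒱 1 (G 1 β) y =
      ∑ α, r α y * G 0 α y + ∑ α, tw (eps α) (k α y) * G 0 α y := by
    simp only [Finset.sum_apply, Finset.sum_mul, Pi.mul_apply, Pi.add_apply, twF_apply]
    rw [Finset.sum_comm, ← Finset.sum_add_distrib]
    refine Finset.sum_congr rfl fun α _ => ?_
    rw [← add_mul, (hRS y hyU).2 α, Finset.mul_sum]
    exact Finset.sum_congr rfl fun β _ => mul_assoc _ _ _
  rw [h.inv_init (D.smooth_H.smooth hz) hyU, hform y hy.1, e2, e3] at e1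
  rw [e4, eq_sub_of_add_eq e1]
  abel

end DeformedFrame
end PulledFormula

/-! ### The square root formula for the deformed action -/

section Final

variable {a b : ℕ} {T : Set ℝ} {U : Set (CIdx a b → ℝ)} {ρ : SFun₀ a b}
  {E : Coord₀ a b → Coord₀ a b → SFun₀ a b} {ψ : ℝ → SFun₀ a b}
  {F G : ℝ → CIdx a b → SFun₀ a b} {M : CIdx a b → CIdx a b → ℝ → SFun₀ a b}
  {H : ℝ → SFun₀ a b} {ν : CIdx a b → ℝ → SFun₀ a b} {𝒰 𝒱 : ℝ → SFun₀ a b → SFun₀ a b}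

/-- A point x of the final constraint surface has a base point on the pulled back surface. The
formula proved near that base point is carried back by 𝒰 with a cut-off, evaluated at each x' near
x. -/
theorem DeformedFrame.squareRootFormula_one (D : DeformedFrame T U ρ E ψ F G M H ν)
    (h : Flow T U E ψ 𝒰 𝒱) (h1 : (1 : ℝ) ∈ T) {c : ℝ}
    (hi : SquareRootFormula U ρ E (F 0) (G 0) (H 0) c) :
    SquareRootFormula U ρ E (F 1) (G 1) (H 1) c := by
  intro x hx hbx
  have hU := h.isOpen
  have sF := fun α => (D.smooth_F α).smooth h1
  have sG := fun α => (D.smooth_G α).smooth h1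
  set y₀ := basePoint (𝒰 1) x with hy₀
  have hy₀U : y₀ ∈ U := h.basePoint_mem h1 hx
  have hb : ∀ i : Fin a, body (𝒱 1 (G 1 (Sum.inl i)) y₀) = 0 := fun i => by
    rw [← (h.body_exp h1 hx (h.smooth_inv_at h1 (sG _))).2, h.exp_inv 1 h1 _ (sG _) hx, hbx]
  obtain ⟨V₀, hV₀U, hV₀, hyV₀, hu₀, r, hr, hform⟩ := D.exists_pulled_formula h h1 hi hy₀U hb
  have hσ₀ := D.smooth_pullRatio h h1 hV₀U hu₀
  set s := body (pullRatio 𝒱 ρ E F G 1 y₀) with hs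
  have hs0 : s ≠ 0 := D.body_pullRatio h h1 hy₀U (hu₀ y₀ hyV₀).1 (hu₀ y₀ hyV₀).2
  -- On V the body of the ratio keeps the sign it has at the base point, as `exp_cut_grLog`
  -- requires.
  set V := V₀ ∩ (fun y => s * body (pullRatio 𝒱 ρ E F G 1 y)) ⁻¹' Set.Ioi 0 with hVdef
  have hV : IsOpen V :=
    (continuousOn_const.mul hσ₀.body.continuousOn).isOpen_inter_preimage hV₀ isOpen_Ioi
  have hVV₀ : V ⊆ V₀ := Set.inter_subset_left
  have hVU : V ⊆ U := hVV₀.trans hV₀U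
  have hyV : y₀ ∈ V := ⟨hyV₀, mul_self_pos.2 hs0⟩
  have hu : ∀ y ∈ V, IsUnit (pullJac 𝒱 F G 1 y) ∧ IsUnit (pullBr 𝒱 E F G 1 y) := fun y hy =>
    hu₀ y (hVV₀ hy)
  obtain ⟨ε, hε, hball⟩ := Metric.isOpen_iff.1 hV y₀ hyV
  set β : ContDiffBump y₀ := ⟨ε / 4, ε / 2, by positivity, by linarith⟩ with hβ
  have hsupp : tsupport β ⊆ V := by
    rw [β.tsupport_eq]
    exact (Metric.closedBall_subset_ball (by change ε / 2 < ε; linarith)).trans hball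
  have hβs : ContDiff ℝ ∞ (β : (CIdx a b → ℝ) → ℝ) := β.contDiff
  -- The radius ε / 4 is the inner radius of the bump: for these points the base point lies where
  -- the cut-off is identically 1.
  refine ⟨U ∩ basePoint (𝒰 1) ⁻¹' Metric.ball y₀ (ε / 4), Set.inter_subset_left,
    (h.continuousOn_basePoint h1).isOpen_inter_preimage hU Metric.isOpen_ball,
    ⟨hx, Metric.mem_ball_self (by positivity)⟩, ?_⟩
  have key : ∀ x' ∈ U ∩ basePoint (𝒰 1) ⁻¹' Metric.ball y₀ (ε / 4),
      (IsUnit (jacobian (F 1) (G 1) x') ∧ IsUnit (bracketMatrix E (F 1) (G 1) x')) ∧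
      H 1 x' = algebraMap ℝ (Gr (CIdx a b)) c -
          (1 / 2 : ℝ) • grLog (sdet (jacobian (F 1) (G 1) x') *
            sdet (bracketMatrix E (F 1) (G 1) x') * Ring.inverse (ρ x')) +
          ∑ α, 𝒰 1 (cut β (r α)) x' * G 1 α x' := by
    rintro x' ⟨hx', hmem⟩
    have hβ1 : β =ᶠ[nhds (basePoint (𝒰 1) x')] 1 := β.eventuallyEq_one_of_mem_ball hmem
    have hχ := h.localChar h1 hx' hV hβs hsupp hβ1
    set χ : SFun₀ a b → Gr (CIdx a b) := fun u => 𝒰 1 (cut β u) x' with hχdef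
    have hinv : ∀ f, Smooth U f → χ (𝒱 1 f) = f x' := fun f hf => by
      rw [hχdef]
      change 𝒰 1 (cut β (𝒱 1 f)) x' = f x'
      rw [h.exp_cut h1 hx' hV hVU hβs hsupp hβ1 (h.smooth_inv_at h1 hf), h.exp_inv 1 h1 _ hf hx']
    have sJ := fun A B => ((D.smooth_pullJac h A B).smooth h1).mono hVU
    have sB := fun A B => ((D.smooth_pullBr h A B).smooth h1).mono hVU
    have eJ : mapMat χ (pullJac 𝒱 F G 1) = jacobian (F 1) (G 1) x' := by
      ext A B
      exact hinv _ (((D.smooth_barGamma A).smooth h1).dR hU B)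
    have eB : mapMat χ (pullBr 𝒱 E F G 1) = bracketMatrix E (F 1) (G 1) x' := by
      ext α β
      exact hinv _ (Smooth.bracket hU h.antisymplectic.smooth (sF α) (sG β))
    have uJ := (hχ.mapMat_inverse sJ fun y hy => (hu y hy).1).1
    have uB := (hχ.mapMat_inverse sB fun y hy => (hu y hy).2).1
    rw [eJ] at uJ
    rw [eB] at uB
    refine ⟨⟨uJ, uB⟩, ?_⟩
    have pJ := fun y (hy : y ∈ V) => D.superEven_pullJac h h1 (hVU hy)
    have pB := fun y (hy : y ∈ V) => D.superEven_pullBr h h1 (hVU hy)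
    have dJ := contDiffOn_sdet sJ pJ fun y hy => (hu y hy).1
    have dB := contDiffOn_sdet sB pB fun y hy => (hu y hy).2
    have sρ := (h.smooth_inv_at h1 D.density.smooth).mono hVU
    have uρ : ∀ y ∈ V, IsUnit (𝒱 1 ρ y) := fun y hy =>
      isUnit_of_body_ne_zero (D.body_pull_density h h1 (hVU hy))
    have hσ := D.smooth_pullRatio h h1 hVU hu
    have eσ : χ (pullRatio 𝒱 ρ E F G 1) = sdet (jacobian (F 1) (G 1) x') *
        sdet (bracketMatrix E (F 1) (G 1) x') * Ring.inverse (ρ x') := by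
      refine (hχ.map_mul _ _ (contDiffOn_grMul dJ dB) (contDiffOn_grInverse sρ uρ)).trans ?_
      rw [(hχ.map_inverse sρ uρ).2, hinv _ D.density.smooth, ← eJ, ← eB,
        ← hχ.map_sdet sJ pJ fun y hy => (hu y hy).1, ← hχ.map_sdet sB pB fun y hy => (hu y hy).2]
      congr 1
      exact hχ.map_mul _ _ dJ dB
    have eL : χ (fun y => grLog (pullRatio 𝒱 ρ E F G 1 y)) =
        grLog (χ (pullRatio 𝒱 ρ E F G 1)) :=
      h.exp_cut_grLog h1 hx' hV hβs hsupp hβ1 (fun y => ⟨β.nonneg, β.le_one⟩) hσ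
        (fun y hy => D.pullRatio_even h h1 (hVU hy) (hu y hy).1 (hu y hy).2) (r := s)
        fun y hy => hy.2
    have sL : Smooth V fun y => grLog (pullRatio 𝒱 ρ E F G 1 y) := contDiffOn_grLog hσ fun y hy =>
      D.body_pullRatio h h1 (hVU hy) (hu y hy).1 (hu y hy).2
    have sR := fun α => ((hr α).mono hVV₀).mul ((h.smooth_inv_at h1 (sG α)).mono hVU)
    have e : Set.EqOn (𝒱 1 (H 1)) ((c • (1 : SFun₀ a b) -
        (1 / 2 : ℝ) • fun y => grLog (pullRatio 𝒱 ρ E F G 1 y)) +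
        ∑ α, r α * 𝒱 1 (G 1 α)) V := by
      intro y hy
      rw [hform y (hVV₀ hy), Algebra.algebraMap_eq_smul_one]
      simp only [Pi.add_apply, Pi.sub_apply, Pi.smul_apply, Pi.one_apply, Finset.sum_apply,
        Pi.mul_apply]
    have sH := D.smooth_H.smooth h1
    rw [← hinv _ sH, hχ.congr _ _ ((h.smooth_inv_at h1 sH).mono hVU) e,
      hχ.map_add _ _ (((Smooth.one V).smul c).sub (sL.smul _)) (Smooth.sum _ fun α _ => sR α),
      hχ.map_sub ((Smooth.one V).smul c) (sL.smul _), hχ.map_smul _ _ (Smooth.one V),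
      hχ.map_one, hχ.map_smul _ _ sL, eL, eσ, hχ.map_sum _ sR, Algebra.algebraMap_eq_smul_one]
    congr 1
    refine Finset.sum_congr rfl fun α _ => ?_
    rw [hχ.map_mul _ _ ((hr α).mono hVV₀) ((h.smooth_inv_at h1 (sG α)).mono hVU), hinv _ (sG α)]
  -- In `key` the constraints stand on the right; the twist moves them to the left, as the
  -- definition of the formula demands.
  refine ⟨fun x' hx' => (key x' hx').1, fun α => twF (eps α) (𝒰 1 (cut β (r α))), fun α =>
    ((h.smooth_exp h1 (smooth_cut hV hβs hsupp ((hr α).mono hVV₀))).tw _).mono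
      Set.inter_subset_left, fun x' hx' => ?_⟩
  rw [(key x' hx').2]
  congr 1
  refine Finset.sum_congr rfl fun α _ => ?_
  exact mul_eq_mul_tw _ (D.parity_G α 1 h1 x' hx'.1)

/-- The rotation is found for the pulled back constraints; applying the homomorphism 𝒰 carries both
the relation and the invertibility of the matrix to the constraints themselves. -/
theorem DeformedFrame.exists_rotation_exp (D : DeformedFrame T U ρ E ψ F G M H ν)
    (h : Flow T U E ψ 𝒰 𝒱) (h1 : (1 : ℝ) ∈ T) :
    ∃ R : CIdx a b → CIdx a b → SFun₀ a b, (∀ α β, Smooth U (R α β)) ∧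
      (∀ α β, HasParity U (eps α + eps β) (R α β)) ∧
      (∀ x ∈ U, IsUnit (Matrix.of fun α β => R α β x)) ∧
      ∀ α, ∀ x ∈ U, G 1 α x = ∑ β, R α β x * 𝒰 1 (G 0 β) x := by
  obtain ⟨R, S, hR, hS, hRp, hRS, -, hG⟩ := D.exists_rotation h h1
  have sG0 := fun α => (D.smooth_G α).smooth h.zero_mem
  have sG1 := fun α => (D.smooth_G α).smooth h1
  refine ⟨fun α β => 𝒰 1 (R α β), fun α β => h.smooth_exp h1 (hR α β),
    fun α β => h.exp_parity h1 (hR α β) (hRp α β), fun x hx => ?_, fun α x hx => ?_⟩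
  · refine isUnit_of_mul_eq_one (N := Matrix.of fun α β => 𝒰 1 (S α β) x) ?_
    ext α γ
    have e : Set.EqOn (∑ β, R α β * S β γ) (if α = γ then 1 else 0) U := fun y hy => by
      have := hRS y hy α γ
      rw [Finset.sum_apply]
      simp only [Pi.mul_apply, this]
      split_ifs <;> rfl
    have e2 := h.exp.congr 1 h1 _ _ (Smooth.sum _ fun β _ => (hR α β).mul (hS β γ)) e hx
    rw [h.exp_sum _ h1 (fun β => (hR α β).mul (hS β γ)) hx, Finset.sum_apply] at e2
    rw [Matrix.mul_apply, Matrix.one_apply]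
    refine (Finset.sum_congr rfl fun β _ => (h.exp_mul h1 (hR α β) (hS β γ) hx).symm).trans
      (e2.trans ?_)
    split_ifs
    · exact h.exp_one h1 hx
    · exact h.exp_zero_fun h1 hx
  · have e : Set.EqOn (𝒱 1 (G 1 α)) (∑ β, R α β * G 0 β) U := fun y hy => by
      rw [(hG y hy).1 α, Finset.sum_apply]
      rfl
    rw [← h.exp_inv 1 h1 _ (sG1 α) hx, h.exp.congr 1 h1 _ _ (h.smooth_inv_at h1 (sG1 α)) e hx,
      h.exp_sum _ h1 (fun β => (hR α β).mul (sG0 β)) hx, Finset.sum_apply]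
    exact Finset.sum_congr rfl fun β _ => h.exp_mul h1 (hR α β) (sG0 β) hx

theorem SquareRootFormula.congr_left (hU : IsOpen U) {c : ℝ} {F F' G : CIdx a b → SFun₀ a b}
    {H : SFun₀ a b} (hF : ∀ α, Set.EqOn (F α) (F' α) U) (h : SquareRootFormula U ρ E F G H c) :
    SquareRootFormula U ρ E F' G H c := by
  have eJ : ∀ y ∈ U, jacobian F G y = jacobian F' G y := by
    intro y hy
    ext A B
    change dR B (barGamma F G A) y = dR B (barGamma F' G A) y
    refine dR_congr_on hU B ?_ hy
    rcases conIdx_cases A with ⟨α, rfl⟩ | ⟨-, α, -, hα⟩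
    · rw [barGamma_conPos, barGamma_conPos]; exact fun _ _ => rfl
    · rw [hα, hα]; exact hF α
  have eB : ∀ y ∈ U, bracketMatrix E F G y = bracketMatrix E F' G y := by
    intro y hy
    ext α β
    exact bracket_congr hU E (hF α) (fun _ _ => rfl) hy
  intro x hx hb
  obtain ⟨V, hVU, hV, hxV, hu, k, hk, hform⟩ := h x hx hb
  refine ⟨V, hVU, hV, hxV, fun y hy => ?_, k, hk, fun y hy => ?_⟩
  · rw [← eJ y (hVU hy), ← eB y (hVU hy)]; exact hu y hy
  · rw [← eJ y (hVU hy), ← eB y (hVU hy)]; exact hform y hy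

theorem IsExactDeformation.exists_flow {W : Set (CIdx a b ⊕ CIdx a b → ℝ)} (hU : IsOpen U)
    (hUW : ∀ x ∈ U, zeroSection x ∈ W) (hE : IsAntisymplectic U E) (hT : IsOpen T)
    (hT' : T.OrdConnected) (h0 : (0 : ℝ) ∈ T) {Ψ X : ℝ → Series a b}
    (hX : IsExactDeformation T W ρ E Ψ X)
    (h𝒰 : IsPathOrderedExp T U E (fun t => restrict (PowerSeries.coeff 0 (Ψ t))) 𝒰) :
    ∃ 𝒱, Flow T U E (fun t => restrict (PowerSeries.coeff 0 (Ψ t))) 𝒰 𝒱 := by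
  obtain ⟨𝒱, hc, hs, hi⟩ := h𝒰.inverse
  exact ⟨𝒱, hT, hT', h0, hU, hE, (hX.smooth_gen 0).restrict hUW,
    fun t ht => restrict_parity hUW (hX.odd_gen t ht 0), h𝒰, hc, hs,
    fun t ht F hF => (hi t ht F hF).1, fun t ht F hF => (hi t ht F hF).2⟩

theorem IsExactDeformation.deformedFrame {W : Set (CIdx a b ⊕ CIdx a b → ℝ)} (hU : IsOpen U)
    (hW : IsOpen W) (hUW : ∀ x ∈ U, zeroSection x ∈ W)
    (hWU : ∀ y ∈ W, (fun i => y (Sum.inl i)) ∈ U) (hE : IsAntisymplectic U E)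
    (hρ : IsDensity U ρ) (hT : IsOpen T) {Ψ X : ℝ → Series a b}
    (hX : IsExactDeformation T W ρ E Ψ X)
    (h : Flow T U E (fun t => restrict (PowerSeries.coeff 0 (Ψ t))) 𝒰 𝒱)
    {F : CIdx a b → SFun₀ a b} (hF : ∀ α, Smooth U (F α))
    (hF' : ∀ α, HasParity U (eps α + 1) (F α)) :
    DeformedFrame T U ρ E (fun t => restrict (PowerSeries.coeff 0 (Ψ t))) (fun t α => 𝒰 t (F α))
      (fun t => constraint (X t)) (rotGen Ψ) (fun t => quantumH (X t)) (shiftGen Ψ) where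
  density := hρ
  smooth_F α := h.smoothFamily_exp (hF α)
  smooth_G := smooth_constraint hW hUW hT hX
  smooth_M := smooth_rotGen hW hUW hT hX
  smooth_H := smooth_quantumH hW hUW hT hX
  smooth_ν := smooth_shiftGen hW hUW hT hX
  parity_F α _ ht := h.exp_parity ht (hF α) (hF' α)
  parity_G α _ ht := constraint_parity hW hUW hT hX α ht
  parity_M α β _ ht := rotGen_parity hW hUW hT hX α β ht
  nabla_F α _ ht := h.nabla_exp (hF α) ht
  nabla_G α _ ht := nabla_constraint hU hW hUW hWU hE hρ hT hX α ht
  nabla_H _ ht _ hx := nabla_quantumH hU hW hUW hWU hE hρ hT hX ht hx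

end Final

end BV

end

theorem mainTheorem10 (a b : ℕ)
    -- the zeroth-level domain and a neighbourhood of it in the first-level phase space
    (U : Set (BV.CIdx a b → ℝ)) (hU : IsOpen U)
    (W : Set (BV.CIdx a b ⊕ BV.CIdx a b → ℝ)) (hW : IsOpen W)
    (hUW : ∀ x ∈ U, BV.zeroSection x ∈ W) (hWU : ∀ y ∈ W, (fun i => y (Sum.inl i)) ∈ U)
    -- antisymplectic structure and measure density
    (E : BV.Coord₀ a b → BV.Coord₀ a b → BV.SFun₀ a b) (hE : BV.IsAntisymplectic U E)
    (ρ : BV.SFun₀ a b) (hρ : BV.IsDensity U ρ)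
    -- a finite exact deformation from `X 0` to `X 1`, with generator `Ψ`
    (T : Set ℝ) (hT : IsOpen T) (hT' : T.OrdConnected) (h0 : (0 : ℝ) ∈ T) (h1 : (1 : ℝ) ∈ T)
    (Ψ X : ℝ → BV.Series a b) (hX : BV.IsExactDeformation T W ρ E Ψ X)
    (hXi : BV.HasPlanckNumber W 1 (X 0)) (hXf : BV.HasPlanckNumber W 1 (X 1))
    -- the exponential of the adjoint action of the zeroth-level part of the generator
    (𝒰 : ℝ → BV.SFun₀ a b → BV.SFun₀ a b)
    (h𝒰 : BV.IsPathOrderedExp T U E (fun t => BV.restrict (PowerSeries.coeff 0 (Ψ t))) 𝒰)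
    -- the square root formula for the initial action
    (F : BV.CIdx a b → BV.SFun₀ a b) (hF : ∀ α, BV.Smooth U (F α))
    (hF' : ∀ α, BV.HasParity U (BV.eps α + 1) (F α)) (c : ℝ)
    (hi : BV.SquareRootFormula U ρ E F (BV.constraint (X 0)) (BV.quantumH (X 0)) c) :
    -- the constraints are rotated and anticanonically transformed
    BV.IsAnticanonical U E (𝒰 1) ∧
    (∃ R : BV.CIdx a b → BV.CIdx a b → BV.SFun₀ a b,
      (∀ α β, BV.Smooth U (R α β)) ∧
      (∀ α β, BV.HasParity U (BV.eps α + BV.eps β) (R α β)) ∧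
      (∀ x ∈ U, IsUnit (Matrix.of fun α β => R α β x)) ∧
      ∀ α, ∀ x ∈ U, BV.constraint (X 1) α x =
        ∑ β, R α β x * 𝒰 1 (BV.constraint (X 0) β) x) ∧
    -- the square root formula for the final action, with the same integration constant
    BV.SquareRootFormula U ρ E (fun α => 𝒰 1 (F α)) (BV.constraint (X 1))
      (BV.quantumH (X 1)) c := by
  obtain ⟨𝒱, h⟩ := hX.exists_flow hU hUW hE hT hT' h0 h𝒰
  have D := hX.deformedFrame hU hW hUW hWU hE hρ hT h hF hF'
  refine ⟨h.isAnticanonical h1, D.exists_rotation_exp h h1, D.squareRootFormula_one h h1 ?_⟩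
  -- The deformed frame starts at 𝒰 0 F, which agrees with F on U only; on an open set this suffices
  -- for all derivatives involved.
  exact hi.congr_left hU fun α x hx => (h𝒰.init (F α) (hF α) hx).symm
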